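/- **Notation.** Write $\mathbb D(0,r)=\{|\zeta|<r\}\subset\mathbb C$, $j=e^{2\pi i/3}$, $\mathrm{diag}(a,b)(z,w)=(az,bw)$, and $\|(z,w)\|=\max(|z|,|w|)$. For $\alpha,\beta\in\mathbb C$ let $\lambda_1=e^{2\pi i(-\alpha+\beta/2)}$, $\lambda_2=e^{2\pi i(\alpha+\beta/2)}$ and let the modified Hénon map be $$h_{\alpha,\beta}(z,w)=(\lambda_1z,\lambda_2w)+\frac{e^{i\pi\beta}(\lambda_1z+\lambda_2w)^2}{\lambda_1-\lambda_2}\,(1,-1).$$ For a holomorphic function $F$ of two variables the canonical (exact symplectic) map $\iota_F$ is defined by $$\iota_F(z,w)=(\tilde z,\tilde w)\iff \tilde z=z+\partial_{\tilde w}F(z,\tilde w),\quad w=\tilde w+\partial_zF(z,\tilde w);$$ when it is considered near the origin and fixes the origin, the branch is the holomorphic germ fixing $0$, continued to a connected neighbourhood of $0$ on which it is biholomorphic onto its image. $\phi^1_X$ is the time-one map of the holomorphic vector field $X$, $\mathrm{div}X=\partial_zX_z+\partial_wX_w$, and $D_*X=D\circ X\circ D^{-1}$ for linear invertible $D$. Put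 $\mu=1/\sqrt3$, $\nu=-\tfrac23\cdot\tfrac1{\sqrt3}$. **Resonant Birkhoff normal form.** Given $m\ge1$, $\rho,C,\eta$, say that $\iota_Y$ is a *normalizing map of order $m$ for $h_{\alpha,\beta}$ (with constants $\rho,C,\eta$)* if $Y$ and some $F$ are holomorphic on $\mathbb D(0,2\rho)^2$, $|Y|\le C\|(z,w)\|^3$ there, and on $\mathbb D(0,\rho)^2$ $$\iota_Y^{-1}\circ h_{\alpha,\beta}\circ\iota_Y=\mathrm{diag}(\lambda_1,\lambda_2)\circ\iota_F ,$$ where on $\mathbb D(0,2\rho)^2$ $$F(z,w)=b_{2,1}z^2w+b_{0,4}w^4+\sum_{k=3}^{3m}b_{k,1}z^kw+\sum_{n=2}^{m}b_{0,3n+1}w^{3n+1}+E(z,w),\qquad |E(z,w)|\le C\|(z,w)\|^{3m+2},$$ with $|b_{2,1}-i\mu|\le C\eta$, $|b_{0,4}-i\nu/4|\le C\eta$, and all the other coefficients bounded by $C$ in modulus. **Theorem.** Let $m\ge1$ be an integer. (A) There are $\rho,\varepsilon>0$ and $C$ such that for all $\mathring\alpha,\mathring\beta\in\mathbb C$ and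 $\delta\in\mathbb R$ with $\eta:=|\delta|(|\mathring\alpha|+|\mathring\beta|)<\varepsilon$, the map $h_{\alpha,\beta}$ with $\alpha=\frac16+\delta\mathring\alpha$, $\beta=\frac13+\delta\mathring\beta$ has a normalizing map of order $m$ with constants $\rho,C,\eta$. (B) Let $M>0$, $\mathring\beta\in\mathbb C\setminus\{0\}$, $\tau\in\mathbb C$. There are $\delta_0,\rho>0$ and $C$ such that for every real $\delta$ with $0<|\delta|<\delta_0$ the following holds. Put $\alpha=\frac16+\delta(\tau-\frac12)\mathring\beta$, $\beta=\frac13+\delta\mathring\beta$, $\kappa=2\pi\frac{\sqrt3}2\mathring\beta\delta$, and let $\omega$ be any complex number with $\omega^3=\kappa^2$ (any determination of $\kappa^{2/3}$). There exist a holomorphic diffeomorphism $$Z=\mathrm{diag}(\kappa^{-1},\omega^{-1})\circ\iota_G,\qquad G\ \text{holomorphic on}\ \mathbb D(0,M)^2,$$ defined on a connected open neighbourhood of $0$ and whose image contains $\mathbb D(0,M)^2$, such that $\iota_G^{-1}=\iota_Y$ is a normalizing map of order $m$ for $h_{\alpha,\beta}$ with constants $\rho,C,|\delta|$; a holomorphic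 vector field $X$ on $\mathbb D(0,2M)^2$ with $$\mathrm{div}X=2\pi i,\qquad \mathrm{diag}(1,j)_*X=X,\qquad \Bigl\|X(z,w)-2\pi i\bigl((1-\tau)z+\tfrac{z^2}2-\tfrac{w^3}3,\ \tau w-zw\bigr)\Bigr\|\le C|\delta| ;$$ and a holomorphic function $R$ on $\mathbb D(0,2M)^2$ with $|R|\le C|\delta|^{2m-1/3}$; such that $\iota_R$ is defined on $\mathbb D(0,M)^2$ and on $\mathbb D(0,M)^2$ $$Z\circ h_{\alpha,\beta}\circ Z^{-1}=\mathrm{diag}(1,j)\circ\phi^1_{\delta\mathring\beta X}\circ\iota_R ,$$ both sides being defined there (the integral curves defining $\phi^1_{\delta\mathring\beta X}$ stay in $\mathbb D(0,2M)^2$). -/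

import Mathlib

open scoped Real

noncomputable section

/-- The polydisk `𝔻(0,r) × 𝔻(0,r)` of `ℂ²`. -/
def polydisk (r : ℝ) : Set (ℂ × ℂ) := Metric.ball (0 : ℂ) r ×ˢ Metric.ball (0 : ℂ) r

/-- The linear map `diag(a,b) : (z,w) ↦ (a z, b w)`. -/
def diag (a b : ℂ) (p : ℂ × ℂ) : ℂ × ℂ := (a * p.1, b * p.2)

/-- The complex derivative `∂_z F` in the first variable. -/
def dz (F : ℂ × ℂ → ℂ) (p : ℂ × ℂ) : ℂ := fderiv ℂ F p (1, 0)

/-- The complex derivative `∂_w F` in the second variable. -/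
def dw (F : ℂ × ℂ → ℂ) (p : ℂ × ℂ) : ℂ := fderiv ℂ F p (0, 1)

/-- The eigenvalue `λ₁ = e^{2πi(-α+β/2)}`. -/
def eig₁ (α β : ℂ) : ℂ := Complex.exp (2 * π * Complex.I * (-α + β / 2))

/-- The eigenvalue `λ₂ = e^{2πi(α+β/2)}`. -/
def eig₂ (α β : ℂ) : ℂ := Complex.exp (2 * π * Complex.I * (α + β / 2))

/-- The modified Hénon map
`(z,w) ↦ (λ₁ z, λ₂ w) + q(λ₁ z + λ₂ w) / (λ₁ - λ₂) • (1,-1)`, with `q(x) = e^{iπβ} x²`. -/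
def henonMod (α β : ℂ) (p : ℂ × ℂ) : ℂ × ℂ :=
  diag (eig₁ α β) (eig₂ α β) p +
    (Complex.exp (Complex.I * π * β) * (eig₁ α β * p.1 + eig₂ α β * p.2) ^ 2 /
      (eig₁ α β - eig₂ α β)) • ((1, -1) : ℂ × ℂ)

/-- `F` is holomorphic on `U` and `f` is, on `V`, the canonical (exact symplectic) map `ι_F`:
`f(z,w) = (z',w')` with `z' = z + ∂_{w'}F(z,w')` and `w = w' + ∂_z F(z,w')`, `(z,w') ∈ U`. -/
structure IsCanonicalOn (F : ℂ × ℂ → ℂ) (U V : Set (ℂ × ℂ)) (f : ℂ × ℂ → ℂ × ℂ) : Prop where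
  holo_obs : DifferentiableOn ℂ F U
  holo : DifferentiableOn ℂ f V
  mem : ∀ p ∈ V, (p.1, (f p).2) ∈ U
  eq_fst : ∀ p ∈ V, (f p).1 = p.1 + dw F (p.1, (f p).2)
  eq_snd : ∀ p ∈ V, p.2 = (f p).2 + dz F (p.1, (f p).2)

/-- `φ` is the biholomorphism, from a connected open neighbourhood `φ.source` of the origin onto
`φ.target`, that fixes the origin and is the canonical map `ι_F`; the generating observable `F` is
holomorphic on `U`. (Connectedness and `φ 0 = 0` single out the germ `ι_F` at the origin.) -/
structure IsCanonicalDiffeo (F : ℂ × ℂ → ℂ) (U : Set (ℂ × ℂ))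
    (φ : OpenPartialHomeomorph (ℂ × ℂ) (ℂ × ℂ)) : Prop where
  connected : IsConnected φ.source
  zero_mem : (0 : ℂ × ℂ) ∈ φ.source
  map_zero : φ 0 = 0
  canonical : IsCanonicalOn F U φ.source φ
  holo_symm : DifferentiableOn ℂ φ.symm φ.target

/-- On the polydisk of radius `ρ`, the map `φ = ι_Y` with `Y = O³(z,w)` conjugates the modified
Hénon map to its resonant Birkhoff normal form of order `m`:
`ι_Y⁻¹ ∘ h ∘ ι_Y = diag(λ₁,λ₂) ∘ ι_F`, with
`F = b_{2,1} z²w + b_{0,4} w⁴ + ∑_{k=3}^{3m} b_{k,1} z^k w + ∑_{n=2}^m b_{0,3n+1} w^{3n+1}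
  + O^{3m+2}(z,w)`,
`b_{2,1} = iμ + O(η)`, `b_{0,4} = (iν + O(η))/4`, `μ = 1/√3`, `ν = -(2/3)/√3`, and the other
coefficients bounded. All implied constants are `C`. The observables `Y`, `F` live on the polydisk
of radius `2ρ`, so that the maps can be formed on the polydisk of radius `ρ`. -/
structure IsResonantBNF (m : ℕ) (ρ C η : ℝ) (α β : ℂ) (Y F : ℂ × ℂ → ℂ)
    (φ : OpenPartialHomeomorph (ℂ × ℂ) (ℂ × ℂ)) : Prop where
  change : IsCanonicalDiffeo Y (polydisk (2 * ρ)) φ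
  change_dom : polydisk ρ ⊆ φ.source
  change_order : ∀ p ∈ polydisk (2 * ρ), ‖Y p‖ ≤ C * ‖p‖ ^ 3
  conj : ∃ ψ : OpenPartialHomeomorph (ℂ × ℂ) (ℂ × ℂ),
    IsCanonicalDiffeo F (polydisk (2 * ρ)) ψ ∧ polydisk ρ ⊆ ψ.source ∧
    ∀ p ∈ polydisk ρ, henonMod α β (φ p) ∈ φ.target ∧
      φ.symm (henonMod α β (φ p)) = diag (eig₁ α β) (eig₂ α β) (ψ p)
  normal_form : ∃ (b₂₁ b₀₄ : ℂ) (b c : ℕ → ℂ),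
    ‖b₂₁ - Complex.I * (1 / √3 : ℝ)‖ ≤ C * η ∧
    ‖b₀₄ - Complex.I * (-(2 / 3) * (1 / √3) : ℝ) / 4‖ ≤ C * η ∧
    (∀ k ∈ Finset.Icc 3 (3 * m), ‖b k‖ ≤ C) ∧
    (∀ n ∈ Finset.Icc 2 m, ‖c n‖ ≤ C) ∧
    ∀ p ∈ polydisk (2 * ρ),
      ‖F p - (b₂₁ * p.1 ^ 2 * p.2 + b₀₄ * p.2 ^ 4
          + ∑ k ∈ Finset.Icc 3 (3 * m), b k * p.1 ^ k * p.2
          + ∑ n ∈ Finset.Icc 2 m, c n * p.2 ^ (3 * n + 1))‖ ≤ C * ‖p‖ ^ (3 * m + 2)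

/-- The divergence `∂_z X_z + ∂_w X_w` of a vector field on `ℂ²`. -/
def divergence (X : ℂ × ℂ → ℂ × ℂ) (p : ℂ × ℂ) : ℂ :=
  (fderiv ℂ X p (1, 0)).1 + (fderiv ℂ X p (0, 1)).2

/-- The push-forward `diag(a,b)_* X = D ∘ X ∘ D⁻¹` of a vector field by `D = diag(a,b)`. -/
def diagPush (a b : ℂ) (X : ℂ × ℂ → ℂ × ℂ) (p : ℂ × ℂ) : ℂ × ℂ :=
  diag a b (X (diag a⁻¹ b⁻¹ p))

/-- `φ¹_X(p)` is defined in `U` and equals `q`: the integral curve of `X` issued from `p` exists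
on `[0,1]`, stays in `U`, and is at `q` at time `1`. -/
def TimeOneMap (X : ℂ × ℂ → ℂ × ℂ) (U : Set (ℂ × ℂ)) (p q : ℂ × ℂ) : Prop :=
  ∃ γ : ℝ → ℂ × ℂ, γ 0 = p ∧ γ 1 = q ∧
    IsIntegralCurveOn γ (fun _ => X) (Set.Icc 0 1) ∧ ∀ t ∈ Set.Icc (0 : ℝ) 1, γ t ∈ U

/-- `j = e^{2πi/3}`. -/
def jRoot : ℂ := Complex.exp (2 * π * Complex.I / 3)

/-- The model vector field `2πi ((1-τ)z + z²/2 - w³/3, τw - zw)`. -/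
def modelField (τ : ℂ) (p : ℂ × ℂ) : ℂ × ℂ :=
  (2 * π * Complex.I : ℂ) •
    (((1 - τ) * p.1 + p.1 ^ 2 / 2 - p.2 ^ 3 / 3, τ * p.2 - p.1 * p.2) : ℂ × ℂ)

/-- The dilation factor `κ = 2π(√3/2)β̊δ` of the first coordinate. -/
def zoom (bo : ℂ) (δ : ℝ) : ℂ := ((2 * π * (√3 / 2) : ℝ) : ℂ) * bo * (δ : ℂ)

end

/-!
Write `q = (α - 1/6, β - 1/3)`. At `q = 0` the eigenvalues of the Hénon map are `1` and `j`, so a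
monomial `z^k w^l` of a generating function is resonant iff `l ≡ 1 mod 3`. Poincaré–Dulac theory
leaves all resonant monomials; here those divisible by `z w⁴` have to disappear as well. They lie in
the image of the Poisson bracket with `w⁴`, so the coefficient of `w⁴` acts as a second small
divisor. The weighted dilation `(s⁵ z, s³ w)`, under which `w⁴` has order `s⁴` and `z² w` order
`s⁵`, makes this quantitative: after an explicit change of coordinates (`prelim`,
`exists_prelimBounds`) the dilated map is `diag(λ₁,λ₂) ∘ (id + s⁴ X_{b w⁴} + s⁵ X_{c z²w} + O(s⁶))`.

*Normal form.* Conjugate by the canonical map of a polynomial with one unknown coefficient for each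
monomial to be removed, of size `s⁵` for the nonresonant ones and `s` for the resonant ones. Its effect
is of order `s⁵`, and linear and diagonal in the unknowns up to `O(s⁶)` (`conjugation_expansion`,
`exists_familyBounds`); for small fixed `s` a contraction therefore makes all bad coefficients vanish,
with Lipschitz dependence on `q` (`exists_normalizedFamily`). Undoing the dilation gives the
normalizing germ (`exists_germ`). That the leading coefficients are exactly `b` and `c` at `q = 0`,
although the contraction only controls them up to `O(s⁶)`, is seen by letting a second dilation
parameter `σ` tend to `0` (`leading_coefficients_eq`, `IsNormalizedFamily.exact`).

*Generators.* Every area-preserving map close to the identity is canonical: Poincaré's lemma, after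
inverting the second component in `w` (`exists_generating`). Since `G` has to be holomorphic on an
arbitrarily large polydisk, the inverse of the normalizing map is replaced by the canonical map of
the Taylor polynomial of its generator, which agrees with it to an order high enough not to disturb
the normal form (`exists_polynomial_approximation`, `exists_resonantBNF`). This gives (A).

*Interpolation.* In the coordinates `diag(κ,ω)` with `ω³ = κ²`, the terms `z²w` and `w⁴` both have
size `κ`, the other terms of the normal form are `O(κ²)`, and the error term is
`O(κ^{2m-1/3})` since `‖ω‖^{3m+1}/‖κ‖ = ‖κ‖^{2m-1/3}`. The truncated map is `ε`-close to the identity,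
up to `diag(1,j)`, with which it commutes, and its Jacobian is `e^{2πiε}`, where `ε = β̊δ`
(`exists_zoomed_model`). The defect between such a map and the time-one map of `ε X` is canonical and
commutes with `diag(1,j)`, so adding `ε⁻¹` times the Hamiltonian field of its generator to `X` gains
one power of `ε` (`isInterpolating_step`, `exists_isInterpolating`). After finitely many steps the
remaining defect, error term included, is canonical with a generator `R` of the required size
(`exists_interpolation`). This gives (B).
-/

open Metric Set Filter Topology
open Complex (I exp)

noncomputable section

-- `𝔻 r` is the polydisk of radius `r`, since `ℂ²` carries the maximum norm
local notation "ℂ²" => ℂ × ℂ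
local notation "𝔻" => ball (0 : ℂ²)
local notation "Holo" => DifferentiableOn ℂ
local notation "HoloAt" => DifferentiableAt ℂ
local notation "𝕀" => Icc (0 : ℝ) 1
local notation "𝔼" => (ℂ × ℂ²) × ℂ²
local notation "𝓝₊" => 𝓝[>] (0 : ℝ)

lemma norm_lt {E : Type*} [SeminormedAddGroup E] {x : E} {r : ℝ} (h : x ∈ ball 0 r) : ‖x‖ < r := mem_ball_zero_iff.1 h

lemma mem_ball₀ {E : Type*} [SeminormedAddGroup E] {x : E} {r : ℝ} (h : ‖x‖ < r := by linarith) : x ∈ ball 0 r := mem_ball_zero_iff.2 h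

lemma ball_mono {E : Type*} [PseudoMetricSpace E] {x p : E} {r R : ℝ} (hp : p ∈ ball x r) (h : r ≤ R := by linarith) : p ∈ ball x R := ball_subset_ball h hp

lemma ball_le {E : Type*} [PseudoMetricSpace E] {x : E} {r R : ℝ} (h : r ≤ R := by first | norm_num; done | linarith) :
    ball x r ⊆ ball x R := ball_subset_ball h

lemma norm_le_add_sub {E : Type*} [SeminormedAddCommGroup E] (x y : E) : ‖x‖ ≤ ‖y‖ + ‖x - y‖ := norm_le_norm_add_norm_sub' x y

/-! ### Cauchy estimates -/

section Cauchy

variable {E F : Type*} [NormedAddCommGroup E] [NormedSpace ℂ E]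
  [NormedAddCommGroup F] [NormedSpace ℂ F]

lemma DifferentiableOn.at_ball {f : E → F} {x p : E} {r : ℝ} (hf : Holo f (ball x r)) (hp : p ∈ ball x r) :
    HoloAt f p := hf.differentiableAt (isOpen_ball.mem_nhds hp)

lemma polydisk_eq_ball (r : ℝ) : polydisk r = 𝔻 r := by
  rw [polydisk, ball_prod_same]; rfl

lemma norm_fderiv_le_of_bound {f : E → F} {R c d : ℝ} {x : E}
    (hf : Holo f (ball 0 R)) (hb : ∀ y ∈ ball (0 : E) R, ‖f y‖ ≤ c)
    (hd : 0 < d) (hx : ‖x‖ + d ≤ R) : ‖fderiv ℂ f x‖ ≤ 2 * c / d := by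
  have hsub : ball x d ⊆ ball 0 R := by
    apply ball_subset_ball'
    rw [dist_zero_right]; linarith
  refine Complex.norm_fderiv_le_div_of_mapsTo_ball (hf.mono hsub) ?_ hd
  intro y hy
  rw [mem_closedBall, dist_eq_norm]
  have h1 := hb y (hsub hy)
  have h2 := hb x (hsub (mem_ball_self hd))
  linarith [norm_sub_le (f y) (f x)]

lemma norm_sub_le_of_bound {f : E → F} {R c d : ℝ} {x y : E}
    (hf : Holo f (ball 0 R)) (hb : ∀ y ∈ ball (0 : E) R, ‖f y‖ ≤ c)
    (hd : 0 < d) (hx : ‖x‖ < R - d) (hy : ‖y‖ < R - d) :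
    ‖f x - f y‖ ≤ 2 * c / d * ‖x - y‖ := by
  let _ : NormedSpace ℝ E := NormedSpace.restrictScalars ℝ ℂ E
  have hs : ball (0 : E) (R - d) ⊆ ball 0 R := ball_subset_ball (by linarith)
  refine (convex_ball (0 : E) (R - d)).norm_image_sub_le_of_norm_fderiv_le (𝕜 := ℂ) (f := f)
    (fun z hz => hf.at_ball (hs hz)) (fun z hz => ?_)
    (by simpa using hy) (by simpa using hx)
  exact norm_fderiv_le_of_bound hf hb hd (by have := norm_lt hz; linarith)

/-- The quadratic Taylor estimate, in Cauchy form. -/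
lemma norm_taylor_two_le_of_ball {f : E → F} {c d : ℝ} {x h : E}
    (hf : Holo f (ball x d)) (hb : ∀ y ∈ ball x d, ‖f y‖ ≤ c)
    (hh : ‖h‖ < d) :
    ‖f (x + h) - f x - fderiv ℂ f x h‖ ≤ 4 * c * (‖h‖ / d) ^ 2 := by
  have hd : 0 < d := (norm_nonneg h).trans_lt hh
  have hc : 0 ≤ c := (norm_nonneg _).trans (hb x (mem_ball_self hd))
  have hmem : ∀ y ∈ ball (0 : E) d, x + y ∈ ball x d := by
    intro y hy
    simpa using hy
  set g : E → F := fun y => f (x + y) - f x - fderiv ℂ f x y with hg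
  have hg0 : g 0 = 0 := by simp [hg]
  have hdg : Holo g (ball 0 d) := by
    refine DifferentiableOn.sub (DifferentiableOn.sub ?_ (differentiableOn_const _))
      (fderiv ℂ f x).differentiable.differentiableOn
    exact hf.comp ((differentiableOn_const _).add differentiableOn_id) hmem
  have hfd : ‖fderiv ℂ f x‖ ≤ 2 * c / d := by
    refine Complex.norm_fderiv_le_div_of_mapsTo_ball hf ?_ hd
    intro y hy
    rw [mem_closedBall, dist_eq_norm]
    linarith [norm_sub_le (f y) (f x), hb y hy, hb x (mem_ball_self hd)]
  have hmaps : MapsTo g (ball 0 d) (closedBall (g 0) (4 * c)) := by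
    intro y hy
    rw [hg0, mem_closedBall_zero_iff]
    have h1 := hb _ (hmem y hy)
    have h2 := hb _ (hmem 0 (mem_ball_self hd))
    rw [add_zero] at h2
    have h3 : ‖fderiv ℂ f x y‖ ≤ 2 * c := by
      refine ((fderiv ℂ f x).le_opNorm y).trans ?_
      have h5 := norm_lt hy
      calc _ ≤ 2 * c / d * d := by gcongr
        _ = 2 * c := by field_simp
    calc _ ≤ ‖f (x + y)‖ + ‖f x‖ + ‖fderiv ℂ f x y‖ := by
          refine (norm_sub_le _ _).trans ?_
          gcongr
          exact norm_sub_le _ _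
      _ ≤ 4 * c := by linarith
  have hlit : (fun y => g y - g 0) =o[𝓝 0] (fun y => ‖y - 0‖ ^ 1) := by
    have hda : HoloAt f x :=
      hf.at_ball (mem_ball_self hd)
    have := (hasFDerivAt_iff_isLittleO_nhds_zero.1 hda.hasFDerivAt)
    simpa [hg0, hg] using this.norm_right
  have := Complex.dist_le_mul_div_pow_of_mapsTo_ball_of_isLittleO hdg hmaps hlit
    (z := h) (by simpa using hh)
  simpa [hg0, dist_eq_norm, hg] using this

lemma norm_taylor_two_le {f : E → F} {R c d : ℝ} {x h : E}
    (hf : Holo f (ball 0 R)) (hb : ∀ y ∈ ball (0 : E) R, ‖f y‖ ≤ c)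
    (hx : ‖x‖ + d ≤ R) (hh : ‖h‖ < d) :
    ‖f (x + h) - f x - fderiv ℂ f x h‖ ≤ 4 * c * (‖h‖ / d) ^ 2 := by
  have hsub : ball x d ⊆ ball 0 R := by
    apply ball_subset_ball'
    rw [dist_zero_right]; linarith
  exact norm_taylor_two_le_of_ball (hf.mono hsub) (fun y hy => hb y (hsub hy)) hh

/-- Weierstrass: a locally uniform limit of holomorphic maps is holomorphic. -/
lemma differentiableAt_of_tendstoUniformlyOn [CompleteSpace F] {f : ℕ → E → F} {g : E → F} {x : E}
    {r : ℝ} (hr : 0 < r) (hf : ∀ᶠ n in atTop, Holo (f n) (ball x r))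
    (hg : TendstoUniformlyOn f g atTop (ball x r)) : HoloAt g x := by
  have hr2 : 0 < r / 2 := by linarith
  -- translate so that Cauchy estimates apply
  have key : ∀ n m : ℕ, ∀ c : ℝ, Holo (f n) (ball x r) →
      Holo (f m) (ball x r) → (∀ y ∈ ball x r, ‖f n y - f m y‖ ≤ c) →
      ∀ y ∈ ball x (r / 2), ‖fderiv ℂ (f n) y - fderiv ℂ (f m) y‖ ≤ 2 * c / (r / 2) := by
    intro n m c hn hm hc y hy
    have hsub : ball y (r / 2) ⊆ ball x r := by
      apply ball_subset_ball'
      have := mem_ball.1 hy; linarith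
    have hyx : y ∈ ball x r := hsub (mem_ball_self hr2)
    have e1 := (hn.at_ball hyx)
    have e2 := (hm.at_ball hyx)
    rw [← fderiv_sub e1 e2]
    refine Complex.norm_fderiv_le_div_of_mapsTo_ball ((hn.sub hm).mono hsub) ?_ hr2
    intro z hz
    rw [mem_closedBall, dist_eq_norm]
    have h1 := hc z (hsub hz)
    have h2 := hc y hyx
    simp only [Pi.sub_apply]
    linarith [norm_sub_le (f n z - f m z) (f n y - f m y)]
  have hcau : UniformCauchySeqOn (fun n => fderiv ℂ (f n)) atTop (ball x (r / 2)) := by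
    have h0 := hg.uniformCauchySeqOn
    rw [Metric.uniformCauchySeqOn_iff] at h0 ⊢
    intro ε hε
    obtain ⟨N0, hN0⟩ := eventually_atTop.1 hf
    obtain ⟨N, hN⟩ := h0 (ε * r / 8) (by positivity)
    refine ⟨max N N0, fun m hm n hn y hy => ?_⟩
    rw [dist_eq_norm]
    refine (key m n (ε * r / 8) (hN0 m (le_of_max_le_right hm)) (hN0 n (le_of_max_le_right hn))
      (fun z hz => ?_) y hy).trans_lt ?_
    · rw [← dist_eq_norm]; exact (hN m (le_of_max_le_left hm) n (le_of_max_le_left hn) z hz).le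
    · have : 2 * (ε * r / 8) / (r / 2) = ε / 2 := by field_simp; norm_num
      rw [this]; linarith
  have hlim : ∀ y ∈ ball x (r / 2), ∃ l, Tendsto (fun n => fderiv ℂ (f n) y) atTop (𝓝 l) := by
    intro y hy
    exact cauchySeq_tendsto_of_complete (hcau.cauchySeq hy)
  choose! g' hg' using hlim
  have hunif := hcau.tendstoUniformlyOn_of_tendsto hg'
  have hx : x ∈ ball x (r / 2) := mem_ball_self hr2
  obtain ⟨N0, hN0⟩ := eventually_atTop.1 hf
  have : HasFDerivAt g (g' x) x := by
    refine hasFDerivAt_of_tendstoUniformlyOn (f := fun n => f (n + N0))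
      (f' := fun n => fderiv ℂ (f (n + N0))) (l := atTop) isOpen_ball ?_ ?_ ?_ hx
    · intro u hu
      exact (tendsto_add_atTop_nat N0).eventually (hunif u hu)
    · intro n y hy
      exact ((hN0 (n + N0) (by omega)).differentiableAt (isOpen_ball.mem_nhds
        (ball_mono hy))).hasFDerivAt
    · intro y hy
      exact (hg.tendsto_at (ball_mono hy)).comp (tendsto_add_atTop_nat N0)
  exact this.differentiableAt

/-- The directional derivatives of a holomorphic map are holomorphic. -/
lemma DifferentiableOn.fderiv_apply_const [CompleteSpace F] {f : E → F} {U : Set E}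
    (hf : Holo f U) (hU : IsOpen U) (v : E) :
    Holo (fun x => fderiv ℂ f x v) U := by
  intro x hx
  refine DifferentiableAt.differentiableWithinAt ?_
  obtain ⟨r, hr, hrU⟩ : ∃ r > 0, ∀ y ∈ ball x r, y ∈ U ∧ ‖f y‖ ≤ ‖f x‖ + 1 := by
    have h1 := hU.mem_nhds hx
    have h2 : ∀ᶠ y in 𝓝 x, ‖f y‖ < ‖f x‖ + 1 :=
      (hf.continuousOn.continuousAt h1).norm.eventually_lt_const (by linarith)
    obtain ⟨r, hr, h⟩ := Metric.mem_nhds_iff.1 (Filter.inter_mem h1 h2)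
    exact ⟨r, hr, fun y hy => ⟨(h hy).1, (h hy).2.le⟩⟩
  set c := ‖f x‖ + 1 with hc
  have hc0 : 0 ≤ c := by positivity
  have hfr : Holo f (ball x r) := hf.mono fun y hy => (hrU y hy).1
  have hsub : ∀ y ∈ ball x (r / 2), ball y (r / 2) ⊆ ball x r := fun y hy =>
    ball_subset_ball' (by have := mem_ball.1 hy; linarith)
  have hsmall : ∀ n : ℕ, n ≠ 0 → ‖((n : ℂ)⁻¹ • v)‖ = ‖v‖ / n := by
    intro n hn
    rw [norm_smul, norm_inv, Complex.norm_natCast]; field_simp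
  have hlim : Tendsto (fun n : ℕ => ‖v‖ / (n : ℝ)) atTop (𝓝 0) := tendsto_const_div_atTop_nhds_zero_nat _
  have hN : ∀ᶠ n : ℕ in atTop, ‖v‖ / (n : ℝ) < r / 2 := hlim.eventually_lt_const (by linarith)
  refine differentiableAt_of_tendstoUniformlyOn (r := r / 2)
    (f := fun n y => (n : ℂ) • (f (y + (n : ℂ)⁻¹ • v) - f y)) (by linarith) ?_ ?_
  · filter_upwards [hN, eventually_ne_atTop 0] with n hn hn0
    refine DifferentiableOn.const_smul (DifferentiableOn.sub ?_ (hfr.mono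
      (ball_subset_ball (by linarith)))) _
    refine hfr.comp (differentiableOn_id.add (differentiableOn_const _)) fun y hy => ?_
    apply hsub y hy
    simp only [mem_ball, dist_eq_norm, add_sub_cancel_left]
    rw [hsmall n hn0]; exact hn
  · rw [Metric.tendstoUniformlyOn_iff]
    intro ε hε
    have hlim2 : Tendsto (fun n : ℕ => (4 * c * ‖v‖ / (r / 2) ^ 2) * (‖v‖ / (n : ℝ))) atTop (𝓝 0) := by
      simpa using hlim.const_mul (4 * c * ‖v‖ / (r / 2) ^ 2)
    filter_upwards [hN, eventually_ne_atTop 0, hlim2.eventually_lt_const hε] with n hn hn0 hne y hy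
    have hT := norm_taylor_two_le_of_ball (hfr.mono (hsub y hy))
      (fun z hz => (hrU z (hsub y hy hz)).2) (h := (n : ℂ)⁻¹ • v) (by rw [hsmall n hn0]; exact hn)
    rw [hsmall n hn0] at hT
    have hnC : (n : ℂ) ≠ 0 := by exact_mod_cast hn0
    have hnR : (0 : ℝ) < n := by positivity
    rw [dist_comm, dist_eq_norm]
    have e : (n : ℂ) • (f (y + (n : ℂ)⁻¹ • v) - f y) - fderiv ℂ f y v
        = (n : ℂ) • (f (y + (n : ℂ)⁻¹ • v) - f y - fderiv ℂ f y ((n : ℂ)⁻¹ • v)) := by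
      rw [map_smul, smul_sub (n : ℂ) _ ((n : ℂ)⁻¹ • _), smul_smul, mul_inv_cancel₀ hnC, one_smul]
    rw [e, norm_smul, Complex.norm_natCast]
    calc _ ≤ n * (4 * c * (‖v‖ / n / (r / 2)) ^ 2) := by gcongr
      _ = (4 * c * ‖v‖ / (r / 2) ^ 2) * (‖v‖ / (n : ℝ)) := by field_simp
      _ < ε := hne

end Cauchy

/-! ### Taylor coefficients in two variables -/

section TaylorCoefficients

/-- The `n`-th Taylor coefficient at the origin of a function of one variable. -/
def taylorCoeff (n : ℕ) (f : ℂ → ℂ) : ℂ := iteratedDeriv n f 0 / (n.factorial : ℂ)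

lemma taylorCoeff_congr {n : ℕ} {f g : ℂ → ℂ} (h : f =ᶠ[𝓝 0] g) :
    taylorCoeff n f = taylorCoeff n g := by
  rw [taylorCoeff, taylorCoeff, h.iteratedDeriv_eq]

lemma norm_taylorCoeff_le {n : ℕ} {f : ℂ → ℂ} {R B : ℝ} (hR : 0 < R)
    (hf : Holo f (ball 0 R)) (hb : ∀ z ∈ ball (0 : ℂ) R, ‖f z‖ ≤ B) :
    ‖taylorCoeff n f‖ ≤ B * (2 / R) ^ n := by
  have hsub : closedBall (0 : ℂ) (R / 2) ⊆ ball 0 R := closedBall_subset_ball (by linarith)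
  have h := Complex.norm_iteratedDeriv_le_of_forall_mem_sphere_norm_le (c := 0) (n := n) (C := B)
    (f := f) (half_pos hR) ((hf.mono (by
      rw [closure_ball _ (half_pos hR).ne'] ; exact hsub)).diffContOnCl)
    (fun z hz => hb z (hsub (sphere_subset_closedBall hz)))
  rw [taylorCoeff, norm_div, Complex.norm_natCast, div_le_iff₀ (by positivity)]
  refine h.trans_eq ?_
  rw [div_pow, div_pow]
  field_simp

lemma taylorCoeff_sub {n : ℕ} {f g : ℂ → ℂ} (hf : AnalyticAt ℂ f 0) (hg : AnalyticAt ℂ g 0) :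
    taylorCoeff n (fun z => f z - g z) = taylorCoeff n f - taylorCoeff n g := by
  have := iteratedDeriv_fun_sub (n := n) (x := (0 : ℂ)) hf.contDiffAt hg.contDiffAt
  rw [taylorCoeff, this, sub_div]; rfl

lemma taylorCoeff_const_mul {n : ℕ} (c : ℂ) (f : ℂ → ℂ) :
    taylorCoeff n (fun z => c * f z) = c * taylorCoeff n f := by
  rw [taylorCoeff, taylorCoeff, mul_div_assoc', ← iteratedDeriv_const_mul_field]

lemma taylorCoeff_sum {ι : Type*} (s : Finset ι) {n : ℕ} {f : ι → ℂ → ℂ}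
    (hf : ∀ i ∈ s, AnalyticAt ℂ (f i) 0) :
    taylorCoeff n (fun z => ∑ i ∈ s, f i z) = ∑ i ∈ s, taylorCoeff n (f i) := by
  rw [taylorCoeff, iteratedDeriv_fun_sum fun i hi => (hf i hi).contDiffAt, Finset.sum_div]; rfl

lemma taylorCoeff_pow (n k : ℕ) : taylorCoeff n (fun z => z ^ k) = if n = k then 1 else 0 := by
  rw [taylorCoeff, iteratedDeriv_fun_pow_zero]
  split_ifs with h
  · rw [h, div_self (by exact_mod_cast k.factorial_ne_zero)]
  · simp

lemma norm_sub_taylor_le {f : ℂ → ℂ} {R B : ℝ} (N : ℕ)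
    (hf : Holo f (ball 0 R)) (hb : ∀ z ∈ ball (0 : ℂ) R, ‖f z‖ ≤ B)
    {z : ℂ} (hz : z ∈ ball (0 : ℂ) R) :
    ‖f z - ∑ n ∈ Finset.range N, taylorCoeff n f * z ^ n‖ ≤ B * 2 ^ N * (‖z‖ / R) ^ N := by
  have hR : 0 < R := (norm_nonneg z).trans_lt (norm_lt hz)
  have hB : 0 ≤ B := (norm_nonneg _).trans (hb z hz)
  rcases N with _ | N
  · simpa using hb z hz
  set g : ℂ → ℂ := fun z => f z - ∑ n ∈ Finset.range (N + 1), taylorCoeff n f * z ^ n with hg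
  have hg0 : g 0 = 0 := by
    simp [hg, Finset.sum_range_succ', taylorCoeff]
  have hdg : Holo g (ball 0 R) := by
    refine hf.sub (Differentiable.differentiableOn ?_)
    fun_prop
  have hgeo : ∀ M : ℕ, (1 : ℝ) + ∑ n ∈ Finset.range M, (2 : ℝ) ^ n = 2 ^ M := by
    intro M
    induction M with
    | zero => simp
    | succ M ih => rw [Finset.sum_range_succ, ← add_assoc, ih]; ring
  have hmaps : MapsTo g (ball 0 R) (closedBall (g 0) (B * 2 ^ (N + 1))) := by
    intro y hy
    rw [hg0, mem_closedBall_zero_iff, ← hgeo, mul_add, mul_one, Finset.mul_sum]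
    refine (norm_sub_le _ _).trans (add_le_add (hb y hy) ((norm_sum_le _ _).trans
      (Finset.sum_le_sum fun n _ => ?_)))
    rw [norm_mul, norm_pow]
    have hy' := (norm_lt hy).le
    calc _ ≤ (B * (2 / R) ^ n) * R ^ n := by
          gcongr; exact norm_taylorCoeff_le hR hf hb
      _ = B * 2 ^ n := by rw [div_pow]; field_simp
  have han : AnalyticAt ℂ f 0 := hf.analyticAt (isOpen_ball.mem_nhds (mem_ball_self hR))
  have hO := han.hasFPowerSeriesAt.isBigO_sub_partialSum_pow (N + 1)
  have hlit : (fun y => g y - g 0) =o[𝓝 0] (fun y : ℂ => ‖y - 0‖ ^ N) := by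
    have h1 : (fun y => g y - g 0) =O[𝓝 0] (fun y : ℂ => ‖y‖ ^ (N + 1)) := by
      refine hO.congr_left fun y => ?_
      rw [hg0, sub_zero]
      simp [hg, FormalMultilinearSeries.partialSum, taylorCoeff,
        FormalMultilinearSeries.ofScalars, mul_comm]
    refine h1.trans_isLittleO ?_
    simp only [sub_zero]
    have := (Asymptotics.isLittleO_pow_pow (𝕜 := ℝ) (Nat.lt_succ_self N)).comp_tendsto
      (tendsto_norm_zero (E := ℂ))
    exact this
  have := Complex.dist_le_mul_div_pow_of_mapsTo_ball_of_isLittleO hdg hmaps hlit hz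
  rwa [hg0, dist_eq_norm, dist_eq_norm, sub_zero, sub_zero] at this

lemma hasDerivAt_slice_fst {F : ℂ² → ℂ} {z w : ℂ} (h : HoloAt F (z, w)) :
    HasDerivAt (fun x => F (x, w)) (dz F (z, w)) z := by
  have h1 : HasDerivAt (fun x : ℂ => (x, w)) (1, 0) z :=
    (hasDerivAt_id z).prodMk (hasDerivAt_const z w)
  exact h.hasFDerivAt.comp_hasDerivAt z h1

lemma mem_ball_prod {z w : ℂ} {R : ℝ} :
    (z, w) ∈ 𝔻 R ↔ ‖z‖ < R ∧ ‖w‖ < R := by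
  rw [mem_ball_zero_iff, Prod.norm_mk, max_lt_iff]

lemma iteratedDeriv_slice {k : ℕ} {F : ℂ² → ℂ} {R : ℝ} (hF : Holo F (ball 0 R))
    {w : ℂ} (hw : w ∈ ball (0 : ℂ) R) :
    iteratedDeriv k (fun z => F (z, w)) 0 = (dz^[k] F) (0, w) := by
  have hR : 0 < R := (norm_nonneg w).trans_lt (norm_lt hw)
  induction k generalizing F with
  | zero => simp
  | succ k ih =>
    rw [iteratedDeriv_succ', Function.iterate_succ_apply,
      ← ih (F := dz F) (hF.fderiv_apply_const isOpen_ball _)]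
    refine Filter.EventuallyEq.iteratedDeriv_eq _ ?_
    filter_upwards [ball_mem_nhds (0 : ℂ) hR] with z hz
    refine (hasDerivAt_slice_fst (hF.differentiableAt (isOpen_ball.mem_nhds ?_))).deriv
    exact mem_ball_prod.2 ⟨by simpa using hz, by simpa using hw⟩

lemma differentiableOn_taylorCoeff_slice (k : ℕ) {F : ℂ² → ℂ} {R : ℝ}
    (hF : Holo F (ball 0 R)) :
    Holo (fun w => taylorCoeff k (fun z => F (z, w))) (ball 0 R) := by
  have h1 : Holo (dz^[k] F) (ball 0 R) := by
    induction k generalizing F with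
    | zero => exact hF
    | succ k ih =>
      rw [Function.iterate_succ_apply]
      exact ih (hF.fderiv_apply_const isOpen_ball _)
  have h2 : Holo (fun w : ℂ => (dz^[k] F) (0, w) / (k.factorial : ℂ)) (ball 0 R) := by
    refine DifferentiableOn.div_const (h1.comp (by fun_prop) fun w hw => ?_) _
    exact mem_ball_prod.2 ⟨by simpa using (norm_nonneg w).trans_lt (norm_lt hw),
      by simpa using hw⟩
  refine h2.congr fun w hw => ?_
  rw [taylorCoeff, iteratedDeriv_slice hF hw]

lemma differentiableOn_slice {F : ℂ² → ℂ} {R : ℝ} (hF : Holo F (ball 0 R))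
    {w : ℂ} (hw : ‖w‖ < R) : Holo (fun z => F (z, w)) (ball 0 R) :=
  hF.comp (by fun_prop) fun _ hz => mem_ball_prod.2 ⟨norm_lt hz, hw⟩

/-- The coefficient of `z ^ k * w ^ l` in the Taylor expansion at the origin. -/
def coeff₂ (k l : ℕ) (F : ℂ² → ℂ) : ℂ :=
  taylorCoeff l (fun w => taylorCoeff k (fun z => F (z, w)))

lemma norm_coeff₂_le {k l : ℕ} {F : ℂ² → ℂ} {R B : ℝ} (hR : 0 < R)
    (hF : Holo F (ball 0 R)) (hb : ∀ p ∈ 𝔻 R, ‖F p‖ ≤ B) :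
    ‖coeff₂ k l F‖ ≤ B * (2 / R) ^ (k + l) := by
  have := norm_taylorCoeff_le (n := l) hR (differentiableOn_taylorCoeff_slice k hF)
    (B := B * (2 / R) ^ k) fun w hw => norm_taylorCoeff_le hR
      (differentiableOn_slice hF (norm_lt hw)) fun z hz =>
        hb _ (mem_ball_prod.2 ⟨norm_lt hz, norm_lt hw⟩)
  refine this.trans_eq ?_
  rw [pow_add]; ring

lemma analyticAt_slice {F : ℂ² → ℂ} {R : ℝ} (hF : Holo F (ball 0 R))
    {w : ℂ} (hw : ‖w‖ < R) : AnalyticAt ℂ (fun z => F (z, w)) 0 :=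
  (differentiableOn_slice hF hw).analyticAt
    (isOpen_ball.mem_nhds (mem_ball_self ((norm_nonneg w).trans_lt hw)))

lemma coeff₂_sub {k l : ℕ} {F G : ℂ² → ℂ} {R : ℝ} (hR : 0 < R)
    (hF : Holo F (ball 0 R)) (hG : Holo G (ball 0 R)) :
    coeff₂ k l (fun p => F p - G p) = coeff₂ k l F - coeff₂ k l G := by
  have h0 := isOpen_ball.mem_nhds (mem_ball_self (x := (0 : ℂ)) hR)
  rw [coeff₂, coeff₂, coeff₂,
    ← taylorCoeff_sub ((differentiableOn_taylorCoeff_slice k hF).analyticAt h0)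
      ((differentiableOn_taylorCoeff_slice k hG).analyticAt h0)]
  refine taylorCoeff_congr ?_
  filter_upwards [h0] with w hw
  exact taylorCoeff_sub (analyticAt_slice hF (norm_lt hw))
    (analyticAt_slice hG (norm_lt hw))

lemma coeff₂_monomial (k l m n : ℕ) (c : ℂ) :
    coeff₂ k l (fun p => c * p.1 ^ m * p.2 ^ n) = if k = m ∧ l = n then c else 0 := by
  have h : ∀ w : ℂ, taylorCoeff k (fun z : ℂ => c * z ^ m * w ^ n)
      = (c * if k = m then 1 else 0) * w ^ n := by
    intro w
    have : (fun z : ℂ => c * z ^ m * w ^ n) = fun z => (c * w ^ n) * z ^ m := by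
      funext z; ring
    rw [this, taylorCoeff_const_mul, taylorCoeff_pow]; ring
  simp only [coeff₂, h]
  rw [taylorCoeff_const_mul, taylorCoeff_pow]
  split_ifs <;> simp_all

lemma coeff₂_sum {ι : Type*} (s : Finset ι) {k l : ℕ} {F : ι → ℂ² → ℂ} {R : ℝ} (hR : 0 < R)
    (hF : ∀ i ∈ s, Holo (F i) (ball 0 R)) :
    coeff₂ k l (fun p => ∑ i ∈ s, F i p) = ∑ i ∈ s, coeff₂ k l (F i) := by
  have h0 := isOpen_ball.mem_nhds (mem_ball_self (x := (0 : ℂ)) hR)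
  simp only [coeff₂]
  rw [← taylorCoeff_sum s fun i hi =>
    (differentiableOn_taylorCoeff_slice k (hF i hi)).analyticAt h0]
  refine taylorCoeff_congr ?_
  filter_upwards [h0] with w hw
  exact taylorCoeff_sum s fun i hi => analyticAt_slice (hF i hi) (norm_lt hw)

/-- The Taylor polynomial of degree `< N` in two variables, with a Cauchy bound on the remainder. -/
lemma norm_sub_taylor₂_le {F : ℂ² → ℂ} {R B : ℝ} (N : ℕ)
    (hF : Holo F (ball 0 R)) (hb : ∀ p ∈ 𝔻 R, ‖F p‖ ≤ B)
    {p : ℂ²} (hp : p ∈ 𝔻 R) :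
    ‖F p - ∑ k ∈ Finset.range N, ∑ l ∈ Finset.range (N - k),
      coeff₂ k l F * p.1 ^ k * p.2 ^ l‖ ≤ B * (2 ^ N * (N + 1)) * (‖p‖ / R) ^ N := by
  obtain ⟨z, w⟩ := p
  have hR : 0 < R := (norm_nonneg _).trans_lt (norm_lt hp)
  have hB : 0 ≤ B := (norm_nonneg _).trans (hb _ hp)
  obtain ⟨hz, hw⟩ := mem_ball_prod.1 hp
  set P := ‖((z, w) : ℂ²)‖ with hP
  have hzP : ‖z‖ ≤ P := le_max_left _ _
  have hwP : ‖w‖ ≤ P := le_max_right _ _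
  set a : ℕ → ℂ → ℂ := fun k w => taylorCoeff k (fun z => F (z, w))
  have h1 := norm_sub_taylor_le N (differentiableOn_slice hF hw) (B := B)
    (fun z hz => hb _ (mem_ball_prod.2 ⟨norm_lt hz, hw⟩)) (mem_ball₀ hz)
  have h2 : ∀ k ∈ Finset.range N, ‖a k w * z ^ k - (∑ l ∈ Finset.range (N - k),
      coeff₂ k l F * z ^ k * w ^ l)‖ ≤ B * 2 ^ N * (P / R) ^ N := by
    intro k hk
    have hk' : k < N := Finset.mem_range.1 hk
    have h3 := norm_sub_taylor_le (N - k) (differentiableOn_taylorCoeff_slice k hF)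
      (B := B * (2 / R) ^ k) (fun w hw => norm_taylorCoeff_le hR
        (differentiableOn_slice hF (norm_lt hw)) fun z hz =>
          hb _ (mem_ball_prod.2 ⟨norm_lt hz, norm_lt hw⟩))
      (mem_ball₀ hw)
    have h4 : a k w * z ^ k - (∑ l ∈ Finset.range (N - k), coeff₂ k l F * z ^ k * w ^ l)
        = (a k w - ∑ l ∈ Finset.range (N - k), coeff₂ k l F * w ^ l) * z ^ k := by
      rw [sub_mul, Finset.sum_mul]
      congr 1
      exact Finset.sum_congr rfl fun l _ => by ring
    rw [h4, norm_mul, norm_pow]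
    calc _ ≤ (B * (2 / R) ^ k * 2 ^ (N - k) * (‖w‖ / R) ^ (N - k)) * ‖z‖ ^ k := by gcongr; exact h3
      _ ≤ (B * (2 / R) ^ k * 2 ^ (N - k) * (P / R) ^ (N - k)) * P ^ k := by gcongr
      _ = B * (2 ^ k * 2 ^ (N - k)) * ((P / R) ^ k * (P / R) ^ (N - k)) := by
          rw [div_pow 2 R k, div_pow P R k]; ring
      _ = B * 2 ^ N * (P / R) ^ N := by rw [← pow_add, ← pow_add, Nat.add_sub_cancel' hk'.le]
  have h5 : F (z, w) - ∑ k ∈ Finset.range N, ∑ l ∈ Finset.range (N - k),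
      coeff₂ k l F * z ^ k * w ^ l
      = (F (z, w) - ∑ k ∈ Finset.range N, a k w * z ^ k)
        + ∑ k ∈ Finset.range N, (a k w * z ^ k - ∑ l ∈ Finset.range (N - k),
          coeff₂ k l F * z ^ k * w ^ l) := by
    rw [Finset.sum_sub_distrib]; ring
  have h6 : ‖F (z, w) - ∑ k ∈ Finset.range N, a k w * z ^ k‖ ≤ B * 2 ^ N * (P / R) ^ N :=
    h1.trans (by gcongr)
  simp only at *
  rw [h5]
  refine (norm_add_le _ _).trans ((add_le_add h6 ((norm_sum_le _ _).trans
    (Finset.sum_le_sum h2))).trans_eq ?_)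
  simp; ring

end TaylorCoefficients

/-! ### Holomorphic maps close to the identity -/

section NearIdentity

variable {P : Type*} [NormedAddCommGroup P] [NormedSpace ℂ P]

lemma approximatesLinearOn_near_id {f : P → P} {R c d : ℝ}
    (hf : Holo f (ball 0 R)) (hb : ∀ x ∈ ball (0 : P) R, ‖f x - x‖ ≤ c)
    (hd : 0 < d) (hcd : 4 * c ≤ d) :
    ApproximatesLinearOn f ((ContinuousLinearEquiv.refl ℂ P : P ≃L[ℂ] P) : P →L[ℂ] P)
      (ball 0 (R - d)) (1 / 2) := by
  intro x hx y hy
  have h := norm_sub_le_of_bound (f := fun x => f x - x) (hf.sub differentiableOn_id) hb hd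
    (norm_lt hx) (norm_lt hy)
  have h2 : 2 * c / d ≤ 1 / 2 := by rw [div_le_iff₀ hd]; linarith
  calc _ = ‖f x - x - (f y - y)‖ := by simp; congr 1; abel
    _ ≤ 1 / 2 * ‖x - y‖ := h.trans (by gcongr)
    _ = _ := by norm_num

/-- A holomorphic map close to the identity on a ball is, on a smaller ball, a biholomorphism onto
its image, and the image contains a still smaller ball. -/
lemma exists_openPartialHomeomorph_near_id [CompleteSpace P] [Nontrivial P] {f : P → P} {R c d : ℝ}
    (hf : Holo f (ball 0 R)) (hb : ∀ x ∈ ball (0 : P) R, ‖f x - x‖ ≤ c)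
    (hd : 0 < d) (hcd : 4 * c ≤ d) :
    ∃ e : OpenPartialHomeomorph P P, (e : P → P) = f ∧ e.source = ball 0 (R - d) ∧
      ball 0 (R - 2 * d) ⊆ e.target ∧ Holo e.symm e.target := by
  have happ := approximatesLinearOn_near_id hf hb hd hcd
  have hN : ‖((ContinuousLinearEquiv.refl ℂ P).symm : P →L[ℂ] P)‖₊ = 1 := by
    have : ((ContinuousLinearEquiv.refl ℂ P).symm : P →L[ℂ] P) = ContinuousLinearMap.id ℂ P := rfl
    rw [this]; ext; simp
  have hc : Subsingleton P ∨
      (1 / 2 : NNReal) < ‖((ContinuousLinearEquiv.refl ℂ P).symm : P →L[ℂ] P)‖₊⁻¹ := by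
    right; rw [hN]; norm_num [← NNReal.coe_lt_coe]
  have hsub : ball (0 : P) (R - d) ⊆ ball 0 R := ball_le
  refine ⟨happ.toOpenPartialHomeomorph f _ hc isOpen_ball, rfl, rfl, fun y hy => ?_, ?_⟩
  · have hy' := norm_lt hy
    have hyR : y ∈ ball (0 : P) R := ball_mono hy
    have hc0 : 0 ≤ c := (norm_nonneg _).trans (hb y hyR)
    have := happ.closedBall_subset_target hc isOpen_ball (b := y) (ε := 2 * c) (by linarith)
      (fun z hz => by
        rw [mem_ball_zero_iff]
        have := mem_closedBall_iff_norm.1 hz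
        linarith [norm_le_add_sub z y])
    refine this ?_
    rw [hN, mem_closedBall, dist_comm, dist_eq_norm]
    refine (hb y hyR).trans ?_
    norm_num
    linarith
  · intro y hy
    set e := happ.toOpenPartialHomeomorph f _ hc isOpen_ball with he
    have hx : e.symm y ∈ ball (0 : P) (R - d) := e.map_target hy
    have hdf : HoloAt f (e.symm y) :=
      hf.at_ball (hsub hx)
    have hnorm : ‖fderiv ℂ (fun x => x - f x) (e.symm y)‖ < 1 := by
      have h := norm_fderiv_le_of_bound (f := fun x => x - f x) (x := e.symm y)
        (differentiableOn_id.sub hf) (fun z hz => by rw [norm_sub_rev]; exact hb z hz) hd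
        (by have := norm_lt hx; linarith)
      refine h.trans_lt ?_
      rw [div_lt_one hd]
      linarith
    have hfd : fderiv ℂ (fun x => x - f x) (e.symm y) = 1 - fderiv ℂ f (e.symm y) := by
      rw [fderiv_fun_sub differentiableAt_fun_id hdf, fderiv_fun_id]; rfl
    set u : (P →L[ℂ] P)ˣ := Units.oneSub (fderiv ℂ (fun x => x - f x) (e.symm y)) hnorm with hu
    have hu' : ((ContinuousLinearEquiv.unitsEquiv ℂ P u : P ≃L[ℂ] P) : P →L[ℂ] P)
        = fderiv ℂ f (e.symm y) := by
      ext z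
      have : (u : P →L[ℂ] P) = fderiv ℂ f (e.symm y) := by
        rw [hu, Units.val_oneSub, hfd, sub_sub_cancel]
      simp [← this]
    refine (e.hasFDerivAt_symm (f' := ContinuousLinearEquiv.unitsEquiv ℂ P u) hy ?_).differentiableAt.differentiableWithinAt
    rw [hu']
    exact hdf.hasFDerivAt

/-- Solution of `x + v (q, x) = y` for a small holomorphic perturbation `v` depending
holomorphically on a parameter `q`: the solution is holomorphic in `(q, y)`. -/
lemma exists_parametric_inverse [CompleteSpace P] [Nontrivial P] {Q : Type*} [NormedAddCommGroup Q] [NormedSpace ℂ Q]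
    {U : Set Q} (hU : IsOpen U) {v : Q × P → P} {R c d : ℝ}
    (hv : Holo v (U ×ˢ ball 0 R)) (hb : ∀ q ∈ U, ∀ x ∈ ball (0 : P) R, ‖v (q, x)‖ ≤ c)
    (hd : 0 < d) (hcd : 4 * c ≤ d) :
    ∃ g : Q × P → P, Holo g (U ×ˢ ball 0 (R - 2 * d)) ∧
      (∀ q ∈ U, ∀ y ∈ ball (0 : P) (R - 2 * d), g (q, y) ∈ ball (0 : P) (R - d) ∧
        g (q, y) + v (q, g (q, y)) = y) ∧
      ∀ q ∈ U, ∀ x ∈ ball (0 : P) (R - d), x + v (q, x) ∈ ball (0 : P) (R - 2 * d) →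
        g (q, x + v (q, x)) = x := by
  have hsl : ∀ q ∈ U, Holo (fun x => x + v (q, x)) (ball 0 R) := fun q hq =>
    differentiableOn_id.add (hv.comp (by fun_prop) fun x hx => ⟨hq, hx⟩)
  have hsb : ∀ q ∈ U, ∀ x ∈ ball (0 : P) R, ‖x + v (q, x) - x‖ ≤ c := fun q hq x hx => by
    rw [add_sub_cancel_left]; exact hb q hq x hx
  have hex := fun q hq => exists_openPartialHomeomorph_near_id (hsl q hq) (hsb q hq) hd hcd
  have : Nonempty (OpenPartialHomeomorph P P) := ⟨OpenPartialHomeomorph.refl P⟩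
  choose! e he using hex
  have hprop : ∀ q ∈ U, ∀ y ∈ ball (0 : P) (R - 2 * d), (e q).symm y ∈ ball (0 : P) (R - d) ∧
      (e q).symm y + v (q, (e q).symm y) = y := by
    intro q hq y hy
    obtain ⟨h1, h2, h3, -⟩ := he q hq
    refine ⟨h2 ▸ (e q).map_target (h3 hy), ?_⟩
    have := (e q).right_inv (h3 hy)
    rwa [h1] at this
  refine ⟨fun p => (e p.1).symm p.2, ?_, hprop, ?_⟩
  · rintro ⟨q₀, y₀⟩ ⟨hq₀, hy₀⟩
    refine DifferentiableAt.differentiableWithinAt ?_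
    simp only at hq₀ hy₀
    obtain ⟨hx₀, hxy₀⟩ := hprop q₀ hq₀ y₀ hy₀
    set x₀ := (e q₀).symm y₀ with hx₀d
    have hsub : ball (0 : P) (R - d) ⊆ ball 0 R := ball_le
    have hW : U ×ˢ ball (0 : P) (R - 2 * d) ∈ 𝓝 (q₀, y₀) :=
      (hU.prod isOpen_ball).mem_nhds ⟨hq₀, hy₀⟩
    have hvd : HoloAt v (q₀, x₀) :=
      hv.differentiableAt ((hU.prod isOpen_ball).mem_nhds ⟨hq₀, hsub hx₀⟩)
    have hc2 : 2 * c / d ≤ 1 / 2 := by rw [div_le_iff₀ hd]; linarith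
    set G : Q × P → Q × P := fun p => (p.1, (e p.1).symm p.2) with hG
    have hGc : ContinuousAt G (q₀, y₀) := by
      refine ContinuousAt.prodMk continuousAt_fst ?_
      rw [ContinuousAt, tendsto_iff_norm_sub_tendsto_zero]
      have hlim : Tendsto (fun p : Q × P => 2 * (‖p.2 - y₀‖ + ‖v (p.1, x₀) - v (q₀, x₀)‖))
          (𝓝 (q₀, y₀)) (𝓝 0) := by
        have h1 : Tendsto (fun p : Q × P => ‖p.2 - y₀‖) (𝓝 (q₀, y₀)) (𝓝 0) := by
          have : ContinuousAt (fun p : Q × P => ‖p.2 - y₀‖) (q₀, y₀) := by fun_prop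
          simpa [ContinuousAt] using this
        have h2 : Tendsto (fun p : Q × P => ‖v (p.1, x₀) - v (q₀, x₀)‖) (𝓝 (q₀, y₀)) (𝓝 0) := by
          have h3 : ContinuousAt (fun p : Q × P => v (p.1, x₀)) (q₀, y₀) := by
            refine ContinuousAt.comp (g := v) (f := fun p : Q × P => (p.1, x₀))
              hvd.continuousAt (by fun_prop)
          simpa [ContinuousAt] using (h3.sub (continuousAt_const (y := v (q₀, x₀)))).norm
        simpa using (h1.add h2).const_mul 2
      refine squeeze_zero' (Eventually.of_forall fun _ => norm_nonneg _) ?_ hlim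
      filter_upwards [hW] with p hp
      obtain ⟨hx, hxy⟩ := hprop p.1 hp.1 p.2 hp.2
      simp only [← hx₀d]
      set x := (e p.1).symm p.2
      have h4 := norm_sub_le_of_bound (f := fun x => v (p.1, x))
        (hv.comp (by fun_prop) fun x hx => ⟨hp.1, hx⟩) (hb p.1 hp.1) hd
        (norm_lt hx) (norm_lt hx₀)
      have h5 : x - x₀ = (p.2 - y₀) - (v (p.1, x) - v (p.1, x₀)) - (v (p.1, x₀) - v (q₀, x₀)) := by
        rw [← hxy, ← hxy₀]; abel
      have h6 : ‖x - x₀‖ ≤ ‖p.2 - y₀‖ + ‖v (p.1, x) - v (p.1, x₀)‖ + ‖v (p.1, x₀) - v (q₀, x₀)‖ := by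
        conv_lhs => rw [h5]
        exact (norm_sub_le _ _).trans (add_le_add_left (norm_sub_le _ _) _)
      have h7 : ‖v (p.1, x) - v (p.1, x₀)‖ ≤ 1 / 2 * ‖x - x₀‖ := h4.trans (by gcongr)
      linarith
    -- the derivative of `(q, x) ↦ (q, x + v (q, x))` is block triangular and invertible
    set D := fderiv ℂ v (q₀, x₀) with hD
    set A : P →L[ℂ] P := D.comp (ContinuousLinearMap.inr ℂ Q P) with hA
    have hAn : ‖-A‖ < 1 := by
      have h8 : HasFDerivAt (fun x => v (q₀, x)) A x₀ :=
        hvd.hasFDerivAt.comp x₀ (hasFDerivAt_prodMk_right q₀ x₀)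
      have h9 := norm_fderiv_le_of_bound (f := fun x => v (q₀, x)) (x := x₀)
        (hv.comp (by fun_prop) fun x hx => ⟨hq₀, hx⟩) (hb q₀ hq₀) hd
        (by have := norm_lt hx₀; linarith)
      rw [h8.fderiv] at h9
      rw [norm_neg]; linarith
    set u := Units.oneSub (-A) hAn with hu
    have hu' : ∀ z, (u : P →L[ℂ] P) z = z + A z := fun z => by
      rw [hu, Units.val_oneSub]; simp
    set L : (Q × P) ≃L[ℂ] (Q × P) := (ContinuousLinearEquiv.refl ℂ Q).skewProd
      (ContinuousLinearEquiv.unitsEquiv ℂ P u) (D.comp (ContinuousLinearMap.inl ℂ Q P)) with hL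
    have hΦ : HasFDerivAt (fun p : Q × P => (p.1, p.2 + v p)) (L : (Q × P) →L[ℂ] (Q × P))
        (G (q₀, y₀)) := by
      have h10 : HasFDerivAt (fun p : Q × P => (p.1, p.2 + v p))
          ((ContinuousLinearMap.fst ℂ Q P).prod (ContinuousLinearMap.snd ℂ Q P + D)) (q₀, x₀) :=
        hasFDerivAt_fst.prodMk (hasFDerivAt_snd.add hvd.hasFDerivAt)
      convert! h10 using 1
      refine ContinuousLinearMap.ext fun p => ?_
      have h11 : D p = D (p.1, 0) + D (0, p.2) := by rw [← map_add]; simp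
      simp [hL, hu', hA, h11]
      abel
    have hinv : ∀ᶠ p in 𝓝 (q₀, y₀), (fun p : Q × P => (p.1, p.2 + v p)) (G p) = p := by
      filter_upwards [hW] with p hp
      exact Prod.ext rfl (hprop p.1 hp.1 p.2 hp.2).2
    have := HasFDerivAt.of_local_left_inverse hGc hΦ hinv
    exact this.differentiableAt.snd
  · intro q hq x hx hy
    obtain ⟨h1, h2, h3, -⟩ := he q hq
    have := (e q).left_inv (h2 ▸ hx)
    rw [h1] at this
    exact this

end NearIdentity

/-! ### Jacobians and canonical relations -/

section PlaneMaps

variable {F : Type*} [NormedAddCommGroup F] [NormedSpace ℂ F]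

lemma clm_prod_apply (L : ℂ² →L[ℂ] F) (p : ℂ²) :
    L p = p.1 • L (1, 0) + p.2 • L (0, 1) := by
  rw [← map_smul, ← map_smul, ← map_add]
  simp

lemma DifferentiableOn.fderiv_prod [CompleteSpace F] {f : ℂ² → F} {U : Set ℂ²}
    (hf : Holo f U) (hU : IsOpen U) : Holo (fderiv ℂ f) U := by
  have h1 := hf.fderiv_apply_const hU (1, 0)
  have h2 := hf.fderiv_apply_const hU (0, 1)
  have h3 : fderiv ℂ f = fun p =>
      (ContinuousLinearMap.smulRightL ℂ ℂ² F (ContinuousLinearMap.fst ℂ ℂ ℂ)) (fderiv ℂ f p (1, 0))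
      + (ContinuousLinearMap.smulRightL ℂ ℂ² F (ContinuousLinearMap.snd ℂ ℂ ℂ))
        (fderiv ℂ f p (0, 1)) := by
    funext p
    refine ContinuousLinearMap.ext fun q => ?_
    rw [clm_prod_apply (fderiv ℂ f p) q]
    simp
  rw [h3]
  exact ((ContinuousLinearMap.differentiable _).comp_differentiableOn h1).add
    ((ContinuousLinearMap.differentiable _).comp_differentiableOn h2)

lemma dw_dz_comm {H : ℂ² → ℂ} {U : Set ℂ²} (hH : Holo H U) (hU : IsOpen U)
    {p : ℂ²} (hp : p ∈ U) : dw (dz H) p = dz (dw H) p := by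
  have hd := (hH.fderiv_prod hU).differentiableAt (hU.mem_nhds hp)
  have hsym := second_derivative_symmetric_of_eventually (f := H) (f' := fderiv ℂ H) (x := p)
    (by filter_upwards [hU.mem_nhds hp] with y hy
        exact (hH.differentiableAt (hU.mem_nhds hy)).hasFDerivAt) hd.hasFDerivAt (0, 1) (1, 0)
  have e : ∀ v u : ℂ², fderiv ℂ (fun x => fderiv ℂ H x v) p u = fderiv ℂ (fderiv ℂ H) p u v := by
    intro v u
    have := (hd.hasFDerivAt.clm_apply (hasFDerivAt_const v p)).fderiv
    rw [this]; simp
  change fderiv ℂ (fun x => fderiv ℂ H x (1, 0)) p (0, 1) = fderiv ℂ (fun x => fderiv ℂ H x (0, 1)) p (1, 0)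
  rw [e, e, hsym]

/-- The complex Jacobian determinant of a map of `ℂ²`. -/
def jac (f : ℂ² → ℂ²) (p : ℂ²) : ℂ :=
  (fderiv ℂ f p (1, 0)).1 * (fderiv ℂ f p (0, 1)).2 -
    (fderiv ℂ f p (0, 1)).1 * (fderiv ℂ f p (1, 0)).2

lemma jac_comp {f g : ℂ² → ℂ²} {p : ℂ²} (hg : HoloAt g (f p))
    (hf : HoloAt f p) : jac (fun x => g (f x)) p = jac g (f p) * jac f p := by
  have h : fderiv ℂ (fun x => g (f x)) p = (fderiv ℂ g (f p)).comp (fderiv ℂ f p) :=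
    fderiv_comp p hg hf
  simp only [jac, h, ContinuousLinearMap.comp_apply]
  rw [clm_prod_apply (fderiv ℂ g (f p)) (fderiv ℂ f p (1, 0)),
    clm_prod_apply (fderiv ℂ g (f p)) (fderiv ℂ f p (0, 1))]
  simp only [Prod.fst_add, Prod.snd_add, Prod.smul_fst, Prod.smul_snd, smul_eq_mul]
  ring

lemma jac_congr {f g : ℂ² → ℂ²} {p : ℂ²} (h : f =ᶠ[𝓝 p] g) : jac f p = jac g p := by
  simp only [jac, h.fderiv_eq]

lemma jac_id (p : ℂ²) : jac (fun x => x) p = 1 := by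
  simp [jac]

lemma differentiable_diag (a b : ℂ) : Differentiable ℂ (diag a b) := by
  unfold diag; fun_prop

lemma jac_diag (a b : ℂ) (p : ℂ²) : jac (diag a b) p = a * b := by
  have h : HasFDerivAt (diag a b) ((a • ContinuousLinearMap.fst ℂ ℂ ℂ).prod
      (b • ContinuousLinearMap.snd ℂ ℂ ℂ)) p :=
    (hasFDerivAt_fst.const_mul a).prodMk (hasFDerivAt_snd.const_mul b)
  simp [jac, h.fderiv]

/-- The relation `q = ι_H p` between points: `H` is the generating observable. -/
def IsCanonicalPair (H : ℂ² → ℂ) (p q : ℂ²) : Prop :=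
  q.1 = p.1 + dw H (p.1, q.2) ∧ p.2 = q.2 + dz H (p.1, q.2)

lemma jac_eq_one_of_canonical {H : ℂ² → ℂ} {U : Set ℂ²} (hH : Holo H U)
    (hU : IsOpen U) {f : ℂ² → ℂ²} {p : ℂ²} (hf : HoloAt f p)
    (hp : (p.1, (f p).2) ∈ U) (hc : ∀ᶠ x in 𝓝 p, IsCanonicalPair H x (f x)) : jac f p = 1 := by
  have hz : HoloAt (dz H) (p.1, (f p).2) :=
    (hH.fderiv_apply_const hU (1, 0)).differentiableAt (hU.mem_nhds hp)
  have hw : HoloAt (dw H) (p.1, (f p).2) :=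
    (hH.fderiv_apply_const hU (0, 1)).differentiableAt (hU.mem_nhds hp)
  have hcomm : fderiv ℂ (dz H) (p.1, (f p).2) (0, 1) = fderiv ℂ (dw H) (p.1, (f p).2) (1, 0) :=
    dw_dz_comm hH hU hp
  have hf' := hf.hasFDerivAt
  set f' := fderiv ℂ f p with hf'd
  have hy : HasFDerivAt (fun x : ℂ² => (x.1, (f x).2))
      ((ContinuousLinearMap.fst ℂ ℂ ℂ).prod ((ContinuousLinearMap.snd ℂ ℂ ℂ).comp f')) p :=
    hasFDerivAt_fst.prodMk hf'.snd
  have e1 : HasFDerivAt (fun x : ℂ² => x.1 + dw H (x.1, (f x).2)) _ p :=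
    (hasFDerivAt_fst (𝕜 := ℂ) (p := p)).fun_add (hw.hasFDerivAt.comp p hy :)
  have e2 : HasFDerivAt (fun x : ℂ² => (f x).2 + dz H (x.1, (f x).2)) _ p :=
    hf'.snd.fun_add (hz.hasFDerivAt.comp p hy :)
  have c1 : (fun x => (f x).1) =ᶠ[𝓝 p] fun x => x.1 + dw H (x.1, (f x).2) := by
    filter_upwards [hc] with x hx using hx.1
  have c2 : (fun x : ℂ² => x.2) =ᶠ[𝓝 p] fun x => (f x).2 + dz H (x.1, (f x).2) := by
    filter_upwards [hc] with x hx using hx.2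
  have u1 := (e1.congr_of_eventuallyEq c1).unique hf'.fst
  have u2 := (e2.congr_of_eventuallyEq c2).unique hasFDerivAt_snd
  have a1 := fun v => DFunLike.congr_fun u1 v
  have a2 := fun v => DFunLike.congr_fun u2 v
  simp only [add_apply, ContinuousLinearMap.comp_apply,
    ContinuousLinearMap.coe_fst', ContinuousLinearMap.coe_snd', ContinuousLinearMap.prod_apply] at a1 a2
  have b1 := a1 (1, 0)
  have b2 := a1 (0, 1)
  have b3 := a2 (1, 0)
  have b4 := a2 (0, 1)
  rw [clm_prod_apply (fderiv ℂ (dw H) _)] at b1 b2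
  rw [clm_prod_apply (fderiv ℂ (dz H) _)] at b3 b4
  simp only [smul_eq_mul] at b1 b2 b3 b4
  simp only [jac, ← hf'd]
  rw [← hcomm] at b1 b2
  linear_combination (f' (1, 0)).2 * b2 - (f' (0, 1)).2 * b1 + b4
end PlaneMaps

/-! ### Poincaré lemma -/

section GeneratingFunction

/-- A holomorphic map with unit Jacobian whose second component can be inverted in `w`, with inverse
`W`, has a generating observable: Poincaré's lemma for the form `(W - w') dz + (z' - z) dw'`. -/
lemma exists_generating_of_partial_inverse {f : ℂ² → ℂ²} {W : ℂ² → ℂ} {R r : ℝ}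
    (hf : Holo f (ball 0 R)) (hj : ∀ p ∈ 𝔻 R, jac f p = 1)
    (hW : Holo W (ball 0 r))
    (hWf : ∀ y ∈ 𝔻 r, (y.1, W y) ∈ 𝔻 R ∧ (f (y.1, W y)).2 = y.2) :
    ∃ H : ℂ² → ℂ, Holo H (ball 0 r) ∧ H 0 = 0 ∧
      ∀ y ∈ 𝔻 r, dz H y = W y - y.2 ∧ dw H y = (f (y.1, W y)).1 - y.1 := by
  set A : ℂ² → ℂ := fun y => (f (y.1, W y)).1 - y.1 with hA
  set B : ℂ² → ℂ := fun y => W y - y.2 with hB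
  set ω : ℂ² → ℂ² →L[ℂ] ℂ := fun y =>
    B y • ContinuousLinearMap.fst ℂ ℂ ℂ + A y • ContinuousLinearMap.snd ℂ ℂ ℂ with hω
  have hfW : Holo (fun y : ℂ² => f (y.1, W y)) (ball 0 r) :=
    hf.comp (differentiableOn_fst.prodMk hW) fun y hy => (hWf y hy).1
  have hAd : Holo A (ball 0 r) := hfW.fst.sub differentiableOn_fst
  have hBd : Holo B (ball 0 r) := hW.sub differentiableOn_snd
  have hωd : Holo ω (ball 0 r) :=
    (hBd.smul_const _).add (hAd.smul_const _)
  have hclosed : ∀ y ∈ 𝔻 r, fderiv ℂ A y (1, 0) = fderiv ℂ B y (0, 1) := by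
    intro y hy
    have hn := isOpen_ball.mem_nhds hy
    have hWd := (hW.differentiableAt hn).hasFDerivAt
    have hfd := (hf.at_ball (hWf y hy).1).hasFDerivAt
    have hq : HasFDerivAt (fun y : ℂ² => (y.1, W y))
      ((ContinuousLinearMap.fst ℂ ℂ ℂ).prod (fderiv ℂ W y)) y := hasFDerivAt_fst.prodMk hWd
    have hc : HasFDerivAt (fun y : ℂ² => f (y.1, W y)) _ y := hfd.comp y hq
    have heq : (fun y : ℂ² => y.2) =ᶠ[𝓝 y] fun y => (f (y.1, W y)).2 := by
      filter_upwards [hn] with x hx using (hWf x hx).2.symm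
    have u := (hc.snd.congr_of_eventuallyEq heq).unique hasFDerivAt_snd
    have hA' : HasFDerivAt A _ y := hc.fst.sub hasFDerivAt_fst
    have hB' : HasFDerivAt B _ y := hWd.sub hasFDerivAt_snd
    have a := fun v => DFunLike.congr_fun u v
    have b1 := a (1, 0)
    have b2 := a (0, 1)
    have hjac := hj _ (hWf y hy).1
    rw [hA'.fderiv, hB'.fderiv]
    simp only [ContinuousLinearMap.comp_apply, ContinuousLinearMap.coe_fst',
      ContinuousLinearMap.coe_snd', ContinuousLinearMap.prod_apply, sub_apply] at b1 b2 ⊢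
    rw [clm_prod_apply (fderiv ℂ f _)] at b1 b2 ⊢
    simp only [jac] at hjac
    simp only [Prod.fst_add, Prod.snd_add, Prod.smul_fst, Prod.smul_snd, smul_eq_mul, one_mul,
      zero_mul, zero_add] at b1 b2 ⊢
    set a := (fderiv ℂ f (y.1, W y) (1, 0)).1
    set b := (fderiv ℂ f (y.1, W y) (0, 1)).1
    set c := (fderiv ℂ f (y.1, W y) (1, 0)).2
    set e := (fderiv ℂ f (y.1, W y) (0, 1)).2
    set s := fderiv ℂ W y (1, 0)
    set t := fderiv ℂ W y (0, 1)
    linear_combination t * hjac - (a + b * s) * b2 + b * t * b1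
  have hsymm : ∀ y ∈ 𝔻 r, ∀ u v : ℂ², fderiv ℝ ω y u v = fderiv ℝ ω y v u := by
    intro y hy u v
    have hn := isOpen_ball.mem_nhds hy
    have h1 := (hωd.differentiableAt hn).fderiv_restrictScalars ℝ
    have h2 : HasFDerivAt ω _ y :=
      ((hBd.differentiableAt hn).hasFDerivAt.smul_const (ContinuousLinearMap.fst ℂ ℂ ℂ)).fun_add
      ((hAd.differentiableAt hn).hasFDerivAt.smul_const (ContinuousLinearMap.snd ℂ ℂ ℂ))
    rw [h1, h2.fderiv]
    simp only [ContinuousLinearMap.coe_restrictScalars', add_apply,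
      ContinuousLinearMap.smulRight_apply, smul_apply,
      ContinuousLinearMap.coe_fst', ContinuousLinearMap.coe_snd', smul_eq_mul]
    rw [clm_prod_apply (fderiv ℂ A y) u, clm_prod_apply (fderiv ℂ A y) v,
      clm_prod_apply (fderiv ℂ B y) u, clm_prod_apply (fderiv ℂ B y) v, hclosed y hy]
    simp only [smul_eq_mul]
    ring
  obtain ⟨H₀, hH₀⟩ := (convex_ball (0 : ℂ²) r).exists_forall_hasFDerivAt_of_fderiv_symmetric
    isOpen_ball (fun y hy => ((hωd y hy).restrictScalars ℝ)) hsymm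
  have hH : ∀ y ∈ 𝔻 r, HasFDerivAt (fun y => H₀ y - H₀ 0) (ω y) y := fun y hy =>
    (hH₀ y hy).sub_const _
  refine ⟨fun y => H₀ y - H₀ 0, fun y hy => (hH y hy).differentiableAt.differentiableWithinAt,
    sub_self _, fun y hy => ?_⟩
  simp [dz, dw, (hH y hy).fderiv, hω, hA, hB]

/-- The second component of a family of maps close to the identity can be inverted in `w`,
holomorphically in all variables. -/
lemma exists_partial_inverse {Q : Type*} [NormedAddCommGroup Q] [NormedSpace ℂ Q]
    {U : Set Q} (hU : IsOpen U) {k : Q × ℂ² → ℂ²} {R c d : ℝ}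
    (hk : Holo k (U ×ˢ ball 0 R))
    (hb : ∀ q ∈ U, ∀ p ∈ 𝔻 R, ‖k (q, p) - p‖ ≤ c)
    (hd : 0 < d) (hcd : 4 * c ≤ d) :
    ∃ W : Q × ℂ² → ℂ, Holo W (U ×ˢ ball 0 (R - 2 * d)) ∧
      (∀ q ∈ U, ∀ y ∈ 𝔻 (R - 2 * d), (y.1, W (q, y)) ∈ 𝔻 (R - d) ∧
        (k (q, (y.1, W (q, y)))).2 = y.2) ∧
      ∀ q ∈ U, ∀ p ∈ 𝔻 (R - d), (p.1, (k (q, p)).2) ∈ 𝔻 (R - 2 * d) →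
        W (q, (p.1, (k (q, p)).2)) = p.2 := by
  obtain ⟨g, hg, hg1, hg2⟩ := exists_parametric_inverse (P := ℂ) (Q := Q × ℂ)
    (U := U ×ˢ ball (0 : ℂ) R) (hU.prod isOpen_ball)
    (v := fun x => (k (x.1.1, (x.1.2, x.2))).2 - x.2) (R := R) (c := c) (d := d)
    (by
      refine DifferentiableOn.sub (DifferentiableOn.snd ?_) differentiableOn_snd
      refine hk.comp (by fun_prop) fun x hx => ⟨hx.1.1, ?_⟩
      exact mem_ball_prod.2 ⟨norm_lt hx.1.2, norm_lt hx.2⟩)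
    (fun q hq x hx => (norm_snd_le _).trans (hb q.1 hq.1 (q.2, x)
      (mem_ball_prod.2 ⟨norm_lt hq.2, norm_lt hx⟩))) hd hcd
  refine ⟨fun x => g ((x.1, x.2.1), x.2.2), ?_, ?_, ?_⟩
  · refine hg.comp (by fun_prop) fun x hx => ?_
    have := mem_ball_prod.1 (show (x.2.1, x.2.2) ∈ 𝔻 _ from hx.2)
    exact ⟨⟨hx.1, mem_ball₀⟩, mem_ball₀ this.2⟩
  · intro q hq y hy
    have hy' := mem_ball_prod.1 (show (y.1, y.2) ∈ 𝔻 _ from hy)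
    obtain ⟨h1, h2⟩ := hg1 (q, y.1) ⟨hq, mem_ball₀⟩ y.2
      (mem_ball₀ hy'.2)
    refine ⟨mem_ball_prod.2 ⟨by linarith, norm_lt h1⟩, ?_⟩
    simpa using h2
  · intro q hq p hp hy
    have hp' := mem_ball_prod.1 (show (p.1, p.2) ∈ 𝔻 _ from hp)
    have hy' := mem_ball_prod.1 hy
    have := hg2 (q, p.1) ⟨hq, mem_ball₀⟩ p.2 (mem_ball₀ hp'.2)
      (by simpa using hy'.2)
    simpa using this

end GeneratingFunction

/-! ### Canonical maps and their generators -/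

section CanonicalMaps

/-- A map of `ℂ²` close to the identity with unit Jacobian has a generating observable. -/
lemma exists_generating {f : ℂ² → ℂ²} {R c d : ℝ}
    (hf : Holo f (ball 0 R)) (hb : ∀ p ∈ 𝔻 R, ‖f p - p‖ ≤ c)
    (hj : ∀ p ∈ 𝔻 R, jac f p = 1) (hd : 0 < d) (hcd : 4 * c ≤ d) :
    ∃ H : ℂ² → ℂ, Holo H (ball 0 (R - 2 * d)) ∧ H 0 = 0 ∧
      (∀ p ∈ 𝔻 (R - d), (p.1, (f p).2) ∈ 𝔻 (R - 2 * d) →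
        IsCanonicalPair H p (f p)) ∧
      ∀ y ∈ 𝔻 (R - 2 * d), ∃ p ∈ 𝔻 (R - d), p.1 = y.1 ∧
        (f p).2 = y.2 ∧ IsCanonicalPair H p (f p) := by
  obtain ⟨W, hW, hW1, hW2⟩ := exists_partial_inverse (Q := ℂ) (U := univ) isOpen_univ
    (k := fun x => f x.2) (R := R) (c := c) (d := d)
    (hf.comp differentiableOn_snd fun x hx => hx.2) (fun _ _ p hp => hb p hp) hd hcd
  obtain ⟨H, hH, hH0, hH1⟩ := exists_generating_of_partial_inverse (W := fun y => W (0, y))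
    (r := R - 2 * d) hf hj (hW.comp (by fun_prop) fun y hy => ⟨mem_univ _, hy⟩)
    (fun y hy => ⟨ball_mono (hW1 0 (mem_univ _) y hy).1,
      (hW1 0 (mem_univ _) y hy).2⟩)
  have key : ∀ p ∈ 𝔻 (R - d), (p.1, (f p).2) ∈ 𝔻 (R - 2 * d) →
        IsCanonicalPair H p (f p) := by
    intro p hp hy
    have h1 := hW2 0 (mem_univ _) p hp hy
    obtain ⟨h2, h3⟩ := hH1 _ hy
    simp only [h1] at h2 h3
    exact ⟨by rw [h3]; ring, by rw [h2]; ring⟩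
  refine ⟨H, hH, hH0, key, fun y hy => ?_⟩
  obtain ⟨h1, h2⟩ := hW1 0 (mem_univ _) y hy
  refine ⟨(y.1, W (0, y)), h1, rfl, h2, key _ h1 ?_⟩
  simp only at h2
  rw [h2]
  exact hy

/-- A family of small observables generates a family of canonical maps, holomorphic in the
parameter. -/
lemma exists_canonical_family {Q : Type*} [NormedAddCommGroup Q] [NormedSpace ℂ Q]
    {U : Set Q} (hU : IsOpen U) {H : Q → ℂ² → ℂ} {R c d : ℝ}
    (hz : Holo (fun x : Q × ℂ² => dz (H x.1) x.2) (U ×ˢ ball 0 R))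
    (hw : Holo (fun x : Q × ℂ² => dw (H x.1) x.2) (U ×ˢ ball 0 R))
    (hbz : ∀ q ∈ U, ∀ p ∈ 𝔻 R, ‖dz (H q) p‖ ≤ c)
    (hbw : ∀ q ∈ U, ∀ p ∈ 𝔻 R, ‖dw (H q) p‖ ≤ c)
    (hd : 0 < d) (hcd : 4 * c ≤ d) :
    ∃ θ : Q × ℂ² → ℂ², Holo θ (U ×ˢ ball 0 (R - 2 * d)) ∧
      (∀ q ∈ U, ∀ p ∈ 𝔻 (R - 2 * d), (p.1, (θ (q, p)).2) ∈ 𝔻 (R - d) ∧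
        IsCanonicalPair (H q) p (θ (q, p)) ∧ ‖θ (q, p) - p‖ ≤ c) ∧
      ∀ q ∈ U, ∀ p ∈ 𝔻 (R - 2 * d), ∀ p', (p.1, p'.2) ∈ 𝔻 (R - d) →
        IsCanonicalPair (H q) p p' → p' = θ (q, p) := by
  obtain ⟨g, hg, hg1, hg2⟩ := exists_parametric_inverse (P := ℂ) (Q := Q × ℂ)
    (U := U ×ˢ ball (0 : ℂ) R) (hU.prod isOpen_ball)
    (v := fun x => dz (H x.1.1) (x.1.2, x.2)) (R := R) (c := c) (d := d)
    (by
      refine hz.comp (f := fun x : (Q × ℂ) × ℂ => (x.1.1, (x.1.2, x.2))) (by fun_prop)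
        fun x hx => ⟨hx.1.1, ?_⟩
      exact mem_ball_prod.2 ⟨norm_lt hx.1.2, norm_lt hx.2⟩)
    (fun q hq x hx => hbz q.1 hq.1 (q.2, x)
      (mem_ball_prod.2 ⟨norm_lt hq.2, norm_lt hx⟩)) hd hcd
  have hin : ∀ q ∈ U, ∀ p ∈ 𝔻 (R - 2 * d), (q, p.1) ∈ U ×ˢ ball (0 : ℂ) R ∧
      p.2 ∈ ball (0 : ℂ) (R - 2 * d) := by
    intro q hq p hp
    have := mem_ball_prod.1 (show (p.1, p.2) ∈ 𝔻 _ from hp)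
    exact ⟨⟨hq, mem_ball₀⟩, mem_ball₀ this.2⟩
  have hgd : Holo (fun x : Q × ℂ² => g ((x.1, x.2.1), x.2.2))
      (U ×ˢ ball 0 (R - 2 * d)) :=
    hg.comp (by fun_prop) fun x hx => ⟨(hin x.1 hx.1 x.2 hx.2).1, (hin x.1 hx.1 x.2 hx.2).2⟩
  have hmem : ∀ q ∈ U, ∀ p ∈ 𝔻 (R - 2 * d),
      (p.1, g ((q, p.1), p.2)) ∈ 𝔻 (R - d) := by
    intro q hq p hp
    have h1 := (hg1 _ (hin q hq p hp).1 _ (hin q hq p hp).2).1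
    have := mem_ball_prod.1 (show (p.1, p.2) ∈ 𝔻 _ from hp)
    exact mem_ball_prod.2 ⟨by linarith, norm_lt h1⟩
  refine ⟨fun x => (x.2.1 + dw (H x.1) (x.2.1, g ((x.1, x.2.1), x.2.2)), g ((x.1, x.2.1), x.2.2)),
    ?_, ?_, ?_⟩
  · refine DifferentiableOn.prodMk (DifferentiableOn.add (by fun_prop) ?_) hgd
    refine hw.comp (f := fun x : Q × ℂ² => (x.1, (x.2.1, g ((x.1, x.2.1), x.2.2))))
      (differentiableOn_fst.prodMk (DifferentiableOn.prodMk (by fun_prop) hgd)) fun x hx => ?_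
    exact ⟨hx.1, ball_mono (hmem x.1 hx.1 x.2 hx.2)⟩
  · intro q hq p hp
    have h1 := (hg1 _ (hin q hq p hp).1 _ (hin q hq p hp).2).2
    have hm := hmem q hq p hp
    have hm' : (p.1, g ((q, p.1), p.2)) ∈ 𝔻 R := ball_mono hm
    refine ⟨hm, ⟨rfl, h1.symm⟩, ?_⟩
    rw [Prod.norm_def]
    refine max_le ?_ ?_
    · simpa using hbw q hq _ hm'
    · have : (g ((q, p.1), p.2) - p.2) = - dz (H q) (p.1, g ((q, p.1), p.2)) := by
        linear_combination h1
      simp only [Prod.snd_sub]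
      rw [this, norm_neg]
      exact hbz q hq _ hm'
  · intro q hq p hp p' hp' hcan
    have h2 := hg2 (q, p.1) (hin q hq p hp).1 p'.2 (mem_ball₀ (mem_ball_prod.1 hp').2)
      (by simp only; rw [← hcan.2]; exact (hin q hq p hp).2)
    simp only at h2
    rw [← hcan.2] at h2
    refine Prod.ext ?_ h2.symm
    simp only [h2]
    exact hcan.1

/-- The Hamiltonian field `(∂_w H, -∂_z H)`. -/
def sgrad (H : ℂ² → ℂ) (p : ℂ²) : ℂ² := (dw H p, -dz H p)

/-- First-order comparison of the canonical maps of two small observables `H` and `H'`: their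
difference is the Hamiltonian field of `H' - H`, up to quadratic terms. -/
lemma canonicalPair_compare {H H' : ℂ² → ℂ} {R c c' k d : ℝ} {p q q' : ℂ²}
    (hH : Holo H (ball 0 R)) (hH' : Holo H' (ball 0 R))
    (hb : ∀ y ∈ 𝔻 R, ‖sgrad H y‖ ≤ c)
    (hb' : ∀ y ∈ 𝔻 R, ‖sgrad H' y‖ ≤ c')
    (hk : ∀ y ∈ 𝔻 R, ‖sgrad H' y - sgrad H y‖ ≤ k)
    (hd : 0 < d) (hcd' : 4 * c' ≤ d)
    (hp : ‖p‖ < R - d) (hq : ‖(p.1, q.2)‖ < R - d) (hq' : ‖(p.1, q'.2)‖ < R - d)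
    (h : IsCanonicalPair H p q) (h' : IsCanonicalPair H' p q') :
    ‖q' - q‖ ≤ 2 * k ∧
      ‖q' - q - (sgrad H' p - sgrad H p)‖ ≤ 2 * k / d * (c + 2 * c') := by
  have hgd : ∀ {G : ℂ² → ℂ}, Holo G (ball 0 R) →
      Holo (sgrad G) (ball 0 R) := fun hG =>
    (hG.fderiv_apply_const isOpen_ball (0, 1)).prodMk (hG.fderiv_apply_const isOpen_ball (1, 0)).neg
  set y : ℂ² := (p.1, q.2) with hy
  set y' : ℂ² := (p.1, q'.2) with hy'
  have e : q = p + sgrad H y := by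
    refine Prod.ext h.1 ?_
    simp only [sgrad, Prod.snd_add]; linear_combination -h.2
  have e' : q' = p + sgrad H' y' := by
    refine Prod.ext h'.1 ?_
    simp only [sgrad, Prod.snd_add]; linear_combination -h'.2
  have hyy : ‖y' - y‖ ≤ ‖q' - q‖ := by
    simp only [hy, hy', Prod.mk_sub_mk, sub_self, Prod.norm_def, norm_zero]
    exact max_le (le_max_of_le_left (norm_nonneg _)) (le_max_right _ _)
  have hyp : ‖y - p‖ ≤ c := by
    have h1 : ‖y - p‖ ≤ ‖q - p‖ := by
      simp only [hy, Prod.norm_def, Prod.fst_sub, Prod.snd_sub, sub_self, norm_zero]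
      exact max_le (le_max_of_le_left (norm_nonneg _)) (le_max_right _ _)
    refine h1.trans ?_
    rw [e, add_sub_cancel_left]
    exact hb y mem_ball₀
  have hlip := norm_sub_le_of_bound (hgd hH') hb' hd hq' hq
  have hk0 : 0 ≤ k := (norm_nonneg _).trans (hk y mem_ball₀)
  have hc0 : 0 ≤ c' := (norm_nonneg _).trans (hb' y mem_ball₀)
  have hc2 : 2 * c' / d ≤ 1 / 2 := by rw [div_le_iff₀ hd]; linarith
  have hsplit : q' - q = (sgrad H' y' - sgrad H' y) + (sgrad H' y - sgrad H y) := by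
    conv_lhs => rw [e, e']
    abel
  have h1 : ‖q' - q‖ ≤ 2 * k := by
    have : ‖q' - q‖ ≤ 1 / 2 * ‖q' - q‖ + k := by
      conv_lhs => rw [hsplit]
      refine norm_add_le_of_le (hlip.trans ?_)
        (hk y mem_ball₀)
      gcongr
    linarith
  refine ⟨h1, ?_⟩
  have hlipk := norm_sub_le_of_bound (f := fun y => sgrad H' y - sgrad H y)
    ((hgd hH').sub (hgd hH)) hk hd hq hp
  have hsplit2 : q' - q - (sgrad H' p - sgrad H p)
      = (sgrad H' y' - sgrad H' y) +
        ((sgrad H' y - sgrad H y) - (sgrad H' p - sgrad H p)) := by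
    rw [hsplit]; abel
  rw [hsplit2]
  calc _ ≤ 2 * c' / d * (2 * k) + 2 * k / d * c := by
        refine norm_add_le_of_le (hlip.trans ?_) (hlipk.trans ?_)
        · gcongr; exact hyy.trans h1
        · gcongr
    _ = 2 * k / d * (c + 2 * c') := by ring

lemma norm_fderiv_prod_le (L : ℂ² →L[ℂ] ℂ) : ‖L‖ ≤ ‖L (1, 0)‖ + ‖L (0, 1)‖ := by
  refine L.opNorm_le_bound (by positivity) fun p => ?_
  rw [clm_prod_apply L p]
  calc _ ≤ ‖p.1‖ * ‖L (1, 0)‖ + ‖p.2‖ * ‖L (0, 1)‖ := by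
        refine (norm_add_le _ _).trans_eq ?_
        rw [norm_smul, norm_smul]
    _ ≤ ‖p‖ * ‖L (1, 0)‖ + ‖p‖ * ‖L (0, 1)‖ := by
        gcongr
        · exact norm_fst_le p
        · exact norm_snd_le p
    _ = _ := by ring

lemma norm_le_of_sgrad_le {H : ℂ² → ℂ} {r c : ℝ} {y : ℂ²}
    (hH : Holo H (ball 0 r)) (h0 : H 0 = 0) (hy : y ∈ 𝔻 r)
    (hb : ∀ x, ‖x‖ ≤ ‖y‖ → ‖sgrad H x‖ ≤ c) : ‖H y‖ ≤ 2 * c * ‖y‖ := by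
  have hy' := norm_lt hy
  have hs : closedBall (0 : ℂ²) ‖y‖ ⊆ ball 0 r := closedBall_subset_ball hy'
  have := (convex_closedBall (0 : ℂ²) ‖y‖).norm_image_sub_le_of_norm_hasFDerivWithin_le
    (𝕜 := ℂ) (f := H) (f' := fderiv ℂ H) (C := 2 * c) (x := 0) (y := y)
    (fun x hx => ((hH.at_ball (hs hx)).hasFDerivAt).hasFDerivWithinAt)
    (fun x hx => ?_) (by simp) (by simp)
  · simpa [h0] using this
  · have h1 := hb x (mem_closedBall_zero_iff.1 hx)
    have h2 := (norm_fst_le (sgrad H x)).trans h1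
    have h3 := (norm_snd_le (sgrad H x)).trans h1
    simp only [sgrad, norm_neg] at h2 h3
    refine (norm_fderiv_prod_le _).trans ?_
    simp only [dz, dw] at h2 h3
    linarith

/-- A canonical map close to the identity is `id + sgrad H` up to quadratic terms. -/
lemma sgrad_approx {H : ℂ² → ℂ} {f : ℂ² → ℂ²} {R c d : ℝ} {y p : ℂ²}
    (hf : Holo f (ball 0 R)) (hb : ∀ p ∈ 𝔻 R, ‖f p - p‖ ≤ c)
    (hd : 0 < d) (hy : ‖y‖ < R - d) (hp : ‖p‖ < R - d) (h1 : p.1 = y.1) (h2 : (f p).2 = y.2)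
    (hc : IsCanonicalPair H p (f p)) :
    ‖sgrad H y‖ ≤ c ∧ ‖f y - y - sgrad H y‖ ≤ 2 * c / d * c := by
  have hfy : f p - p = sgrad H y := by
    have hyp : (p.1, (f p).2) = y := Prod.ext h1 h2
    rw [IsCanonicalPair, hyp] at hc
    refine Prod.ext ?_ ?_
    · simp only [Prod.fst_sub, sgrad]; linear_combination hc.1
    · simp only [Prod.snd_sub, sgrad]; linear_combination -hc.2
  have hpc : ‖f p - p‖ ≤ c := hb p mem_ball₀
  have hc0 : 0 ≤ c := (norm_nonneg _).trans hpc
  rw [← hfy]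
  refine ⟨hpc, ?_⟩
  have hyp : ‖y - p‖ ≤ c := by
    refine le_trans ?_ hpc
    simp only [Prod.norm_def, Prod.fst_sub, Prod.snd_sub, h1, sub_self, norm_zero, h2]
    exact max_le (le_max_of_le_left (norm_nonneg _)) (le_max_right _ _)
  refine (norm_sub_le_of_bound (f := fun x => f x - x) (hf.sub differentiableOn_id) hb hd hy hp).trans ?_
  gcongr

end CanonicalMaps

/-! ### Time-one maps of holomorphic vector fields -/

section Flows

/-- Picard–Lindelöf on `[0, 1]`, with the information that the solution stays in the ball. -/
lemma exists_curve_of_lipschitz {E : Type*} [NormedAddCommGroup E] [NormedSpace ℝ E]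
    [CompleteSpace E] {f : ℝ → E → E} {x₀ : E} {a K : NNReal}
    (hl : ∀ t ∈ 𝕀, LipschitzOnWith K (f t) (closedBall x₀ a))
    (hc : ∀ x ∈ closedBall x₀ (a : ℝ), ContinuousOn (f · x) (Icc 0 1))
    (hb : ∀ t ∈ 𝕀, ∀ x ∈ closedBall x₀ (a : ℝ), ‖f t x‖ ≤ a) :
    ∃ γ : ℝ → E, γ 0 = x₀ ∧ IsIntegralCurveOn γ f (Icc 0 1) ∧
      ∀ t ∈ 𝕀, γ t ∈ closedBall x₀ (a : ℝ) := by
  set t₀ : 𝕀 := ⟨0, by simp⟩ with ht₀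
  have hf : IsPicardLindelof f t₀ x₀ a 0 a K := ⟨hl, hc, hb, by simp [ht₀]⟩
  have hx : x₀ ∈ closedBall x₀ ((0 : NNReal) : ℝ) := mem_closedBall_self le_rfl
  obtain ⟨α, hα⟩ := ODE.FunSpace.exists_isFixedPt_next hf hx
  have hmem : ∀ t, α.compProj t ∈ closedBall x₀ (a : ℝ) := fun t =>
    α.compProj_mem_closedBall hf.mul_max_le
  refine ⟨α.compProj, ?_, fun t ht ↦ ?_, fun t _ => hmem t⟩
  · have : α.compProj (t₀ : ℝ) = x₀ := by
      rw [ODE.FunSpace.compProj_val, ← hα, ODE.FunSpace.next_apply₀]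
    simpa [ht₀] using this
  · apply ODE.hasDerivWithinAt_picard_Icc t₀.2 hf.continuousOn_uncurry
      α.continuous_compProj.continuousOn (fun _ ht' ↦ hmem _) x₀ ht |>.congr_of_mem _ ht
    intro t' ht'
    nth_rw 1 [← hα]
    rw [ODE.FunSpace.compProj_of_mem ht', ODE.FunSpace.next_apply]

lemma norm_le_of_deriv_le_half {E : Type*} [NormedAddCommGroup E] [NormedSpace ℝ E]
    {u u' : ℝ → E} {e : ℝ} (hu : ∀ t ∈ 𝕀, HasDerivWithinAt u (u' t) (Icc 0 1) t)
    (h : ∀ t ∈ 𝕀, ‖u' t‖ ≤ e + 1 / 2 * ‖u t‖) {t : ℝ} (ht : t ∈ 𝕀) :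
    ‖u t‖ ≤ 2 * (‖u 0‖ + e) := by
  have hcont : ContinuousOn (fun t => ‖u t‖) (Icc 0 1) :=
    (fun t ht => (hu t ht).continuousWithinAt.norm)
  obtain ⟨s, hs, hmax⟩ := isCompact_Icc.exists_isMaxOn (nonempty_Icc.2 zero_le_one) hcont
  have h0 : (0 : ℝ) ∈ 𝕀 := by simp
  have hM : ∀ t ∈ 𝕀, ‖u' t‖ ≤ e + 1 / 2 * ‖u s‖ := fun t ht =>
    (h t ht).trans (by have := hmax ht; simp only [mem_ofPred_eq] at this; linarith)
  have hC : 0 ≤ e + 1 / 2 * ‖u s‖ := (norm_nonneg _).trans (hM 0 h0)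
  have h1 := (convex_Icc (0 : ℝ) 1).norm_image_sub_le_of_norm_hasDerivWithin_le hu hM h0 hs
  have h2 : ‖s - 0‖ ≤ 1 := by rw [sub_zero, Real.norm_of_nonneg hs.1]; exact hs.2
  have h3 : ‖u s - u 0‖ ≤ e + 1 / 2 * ‖u s‖ := h1.trans (by nlinarith)
  have h4 := norm_le_add_sub (u s) (u 0)
  have h5 : ‖u t‖ ≤ ‖u s‖ := hmax ht
  linarith

variable {Ξ Ξ' : ℂ² → ℂ²} {R c c' d e : ℝ}

lemma exists_integralCurve (hΞ : Holo Ξ (ball 0 R))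
    (hb : ∀ p ∈ 𝔻 R, ‖Ξ p‖ ≤ c) (hd : 0 < d) (hcd : 4 * c ≤ d) {p : ℂ²}
    (hp : ‖p‖ < R - 2 * d) :
    ∃ γ : ℝ → ℂ², γ 0 = p ∧ IsIntegralCurveOn γ (fun _ => Ξ) (Icc 0 1) ∧
      ∀ t ∈ 𝕀, ‖γ t - p‖ ≤ c := by
  have hc : 0 ≤ c := (norm_nonneg _).trans (hb p mem_ball₀)
  lift c to NNReal using hc
  have hsub : ∀ x ∈ closedBall p (c : ℝ), ‖x‖ < R - d := fun x hx => by
    have := mem_closedBall_iff_norm.1 hx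
    linarith [norm_le_add_sub x p]
  obtain ⟨γ, h0, h1, h2⟩ := exists_curve_of_lipschitz (f := fun _ => Ξ) (x₀ := p) (a := c)
    (K := (2 * c / d).toNNReal)
    (fun t _ => LipschitzOnWith.of_dist_le_mul fun x hx y hy => by
      rw [dist_eq_norm, dist_eq_norm, Real.coe_toNNReal _ (by positivity)]
      exact norm_sub_le_of_bound hΞ hb hd (hsub x hx) (hsub y hy))
    (fun x _ => continuousOn_const)
    (fun t _ x hx => hb x (mem_ball₀ (by linarith [hsub x hx])))
  exact ⟨γ, h0, h1, fun t ht => mem_closedBall_iff_norm.1 (h2 t ht)⟩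

/-- Gronwall comparison of integral curves of two fields. -/
lemma integralCurve_compare (hΞ : Holo Ξ (ball 0 R))
    (hb : ∀ p ∈ 𝔻 R, ‖Ξ p‖ ≤ c) (hd : 0 < d) (hcd : 4 * c ≤ d)
    (he : ∀ p ∈ 𝔻 R, ‖Ξ' p - Ξ p‖ ≤ e) {γ γ' : ℝ → ℂ²}
    (h : IsIntegralCurveOn γ (fun _ => Ξ) (Icc 0 1)) (hγ : ∀ t ∈ 𝕀, ‖γ t‖ < R - d)
    (h' : IsIntegralCurveOn γ' (fun _ => Ξ') (Icc 0 1)) (hγ' : ∀ t ∈ 𝕀, ‖γ' t‖ < R - d)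
    {t : ℝ} (ht : t ∈ 𝕀) : ‖γ' t - γ t‖ ≤ 2 * (‖γ' 0 - γ 0‖ + e) := by
  refine norm_le_of_deriv_le_half (u := fun t => γ' t - γ t) (fun t ht => (h' t ht).sub (h t ht))
    (fun t ht => ?_) ht
  have h1 := norm_sub_le_of_bound hΞ hb hd (hγ' t ht) (hγ t ht)
  have h2 := he (γ' t) (mem_ball₀ (by linarith [hγ' t ht]))
  have hc2 : 2 * c / d ≤ 1 / 2 := by rw [div_le_iff₀ hd]; linarith
  calc _ = ‖(Ξ' (γ' t) - Ξ (γ' t)) + (Ξ (γ' t) - Ξ (γ t))‖ := by congr 1; abel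
    _ ≤ e + 1 / 2 * ‖γ' t - γ t‖ :=
      norm_add_le_of_le h2 (h1.trans (by gcongr))

/-- First-order effect on the time-one map of a perturbation of the field. -/
lemma integralCurve_compare_two (hΞ : Holo Ξ (ball 0 R))
    (hΞ' : Holo Ξ' (ball 0 R))
    (hb : ∀ p ∈ 𝔻 R, ‖Ξ p‖ ≤ c)
    (hd : 0 < d) (hcd : 4 * c ≤ d)
    (he : ∀ p ∈ 𝔻 R, ‖Ξ' p - Ξ p‖ ≤ e) {γ γ' : ℝ → ℂ²}
    (h : IsIntegralCurveOn γ (fun _ => Ξ) (Icc 0 1)) (hγ : ∀ t ∈ 𝕀, ‖γ t‖ < R - d)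
    (h' : IsIntegralCurveOn γ' (fun _ => Ξ') (Icc 0 1)) (hγ' : ∀ t ∈ 𝕀, ‖γ' t‖ < R - d)
    (h0 : γ' 0 = γ 0) (hγ0 : ∀ t ∈ 𝕀, ‖γ' t - γ 0‖ ≤ c') :
    ‖γ' 1 - γ 1 - (Ξ' (γ 0) - Ξ (γ 0))‖ ≤ 2 * e / d * (2 * c + c') := by
  have z : (0 : ℝ) ∈ 𝕀 := by simp
  have o : (1 : ℝ) ∈ 𝕀 := by simp
  set w := Ξ' (γ 0) - Ξ (γ 0) with hw
  have hc0 : 0 ≤ c := (norm_nonneg _).trans (hb (γ 0) (mem_ball₀ (by linarith [hγ 0 z])))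
  have he0 : 0 ≤ e := (norm_nonneg _).trans (he (γ 0) (mem_ball₀ (by linarith [hγ 0 z])))
  have hu : ∀ t ∈ 𝕀, HasDerivWithinAt (fun t => γ' t - γ t - t • w)
      (Ξ' (γ' t) - Ξ (γ t) - (1 : ℝ) • w) (Icc 0 1) t := fun t ht =>
    ((h' t ht).sub (h t ht)).sub ((hasDerivWithinAt_id t _).smul_const w)
  have hM : ∀ t ∈ 𝕀, ‖Ξ' (γ' t) - Ξ (γ t) - (1 : ℝ) • w‖ ≤ 2 * e / d * (2 * c + c') := by
    intro t ht
    have h1 := norm_sub_le_of_bound hΞ hb hd (hγ' t ht) (hγ t ht)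
    have h2 := integralCurve_compare hΞ hb hd hcd he h hγ h' hγ' ht
    rw [h0, sub_self, norm_zero, zero_add] at h2
    have h3 := norm_sub_le_of_bound (f := fun p => Ξ' p - Ξ p) (hΞ'.sub hΞ) he hd (hγ' t ht) (hγ 0 z)
    calc _ = ‖(Ξ (γ' t) - Ξ (γ t)) + (Ξ' (γ' t) - Ξ (γ' t) - (Ξ' (γ 0) - Ξ (γ 0)))‖ := by
          congr 1; rw [hw, one_smul]; abel
      _ ≤ 2 * c / d * (2 * e) + 2 * e / d * c' := by
          refine norm_add_le_of_le (h1.trans ?_) (h3.trans ?_)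
          · gcongr
          · gcongr; exact hγ0 t ht
      _ = _ := by ring
  have := (convex_Icc (0 : ℝ) 1).norm_image_sub_le_of_norm_hasDerivWithin_le hu hM z o
  simpa [h0] using this

/-- The time-one map of a small holomorphic vector field of constant divergence is holomorphic,
with constant Jacobian (Liouville's formula). -/
lemma exists_timeOneMap {κ : ℂ} (hΞ : Holo Ξ (ball 0 R))
    (hb : ∀ p ∈ 𝔻 R, ‖Ξ p‖ ≤ c) (hd : 0 < d) (hcd : 4 * c ≤ d)
    (hdiv : ∀ p ∈ 𝔻 R, divergence Ξ p = κ) :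
    ∃ φ : ℂ² → ℂ², Holo φ (ball 0 (R - 2 * d)) ∧
      ∀ p ∈ 𝔻 (R - 2 * d), jac φ p = exp κ ∧ ‖φ p - p‖ ≤ c ∧
        ∃ γ : ℝ → ℂ², γ 0 = p ∧ γ 1 = φ p ∧ IsIntegralCurveOn γ (fun _ => Ξ) (Icc 0 1) ∧
          ∀ t ∈ 𝕀, ‖γ t - p‖ ≤ c := by
  have z : (0 : ℝ) ∈ 𝕀 := by simp
  have o : (1 : ℝ) ∈ 𝕀 := by simp
  have hex := fun p (hp : p ∈ 𝔻 (R - 2 * d)) =>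
    exists_integralCurve hΞ hb hd hcd (norm_lt hp)
  choose! γ hγ0 hγ hγc using hex
  have hc2 : 2 * c / d ≤ 1 / 2 := by rw [div_le_iff₀ hd]; linarith
  have hin : ∀ p ∈ 𝔻 (R - 2 * d), ∀ t ∈ 𝕀, ‖γ p t‖ < R - d := by
    intro p hp t ht
    have := hγc p hp t ht
    have := norm_lt hp
    linarith [norm_le_add_sub (γ p t) p]
  have hDc : ContinuousOn (fderiv ℂ Ξ) (ball 0 R) := (hΞ.fderiv_prod isOpen_ball).continuousOn
  have key : ∀ p ∈ 𝔻 (R - 2 * d), ∃ L : ℂ² →L[ℂ] ℂ²,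
      HasFDerivAt (fun p => γ p 1) L p ∧
        (L (1, 0)).1 * (L (0, 1)).2 - (L (0, 1)).1 * (L (1, 0)).2 = exp κ := by
    intro p hp
    have hinR : ∀ t ∈ 𝕀, γ p t ∈ 𝔻 R := fun t ht =>
      mem_ball₀ (by linarith [hin p hp t ht])
    set A : ℝ → ℂ² →L[ℂ] ℂ² := fun t => fderiv ℂ Ξ (γ p t) with hA
    have hAc : ContinuousOn A (Icc 0 1) := hDc.comp
      (fun t ht => (hγ p hp t ht).continuousWithinAt) hinR
    have hAn : ∀ t ∈ 𝕀, ‖A t‖ ≤ 1 / 2 := fun t ht =>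
      (norm_fderiv_le_of_bound hΞ hb hd (by linarith [hin p hp t ht])).trans hc2
    -- the variational equation
    obtain ⟨M, hM0, hM, -⟩ := exists_curve_of_lipschitz (f := fun t B => (A t).comp B)
      (x₀ := ContinuousLinearMap.id ℂ ℂ²) (a := 1) (K := 1 / 2)
      (fun t ht => LipschitzOnWith.of_dist_le_mul fun x _ y _ => by
        rw [dist_eq_norm, dist_eq_norm, ← ContinuousLinearMap.comp_sub]
        refine (ContinuousLinearMap.opNorm_comp_le _ _).trans ?_
        have := hAn t ht
        have e : ((1 / 2 : NNReal) : ℝ) = 1 / 2 := by norm_num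
        rw [e]
        gcongr)
      (fun x _ => hAc.clm_comp continuousOn_const)
      (fun t ht x hx => by
        refine (ContinuousLinearMap.opNorm_comp_le _ _).trans ?_
        have h1 := hAn t ht
        have h2 : ‖x‖ ≤ 2 := by
          have h3 := mem_closedBall_iff_norm.1 hx
          have h4 := norm_le_add_sub x (ContinuousLinearMap.id ℂ ℂ²)
          have h5 : ‖ContinuousLinearMap.id ℂ ℂ²‖ ≤ 1 := ContinuousLinearMap.norm_id_le
          simp only [NNReal.coe_one] at h3
          linarith
        calc _ ≤ 1 / 2 * 2 := by gcongr
          _ = ((1 : NNReal) : ℝ) := by norm_num)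
    have hMv : ∀ v, ∀ t ∈ 𝕀,
        HasDerivWithinAt (fun t => M t v) (A t (M t v)) (Icc 0 1) t := by
      intro v t ht
      exact (((ContinuousLinearMap.apply ℂ ℂ² v).restrictScalars ℝ).hasFDerivAt.comp_hasDerivWithinAt
        t (hM t ht) :)
    refine ⟨M 1, ?_, ?_⟩
    · rw [hasFDerivAt_iff_isLittleO_nhds_zero]
      have hO : (fun h => γ (p + h) 1 - γ p 1 - M 1 h) =O[𝓝 0] (fun h : ℂ² => ‖h‖ ^ 2) := by
        refine Asymptotics.IsBigO.of_bound (2 * (4 * c * (2 / d) ^ 2)) ?_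
        have hnear : ∀ᶠ h : ℂ² in 𝓝 0, p + h ∈ 𝔻 (R - 2 * d) := by
          have : ContinuousAt (fun h : ℂ² => p + h) 0 := by fun_prop
          exact this.eventually (isOpen_ball.mem_nhds (by simpa using hp))
        filter_upwards [hnear, ball_mem_nhds (0 : ℂ²) (half_pos hd)] with h hh hhd
        rw [mem_ball_zero_iff] at hhd
        set k : ℝ → ℂ² := fun t => γ (p + h) t - γ p t with hk
        have hkn : ∀ t ∈ 𝕀, ‖k t‖ ≤ 2 * ‖h‖ := by
          intro t ht
          have := integralCurve_compare (Ξ' := Ξ) (e := 0) hΞ hb hd hcd (fun _ _ => by simp)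
            (hγ p hp) (hin p hp) (hγ _ hh) (hin _ hh) ht
          simpa [hγ0 p hp, hγ0 _ hh] using this
        have := norm_le_of_deriv_le_half (u := fun t => k t - M t h)
          (u' := fun t => Ξ (γ (p + h) t) - Ξ (γ p t) - A t (M t h)) (e := 4 * c * (2 / d) ^ 2 * ‖h‖ ^ 2)
          (fun t ht => ((hγ _ hh t ht).sub (hγ p hp t ht)).sub (hMv h t ht)) (fun t ht => ?_) o
        · refine this.trans_eq ?_
          simp [hk, hγ0 p hp, hγ0 _ hh, hM0]
          ring
        · have h1 := norm_taylor_two_le hΞ hb (x := γ p t) (h := k t) (d := d)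
            (by linarith [hin p hp t ht]) ((hkn t ht).trans_lt (by linarith))
          have h2 : γ p t + k t = γ (p + h) t := by simp [hk]
          rw [h2] at h1
          calc _ = ‖(Ξ (γ (p + h) t) - Ξ (γ p t) - A t (k t)) + A t (k t - M t h)‖ := by
                have e : A t (k t - M t h) = A t (k t) - A t (M t h) := map_sub _ _ _
                rw [e]; congr 1; abel
            _ ≤ 4 * c * (‖k t‖ / d) ^ 2 + 1 / 2 * ‖k t - M t h‖ := by
                refine norm_add_le_of_le h1 (((A t).le_opNorm _).trans ?_)
                gcongr
                exact hAn t ht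
            _ ≤ 4 * c * (2 * ‖h‖ / d) ^ 2 + 1 / 2 * ‖k t - M t h‖ := by
                have hc0 : 0 ≤ c := (norm_nonneg _).trans (hb _ (hinR 0 z))
                gcongr
                exact hkn t ht
            _ = _ := by ring
      refine hO.trans_isLittleO ?_
      have := (Asymptotics.isLittleO_pow_pow (𝕜 := ℝ) (show 1 < 2 by norm_num)).comp_tendsto
        (tendsto_norm_zero (E := ℂ²))
      refine Asymptotics.isLittleO_norm_right.1 ?_
      simpa [Function.comp_def] using this
    · -- Liouville
      set D : ℝ → ℂ := fun t => (M t (1, 0)).1 * (M t (0, 1)).2 - (M t (0, 1)).1 * (M t (1, 0)).2 with hD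
      have hfst : ∀ v, ∀ t ∈ 𝕀,
          HasDerivWithinAt (fun t => (M t v).1) (A t (M t v)).1 (Icc 0 1) t := fun v t ht =>
        ((ContinuousLinearMap.fst ℝ ℂ ℂ).hasFDerivAt.comp_hasDerivWithinAt t (hMv v t ht) :)
      have hsnd : ∀ v, ∀ t ∈ 𝕀,
          HasDerivWithinAt (fun t => (M t v).2) (A t (M t v)).2 (Icc 0 1) t := fun v t ht =>
        ((ContinuousLinearMap.snd ℝ ℂ ℂ).hasFDerivAt.comp_hasDerivWithinAt t (hMv v t ht) :)
      have hexp : ∀ t : ℝ, HasDerivAt (fun t : ℝ => exp (-(κ * t))) (exp (-(κ * t)) * (-κ)) t := by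
        intro t
        have h1 : HasDerivAt (fun t : ℝ => -(κ * (t : ℂ))) (-κ) t := by
          simpa using ((Complex.ofRealCLM.hasDerivAt (x := t)).const_mul κ).fun_neg
        exact h1.cexp
      have hDE : ∀ t ∈ 𝕀, HasDerivWithinAt (fun t => D t * exp (-(κ * t))) 0 (Icc 0 1) t := by
        intro t ht
        have h1 := (((hfst (1, 0) t ht).mul (hsnd (0, 1) t ht)).sub
          ((hfst (0, 1) t ht).mul (hsnd (1, 0) t ht))).mul (hexp t).hasDerivWithinAt
        refine h1.congr_deriv ?_
        have h2 := hdiv _ (hinR t ht)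
        simp only [divergence] at h2
        simp only [hA]
        rw [clm_prod_apply _ (M t (1, 0)), clm_prod_apply _ (M t (0, 1))]
        simp only [Prod.fst_add, Prod.snd_add, Prod.smul_fst, Prod.smul_snd, smul_eq_mul, Pi.mul_apply,
          Pi.sub_apply]
        rw [← h2]
        ring
      have hconst := (convex_Icc (0 : ℝ) 1).norm_image_sub_le_of_norm_hasDerivWithin_le (C := 0) hDE
        (fun t _ => by simp) z o
      rw [zero_mul, norm_le_zero_iff, sub_eq_zero] at hconst
      have h0 : D 0 = 1 := by simp [hD, hM0]
      rw [h0] at hconst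
      simp only [Complex.ofReal_one, mul_one, Complex.ofReal_zero, mul_zero, neg_zero,
        Complex.exp_zero] at hconst
      change D 1 = _
      rw [Complex.exp_neg] at hconst
      field_simp at hconst
      exact hconst
  refine ⟨fun p => γ p 1, fun p hp => ?_, fun p hp => ⟨?_, hγc p hp 1 o, γ p, hγ0 p hp, rfl, hγ p hp,
    hγc p hp⟩⟩
  · obtain ⟨L, hL, -⟩ := key p hp
    exact hL.differentiableAt.differentiableWithinAt
  · obtain ⟨L, hL, hL2⟩ := key p hp
    rw [jac, hL.fderiv, hL2]

end Flows

/-! ### Interpolation by a vector field -/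

section Interpolation

lemma norm_jRoot : ‖jRoot‖ = 1 := by
  have : (2 * π * I / 3 : ℂ) = ((2 * π / 3 : ℝ) : ℂ) * I := by push_cast; ring
  rw [jRoot, this, Complex.norm_exp_ofReal_mul_I]

lemma jRoot_pow_three : jRoot ^ 3 = 1 := by
  rw [jRoot, ← Complex.exp_nat_mul]
  have : ((3 : ℕ) : ℂ) * (2 * π * I / 3) = 2 * π * I := by push_cast; ring
  rw [this, Complex.exp_two_pi_mul_I]

lemma jRoot_ne_zero : jRoot ≠ 0 := Complex.exp_ne_zero _

lemma norm_diag_one_jRoot (p : ℂ²) : ‖diag 1 jRoot p‖ = ‖p‖ := by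
  simp [diag, Prod.norm_def, norm_jRoot]

lemma diag_diag (a b a' b' : ℂ) (p : ℂ²) : diag a b (diag a' b' p) = diag (a * a') (b * b') p := by
  simp [diag, mul_assoc]

lemma diag_one_one (p : ℂ²) : diag 1 1 p = p := by simp [diag]

/-- `diag(a,b)` as a continuous linear map. -/
def diagL (a b : ℂ) : ℂ² →L[ℂ] ℂ² :=
  (a • ContinuousLinearMap.fst ℂ ℂ ℂ).prod (b • ContinuousLinearMap.snd ℂ ℂ ℂ)

lemma diagL_apply (a b : ℂ) (p : ℂ²) : diagL a b p = diag a b p := rfl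

lemma differentiable_modelField (τ : ℂ) : Differentiable ℂ (modelField τ) := by
  unfold modelField; fun_prop

lemma divergence_modelField (τ : ℂ) (p : ℂ²) :
    divergence (modelField τ) p = 2 * π * I := by
  have h1 : HasFDerivAt (fun p : ℂ² => p.1) (ContinuousLinearMap.fst ℂ ℂ ℂ) p := hasFDerivAt_fst
  have h2 : HasFDerivAt (fun p : ℂ² => p.2) (ContinuousLinearMap.snd ℂ ℂ ℂ) p := hasFDerivAt_snd
  have h3 := (((h1.const_mul (1 - τ)).add ((h1.pow 2).mul_const (2⁻¹ : ℂ))).sub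
    ((h2.pow 3).mul_const (3⁻¹ : ℂ))).prodMk ((h2.const_mul τ).sub (h1.mul h2))
  have h4 := h3.const_smul (2 * π * I : ℂ)
  have h5 : HasFDerivAt (modelField τ) _ p := h4
  rw [divergence, h5.fderiv]
  simp
  ring

lemma modelField_equivariant (τ : ℂ) (p : ℂ²) :
    modelField τ (diag 1 jRoot p) = diag 1 jRoot (modelField τ p) := by
  simp only [modelField, diag, Prod.smul_mk, smul_eq_mul, mul_pow, jRoot_pow_three]
  ext <;> ring

lemma exists_bound_modelField (τ : ℂ) (R : ℝ) :
    ∃ K, 0 ≤ K ∧ ∀ p ∈ 𝔻 R, ‖modelField τ p‖ ≤ K := by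
  obtain ⟨K, hK⟩ := (isCompact_closedBall (0 : ℂ²) R).exists_bound_of_continuousOn
    (differentiable_modelField τ).continuous.continuousOn
  exact ⟨max K 0, le_max_right _ _, fun p hp => (hK p (ball_subset_closedBall hp)).trans (le_max_left _ _)⟩

/-- The field `X` has the symmetries required of an interpolating field on the ball of radius `R`,
and the time-one map of `ε X` is `f` up to `O(ε^{n+2})`. -/
structure IsInterpolating (τ ε : ℂ) (f X : ℂ² → ℂ²) (R C : ℝ) (n : ℕ) : Prop where
  holo : Holo X (ball 0 R)
  div : ∀ p ∈ 𝔻 R, divergence X p = 2 * π * I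
  equivariant : ∀ p ∈ 𝔻 R, X (diag 1 jRoot p) = diag 1 jRoot (X p)
  near : ∀ p ∈ 𝔻 R, ‖X p - modelField τ p‖ ≤ C * ‖ε‖
  flow : ∀ γ : ℝ → ℂ², IsIntegralCurveOn γ (fun _ p => ε • X p) (Icc 0 1) →
    (∀ t ∈ 𝕀, ‖γ t‖ < R - 1 / 4) → ‖γ 1 - f (γ 0)‖ ≤ C * ‖ε‖ ^ (n + 2)

lemma divergence_sgrad {H : ℂ² → ℂ} {U : Set ℂ²} (hH : Holo H U)
    (hU : IsOpen U) {p : ℂ²} (hp : p ∈ U) : divergence (sgrad H) p = 0 := by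
  have h1 : HoloAt (dz H) p := (hH.fderiv_apply_const hU _).differentiableAt (hU.mem_nhds hp)
  have h2 : HoloAt (dw H) p := (hH.fderiv_apply_const hU _).differentiableAt (hU.mem_nhds hp)
  have h3 : HasFDerivAt (sgrad H) _ p := h2.hasFDerivAt.prodMk h1.hasFDerivAt.neg
  rw [divergence, h3.fderiv]
  have := dw_dz_comm hH hU hp
  simp only [dz, dw] at this
  simp [this]

lemma differentiableOn_sgrad {H : ℂ² → ℂ} {U : Set ℂ²} (hH : Holo H U)
    (hU : IsOpen U) : Holo (sgrad H) U :=
  (hH.fderiv_apply_const hU _).prodMk (hH.fderiv_apply_const hU _).neg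

lemma divergence_add {X Y : ℂ² → ℂ²} {p : ℂ²} (hX : HoloAt X p)
    (hY : HoloAt Y p) :
    divergence (fun x => X x + Y x) p = divergence X p + divergence Y p := by
  simp only [divergence, fderiv_fun_add hX hY, add_apply, Prod.fst_add, Prod.snd_add]
  ring

lemma divergence_const_smul {X : ℂ² → ℂ²} {p : ℂ²} (a : ℂ) (hX : HoloAt X p) :
    divergence (fun x => a • X x) p = a * divergence X p := by
  simp only [divergence, fderiv_fun_const_smul hX a, smul_apply, Prod.smul_fst,
    Prod.smul_snd, smul_eq_mul]
  ring

lemma isInterpolating_model (τ : ℂ) (R C₀ : ℝ) (hC₀ : 0 ≤ C₀) :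
    ∃ C, 0 ≤ C ∧ ∀ (ε : ℂ) (f : ℂ² → ℂ²),
      (∀ p ∈ 𝔻 R, ‖f p - (p + ε • modelField τ p)‖ ≤ C₀ * ‖ε‖ ^ 2) →
      IsInterpolating τ ε f (modelField τ) R C 0 := by
  obtain ⟨K, hK0, hK⟩ := exists_bound_modelField τ R
  refine ⟨16 * K ^ 2 + C₀, by positivity, fun ε f hf => ⟨(differentiable_modelField τ).differentiableOn,
    fun p _ => divergence_modelField τ p, fun p _ => modelField_equivariant τ p,
    fun p _ => by simp; positivity, fun γ hγ hγR => ?_⟩⟩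
  have z : (0 : ℝ) ∈ 𝕀 := by simp
  have hb : ∀ p ∈ 𝔻 R, ‖ε • modelField τ p - (0 : ℂ²)‖ ≤ ‖ε‖ * K := fun p hp => by
    rw [sub_zero, norm_smul]; gcongr; exact hK p hp
  have h0 : IsIntegralCurveOn (fun _ : ℝ => γ 0) (fun _ _ => (0 : ℂ²)) (Icc 0 1) :=
    fun t _ => hasDerivWithinAt_const _ _ _
  have hR : ∀ t ∈ 𝕀, ‖γ 0‖ < R - 1 / 4 := fun t _ => hγR 0 z
  have hcmp : ∀ t ∈ 𝕀, ‖γ t - γ 0‖ ≤ 2 * (‖ε‖ * K) := fun t ht => by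
    have := integralCurve_compare (Ξ := fun _ => 0) (c := 0) (d := 1 / 4) (R := R)
      (differentiableOn_const _) (by simp) (by norm_num) (by norm_num) hb h0 hR hγ hγR ht
    simpa using this
  have h2 := integralCurve_compare_two (Ξ := fun _ => 0) (c := 0) (d := 1 / 4) (R := R)
    (differentiableOn_const _) ((differentiable_modelField τ).differentiableOn.const_smul ε) (by simp)
    (by norm_num) (by norm_num) hb h0 hR hγ hγR rfl hcmp
  simp only [Pi.smul_apply, sub_zero] at h2
  have h3 := hf (γ 0) (mem_ball₀ (by linarith [hγR 0 z]))
  calc _ = ‖(γ 1 - γ 0 - ε • modelField τ (γ 0)) - (f (γ 0) - (γ 0 + ε • modelField τ (γ 0)))‖ := by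
        congr 1; abel
    _ ≤ 2 * (‖ε‖ * K) / (1 / 4) * (2 * 0 + 2 * (‖ε‖ * K)) + C₀ * ‖ε‖ ^ 2 :=
        (norm_sub_le _ _).trans (add_le_add h2 h3)
    _ = _ := by ring

/-- One step of the interpolation: the map that remains to be interpolated is canonical, and the
Hamiltonian field of its generator, divided by `ε`, is added to the field. -/
lemma isInterpolating_step (τ : ℂ) (R C₀ C : ℝ) (hC₀ : 0 ≤ C₀) (hC : 0 ≤ C) (n : ℕ) :
    ∃ C' ε₀ : ℝ, 0 ≤ C' ∧ 0 < ε₀ ∧ ∀ (ε : ℂ) (f X : ℂ² → ℂ²), ε ≠ 0 → ‖ε‖ < ε₀ →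
      Holo f (ball 0 (R + 1)) →
      (∀ p ∈ 𝔻 (R + 1), f (diag 1 jRoot p) = diag 1 jRoot (f p)) →
      (∀ p ∈ 𝔻 (R + 1), jac f p = exp (2 * π * I * ε)) →
      (∀ p ∈ 𝔻 (R + 1), ‖f p - (p + ε • modelField τ p)‖ ≤ C₀ * ‖ε‖ ^ 2) →
      IsInterpolating τ ε f X (R + 1) C n → ∃ X', IsInterpolating τ ε f X' R C' (n + 1) := by
  obtain ⟨K, hK0, hK⟩ := exists_bound_modelField τ (R + 1)
  set B := K + 4 * C + C₀ + 1 with hB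
  refine ⟨3 * C + 512 * C * B, min 1 (1 / (64 * B)), by positivity, by positivity,
    fun ε f X hε0 hε hf hfD hfj hfm hX => ?_⟩
  have hn : 0 < ‖ε‖ := norm_pos_iff.2 hε0
  have hε1 : ‖ε‖ ≤ 1 := hε.le.trans (min_le_left _ _)
  have hεB : B * ‖ε‖ ≤ 1 / 64 := by
    have h1 : ‖ε‖ < 1 / (64 * B) := hε.trans_le (min_le_right _ _)
    rw [lt_div_iff₀ (by positivity)] at h1
    linarith
  set c := B * ‖ε‖ with hc
  set c₂ := 2 * C * ‖ε‖ ^ (n + 2) with hc₂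
  have hpow : ‖ε‖ ^ (n + 2) ≤ ‖ε‖ := by
    calc _ ≤ ‖ε‖ ^ 1 := pow_le_pow_of_le_one hn.le hε1 (by omega)
      _ = ‖ε‖ := pow_one _
  have hpow1 : ‖ε‖ ^ (n + 1) ≤ ‖ε‖ := by
    calc _ ≤ ‖ε‖ ^ 1 := pow_le_pow_of_le_one hn.le hε1 (by omega)
      _ = ‖ε‖ := pow_one _
  have hc0 : 0 ≤ c := by positivity
  have hc₂0 : 0 ≤ c₂ := by positivity
  have hc₂c : c₂ ≤ c := by
    calc _ ≤ 2 * C * ‖ε‖ := mul_le_mul_of_nonneg_left hpow (by positivity)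
      _ ≤ c := by rw [hc, hB]; nlinarith
  have hz : (0 : ℝ) ∈ 𝕀 := by simp
  have ho : (1 : ℝ) ∈ 𝕀 := by simp
  -- the time-one map of `ε X`
  have hΞ : Holo (fun p => ε • X p) (ball 0 (R + 1)) := hX.holo.const_smul ε
  have hΞb : ∀ p ∈ 𝔻 (R + 1), ‖ε • X p‖ ≤ c := fun p hp => by
    have h1 := hX.near p hp
    have h2 := hK p hp
    have h3 := norm_le_add_sub (X p) (modelField τ p)
    have h4 : ‖X p‖ ≤ B := by rw [hB]; nlinarith
    rw [norm_smul, hc, mul_comm]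
    exact mul_le_mul_of_nonneg_right h4 hn.le
  obtain ⟨φ, hφ, hφp⟩ := exists_timeOneMap (κ := ε * (2 * π * I)) (d := 1 / 16) hΞ hΞb
    (by norm_num) (by linarith) (fun p hp => by
      rw [divergence_const_smul ε (hX.holo.at_ball hp), hX.div p hp])
  have hsub : 𝔻 (R + 1 / 2) ⊆ ball 0 (R + 1 - 2 * (1 / 16)) := ball_le
  have hφ' := hφ.mono hsub
  have hφb : ∀ p ∈ 𝔻 (R + 1 / 2), ‖φ p - p‖ ≤ c := fun p hp => (hφp p (hsub hp)).2.1
  have hφf : ∀ p ∈ 𝔻 (R + 1 / 2), ‖φ p - f p‖ ≤ C * ‖ε‖ ^ (n + 2) := by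
    intro p hp
    obtain ⟨γ, h0, h1, h2, h3⟩ := (hφp p (hsub hp)).2.2
    have := hX.flow γ h2 (fun t ht => by
      have := h3 t ht
      have := norm_lt hp
      linarith [norm_le_add_sub (γ t) p])
    rwa [h0, h1] at this
  have hφD : ∀ p ∈ 𝔻 (R + 1 / 2), φ (diag 1 jRoot p) = diag 1 jRoot (φ p) := by
    intro p hp
    have hp' : diag 1 jRoot p ∈ 𝔻 (R + 1 / 2) := by
      rw [mem_ball_zero_iff, norm_diag_one_jRoot]; exact norm_lt hp
    obtain ⟨γ, h0, h1, h2, h3⟩ := (hφp p (hsub hp)).2.2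
    obtain ⟨γ', h0', h1', h2', h3'⟩ := (hφp _ (hsub hp')).2.2
    have hγ : ∀ t ∈ 𝕀, ‖γ t‖ < R + 1 - 1 / 16 := fun t ht => by
      have := h3 t ht
      have := norm_lt hp
      linarith [norm_le_add_sub (γ t) p]
    have hγ' : ∀ t ∈ 𝕀, ‖γ' t‖ < R + 1 - 1 / 16 := fun t ht => by
      have := h3' t ht
      have := norm_lt hp'
      linarith [norm_le_add_sub (γ' t) (diag 1 jRoot p)]
    have hD : IsIntegralCurveOn (fun t => diag 1 jRoot (γ t)) (fun _ p => ε • X p) (Icc 0 1) := by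
      intro t ht
      have h5 : HasDerivWithinAt (fun t => diag 1 jRoot (γ t)) (diag 1 jRoot (ε • X (γ t))) (Icc 0 1) t :=
        (((diagL 1 jRoot).restrictScalars ℝ).hasFDerivAt.comp_hasDerivWithinAt t (h2 t ht) :)
      refine h5.congr_deriv ?_
      simp only
      rw [hX.equivariant _ (mem_ball₀ (by linarith [hγ t ht]))]
      exact (diagL 1 jRoot).map_smul ε (X (γ t))
    have := integralCurve_compare (Ξ' := fun p => ε • X p) (e := 0) hΞ hΞb (d := 1 / 16) (by norm_num)
      (by linarith) (fun _ _ => by simp) hD (fun t ht => by rw [norm_diag_one_jRoot]; exact hγ t ht)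
      h2' hγ' ho
    rw [h0', h0, h1, h1', sub_self, norm_zero, add_zero, mul_zero, norm_le_zero_iff, sub_eq_zero] at this
    exact this
  -- the defect `r = φ⁻¹ ∘ f`
  obtain ⟨e, heφ, hes, het, heh⟩ := exists_openPartialHomeomorph_near_id (d := 1 / 16) hφ' hφb
    (by norm_num) (by linarith)
  have hfb : ∀ p ∈ 𝔻 (R + 1), ‖f p - p‖ ≤ c := fun p hp => by
    have h1 := hfm p hp
    have h2 : ‖ε • modelField τ p‖ ≤ ‖ε‖ * K := by rw [norm_smul]; gcongr; exact hK p hp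
    calc _ = ‖(f p - (p + ε • modelField τ p)) + ε • modelField τ p‖ := by congr 1; abel
      _ ≤ C₀ * ‖ε‖ ^ 2 + ‖ε‖ * K := norm_add_le_of_le h1 h2
      _ ≤ c := by
        have : ‖ε‖ ^ 2 ≤ ‖ε‖ := by nlinarith
        rw [hc, hB]; nlinarith
  have hft : ∀ p ∈ 𝔻 (R + 5 / 16), f p ∈ e.target := fun p hp => het (by
    have h1 := norm_lt hp
    have h2 := hfb p mem_ball₀
    rw [mem_ball_zero_iff]
    linarith [norm_le_add_sub (f p) p])
  set r : ℂ² → ℂ² := fun p => e.symm (f p) with hr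
  have hrs : ∀ p ∈ 𝔻 (R + 5 / 16), r p ∈ 𝔻 (R + 1 / 2 - 1 / 16) := fun p hp => by
    rw [← hes]; exact e.map_target (hft p hp)
  have hφr : ∀ p ∈ 𝔻 (R + 5 / 16), φ (r p) = f p := fun p hp => by
    rw [← heφ]; exact e.right_inv (hft p hp)
  have hrd : Holo r (ball 0 (R + 5 / 16)) :=
    heh.comp (hf.mono ball_le) (fun p hp => hft p hp)
  have hφlip : ∀ p ∈ 𝔻 (R + 5 / 16), ‖(φ (r p) - r p) - (φ p - p)‖ ≤ 2 * c / (1 / 16) * ‖r p - p‖ :=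
    fun p hp => norm_sub_le_of_bound (f := fun p => φ p - p) (hφ'.sub differentiableOn_id) hφb (by norm_num)
      (norm_lt (hrs p hp)) (by linarith [norm_lt hp])
  have hrb : ∀ p ∈ 𝔻 (R + 5 / 16), ‖r p - p‖ ≤ c₂ := fun p hp => by
    have h1 := hφlip p hp
    have h2 := hφf p (mem_ball₀ (by linarith [norm_lt hp]))
    have h3 : ‖r p - p‖ ≤ ‖φ (r p) - φ p‖ + ‖(φ (r p) - r p) - (φ p - p)‖ := by
      calc _ = ‖(φ (r p) - φ p) - ((φ (r p) - r p) - (φ p - p))‖ := by congr 1; abel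
        _ ≤ _ := norm_sub_le _ _
    rw [hφr p hp, norm_sub_rev (f p)] at h3
    rw [hφr p hp] at h1
    have h4 : 2 * c / (1 / 16) * ‖r p - p‖ ≤ 1 / 2 * ‖r p - p‖ :=
      mul_le_mul_of_nonneg_right (by linarith) (norm_nonneg _)
    rw [hc₂]
    linarith
  have hrj : ∀ p ∈ 𝔻 (R + 5 / 16), jac r p = 1 := fun p hp => by
    have hrq := hsub (ball_mono (hrs p hp))
    have h1 : jac (fun x => φ (r x)) p = jac φ (r p) * jac r p :=
      jac_comp (hφ.at_ball hrq) (hrd.at_ball hp)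
    have h2 : jac (fun x => φ (r x)) p = jac f p :=
      jac_congr (by filter_upwards [isOpen_ball.mem_nhds hp] with x hx using hφr x hx)
    rw [h2, hfj p (mem_ball₀ (by linarith [norm_lt hp])), (hφp _ hrq).1,
      mul_comm ε] at h1
    exact (mul_left_cancel₀ (Complex.exp_ne_zero _) (by rw [mul_one]; exact h1)).symm
  have hrD : ∀ p ∈ 𝔻 (R + 5 / 16), r (diag 1 jRoot p) = diag 1 jRoot (r p) := fun p hp => by
    have hq := hrs p hp
    have h1 : φ (diag 1 jRoot (r p)) = f (diag 1 jRoot p) := by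
      rw [hφD _ (ball_mono hq), hφr p hp,
        hfD p (mem_ball₀ (by linarith [norm_lt hp]))]
    have h2 : diag 1 jRoot (r p) ∈ e.source := by
      rw [hes, mem_ball_zero_iff, norm_diag_one_jRoot]; exact norm_lt hq
    rw [hr]
    simp only
    rw [← h1, ← heφ, e.left_inv h2]
  obtain ⟨H, hH, -, hH1, hH2⟩ := exists_generating (d := 1 / 16) hrd hrb hrj (by norm_num) (by linarith)
  have hHr : ∀ y ∈ 𝔻 (R + 5 / 16 - 2 * (1 / 16)),
      ‖sgrad H y‖ ≤ c₂ ∧ ‖r y - y - sgrad H y‖ ≤ 2 * c₂ / (1 / 16) * c₂ := fun y hy => by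
    obtain ⟨p, hp, h1, h2, h3⟩ := hH2 y hy
    exact sgrad_approx hrd hrb (by norm_num) (by linarith [norm_lt hy])
      (norm_lt hp) h1 h2 h3
  have hHD : ∀ y ∈ 𝔻 (R + 5 / 16 - 2 * (1 / 16)),
      sgrad H (diag 1 jRoot y) = diag 1 jRoot (sgrad H y) := fun y hy => by
    obtain ⟨p, hp, h1, h2, h3⟩ := hH2 y hy
    have hp' : diag 1 jRoot p ∈ 𝔻 (R + 5 / 16 - 1 / 16) := by
      rw [mem_ball_zero_iff, norm_diag_one_jRoot]; exact norm_lt hp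
    have hpy : (p.1, (r p).2) = y := Prod.ext h1 h2
    have hrp := hrD p (ball_mono hp)
    have hpy' : ((diag 1 jRoot p).1, (r (diag 1 jRoot p)).2) = diag 1 jRoot y := by
      rw [hrp, ← hpy]; rfl
    have h4 := hH1 (diag 1 jRoot p) hp' (by
      rw [hpy', mem_ball_zero_iff, norm_diag_one_jRoot]; exact norm_lt hy)
    rw [IsCanonicalPair, hpy', hrp] at h4
    rw [IsCanonicalPair, hpy] at h3
    simp only [diag, one_mul] at h4 ⊢
    ext
    · simp only [sgrad]
      linear_combination h3.1 - h4.1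
    · simp only [sgrad]
      linear_combination h4.2 - jRoot * h3.2
  have hRsub : 𝔻 R ⊆ ball 0 (R + 5 / 16 - 2 * (1 / 16)) := ball_le
  have hRsub1 : 𝔻 R ⊆ ball 0 (R + 1) := ball_le
  have hgd := (differentiableOn_sgrad hH isOpen_ball).mono hRsub
  have hX'd : Holo (fun p => X p + ε⁻¹ • sgrad H p) (ball 0 R) :=
    (hX.holo.mono hRsub1).add (hgd.const_smul ε⁻¹)
  have hdiff : ∀ p ∈ 𝔻 R, ‖ε • (X p + ε⁻¹ • sgrad H p) - ε • X p‖ ≤ c₂ := fun p hp => by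
    rw [smul_add, add_sub_cancel_left, smul_inv_smul₀ hε0]
    exact (hHr p (hRsub hp)).1
  refine ⟨fun p => X p + ε⁻¹ • sgrad H p, hX'd, fun p hp => ?_, fun p hp => ?_, fun p hp => ?_,
    fun γ' hγ' hγ'R => ?_⟩
  · have h1 := hgd.at_ball hp
    have h2 := divergence_const_smul ε⁻¹ h1
    rw [divergence_add (hX.holo.at_ball (hRsub1 hp)) (h1.fun_const_smul ε⁻¹),
      h2, divergence_sgrad hH isOpen_ball (hRsub hp), mul_zero, add_zero, hX.div p (hRsub1 hp)]
  · rw [hX.equivariant p (hRsub1 hp), hHD p (hRsub hp)]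
    simp only [← diagL_apply, map_add, map_smul]
  · have h1 := hX.near p (hRsub1 hp)
    have h2 : ‖ε⁻¹ • sgrad H p‖ ≤ 2 * C * ‖ε‖ := by
      rw [norm_smul, norm_inv, inv_mul_le_iff₀ hn]
      refine (hHr p (hRsub hp)).1.trans ?_
      calc _ = ‖ε‖ * (2 * C * ‖ε‖ ^ (n + 1)) := by rw [hc₂]; ring
        _ ≤ _ := by gcongr
    calc _ = ‖(X p - modelField τ p) + ε⁻¹ • sgrad H p‖ := by congr 1; abel
      _ ≤ C * ‖ε‖ + 2 * C * ‖ε‖ := norm_add_le_of_le h1 h2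
      _ ≤ _ := by
        have : 0 ≤ 512 * C * B * ‖ε‖ := by positivity
        linarith
  · set p := γ' 0 with hp
    have hpR : ‖p‖ < R - 1 / 4 := hγ'R 0 hz
    have hpb : p ∈ 𝔻 R := mem_ball₀
    have hpb5 : p ∈ 𝔻 (R + 5 / 16) := mem_ball₀
    have hpb2 : p ∈ 𝔻 (R + 1 / 2) := mem_ball₀
    obtain ⟨γ, h0, h1, h2, h3⟩ := (hφp p (hsub hpb2)).2.2
    have hγR : ∀ t ∈ 𝕀, ‖γ t‖ < R - 1 / 16 := fun t ht => by
      have := h3 t ht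
      linarith [norm_le_add_sub (γ t) p]
    have hγ'R' : ∀ t ∈ 𝕀, ‖γ' t‖ < R - 1 / 16 := fun t ht => by linarith [hγ'R t ht]
    have hΞR : Holo (fun p => ε • X p) (ball 0 R) := hΞ.mono hRsub1
    have hΞbR : ∀ p ∈ 𝔻 R, ‖ε • X p‖ ≤ c := fun p hp => hΞb p (hRsub1 hp)
    have hcmp : ∀ t ∈ 𝕀, ‖γ' t - γ 0‖ ≤ 4 * c := fun t ht => by
      have h4 := integralCurve_compare (Ξ' := fun p => ε • (X p + ε⁻¹ • sgrad H p)) (d := 1 / 16) hΞR hΞbR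
        (by norm_num) (by linarith) hdiff h2 hγR hγ' hγ'R' ht
      rw [h0, ← hp, sub_self, norm_zero, zero_add] at h4
      have h5 := h3 t ht
      calc _ = ‖(γ' t - γ t) + (γ t - p)‖ := by rw [h0]; congr 1; abel
        _ ≤ 2 * c₂ + c := norm_add_le_of_le h4 h5
        _ ≤ 4 * c := by linarith
    have h4 := integralCurve_compare_two (Ξ' := fun p => ε • (X p + ε⁻¹ • sgrad H p)) (d := 1 / 16) hΞR
      (hX'd.const_smul ε) hΞbR (by norm_num) (by linarith) hdiff h2 hγR hγ' hγ'R'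
      (by rw [h0]) hcmp
    rw [h0, smul_add, add_sub_cancel_left, smul_inv_smul₀ hε0, h1] at h4
    have h5 := hφlip p hpb5
    have h6 := (hHr p (hRsub hpb)).2
    have h7 : ‖γ' 1 - f p‖ ≤ 2 * c₂ / (1 / 16) * (2 * c + 4 * c) + 2 * c / (1 / 16) * c₂
        + 2 * c₂ / (1 / 16) * c₂ := by
      calc _ = ‖(γ' 1 - φ p - sgrad H p) - ((φ (r p) - r p) - (φ p - p))
            - (r p - p - sgrad H p)‖ := by rw [hφr p hpb5]; congr 1; abel
        _ ≤ _ := by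
          refine (norm_sub_le _ _).trans (add_le_add ((norm_sub_le _ _).trans (add_le_add h4 (h5.trans ?_))) h6)
          gcongr
          exact hrb p hpb5
    refine h7.trans ?_
    calc _ ≤ 2 * c₂ / (1 / 16) * (2 * c + 4 * c) + 2 * c / (1 / 16) * c₂ + 2 * c₂ / (1 / 16) * c := by gcongr
      _ = 512 * C * B * ‖ε‖ ^ (n + 1 + 2) := by rw [hc, hc₂]; ring
      _ ≤ _ := by gcongr; linarith

/-- A map close to `id + ε X₀`, with constant Jacobian `e^{2πiε}` and commuting with `diag(1,j)`,
is up to an arbitrarily high power of `ε` the time-one map of a field `ε X` with the same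
symmetries. -/
theorem exists_isInterpolating (τ : ℂ) (C₀ : ℝ) (hC₀ : 0 ≤ C₀) (n : ℕ) :
    ∀ R : ℝ, ∃ C ε₀ : ℝ, 0 ≤ C ∧ 0 < ε₀ ∧ ∀ (ε : ℂ) (f : ℂ² → ℂ²), ε ≠ 0 → ‖ε‖ < ε₀ →
      Holo f (ball 0 (R + n)) →
      (∀ p ∈ 𝔻 (R + n), f (diag 1 jRoot p) = diag 1 jRoot (f p)) →
      (∀ p ∈ 𝔻 (R + n), jac f p = exp (2 * π * I * ε)) →
      (∀ p ∈ 𝔻 (R + n), ‖f p - (p + ε • modelField τ p)‖ ≤ C₀ * ‖ε‖ ^ 2) →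
      ∃ X, IsInterpolating τ ε f X R C n := by
  induction n with
  | zero =>
    intro R
    obtain ⟨C, hC, h⟩ := isInterpolating_model τ R C₀ hC₀
    exact ⟨C, 1, hC, one_pos, fun ε f _ _ _ _ _ hf => ⟨_, h ε f (by simpa using hf)⟩⟩
  | succ n ih =>
    intro R
    obtain ⟨C, ε₁, hC, hε₁, h⟩ := ih (R + 1)
    obtain ⟨C', ε₂, hC', hε₂, h'⟩ := isInterpolating_step τ R C₀ C hC₀ hC n
    refine ⟨C', min ε₁ ε₂, hC', lt_min hε₁ hε₂, fun ε f hε0 hε hf hD hj hm => ?_⟩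
    have e : R + ((n + 1 : ℕ) : ℝ) = R + 1 + n := by push_cast; ring
    rw [e] at hf hD hj hm
    obtain ⟨X, hX⟩ := h ε f hε0 (hε.trans_le (min_le_left _ _)) hf hD hj hm
    have hs : 𝔻 (R + 1) ⊆ ball 0 (R + 1 + n) := ball_subset_ball (by simp)
    exact h' ε f X hε0 (hε.trans_le (min_le_right _ _)) (hf.mono hs) (fun p hp => hD p (hs hp))
      (fun p hp => hj p (hs hp)) (fun p hp => hm p (hs hp)) hX

end Interpolation

/-! ### Dilations of canonical maps -/

section Zoom

variable {H : ℂ² → ℂ} {x y : ℂ} {p q : ℂ²}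

/-- The observable generating the conjugate by `diag(x,y)` of the canonical map of `H`. -/
def zoomObs (x y : ℂ) (H : ℂ² → ℂ) (p : ℂ²) : ℂ := H (diag x y p) / (x * y)

lemma hasFDerivAt_diag (x y : ℂ) (p : ℂ²) : HasFDerivAt (diag x y) (diagL x y) p :=
  (diagL x y).hasFDerivAt

lemma dz_zoomObs (hx : x ≠ 0) (hH : HoloAt H (diag x y p)) :
    dz (zoomObs x y H) p = dz H (diag x y p) / y := by
  have h : HasFDerivAt (zoomObs x y H) _ p :=
    (hH.hasFDerivAt.comp p (hasFDerivAt_diag x y p)).mul_const (x * y)⁻¹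
  have e : diagL x y (1, 0) = x • ((1, 0) : ℂ²) := by simp [diagL_apply, diag]
  rw [dz, h.fderiv, smul_apply, ContinuousLinearMap.comp_apply, e, map_smul, dz]
  simp only [smul_eq_mul]
  by_cases hy : y = 0
  · simp [hy]
  · field_simp

lemma dw_zoomObs (hy : y ≠ 0) (hH : HoloAt H (diag x y p)) :
    dw (zoomObs x y H) p = dw H (diag x y p) / x := by
  have h : HasFDerivAt (zoomObs x y H) _ p :=
    (hH.hasFDerivAt.comp p (hasFDerivAt_diag x y p)).mul_const (x * y)⁻¹
  have e : diagL x y (0, 1) = y • ((0, 1) : ℂ²) := by simp [diagL_apply, diag]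
  rw [dw, h.fderiv, smul_apply, ContinuousLinearMap.comp_apply, e, map_smul, dw]
  simp only [smul_eq_mul]
  by_cases hx : x = 0
  · simp [hx]
  · field_simp

lemma isCanonicalPair_zoomObs (hx : x ≠ 0) (hy : y ≠ 0)
    (hH : HoloAt H (diag x y (p.1, q.2)))
    (h : IsCanonicalPair H (diag x y p) (diag x y q)) : IsCanonicalPair (zoomObs x y H) p q := by
  obtain ⟨h1, h2⟩ := h
  have e : ((diag x y p).1, (diag x y q).2) = diag x y (p.1, q.2) := rfl
  rw [e] at h1 h2
  refine ⟨?_, ?_⟩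
  · rw [dw_zoomObs hy hH]
    generalize dw H (diag x y (p.1, q.2)) = a at h1 ⊢
    simp only [diag] at h1
    field_simp
    linear_combination h1
  · rw [dz_zoomObs hx hH]
    generalize dz H (diag x y (p.1, q.2)) = a at h2 ⊢
    simp only [diag] at h2
    field_simp
    linear_combination h2

lemma norm_diag_le (x y : ℂ) (p : ℂ²) : ‖diag x y p‖ ≤ max ‖x‖ ‖y‖ * ‖p‖ := by
  rw [diag, Prod.norm_def, norm_mul, norm_mul]
  refine max_le ?_ ?_
  · exact mul_le_mul (le_max_left _ _) (norm_fst_le p) (norm_nonneg _) (by positivity)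
  · exact mul_le_mul (le_max_right _ _) (norm_snd_le p) (norm_nonneg _) (by positivity)

end Zoom

/-! ### Maps tangent to the identity -/

section Tangent

/-- A bounded holomorphic map tangent to the identity at the origin differs from it by a
quadratic quantity, uniformly. -/
lemma norm_sub_self_le_sq {f : ℂ² → ℂ²} {R B : ℝ} (hf : Holo f (ball 0 R))
    (hb : ∀ p ∈ 𝔻 R, ‖f p - p‖ ≤ B) (h0 : f 0 = 0)
    (h1 : HasFDerivAt f (ContinuousLinearMap.id ℂ ℂ²) 0) {p : ℂ²} (hp : ‖p‖ < R) :
    ‖f p - p‖ ≤ 4 * B * (‖p‖ / R) ^ 2 := by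
  have h2 : HasFDerivAt (fun p => f p - p) (0 : ℂ² →L[ℂ] ℂ²) 0 := by
    simpa using h1.fun_sub (hasFDerivAt_id (0 : ℂ²))
  have := norm_taylor_two_le_of_ball (f := fun p => f p - p) (x := 0) (h := p) (hf.sub differentiableOn_id) hb hp
  simpa [h2.fderiv, h0] using this

lemma sgrad_norm_le_of_pair {H : ℂ² → ℂ} {p q y : ℂ²} (h : IsCanonicalPair H p q)
    (h1 : p.1 = y.1) (h2 : q.2 = y.2) : ‖sgrad H y‖ = ‖q - p‖ := by
  have e : (p.1, q.2) = y := Prod.ext h1 h2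
  obtain ⟨h3, h4⟩ := h
  rw [e] at h3 h4
  congr 1
  ext
  · simp [sgrad]; linear_combination -h3
  · simp [sgrad]; linear_combination h4

/-- If `q` is quadratically close to `p` and `y = (p₁, q₂)`, then `‖p‖ ≤ 2‖y‖`. -/
lemma norm_le_two_mul_of_quadratic {p q y : ℂ²} {A r : ℝ} (hA : ‖q - p‖ ≤ A * ‖p‖ ^ 2) (hp : ‖p‖ ≤ r)
    (hr : A * r ≤ 1 / 2) (hA0 : 0 ≤ A) (h1 : p.1 = y.1) (h2 : q.2 = y.2) : ‖p‖ ≤ 2 * ‖y‖ := by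
  have h3 : A * ‖p‖ ^ 2 ≤ 1 / 2 * ‖p‖ := by
    have : A * ‖p‖ ≤ 1 / 2 := (mul_le_mul_of_nonneg_left hp hA0).trans hr
    nlinarith [norm_nonneg p]
  have h4 : ‖p.2‖ ≤ ‖y‖ + 1 / 2 * ‖p‖ := by
    have h5 := norm_snd_le (q - p)
    have h6 := norm_le_add_sub p.2 q.2
    rw [norm_sub_rev] at h6
    rw [Prod.snd_sub] at h5
    have h7 : ‖q.2‖ ≤ ‖y‖ := by rw [h2]; exact norm_snd_le y
    linarith
  have h5 : ‖p.1‖ ≤ ‖y‖ + 1 / 2 * ‖p‖ := by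
    rw [h1]; linarith [norm_fst_le y, norm_nonneg p]
  have h6 : ‖p‖ ≤ ‖y‖ + 1 / 2 * ‖p‖ := by
    conv_lhs => rw [Prod.norm_def]
    exact max_le h5 h4
  linarith

/-- The generating observable of a map quadratically close to the identity is of order three. -/
lemma generating_norm_le_cube {H : ℂ² → ℂ} {f : ℂ² → ℂ²} {A r r' : ℝ} (hA0 : 0 ≤ A)
    (hH : Holo H (ball 0 r')) (h0 : H 0 = 0)
    (hf : ∀ p ∈ 𝔻 r, ‖f p - p‖ ≤ A * ‖p‖ ^ 2) (hr : A * r ≤ 1 / 2)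
    (hc : ∀ y ∈ 𝔻 r', ∃ p ∈ 𝔻 r, p.1 = y.1 ∧ (f p).2 = y.2 ∧
      IsCanonicalPair H p (f p)) {y : ℂ²} (hy : y ∈ 𝔻 r') :
    ‖sgrad H y‖ ≤ 4 * A * ‖y‖ ^ 2 ∧ ‖H y‖ ≤ 8 * A * ‖y‖ ^ 3 := by
  have key : ∀ y ∈ 𝔻 r', ‖sgrad H y‖ ≤ 4 * A * ‖y‖ ^ 2 := by
    intro y hy
    obtain ⟨p, hp, h1, h2, h3⟩ := hc y hy
    have h4 := norm_le_two_mul_of_quadratic (hf p hp) (norm_lt hp).le hr hA0 h1 h2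
    rw [sgrad_norm_le_of_pair h3 h1 h2]
    calc _ ≤ A * ‖p‖ ^ 2 := hf p hp
      _ ≤ A * (2 * ‖y‖) ^ 2 := by gcongr
      _ = _ := by ring
  refine ⟨key y hy, ?_⟩
  have := norm_le_of_sgrad_le (c := 4 * A * ‖y‖ ^ 2) hH h0 hy (fun x hx => by
    refine (key x (mem_ball₀ (hx.trans_lt (norm_lt hy)))).trans ?_
    gcongr)
  refine this.trans_eq (by ring)

end Tangent

/-! ### Polynomial observables -/

section Polynomials

variable {ι : Type*} [Fintype ι]

/-- The polynomial observable `∑ᵢ cᵢ z^{kᵢ} w^{lᵢ}`, where `e i = (kᵢ, lᵢ)`. -/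
def polyObs (e : ι → ℕ × ℕ) (c : ι → ℂ) (p : ℂ²) : ℂ := ∑ i, c i * p.1 ^ (e i).1 * p.2 ^ (e i).2

variable (e : ι → ℕ × ℕ)

lemma differentiable_polyObs (c : ι → ℂ) : Differentiable ℂ (polyObs e c) := by
  unfold polyObs; fun_prop

lemma dz_polyObs (c : ι → ℂ) (p : ℂ²) :
    dz (polyObs e c) p = ∑ i, c i * ((e i).1 * p.1 ^ ((e i).1 - 1) * p.2 ^ (e i).2) := by
  have h1 : HasFDerivAt (fun p : ℂ² => p.1) (ContinuousLinearMap.fst ℂ ℂ ℂ) p := hasFDerivAt_fst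
  have h2 : HasFDerivAt (fun p : ℂ² => p.2) (ContinuousLinearMap.snd ℂ ℂ ℂ) p := hasFDerivAt_snd
  have h : HasFDerivAt (polyObs e c) _ p := HasFDerivAt.fun_sum (u := Finset.univ) fun i _ =>
    ((h1.pow (e i).1).const_mul (c i)).mul (h2.pow (e i).2)
  rw [dz, h.fderiv]
  simp only [sum_apply, add_apply, smul_apply, ContinuousLinearMap.coe_fst', ContinuousLinearMap.coe_snd',
    smul_eq_mul, nsmul_eq_mul, mul_zero, zero_add, mul_one]
  exact Finset.sum_congr rfl fun i _ => by ring

lemma dw_polyObs (c : ι → ℂ) (p : ℂ²) :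
    dw (polyObs e c) p = ∑ i, c i * ((e i).2 * p.1 ^ (e i).1 * p.2 ^ ((e i).2 - 1)) := by
  have h1 : HasFDerivAt (fun p : ℂ² => p.1) (ContinuousLinearMap.fst ℂ ℂ ℂ) p := hasFDerivAt_fst
  have h2 : HasFDerivAt (fun p : ℂ² => p.2) (ContinuousLinearMap.snd ℂ ℂ ℂ) p := hasFDerivAt_snd
  have h : HasFDerivAt (polyObs e c) _ p := HasFDerivAt.fun_sum (u := Finset.univ) fun i _ =>
    ((h1.pow (e i).1).const_mul (c i)).mul (h2.pow (e i).2)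
  rw [dw, h.fderiv]
  simp only [sum_apply, add_apply, smul_apply, ContinuousLinearMap.coe_fst', ContinuousLinearMap.coe_snd',
    smul_eq_mul, nsmul_eq_mul, mul_zero, add_zero, mul_one]
  exact Finset.sum_congr rfl fun i _ => by ring

/-- The Hamiltonian field of the monomial `z^k w^l`. -/
def monoField (e : ℕ × ℕ) (p : ℂ²) : ℂ² :=
  (e.2 * p.1 ^ e.1 * p.2 ^ (e.2 - 1), -(e.1 * p.1 ^ (e.1 - 1) * p.2 ^ e.2))

lemma differentiable_monoField (e : ℕ × ℕ) : Differentiable ℂ (monoField e) := by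
  unfold monoField; fun_prop

lemma sgrad_polyObs (c : ι → ℂ) (p : ℂ²) :
    sgrad (polyObs e c) p = ∑ i, c i • monoField (e i) p := by
  ext
  · simp [sgrad, dw_polyObs, Prod.fst_sum, monoField]
  · simp [sgrad, dz_polyObs, Prod.snd_sum, monoField]

lemma exists_bound_polyField (R : ℝ) : ∃ K, 0 ≤ K ∧ ∀ (c : ι → ℂ), ∀ p ∈ closedBall (0 : ℂ²) R,
    ‖∑ i, c i • monoField (e i) p‖ ≤ K * ‖c‖ := by
  have hc : Continuous fun p : ℂ² => ∑ i, ‖monoField (e i) p‖ :=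
    continuous_finsetSum _ fun i _ => (differentiable_monoField (e i)).continuous.norm
  obtain ⟨K, hK⟩ := (isCompact_closedBall (0 : ℂ²) R).exists_bound_of_continuousOn hc.continuousOn
  refine ⟨max K 0, le_max_right _ _, fun c p hp => ?_⟩
  calc _ ≤ ∑ i, ‖c i • monoField (e i) p‖ := norm_sum_le _ _
    _ ≤ ∑ i, ‖c‖ * ‖monoField (e i) p‖ := Finset.sum_le_sum fun i _ => by
        rw [norm_smul]; gcongr; exact norm_le_pi_norm c i
    _ = ‖c‖ * ∑ i, ‖monoField (e i) p‖ := (Finset.mul_sum _ _ _).symm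
    _ ≤ ‖c‖ * max K 0 := by
        gcongr
        exact ((Real.le_norm_self _).trans (hK p hp)).trans (le_max_left _ _)
    _ = _ := mul_comm _ _

end Polynomials

/-! ### The linearized conjugation -/

section Homological

lemma sgrad_zero (p : ℂ²) : sgrad (fun _ => 0) p = 0 := by
  simp [sgrad, dz, dw]

/-- Second-order expansion of a conjugation: `θ` is generated by `H = s H_r + O(s⁵)`, `θ'` by
`H + s⁵ H_d + O(s⁶)`, and `κ = id + s⁴ u + O(s⁵)`, `κ = κ₀ + O(s⁶)`. Then the conjugate
`k = θ' ∘ κ ∘ θ⁻¹` is `κ₀ + s⁵ V + O(s⁶)`, where `V` is the sum of the Hamiltonian field of `H_d`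
and of a Lie bracket of the fields `X_r` of `H_r` and `u`. -/
lemma conjugation_expansion {R s A : ℝ} {u κ₀ κ Xr Xd θ θ' : ℂ² → ℂ²} {H H' : ℂ² → ℂ}
    (hs : 0 < s) (hs1 : s ≤ 1) (hA : 1 ≤ A) (hsA : 100 * A * s ≤ 1)
    (hu : Holo u (ball 0 R)) (hub : ∀ p ∈ 𝔻 R, ‖u p‖ ≤ A)
    (hκ₀ : Holo κ₀ (ball 0 R))
    (hκ₀u : ∀ p ∈ 𝔻 R, ‖κ₀ p - p - (s : ℂ) ^ 4 • u p‖ ≤ A * s ^ 5)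
    (hκ : ∀ p ∈ 𝔻 R, ‖κ p - κ₀ p‖ ≤ A * s ^ 6)
    (hXr : Holo Xr (ball 0 R)) (hXrb : ∀ p ∈ 𝔻 R, ‖Xr p‖ ≤ A)
    (hXd : Holo Xd (ball 0 R)) (hXdb : ∀ p ∈ 𝔻 R, ‖Xd p‖ ≤ A)
    (hH : Holo H (ball 0 R)) (hH' : Holo H' (ball 0 R))
    (hHr : ∀ p ∈ 𝔻 R, ‖sgrad H p - (s : ℂ) • Xr p‖ ≤ A * s ^ 5)
    (hHd : ∀ p ∈ 𝔻 R, ‖sgrad H' p - sgrad H p - (s : ℂ) ^ 5 • Xd p‖ ≤ A * s ^ 6)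
    (hθ : Holo θ (ball 0 (R - 2)))
    (hθp : ∀ p ∈ 𝔻 (R - 2), (p.1, (θ p).2) ∈ 𝔻 (R - 1) ∧
      IsCanonicalPair H p (θ p))
    (hθ'p : ∀ p ∈ 𝔻 (R - 2), (p.1, (θ' p).2) ∈ 𝔻 (R - 1) ∧
      IsCanonicalPair H' p (θ' p)) {p : ℂ²} (hp : p ∈ 𝔻 (R - 5)) :
    ‖θ' (κ p) - κ₀ (θ p) - (s : ℂ) ^ 5 • (Xd (θ p) + fderiv ℂ Xr (θ p) (u (θ p))
      - fderiv ℂ u (θ p) (Xr (θ p)))‖ ≤ 300 * A ^ 3 * s ^ 6 := by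
  have hA0 : 0 ≤ A := by linarith
  have ns : ∀ n : ℕ, ‖(s : ℂ) ^ n‖ = s ^ n := fun n => by
    rw [norm_pow, Complex.norm_of_nonneg hs.le]
  have ns1 : ‖(s : ℂ)‖ = s := by simpa using ns 1
  have hpow : ∀ m n : ℕ, m ≤ n → s ^ n ≤ s ^ m := fun m n h => pow_le_pow_of_le_one hs.le hs1 h
  have hsm : A * s ≤ 1 / 100 := by linarith
  have sub : ∀ {r r' : ℝ} {x : ℂ²}, x ∈ 𝔻 r → r ≤ r' → x ∈ 𝔻 r' :=
    fun h h' => ball_subset_ball h' h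
  have pos5 : 0 < s ^ 5 := by positivity
  have pos6 : 0 < s ^ 6 := by positivity
  have A2 : 1 ≤ A ^ 2 := one_le_pow₀ hA
  have A12 : A ≤ A ^ 2 := by nlinarith
  have A23 : A ^ 2 ≤ A ^ 3 := by nlinarith
  -- sizes of the fields
  have hHb : ∀ p ∈ 𝔻 R, ‖sgrad H p‖ ≤ 2 * A * s := fun x hx => by
    have h1 := hHr x hx
    have h2 : ‖(s : ℂ) • Xr x‖ ≤ s * A := by rw [norm_smul, ns1]; gcongr; exact hXrb x hx
    have h3 := norm_le_add_sub (sgrad H x) ((s : ℂ) • Xr x)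
    have h4 := hpow 1 5 (by norm_num)
    nlinarith
  have hHk : ∀ p ∈ 𝔻 R, ‖sgrad H' p - sgrad H p‖ ≤ 2 * A * s ^ 5 := fun x hx => by
    have h1 := hHd x hx
    have h2 : ‖(s : ℂ) ^ 5 • Xd x‖ ≤ s ^ 5 * A := by rw [norm_smul, ns]; gcongr; exact hXdb x hx
    have h3 := norm_le_add_sub (sgrad H' x - sgrad H x) ((s : ℂ) ^ 5 • Xd x)
    have h4 := hpow 5 6 (by norm_num)
    nlinarith
  have hH'b : ∀ p ∈ 𝔻 R, ‖sgrad H' p‖ ≤ 4 * A * s := fun x hx => by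
    have h1 := hHk x hx
    have h2 := hHb x hx
    have h3 := norm_le_add_sub (sgrad H' x) (sgrad H x)
    have h4 := hpow 1 5 (by norm_num)
    nlinarith
  -- sizes of the displacements
  have hθb : ∀ p ∈ 𝔻 (R - 2), ‖θ p - p‖ ≤ 2 * A * s := fun x hx => by
    obtain ⟨h1, h2⟩ := hθp x hx
    rw [← sgrad_norm_le_of_pair (y := (x.1, (θ x).2)) h2 rfl rfl]
    exact hHb _ (sub h1 (by linarith))
  have hκ0p : ∀ x ∈ 𝔻 R, ‖κ x - x - (s : ℂ) ^ 4 • u x‖ ≤ 2 * A * s ^ 5 := fun x hx => by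
    have h1 := hκ₀u x hx
    have h2 := hκ x hx
    have h4 := hpow 5 6 (by norm_num)
    calc _ = ‖(κ x - κ₀ x) + (κ₀ x - x - (s : ℂ) ^ 4 • u x)‖ := by
          congr 1; abel
      _ ≤ A * s ^ 6 + A * s ^ 5 := norm_add_le_of_le h2 h1
      _ ≤ _ := by nlinarith
  have hpR : p ∈ 𝔻 R := sub hp (by linarith)
  have hpn := norm_lt hp
  have hκp : ‖κ p - p‖ ≤ 3 * A * s ^ 4 := by
    have h1 := hκ0p p hpR
    have h2 : ‖(s : ℂ) ^ 4 • u p‖ ≤ s ^ 4 * A := by rw [norm_smul, ns]; gcongr; exact hub p hpR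
    have h3 := norm_le_add_sub (κ p - p) ((s : ℂ) ^ 4 • u p)
    have h4 := hpow 4 5 (by norm_num)
    nlinarith
  have hκp1 : ‖κ p - p‖ ≤ 3 / 100 := by
    have h4 := hpow 1 4 (by norm_num)
    nlinarith
  have hκpm : ‖κ p‖ < R - 4 := by linarith [norm_le_add_sub (κ p) p]
  have hκpb : κ p ∈ 𝔻 (R - 2) := mem_ball₀
  have hθpp : ‖θ p - p‖ ≤ 2 * A * s := hθb p (sub hp (by linarith))
  have hqm : ‖θ p‖ < R - 4 := by linarith [norm_le_add_sub (θ p) p]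
  set q := θ p with hq
  have hqR : q ∈ 𝔻 R := mem_ball₀
  -- `θ'` against `θ`
  have e1 : ‖θ' (κ p) - θ (κ p) - (s : ℂ) ^ 5 • Xd q‖ ≤ 55 * A ^ 2 * s ^ 6 := by
    obtain ⟨h1, h2⟩ := hθp _ hκpb
    obtain ⟨h3, h4⟩ := hθ'p _ hκpb
    have h5 := (canonicalPair_compare hH hH' hHb hH'b hHk one_pos (by linarith) (by linarith)
      (norm_lt h1) (norm_lt h3) h2 h4).2
    have h6 := hHd _ (sub hκpb (by linarith))
    have h7 : ‖κ p - q‖ ≤ 5 * A * s := by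
      have h4 := hpow 1 4 (by norm_num)
      calc _ = ‖(κ p - p) - (θ p - p)‖ := by congr 1; rw [hq]; abel
        _ ≤ 3 * A * s ^ 4 + 2 * A * s := (norm_sub_le _ _).trans (add_le_add hκp hθpp)
        _ ≤ _ := by nlinarith
    have h8 := norm_sub_le_of_bound hXd hXdb one_pos (x := κ p) (y := q) (by linarith) (by linarith)
    have h9 : ‖(s : ℂ) ^ 5 • (Xd (κ p) - Xd q)‖ ≤ s ^ 5 * (2 * A / 1 * (5 * A * s)) := by
      rw [norm_smul, ns]
      gcongr
      exact h8.trans (by gcongr)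
    calc _ = ‖(θ' (κ p) - θ (κ p) - (sgrad H' (κ p) - sgrad H (κ p)))
          + (sgrad H' (κ p) - sgrad H (κ p) - (s : ℂ) ^ 5 • Xd (κ p))
          + (s : ℂ) ^ 5 • (Xd (κ p) - Xd q)‖ := by congr 1; rw [smul_sub]; abel
      _ ≤ 2 * (2 * A * s ^ 5) / 1 * (2 * A * s + 2 * (4 * A * s)) + A * s ^ 6
          + s ^ 5 * (2 * A / 1 * (5 * A * s)) :=
        norm_add_le_of_le (norm_add_le_of_le h5 h6) h9
      _ ≤ _ := by nlinarith
  -- `θ - id` is `s Xr` up to `s²`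
  set ρ : ℂ² → ℂ² := fun x => θ x - x - (s : ℂ) • Xr x with hρ
  have hρd : Holo ρ (ball 0 (R - 2)) :=
    (hθ.sub differentiableOn_id).sub
      ((hXr.mono (ball_subset_ball (by linarith : R - 2 ≤ R))).fun_const_smul (s : ℂ))
  have hρb : ∀ x ∈ 𝔻 (R - 2), ‖ρ x‖ ≤ 17 * A ^ 2 * s ^ 2 := fun x hx => by
    obtain ⟨h1, h2⟩ := hθp x hx
    have hx' := norm_lt hx
    have h3 := (canonicalPair_compare (H := fun _ => 0) (H' := H) (c := 0) (k := 2 * A * s) (q := x)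
      (R := R) (d := 1) (differentiableOn_const _) hH (fun y _ => by simp [sgrad_zero]) hHb
      (fun y hy => by rw [sgrad_zero, sub_zero]; exact hHb y hy) one_pos (by linarith) (by linarith)
      (by simpa using (by linarith : ‖x‖ < R - 1)) (norm_lt h1) (by simp [IsCanonicalPair, dz, dw]) h2).2
    rw [sgrad_zero, sub_zero] at h3
    have h4 := hHr x (sub hx (by linarith))
    have h5 := hpow 2 5 (by norm_num)
    calc _ = ‖(θ x - x - sgrad H x) + (sgrad H x - (s : ℂ) • Xr x)‖ := by
          congr 1; simp only [hρ]; abel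
      _ ≤ 2 * (2 * A * s) / 1 * (0 + 2 * (2 * A * s)) + A * s ^ 5 :=
        norm_add_le_of_le h3 h4
      _ ≤ _ := by
        have : A * s ^ 5 ≤ A ^ 2 * s ^ 2 := by gcongr
        nlinarith
  have DXr : ‖fderiv ℂ Xr p‖ ≤ 2 * A := by
    simpa using norm_fderiv_le_of_bound hXr hXrb one_pos (x := p) (by linarith)
  have Du : ‖fderiv ℂ u p‖ ≤ 2 * A := by
    simpa using norm_fderiv_le_of_bound hu hub one_pos (x := p) (by linarith)
  have e2 : ‖θ (κ p) - θ p - (κ p - p) - (s : ℂ) ^ 5 • fderiv ℂ Xr p (u p)‖ ≤ 142 * A ^ 3 * s ^ 6 := by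
    have h1 := norm_sub_le_of_bound hρd hρb one_pos (x := κ p) (y := p) (by linarith) (by linarith)
    have h2 := norm_taylor_two_le hXr hXrb (x := p) (h := κ p - p) (d := 1) (by linarith) (by linarith)
    rw [add_sub_cancel] at h2
    have h3 : ‖fderiv ℂ Xr p (κ p - p - (s : ℂ) ^ 4 • u p)‖ ≤ 2 * A * (2 * A * s ^ 5) :=
      ((fderiv ℂ Xr p).le_opNorm _).trans (mul_le_mul DXr (hκ0p p hpR) (norm_nonneg _) (by positivity))
    have h4 : fderiv ℂ Xr p (κ p - p - (s : ℂ) ^ 4 • u p)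
        = fderiv ℂ Xr p (κ p - p) - (s : ℂ) ^ 4 • fderiv ℂ Xr p (u p) := by rw [map_sub, map_smul]
    have h5 : ‖(s : ℂ) • ((Xr (κ p) - Xr p - fderiv ℂ Xr p (κ p - p)) +
        fderiv ℂ Xr p (κ p - p - (s : ℂ) ^ 4 • u p))‖ ≤ s * (4 * A * (3 * A * s ^ 4 / 1) ^ 2 + 2 * A * (2 * A * s ^ 5)) := by
      rw [norm_smul, ns1]
      gcongr
      refine norm_add_le_of_le (h2.trans ?_) h3
      gcongr
    have h6 := hpow 6 9 (by norm_num)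
    calc _ = ‖(ρ (κ p) - ρ p) + (s : ℂ) • ((Xr (κ p) - Xr p - fderiv ℂ Xr p (κ p - p)) +
        fderiv ℂ Xr p (κ p - p - (s : ℂ) ^ 4 • u p))‖ := by
          congr 1
          rw [h4, hρ]
          simp only [smul_add, smul_sub, smul_smul]
          rw [← pow_succ']
          abel
      _ ≤ 2 * (17 * A ^ 2 * s ^ 2) / 1 * (3 * A * s ^ 4) + s * (4 * A * (3 * A * s ^ 4 / 1) ^ 2 + 2 * A * (2 * A * s ^ 5)) := by
          refine norm_add_le_of_le (h1.trans ?_) h5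
          gcongr
      _ = 102 * A ^ 3 * s ^ 6 + 36 * A ^ 3 * s ^ 9 + 4 * A ^ 2 * s ^ 6 := by ring
      _ ≤ 102 * A ^ 3 * s ^ 6 + 36 * A ^ 3 * s ^ 6 + 4 * A ^ 3 * s ^ 6 := by gcongr
      _ = _ := by ring
  have e3 : ‖(κ₀ q - q) - (κ₀ p - p) - (s : ℂ) ^ 5 • fderiv ℂ u p (Xr p)‖ ≤ 54 * A ^ 3 * s ^ 6 := by
    have h1 := norm_sub_le_of_bound (f := fun x => κ₀ x - x - (s : ℂ) ^ 4 • u x)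
      ((hκ₀.sub differentiableOn_id).sub (hu.fun_const_smul ((s : ℂ) ^ 4))) hκ₀u one_pos (x := q) (y := p) (by linarith) (by linarith)
    have h2 := norm_taylor_two_le hu hub (x := p) (h := q - p) (d := 1) (by linarith) (by linarith)
    rw [add_sub_cancel] at h2
    have h3 : ‖fderiv ℂ u p (ρ p)‖ ≤ 2 * A * (17 * A ^ 2 * s ^ 2) :=
      ((fderiv ℂ u p).le_opNorm _).trans (mul_le_mul Du (hρb p (sub hp (by linarith))) (norm_nonneg _) (by positivity))
    have h4 : fderiv ℂ u p (ρ p) = fderiv ℂ u p (q - p) - (s : ℂ) • fderiv ℂ u p (Xr p) := by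
      rw [hρ, ← map_smul, ← map_sub]
    have h5 : ‖(s : ℂ) ^ 4 • ((u q - u p - fderiv ℂ u p (q - p)) + fderiv ℂ u p (ρ p))‖
        ≤ s ^ 4 * (4 * A * (2 * A * s / 1) ^ 2 + 2 * A * (17 * A ^ 2 * s ^ 2)) := by
      rw [norm_smul, ns]
      gcongr
      refine norm_add_le_of_le (h2.trans ?_) h3
      gcongr
    calc _ = ‖((κ₀ q - q - (s : ℂ) ^ 4 • u q) - (κ₀ p - p - (s : ℂ) ^ 4 • u p)) +
          (s : ℂ) ^ 4 • ((u q - u p - fderiv ℂ u p (q - p)) + fderiv ℂ u p (ρ p))‖ := by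
          congr 1
          rw [h4]
          simp only [smul_add, smul_sub, smul_smul]
          rw [← pow_succ]
          abel
      _ ≤ 2 * (A * s ^ 5) / 1 * (2 * A * s) + s ^ 4 * (4 * A * (2 * A * s / 1) ^ 2 + 2 * A * (17 * A ^ 2 * s ^ 2)) := by
          refine norm_add_le_of_le (h1.trans ?_) h5
          gcongr
      _ = 4 * A ^ 2 * s ^ 6 + 50 * A ^ 3 * s ^ 6 := by ring
      _ ≤ 4 * A ^ 3 * s ^ 6 + 50 * A ^ 3 * s ^ 6 := by gcongr
      _ = _ := by ring
  -- moving the base point of the bracket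
  have lip : ∀ X Y : ℂ² → ℂ², Holo X (ball 0 R) → Holo Y (ball 0 R) →
      (∀ p ∈ 𝔻 R, ‖X p‖ ≤ A) → (∀ p ∈ 𝔻 R, ‖Y p‖ ≤ A) →
      ‖(s : ℂ) ^ 5 • (fderiv ℂ X p (Y p) - fderiv ℂ X q (Y q))‖ ≤ 8 * A ^ 3 * s ^ 6 := by
    intro X Y hX hY hXb hYb
    have h1 : Holo (fun x => fderiv ℂ X x (Y x)) (ball 0 (R - 1)) :=
      ((hX.fderiv_prod isOpen_ball).clm_apply hY).mono ball_le
    have h2 := norm_sub_le_of_bound h1 (c := 2 * A * A) (fun x hx => ?_) one_pos (x := p) (y := q)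
      (by linarith) (by linarith)
    · rw [norm_smul, ns]
      calc _ ≤ s ^ 5 * (2 * (2 * A * A) / 1 * (2 * A * s)) := by
            gcongr
            refine h2.trans ?_
            rw [norm_sub_rev]
            gcongr
        _ = _ := by ring
    · have hx' := norm_lt hx
      refine ((fderiv ℂ X x).le_opNorm _).trans (mul_le_mul ?_ (hYb x (sub hx (by linarith))) (norm_nonneg _) (by positivity))
      simpa using norm_fderiv_le_of_bound hX hXb one_pos (x := x) (by linarith)
  have e4 := lip Xr u hXr hu hXrb hub
  have e5 := lip u Xr hu hXr hub hXrb
  have e6 := hκ p hpR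
  calc _ = ‖(θ' (κ p) - θ (κ p) - (s : ℂ) ^ 5 • Xd q)
        + (θ (κ p) - θ p - (κ p - p) - (s : ℂ) ^ 5 • fderiv ℂ Xr p (u p))
        - ((κ₀ q - q) - (κ₀ p - p) - (s : ℂ) ^ 5 • fderiv ℂ u p (Xr p))
        + (s : ℂ) ^ 5 • (fderiv ℂ Xr p (u p) - fderiv ℂ Xr q (u q))
        - (s : ℂ) ^ 5 • (fderiv ℂ u p (Xr p) - fderiv ℂ u q (Xr q)) + (κ p - κ₀ p)‖ := by
        congr 1
        simp only [smul_add, smul_sub]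
        rw [← hq]
        abel
    _ ≤ 55 * A ^ 2 * s ^ 6 + 142 * A ^ 3 * s ^ 6 + 54 * A ^ 3 * s ^ 6 + 8 * A ^ 3 * s ^ 6
        + 8 * A ^ 3 * s ^ 6 + A * s ^ 6 :=
      norm_add_le_of_le ((norm_sub_le _ _).trans (add_le_add ((norm_add_le _ _).trans
        (add_le_add ((norm_sub_le _ _).trans (add_le_add ((norm_add_le _ _).trans
          (add_le_add e1 e2)) e3)) e4)) e5)) e6
    _ ≤ _ := by nlinarith [mul_nonneg pos6.le (sub_nonneg.2 A12), mul_nonneg pos6.le (sub_nonneg.2 A23)]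

end Homological

/-! ### Shears, twists and the eigenvalues -/

section Preliminary

/-- The symplectic shear `(z,w) ↦ (z + a w², w)`. -/
def shear (a : ℂ) (p : ℂ²) : ℂ² := (p.1 + a * p.2 ^ 2, p.2)

/-- The symplectic map `(z,w) ↦ (z (1+γw)², w/(1+γw))`, generated by `γ z w² + ⋯`. -/
def twist (γ : ℂ) (p : ℂ²) : ℂ² := (p.1 * (1 + γ * p.2) ^ 2, p.2 / (1 + γ * p.2))

/-- The nonlinear part of the Hénon map with eigenvalues `l₁`, `l₂`, in the coordinates
`(s⁵ z, s³ w)`. -/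
def henonCore (c s l₁ l₂ : ℂ) (p : ℂ²) : ℂ² :=
  (p.1 + c / l₁ * s * (l₁ * s ^ 2 * p.1 + l₂ * p.2) ^ 2,
    p.2 - c / l₂ * s ^ 3 * (l₁ * s ^ 2 * p.1 + l₂ * p.2) ^ 2)

lemma shear_neg_shear (a : ℂ) (p : ℂ²) : shear (-a) (shear a p) = p := by
  simp [shear]

lemma twist_neg_twist {γ : ℂ} {p : ℂ²} (h : 1 + γ * p.2 ≠ 0) : twist (-γ) (twist γ p) = p := by
  have h' : 1 + p.2 * γ ≠ 0 := by rwa [mul_comm p.2]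
  have e : 1 + -γ * (p.2 / (1 + γ * p.2)) = (1 + γ * p.2)⁻¹ := by field_simp; ring
  ext
  · simp only [twist, e]; field_simp
  · simp only [twist, e]; field_simp

lemma hasFDerivAt_coords (p : ℂ²) :
    HasFDerivAt (fun p : ℂ² => p.1) (ContinuousLinearMap.fst ℂ ℂ ℂ) p ∧
    HasFDerivAt (fun p : ℂ² => p.2) (ContinuousLinearMap.snd ℂ ℂ ℂ) p :=
  ⟨hasFDerivAt_fst, hasFDerivAt_snd⟩

lemma jac_eq_of_hasFDerivAt {f : ℂ² → ℂ²} {L : ℂ² →L[ℂ] ℂ²} {p : ℂ²}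
    (h : HasFDerivAt f L p) : jac f p = (L (1, 0)).1 * (L (0, 1)).2 - (L (0, 1)).1 * (L (1, 0)).2 := by
  rw [jac, h.fderiv]

lemma eq_id_of_apply {L : ℂ² →L[ℂ] ℂ²} (h1 : L (1, 0) = (1, 0)) (h2 : L (0, 1) = (0, 1)) :
    L = ContinuousLinearMap.id ℂ ℂ² := by
  refine ContinuousLinearMap.ext fun p => ?_
  rw [clm_prod_apply L p, h1, h2]
  simp

lemma shear_deriv (a : ℂ) (p : ℂ²) : ∃ L : ℂ² →L[ℂ] ℂ², HasFDerivAt (shear a) L p ∧ L (1, 0) = (1, 0) ∧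
    L (0, 1) = (2 * a * p.2, 1) := by
  obtain ⟨h1, h2⟩ := hasFDerivAt_coords p
  refine ⟨_, (h1.add ((h2.pow 2).const_mul a)).prodMk h2, ?_, ?_⟩
  · simp
  · simp; ring

lemma twist_deriv {γ : ℂ} {p : ℂ²} (h : 1 + γ * p.2 ≠ 0) : ∃ L : ℂ² →L[ℂ] ℂ², HasFDerivAt (twist γ) L p ∧
    L (1, 0) = ((1 + γ * p.2) ^ 2, 0) ∧
    L (0, 1) = (2 * γ * p.1 * (1 + γ * p.2), (1 + γ * p.2)⁻¹ ^ 2) := by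
  obtain ⟨h1, h2⟩ := hasFDerivAt_coords p
  have h3 := (h2.const_mul γ).const_add 1
  have h5 := (hasDerivAt_inv h).comp_hasFDerivAt p h3
  have h6 : HasFDerivAt (fun p : ℂ² => p.2 / (1 + γ * p.2)) _ p := h2.mul h5
  refine ⟨_, (h1.mul (h3.pow 2)).prodMk h6, ?_, ?_⟩
  · simp
  · simp
    constructor
    · ring
    · field_simp; ring

lemma henonCore_deriv {c s l₁ l₂ : ℂ} (h₁ : l₁ ≠ 0) (h₂ : l₂ ≠ 0) (p : ℂ²) :
    ∃ L : ℂ² →L[ℂ] ℂ², HasFDerivAt (henonCore c s l₁ l₂) L p ∧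
    L (1, 0) = (1 + 2 * c * s ^ 3 * (l₁ * s ^ 2 * p.1 + l₂ * p.2),
      -(2 * c * l₁ / l₂ * s ^ 5 * (l₁ * s ^ 2 * p.1 + l₂ * p.2))) ∧
    L (0, 1) = (2 * c * l₂ / l₁ * s * (l₁ * s ^ 2 * p.1 + l₂ * p.2),
      1 - 2 * c * s ^ 3 * (l₁ * s ^ 2 * p.1 + l₂ * p.2)) := by
  obtain ⟨h1, h2⟩ := hasFDerivAt_coords p
  have h3 := ((h1.const_mul (l₁ * s ^ 2)).add (h2.const_mul l₂)).pow 2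
  refine ⟨_, (h1.add (h3.const_mul (c / l₁ * s))).prodMk (h2.sub (h3.const_mul (c / l₂ * s ^ 3))), ?_, ?_⟩
  · ext
    · simp; field_simp
    · simp; field_simp
  · ext
    · simp; field_simp
    · simp; field_simp

lemma jac_shear (a : ℂ) (p : ℂ²) : jac (shear a) p = 1 := by
  obtain ⟨L, h, h1, h2⟩ := shear_deriv a p
  rw [jac_eq_of_hasFDerivAt h, h1, h2]; ring

lemma jac_twist {γ : ℂ} {p : ℂ²} (h : 1 + γ * p.2 ≠ 0) : jac (twist γ) p = 1 := by
  obtain ⟨L, h', h1, h2⟩ := twist_deriv h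
  rw [jac_eq_of_hasFDerivAt h', h1, h2]; field_simp; ring

lemma jac_henonCore {c s l₁ l₂ : ℂ} (h₁ : l₁ ≠ 0) (h₂ : l₂ ≠ 0) (p : ℂ²) :
    jac (henonCore c s l₁ l₂) p = 1 := by
  obtain ⟨L, h', h1, h2⟩ := henonCore_deriv (c := c) (s := s) h₁ h₂ p
  rw [jac_eq_of_hasFDerivAt h', h1, h2]; field_simp; ring

/-- `f` fixes the origin with identity derivative. -/
def IsTangentId (f : ℂ² → ℂ²) : Prop :=
  f 0 = 0 ∧ HasFDerivAt f (ContinuousLinearMap.id ℂ ℂ²) 0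

lemma IsTangentId.comp {f g : ℂ² → ℂ²} (hf : IsTangentId f) (hg : IsTangentId g) :
    IsTangentId (fun p => f (g p)) := by
  refine ⟨show f (g 0) = 0 by rw [hg.1, hf.1], ?_⟩
  have h : HasFDerivAt f (ContinuousLinearMap.id ℂ ℂ²) (g 0) := by rw [hg.1]; exact hf.2
  have h2 := h.comp (0 : ℂ²) hg.2
  rwa [ContinuousLinearMap.id_comp] at h2

lemma isTangentId_shear (a : ℂ) : IsTangentId (shear a) := by
  obtain ⟨L, h, h1, h2⟩ := shear_deriv a 0
  refine ⟨by simp [shear], ?_⟩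
  rwa [eq_id_of_apply h1 (by simpa using h2)] at h

lemma isTangentId_twist (γ : ℂ) : IsTangentId (twist γ) := by
  obtain ⟨L, h, h1, h2⟩ := twist_deriv (γ := γ) (p := 0) (by simp)
  refine ⟨by simp [twist], ?_⟩
  rwa [eq_id_of_apply (L := L) (by simpa using h1) (by simpa using h2)] at h

lemma isTangentId_henonCore (c s : ℂ) {l₁ l₂ : ℂ} (h₁ : l₁ ≠ 0) (h₂ : l₂ ≠ 0) :
    IsTangentId (henonCore c s l₁ l₂) := by
  obtain ⟨L, h, h1, h2⟩ := henonCore_deriv (c := c) (s := s) h₁ h₂ 0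
  refine ⟨by simp [henonCore], ?_⟩
  rwa [eq_id_of_apply (L := L) (by simpa using h1) (by simpa using h2)] at h

variable {X : Type*} [NormedAddCommGroup X] [NormedSpace ℂ X] {f : X → ℂ²} {x : X}

lemma AnalyticAt.shear {a : X → ℂ} (ha : AnalyticAt ℂ a x) (hf : AnalyticAt ℂ f x) :
    AnalyticAt ℂ (fun x => shear (a x) (f x)) x := by
  have h1 : AnalyticAt ℂ (fun x => (f x).1) x := analyticAt_fst.comp hf
  have h2 : AnalyticAt ℂ (fun x => (f x).2) x := analyticAt_snd.comp hf
  exact (h1.add (ha.mul (h2.pow 2))).prod h2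

lemma AnalyticAt.twist {a : X → ℂ} (ha : AnalyticAt ℂ a x) (hf : AnalyticAt ℂ f x)
    (h0 : 1 + a x * (f x).2 ≠ 0) : AnalyticAt ℂ (fun x => twist (a x) (f x)) x := by
  have h1 : AnalyticAt ℂ (fun x => (f x).1) x := analyticAt_fst.comp hf
  have h2 : AnalyticAt ℂ (fun x => (f x).2) x := analyticAt_snd.comp hf
  have h3 : AnalyticAt ℂ (fun x => 1 + a x * (f x).2) x := analyticAt_const.add (ha.mul h2)
  exact (h1.mul (h3.pow 2)).prod (h2.div h3 h0)

lemma AnalyticAt.henonCore {c s l₁ l₂ : X → ℂ} (hc : AnalyticAt ℂ c x) (hs : AnalyticAt ℂ s x)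
    (h₁ : AnalyticAt ℂ l₁ x) (h₂ : AnalyticAt ℂ l₂ x) (h₁0 : l₁ x ≠ 0) (h₂0 : l₂ x ≠ 0)
    (hf : AnalyticAt ℂ f x) : AnalyticAt ℂ (fun x => henonCore (c x) (s x) (l₁ x) (l₂ x) (f x)) x := by
  have h1 : AnalyticAt ℂ (fun x => (f x).1) x := analyticAt_fst.comp hf
  have h2 : AnalyticAt ℂ (fun x => (f x).2) x := analyticAt_snd.comp hf
  have h3 := (((h₁.mul (hs.pow 2)).mul h1).add (h₂.mul h2)).pow 2
  exact (h1.add (((hc.div h₁ h₁0).mul hs).mul h3)).prod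
    (h2.sub (((hc.div h₂ h₂0).mul (hs.pow 3)).mul h3))

/-- The eigenvalue `λ₁` as a function of `(a, b) = (α - 1/6, β - 1/3)`. -/
def lam₁ (q : ℂ²) : ℂ := eig₁ (1 / 6 + q.1) (1 / 3 + q.2)

/-- The eigenvalue `λ₂` as a function of `(a, b) = (α - 1/6, β - 1/3)`. -/
def lam₂ (q : ℂ²) : ℂ := eig₂ (1 / 6 + q.1) (1 / 3 + q.2)

/-- The coefficient `e^{iπβ}/(λ₁ - λ₂)` as a function of `(a, b) = (α - 1/6, β - 1/3)`. -/
def henonCoeff (q : ℂ²) : ℂ := exp (I * π * (1 / 3 + q.2)) / (lam₁ q - lam₂ q)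

lemma lam₁_ne_zero (q : ℂ²) : lam₁ q ≠ 0 := Complex.exp_ne_zero _
lemma lam₂_ne_zero (q : ℂ²) : lam₂ q ≠ 0 := Complex.exp_ne_zero _

lemma lam₁_eq (q : ℂ²) : lam₁ q = exp (2 * π * I * (-q.1 + q.2 / 2)) := by
  rw [lam₁, eig₁]; congr 1; ring

lemma lam₂_eq (q : ℂ²) : lam₂ q = jRoot * exp (2 * π * I * (q.1 + q.2 / 2)) := by
  rw [lam₂, eig₂, jRoot, ← Complex.exp_add]; congr 1; ring

lemma lam₁_zero : lam₁ 0 = 1 := by simp [lam₁_eq]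
lemma lam₂_zero : lam₂ 0 = jRoot := by simp [lam₂_eq]

lemma jRoot_eq : jRoot = -1 / 2 + (√3 / 2 : ℝ) * I := by
  have h : (2 * π * I / 3 : ℂ) = ((π - π / 3 : ℝ) : ℂ) * I := by push_cast; ring
  rw [jRoot, h, Complex.exp_mul_I, ← Complex.ofReal_cos, ← Complex.ofReal_sin, Real.cos_pi_sub,
    Real.sin_pi_sub, Real.cos_pi_div_three, Real.sin_pi_div_three]
  push_cast; ring

lemma sqrt_three_sq : ((√3 : ℝ) : ℂ) ^ 2 = 3 := by
  rw [← Complex.ofReal_pow, Real.sq_sqrt (by norm_num)]; norm_num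

lemma jRoot_quadratic : jRoot ^ 2 + jRoot + 1 = 0 := by
  rw [jRoot_eq]
  push_cast
  linear_combination (I ^ 2 / 4) * sqrt_three_sq + 3 / 4 * Complex.I_sq

lemma one_sub_jRoot_ne_zero : 1 - jRoot ≠ 0 := by
  intro h
  have h1 : jRoot = 1 := by linear_combination -h
  have := jRoot_quadratic
  rw [h1] at this
  norm_num at this

lemma one_sub_jRoot_sq_ne_zero : 1 - jRoot ^ 2 ≠ 0 := by
  have : 1 - jRoot ^ 2 = (1 - jRoot) * (1 + jRoot) := by ring
  rw [this]
  refine mul_ne_zero one_sub_jRoot_ne_zero fun h => ?_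
  have h1 := jRoot_quadratic
  have h2 : jRoot ^ 2 = 0 := by linear_combination h1 - h
  exact jRoot_ne_zero (pow_eq_zero_iff two_ne_zero |>.1 h2)

lemma henonCoeff_zero : henonCoeff 0 = I * (1 / √3 : ℝ) := by
  have h : (I * π * (1 / 3 + (0 : ℂ²).2) : ℂ) = ((π / 3 : ℝ) : ℂ) * I := by
    push_cast; simp; ring
  have h3 : ((√3 : ℝ) : ℂ) ≠ 0 := by simp
  rw [henonCoeff, lam₁_zero, lam₂_zero, div_eq_iff one_sub_jRoot_ne_zero, h, Complex.exp_mul_I,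
    ← Complex.ofReal_cos, ← Complex.ofReal_sin, Real.cos_pi_div_three, Real.sin_pi_div_three, jRoot_eq]
  push_cast
  field_simp
  linear_combination I * sqrt_three_sq + ((√3 : ℝ) : ℂ) * Complex.I_sq

/-- The parameter of the shear that removes the term `w³` of the Hénon map. -/
def shearCoeff : ℂ := henonCoeff 0 * jRoot ^ 2 / (1 - jRoot ^ 2)

/-- The parameter of the twist that removes the term `z w²` of the Hénon map. -/
def twistCoeff : ℂ := henonCoeff 0 * jRoot / (1 - jRoot)

/-- The coefficient of `w⁴` in the resonant normal form at the exact resonance. -/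
def quartic : ℂ := shearCoeff * henonCoeff 0 * jRoot ^ 2 / 2

lemma quartic_eq : quartic = I * (-(2 / 3) * (1 / √3) : ℝ) / 4 := by
  have h3 : ((√3 : ℝ) : ℂ) ≠ 0 := by simp
  have h4 : (√3 : ℂ) * (√3 : ℂ) = 3 := by rw [← pow_two, sqrt_three_sq]
  have e : jRoot ^ 4 / (1 - jRoot ^ 2) = I / √3 := by
    rw [div_eq_div_iff one_sub_jRoot_sq_ne_zero h3]
    have hj := jRoot_quadratic
    have h5 : jRoot = -1 / 2 + (√3 / 2 : ℂ) * I := by rw [jRoot_eq]; push_cast; ring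
    have h6 : jRoot ^ 4 = jRoot := by linear_combination jRoot * jRoot_pow_three
    rw [h6]
    have h7 : jRoot ^ 2 = -1 - jRoot := by linear_combination hj
    rw [h7, h5]
    linear_combination -(√3 : ℂ) / 2 * Complex.I_sq + I / 2 * sqrt_three_sq
  calc _ = henonCoeff 0 ^ 2 / 2 * (jRoot ^ 4 / (1 - jRoot ^ 2)) := by
        rw [quartic, shearCoeff]; ring
    _ = _ := by
        rw [e, henonCoeff_zero]
        push_cast
        field_simp
        linear_combination 12 * Complex.I_sq + 4 * sqrt_three_sq

end Preliminary

local notation "V[" s ", " p "]" => shear (-(shearCoeff * s)) (twist (-(twistCoeff * s ^ 3)) p)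
local notation "H[" s ", " q ", " p "]" => henonCore (henonCoeff q) s (lam₁ q) (lam₂ q) V[s, p]

/-! ### The preliminary form of the Hénon map -/

section Kappa

/-- The explicit preliminary change of coordinates, in the coordinates `(s⁵ z, s³ w)`. -/
def prelim (s : ℂ) (p : ℂ²) : ℂ² := twist (twistCoeff * s ^ 3) (shear (shearCoeff * s) p)

/-- The nonlinear part of the Hénon map after the preliminary change of coordinates. -/
def prelimHenon (s : ℂ) (q p : ℂ²) : ℂ² :=
  twist (twistCoeff * s ^ 3 * lam₂ q) (shear (shearCoeff * s * lam₂ q ^ 2 / lam₁ q)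
    H[s, q, p])

lemma henonMod_zoom (s : ℂ) (q p : ℂ²) :
    henonMod (1 / 6 + q.1) (1 / 3 + q.2) (diag (s ^ 5) (s ^ 3) p) =
      diag (s ^ 5) (s ^ 3) (diag (lam₁ q) (lam₂ q) (henonCore (henonCoeff q) s (lam₁ q) (lam₂ q) p)) := by
  have h1 := lam₁_ne_zero q
  have h2 := lam₂_ne_zero q
  have e : ∀ x : ℂ, exp (I * π * (1 / 3 + q.2)) * x ^ 2 / (lam₁ q - lam₂ q) =
    henonCoeff q * x ^ 2 := fun x => by rw [henonCoeff]; ring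
  have e1 : eig₁ (1 / 6 + q.1) (1 / 3 + q.2) = lam₁ q := rfl
  have e2 : eig₂ (1 / 6 + q.1) (1 / 3 + q.2) = lam₂ q := rfl
  simp only [henonMod, e1, e2, e, diag, henonCore]
  ext
  · simp only [Prod.fst_add, Prod.smul_fst, smul_eq_mul]
    field_simp
  · simp only [Prod.snd_add, Prod.smul_snd, smul_eq_mul]
    field_simp
    ring

lemma diag_inv_diag {a b : ℂ} (ha : a ≠ 0) (hb : b ≠ 0) (p : ℂ²) :
    diag a⁻¹ b⁻¹ (diag a b p) = p := by
  rw [diag_diag, inv_mul_cancel₀ ha, inv_mul_cancel₀ hb, diag_one_one]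

lemma diag_diag_inv {a b : ℂ} (ha : a ≠ 0) (hb : b ≠ 0) (p : ℂ²) :
    diag a b (diag a⁻¹ b⁻¹ p) = p := by
  rw [diag_diag, mul_inv_cancel₀ ha, mul_inv_cancel₀ hb, diag_one_one]

lemma prelim_diag (s : ℂ) (q p : ℂ²) :
    prelim s (diag (lam₁ q) (lam₂ q) p) = diag (lam₁ q) (lam₂ q)
      (twist (twistCoeff * s ^ 3 * lam₂ q) (shear (shearCoeff * s * lam₂ q ^ 2 / lam₁ q) p)) := by
  have h1 := lam₁_ne_zero q
  simp only [prelim, twist, shear, diag]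
  ext
  · field_simp
  · simp only
    rw [mul_assoc (twistCoeff * s ^ 3), mul_div_assoc]

lemma prelimHenon_prelim (s : ℂ) (q : ℂ²) {p : ℂ²} (h : 1 + twistCoeff * s ^ 3 * p.2 ≠ 0) :
    diag (lam₁ q) (lam₂ q) (prelimHenon s q (prelim s p)) =
      prelim s (diag (lam₁ q) (lam₂ q) (henonCore (henonCoeff q) s (lam₁ q) (lam₂ q) p)) := by
  have e : shear (-(shearCoeff * s)) (twist (-(twistCoeff * s ^ 3)) (prelim s p)) = p := by
    rw [prelim, twist_neg_twist (by simpa [shear] using h), shear_neg_shear]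
  rw [prelim_diag, prelimHenon, e]

lemma isTangentId_prelim (s : ℂ) : IsTangentId (prelim s) :=
  (isTangentId_twist _).comp (isTangentId_shear _)

lemma isTangentId_prelimHenon (s : ℂ) (q : ℂ²) : IsTangentId (prelimHenon s q) :=
  (isTangentId_twist _).comp <| (isTangentId_shear _).comp <|
    (isTangentId_henonCore _ _ (lam₁_ne_zero q) (lam₂_ne_zero q)).comp <|
      (isTangentId_shear _).comp (isTangentId_twist _)

lemma analyticAt_lam (q : ℂ²) : AnalyticAt ℂ lam₁ q ∧ AnalyticAt ℂ lam₂ q := by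
  have h1 : AnalyticAt ℂ (fun q : ℂ² => q.1) q := analyticAt_fst
  have h2 : AnalyticAt ℂ (fun q : ℂ² => q.2) q := analyticAt_snd
  constructor
  · unfold lam₁ eig₁; fun_prop
  · unfold lam₂ eig₂; fun_prop

lemma analyticAt_henonCoeff_zero : AnalyticAt ℂ henonCoeff 0 := by
  obtain ⟨h1, h2⟩ := analyticAt_lam 0
  have h3 : AnalyticAt ℂ (fun q : ℂ² => exp (I * π * (1 / 3 + q.2))) 0 :=
    (analyticAt_const.mul (analyticAt_const.add analyticAt_snd)).cexp
  exact h3.div (h1.sub h2) (by rw [lam₁_zero, lam₂_zero]; exact one_sub_jRoot_ne_zero)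

lemma analyticAt_prelimHenon (p : ℂ²) :
    AnalyticAt ℂ (fun x : 𝔼 => prelimHenon x.1.1 x.1.2 x.2) ((0, 0), p) ∧ AnalyticAt ℂ
      (fun x : 𝔼 => 1 + twistCoeff * x.1.1 ^ 3 * lam₂ x.1.2 * H[x.1.1, x.1.2, x.2].2) ((0, 0), p) := by
  have h1 : AnalyticAt ℂ (fun x : 𝔼 => x.1) ((0, 0), p) := analyticAt_fst
  have hs : AnalyticAt ℂ (fun x : 𝔼 => x.1.1) ((0, 0), p) := analyticAt_fst.comp h1
  have hq : AnalyticAt ℂ (fun x : 𝔼 => x.1.2) ((0, 0), p) := analyticAt_snd.comp h1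
  have hp : AnalyticAt ℂ (fun x : 𝔼 => x.2) ((0, 0), p) := analyticAt_snd
  have hl1 : AnalyticAt ℂ (fun x : 𝔼 => lam₁ x.1.2) ((0, 0), p) :=
    AnalyticAt.comp (g := lam₁) (analyticAt_lam 0).1 hq
  have hl2 : AnalyticAt ℂ (fun x : 𝔼 => lam₂ x.1.2) ((0, 0), p) :=
    AnalyticAt.comp (g := lam₂) (analyticAt_lam 0).2 hq
  have hc : AnalyticAt ℂ (fun x : 𝔼 => henonCoeff x.1.2) ((0, 0), p) :=
    AnalyticAt.comp (g := henonCoeff) analyticAt_henonCoeff_zero hq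
  have ht : AnalyticAt ℂ (fun x : 𝔼 => twistCoeff * x.1.1 ^ 3) ((0, 0), p) :=
    analyticAt_const.mul (hs.pow 3)
  have ha : AnalyticAt ℂ (fun x : 𝔼 => shearCoeff * x.1.1) ((0, 0), p) :=
    analyticAt_const.mul hs
  have k := ((ht.neg.twist hp (by simp)) |> ha.neg.shear) |>
    AnalyticAt.henonCore hc hs hl1 hl2 (lam₁_ne_zero _) (lam₂_ne_zero _)
  exact ⟨(ht.mul hl2).twist (k |> ((ha.mul (hl2.pow 2)).div hl1 (lam₁_ne_zero _)).shear) (by simp),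
    analyticAt_const.add ((ht.mul hl2).mul (analyticAt_snd.comp k))⟩

lemma jac_comp_eq_one {f g : ℂ² → ℂ²} {p : ℂ²} (hg : HoloAt g (f p))
    (hf : HoloAt f p) (h1 : jac g (f p) = 1) (h2 : jac f p = 1) :
    HoloAt (fun x => g (f x)) p ∧ jac (fun x => g (f x)) p = 1 :=
  ⟨hg.comp p hf, by rw [jac_comp hg hf, h1, h2, one_mul]⟩

lemma shear_good (a : ℂ) (p : ℂ²) : HoloAt (shear a) p ∧ jac (shear a) p = 1 := by
  obtain ⟨L, h, -⟩ := shear_deriv a p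
  exact ⟨h.differentiableAt, jac_shear a p⟩

lemma twist_good {γ : ℂ} {p : ℂ²} (h : 1 + γ * p.2 ≠ 0) :
    HoloAt (twist γ) p ∧ jac (twist γ) p = 1 := by
  obtain ⟨L, h', -⟩ := twist_deriv h
  exact ⟨h'.differentiableAt, jac_twist h⟩

lemma jac_prelim (s : ℂ) {p : ℂ²} (h : 1 + twistCoeff * s ^ 3 * p.2 ≠ 0) :
    HoloAt (prelim s) p ∧ jac (prelim s) p = 1 := by
  obtain ⟨h1, h2⟩ := shear_good (shearCoeff * s) p
  obtain ⟨h3, h4⟩ := twist_good (γ := twistCoeff * s ^ 3) (p := shear (shearCoeff * s) p)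
    (by simpa [shear] using h)
  exact jac_comp_eq_one (f := shear (shearCoeff * s)) h3 h1 h4 h2

lemma jac_prelimHenon (s : ℂ) (q : ℂ²) {p : ℂ²} (h : 1 + -(twistCoeff * s ^ 3) * p.2 ≠ 0)
    (h' : 1 + twistCoeff * s ^ 3 * lam₂ q * H[s, q, p].2 ≠ 0) :
    jac (prelimHenon s q) p = 1 := by
  obtain ⟨h1, h2⟩ := twist_good h
  obtain ⟨h3, h4⟩ := shear_good (-(shearCoeff * s)) (twist (-(twistCoeff * s ^ 3)) p)
  obtain ⟨h5, h6⟩ := jac_comp_eq_one (f := twist (-(twistCoeff * s ^ 3))) h3 h1 h4 h2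
  obtain ⟨L, h7, -⟩ := henonCore_deriv (c := henonCoeff q) (s := s) (lam₁_ne_zero q) (lam₂_ne_zero q)
    V[s, p]
  obtain ⟨h8, h9⟩ := jac_comp_eq_one
    (f := fun p => V[s, p]) h7.differentiableAt h5
    (jac_henonCore (lam₁_ne_zero q) (lam₂_ne_zero q) _) h6
  obtain ⟨h10, h11⟩ := shear_good (shearCoeff * s * lam₂ q ^ 2 / lam₁ q)
    H[s, q, p]
  obtain ⟨h12, h13⟩ := jac_comp_eq_one
    (f := fun p => H[s, q, p]) h10 h8 h11 h9
  obtain ⟨h14, h15⟩ := twist_good (γ := twistCoeff * s ^ 3 * lam₂ q) (p := shear (shearCoeff * s * lam₂ q ^ 2 / lam₁ q)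
    H[s, q, p])
    (by simpa [shear] using h')
  exact (jac_comp_eq_one
    (f := fun p => shear (shearCoeff * s * lam₂ q ^ 2 / lam₁ q) H[s, q, p]) h14 h12 h15 h13).2

/-- The explicit remainder at order six, in terms of the preimage `(z,w)` under `prelim s`,
`m = 1/(1+γs³w)` and `m' = 1/(1+γjs³w')`. -/
def remFst (a g c j s z w m : ℂ) : ℂ :=
  let η := 2 * j * z * w + s ^ 2 * z ^ 2
  let ω := -(c * j ^ 2) * (s ^ 2 * z + j * w) ^ 2
  let w' := w + s ^ 3 * ω
  let z₁ := z + a * s * w ^ 2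
  let e₁ := -2 * a * c * j * w * η + a * j ^ 2 * s * ω ^ 2
  let d₃ := 2 * c * j * z * w + c * s ^ 2 * z ^ 2 - 2 * a * c * s * w ^ 3 + s ^ 3 * e₁
  let f := 2 * g * j * w' + g ^ 2 * j ^ 2 * s ^ 3 * w' ^ 2
  let Z := z₁ * (1 + g * s ^ 3 * w) ^ 2
  e₁ + d₃ * f + z₁ * (2 * g * j * ω + g ^ 2 * (j ^ 2 * w' ^ 2 - w ^ 2))
    - (2 * a * c * j ^ 2 * (-(g * s * w ^ 4 * m * (m ^ 2 + m + 1)))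
      + c * ((Z + z) * (a * w ^ 2 + z₁ * (2 * g * s ^ 2 * w + g ^ 2 * s ^ 5 * w ^ 2))))

/-- The second component of the remainder; see `remFst`. -/
def remSnd (a g c j s z w m m' : ℂ) : ℂ :=
  let ω := -(c * j ^ 2) * (s ^ 2 * z + j * w) ^ 2
  let w' := w + s ^ 3 * ω
  let z₁ := z + a * s * w ^ 2
  (-(c * j ^ 2) * s * z ^ 2 + c * j * w * ω) * (m * m')
    + (-2 * c * z * w) * (-(g * s ^ 2 * w * m * m') - g * j * s ^ 2 * w' * m')
    + 2 * c * ((a * w ^ 2 + z₁ * (2 * g * s ^ 2 * w + g ^ 2 * s ^ 5 * w ^ 2)) * (w * m) - z * (g * s ^ 2 * w ^ 2 * m))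

lemma prelim_expansion_fst {a g c j s z w m : ℂ} (ha : a * (1 - j ^ 2) = c * j ^ 2)
    (hg : g * (1 - j) = c * j) (hj : j ^ 2 + j + 1 = 0) (hm : m * (1 + g * s ^ 3 * w) = 1) :
    (z + c * s * (s ^ 2 * z + j * w) ^ 2
        + a * s * j ^ 2 * (w - c * j ^ 2 * s ^ 3 * (s ^ 2 * z + j * w) ^ 2) ^ 2)
      * (1 + g * s ^ 3 * j * (w - c * j ^ 2 * s ^ 3 * (s ^ 2 * z + j * w) ^ 2)) ^ 2
      - (z + a * s * w ^ 2) * (1 + g * s ^ 3 * w) ^ 2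
      - s ^ 4 * (2 * a * c * j ^ 2 * (w * m) ^ 3)
      - s ^ 5 * (c * ((z + a * s * w ^ 2) * (1 + g * s ^ 3 * w) ^ 2) ^ 2) = s ^ 6 * remFst a g c j s z w m := by
  have hj3 : j ^ 3 = 1 := by linear_combination (j - 1) * hj
  -- eliminate `m`, then expand
  have hm3 : (w * m) ^ 3 = w ^ 3 - g * s ^ 3 * w ^ 4 * m * (m ^ 2 + m + 1) := by
    linear_combination (w ^ 3 * (m ^ 2 + m + 1)) * hm
  set ω := -(c * j ^ 2) * (s ^ 2 * z + j * w) ^ 2 with hω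
  set w' := w + s ^ 3 * ω with hw'
  have e1 : w - c * j ^ 2 * s ^ 3 * (s ^ 2 * z + j * w) ^ 2 = w' := by rw [hw', hω]; ring
  set z₁ := z + a * s * w ^ 2 with hz₁
  set Z := z₁ * (1 + g * s ^ 3 * w) ^ 2 with hZ
  set η := 2 * j * z * w + s ^ 2 * z ^ 2 with hη
  set e₁ := -2 * a * c * j * w * η + a * j ^ 2 * s * ω ^ 2 with he₁
  set d₃ := 2 * c * j * z * w + c * s ^ 2 * z ^ 2 - 2 * a * c * s * w ^ 3 + s ^ 3 * e₁ with hd₃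
  have e2 : z + c * s * (s ^ 2 * z + j * w) ^ 2 + a * s * j ^ 2 * w' ^ 2 - z₁ = s ^ 3 * d₃ := by
    have hω2 : ω = -(c * j) * w ^ 2 - s ^ 2 * (c * j ^ 2) * η := by
      rw [hω, hη]; linear_combination -(c * j * w ^ 2) * hj3
    have h1 : a * s * j ^ 2 * w' ^ 2 = a * s * j ^ 2 * w ^ 2 + 2 * a * j ^ 2 * s ^ 4 * w * ω + a * j ^ 2 * s ^ 7 * ω ^ 2 := by
      rw [hw']; ring
    have h2 : 2 * a * j ^ 2 * s ^ 4 * w * ω = -2 * a * c * s ^ 4 * w ^ 3 - 2 * a * c * j * s ^ 6 * w * η := by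
      rw [hω2]; linear_combination (-2 * a * c * s ^ 4 * w ^ 3 - 2 * a * c * j * s ^ 6 * w * η) * hj3
    rw [h1, h2, hd₃, he₁, hz₁, hη]
    linear_combination (-s * w ^ 2) * ha
  have e3 : z + c * s * (s ^ 2 * z + j * w) ^ 2 + a * s * j ^ 2 * w' ^ 2 = z₁ + s ^ 3 * d₃ := by
    linear_combination e2
  rw [e1, e3, hm3, remFst]
  rw [← hη, ← hω, ← hw', ← hz₁, ← hZ, ← he₁, ← hd₃]
  have hZz : Z - z = s * (a * w ^ 2 + z₁ * (2 * g * s ^ 2 * w + g ^ 2 * s ^ 5 * w ^ 2)) := by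
    rw [hZ, hz₁]; ring
  have e4 : Z ^ 2 = z ^ 2 + s * ((Z + z) * (a * w ^ 2 + z₁ * (2 * g * s ^ 2 * w + g ^ 2 * s ^ 5 * w ^ 2))) := by
    linear_combination (Z + z) * hZz
  rw [e4]
  have e5 : z₁ * (1 + g * s ^ 3 * j * w') ^ 2 - Z = 2 * g * (j - 1) * s ^ 3 * z₁ * w +
      s ^ 6 * (z₁ * (2 * g * j * ω + g ^ 2 * (j ^ 2 * w' ^ 2 - w ^ 2))) := by
    rw [hZ]
    have : j * w' = j * w + j * s ^ 3 * ω := by rw [hw']; ring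
    linear_combination 2 * g * s ^ 3 * z₁ * this
  have e6 : 2 * g * (j - 1) * s ^ 3 * z₁ * w = -2 * c * j * s ^ 3 * z * w - 2 * c * j * a * s ^ 4 * w ^ 3 := by
    rw [hz₁]; linear_combination (-2 * s ^ 3 * (z + a * s * w ^ 2) * w) * hg
  have e7 : s ^ 3 * d₃ = 2 * c * j * s ^ 3 * z * w + c * s ^ 5 * z ^ 2 - 2 * a * c * s ^ 4 * w ^ 3 + s ^ 6 * e₁ := by
    rw [hd₃]; ring
  have e8 : (z₁ + s ^ 3 * d₃) * (1 + g * s ^ 3 * j * w') ^ 2 - Z =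
      (z₁ * (1 + g * s ^ 3 * j * w') ^ 2 - Z) + s ^ 3 * d₃
        + s ^ 6 * (d₃ * (2 * g * j * w' + g ^ 2 * j ^ 2 * s ^ 3 * w' ^ 2)) := by ring
  rw [e8, e5, e6, e7]
  linear_combination (-2 * a * c * s ^ 4 * w ^ 3) * hj

lemma prelim_expansion_snd {a g c j s z w m m' : ℂ}
    (hg : g * (1 - j) = c * j) (hj : j ^ 2 + j + 1 = 0) (hm : m * (1 + g * s ^ 3 * w) = 1)
    (hm' : m' * (1 + g * s ^ 3 * j * (w - c * j ^ 2 * s ^ 3 * (s ^ 2 * z + j * w) ^ 2)) = 1) :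
    (w - c * j ^ 2 * s ^ 3 * (s ^ 2 * z + j * w) ^ 2) * m' - w * m
      - s ^ 5 * (-2 * c * ((z + a * s * w ^ 2) * (1 + g * s ^ 3 * w) ^ 2) * (w * m)) =
      s ^ 6 * remSnd a g c j s z w m m' := by
  have hj3 : j ^ 3 = 1 := by linear_combination (j - 1) * hj
  set ω := -(c * j ^ 2) * (s ^ 2 * z + j * w) ^ 2 with hω
  set w' := w + s ^ 3 * ω with hw'
  have e1 : w - c * j ^ 2 * s ^ 3 * (s ^ 2 * z + j * w) ^ 2 = w' := by rw [hw', hω]; ring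
  set z₁ := z + a * s * w ^ 2 with hz₁
  rw [e1] at hm' ⊢
  rw [remSnd]
  rw [← hω, ← hw', ← hz₁]
  have hω2 : ω = -(c * j) * w ^ 2 - s ^ 2 * (2 * c * z * w) - s ^ 4 * (c * j ^ 2) * z ^ 2 := by
    rw [hω]; linear_combination (-(c * j * w ^ 2) - 2 * c * s ^ 2 * z * w) * hj3
  have e2 : w' * m' - w * m = (w' * (1 + g * s ^ 3 * w) - w * (1 + g * s ^ 3 * j * w')) * (m * m') := by
    linear_combination -w' * m' * hm + w * m * hm'
  have e3 : w' * (1 + g * s ^ 3 * w) - w * (1 + g * s ^ 3 * j * w') =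
      s ^ 5 * (-2 * c * z * w) + s ^ 6 * (-(c * j ^ 2) * s * z ^ 2 + c * j * w * ω) := by
    have : w' * (1 + g * s ^ 3 * w) - w * (1 + g * s ^ 3 * j * w') = (w' - w) + s ^ 3 * (g * (1 - j)) * w * w' := by ring
    rw [this, hg, hw']
    linear_combination s ^ 3 * hω2
  have e4 : m * m' - 1 = -(g * s ^ 3 * w * m * m') - g * j * s ^ 3 * w' * m' := by
    linear_combination m' * hm + hm'
  have hZz : z₁ * (1 + g * s ^ 3 * w) ^ 2 - z = s * (a * w ^ 2 + z₁ * (2 * g * s ^ 2 * w + g ^ 2 * s ^ 5 * w ^ 2)) := by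
    rw [hz₁]; ring
  have hWw : w * m - w = -(g * s ^ 3 * w ^ 2 * m) := by linear_combination w * hm
  rw [e2, e3]
  linear_combination s ^ 5 * (-2 * c * z * w) * e4 + 2 * c * s ^ 5 * (w * m) * hZz + 2 * c * s ^ 5 * z * hWw

end Kappa

/-! ### Uniform bounds on the preliminary form -/

section Tube

lemma exists_bound_near {α β E : Type*} [TopologicalSpace α] [TopologicalSpace β] [NormedAddCommGroup E]
    {K : Set β} (hK : IsCompact K) {x₀ : α} {f : α × β → E} (hf : ∀ y ∈ K, ContinuousAt f (x₀, y)) :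
    ∃ B, ∀ᶠ x in 𝓝 x₀, ∀ y ∈ K, ‖f (x, y)‖ ≤ B := by
  obtain ⟨B, hB⟩ := hK.exists_bound_of_continuousOn (f := fun y => f (x₀, y)) fun y hy =>
    ((hf y hy).comp (f := fun y => (x₀, y)) (by fun_prop)).continuousWithinAt
  refine ⟨B + 1, hK.eventually_forall_of_forall_eventually (P := fun x y => ‖f (x, y)‖ ≤ B + 1) fun y hy => ?_⟩
  have h : ∀ᶠ z in 𝓝 (x₀, y), ‖f z‖ < B + 1 :=
    (hf y hy).norm.eventually (gt_mem_nhds ((hB y hy).trans_lt (by linarith)))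
  exact h.mono fun z hz => hz.le

lemma norm_zoom_sub_le {f : ℂ² → ℂ²} {ε B : ℝ} (hf : Holo f (ball 0 ε)) (hε : 0 < ε)
    (hb : ∀ q ∈ 𝔻 ε, ‖f q‖ ≤ B) {q : ℂ²} (hq : ‖q‖ < ε / 2) :
    ‖f q - f 0‖ ≤ 4 * B / ε * ‖q‖ := by
  have := norm_sub_le_of_bound hf hb (half_pos hε) (x := q) (y := 0) (by linarith) (by simpa using by linarith)
  rw [sub_zero] at this
  refine this.trans_eq (by ring)

/-- The leading field `X_{b w⁴}`, `b = quartic`, of the preliminary form of the Hénon map. -/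
def quarticField (p : ℂ²) : ℂ² := (4 * quartic * p.2 ^ 3, 0)

/-- The next field `X_{c z² w}`, `c = henonCoeff 0`, of the preliminary form of the Hénon map. -/
def cubicField (p : ℂ²) : ℂ² := (henonCoeff 0 * p.1 ^ 2, -2 * henonCoeff 0 * p.1 * p.2)

/-- The remainder of order six as a polynomial in `(s, z, w, m, m')`. -/
def remPoly (v : ℂ × ℂ × ℂ × ℂ × ℂ) : ℂ² :=
  (remFst shearCoeff twistCoeff (henonCoeff 0) jRoot v.1 v.2.1 v.2.2.1 v.2.2.2.1,
    remSnd shearCoeff twistCoeff (henonCoeff 0) jRoot v.1 v.2.1 v.2.2.1 v.2.2.2.1 v.2.2.2.2)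

/-- The scaled remainder of order six, as a function of the point at which it is taken. -/
def prelimRem (x : ℂ × ℂ²) : ℂ² :=
  let y := V[x.1, x.2]
  let m := 1 + -(twistCoeff * x.1 ^ 3) * x.2.2
  let m' := (1 + twistCoeff * x.1 ^ 3 * jRoot *
    (y.2 - henonCoeff 0 * jRoot ^ 2 * x.1 ^ 3 * (x.1 ^ 2 * y.1 + jRoot * y.2) ^ 2))⁻¹
  remPoly (x.1, y.1, y.2, m, m')

lemma prelimHenon_zero (s : ℂ) (p : ℂ²) : prelimHenon s 0 p =
    twist (twistCoeff * s ^ 3 * jRoot) (shear (shearCoeff * s * jRoot ^ 2) (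
      let y := V[s, p]
      (y.1 + henonCoeff 0 * s * (s ^ 2 * y.1 + jRoot * y.2) ^ 2,
        y.2 - henonCoeff 0 * jRoot ^ 2 * s ^ 3 * (s ^ 2 * y.1 + jRoot * y.2) ^ 2))) := by
  have e : henonCoeff 0 / jRoot = henonCoeff 0 * jRoot ^ 2 := by
    rw [div_eq_iff jRoot_ne_zero]; linear_combination -henonCoeff 0 * jRoot_pow_three
  simp only [prelimHenon, lam₁_zero, lam₂_zero, div_one, henonCore, one_mul, e]

lemma prelimHenon_expansion {s : ℂ} {p : ℂ²} (h : 1 + -(twistCoeff * s ^ 3) * p.2 ≠ 0)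
    (h' : 1 + twistCoeff * s ^ 3 * lam₂ 0 * H[s, 0, p].2 ≠ 0) :
    prelimHenon s 0 p - p - s ^ 4 • quarticField p - s ^ 5 • cubicField p = s ^ 6 • prelimRem (s, p) := by
  have e : henonCoeff 0 / jRoot = henonCoeff 0 * jRoot ^ 2 := by
    rw [div_eq_iff jRoot_ne_zero]; linear_combination -henonCoeff 0 * jRoot_pow_three
  rw [prelimHenon_zero]
  simp only [prelimRem]
  simp only [lam₁_zero, lam₂_zero, henonCore, one_mul, e] at h'
  set y := V[s, p] with hy
  set m := 1 + -(twistCoeff * s ^ 3) * p.2 with hm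
  have hy2 : y.2 = p.2 / m := rfl
  have hym : y.2 * m = p.2 := by rw [hy2, div_mul_cancel₀ _ h]
  have hm1 : m * (1 + twistCoeff * s ^ 3 * y.2) = 1 := by
    linear_combination hm + twistCoeff * s ^ 3 * hym
  have hy1 : y.1 + shearCoeff * s * y.2 ^ 2 = p.1 * m ^ 2 := by
    simp only [hy, shear, twist, hm]; ring
  have hp1 : (y.1 + shearCoeff * s * y.2 ^ 2) * (1 + twistCoeff * s ^ 3 * y.2) ^ 2 = p.1 := by
    rw [hy1]; linear_combination p.1 * (m * (1 + twistCoeff * s ^ 3 * y.2) + 1) * hm1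
  have ha : shearCoeff * (1 - jRoot ^ 2) = henonCoeff 0 * jRoot ^ 2 :=
    div_mul_cancel₀ _ one_sub_jRoot_sq_ne_zero
  have hg : twistCoeff * (1 - jRoot) = henonCoeff 0 * jRoot := div_mul_cancel₀ _ one_sub_jRoot_ne_zero
  have E1 := prelim_expansion_fst ha hg jRoot_quadratic hm1 (z := y.1)
  have E2 := prelim_expansion_snd (a := shearCoeff) (z := y.1) hg jRoot_quadratic hm1 (inv_mul_cancel₀ h')
  rw [hp1, hym] at E1 E2
  ext
  · simp only [Prod.fst_sub, Prod.smul_fst, smul_eq_mul, quarticField, cubicField, twist, shear, quartic]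
    refine Eq.trans ?_ E1
    ring
  · simp only [Prod.snd_sub, Prod.smul_snd, smul_eq_mul, quarticField, cubicField, twist, shear]
    refine Eq.trans ?_ E2
    rw [div_eq_mul_inv]
    ring

lemma continuousAt_prelimRem (p : ℂ²) : ContinuousAt prelimRem (0, p) := by
  have hs : AnalyticAt ℂ (fun x : ℂ × ℂ² => x.1) (0, p) := analyticAt_fst
  have hp : AnalyticAt ℂ (fun x : ℂ × ℂ² => x.2) (0, p) := analyticAt_snd
  have hy : ContinuousAt (fun x : ℂ × ℂ² =>
      V[x.1, x.2]) (0, p) :=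
    ((analyticAt_const.mul hs).neg.shear ((analyticAt_const.mul (hs.pow 3)).neg.twist hp (by simp))).continuousAt
  have aux : ∀ y : ℂ × ℂ² → ℂ², ContinuousAt y (0, p) → ContinuousAt (fun x : ℂ × ℂ² =>
      (1 + twistCoeff * x.1 ^ 3 * jRoot * ((y x).2 - henonCoeff 0 * jRoot ^ 2 * x.1 ^ 3 *
          (x.1 ^ 2 * (y x).1 + jRoot * (y x).2) ^ 2))⁻¹) (0, p) := fun y hy =>
    ContinuousAt.inv₀ (by fun_prop) (by simp)
  have hm : ContinuousAt (fun x : ℂ × ℂ² => 1 + -(twistCoeff * x.1 ^ 3) * x.2.2) (0, p) := by fun_prop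
  have hG : Continuous remPoly := by
    unfold remPoly remFst remSnd; fun_prop
  exact hG.continuousAt.comp
    (hs.continuousAt.prodMk (hy.fst.prodMk (hy.snd.prodMk (hm.prodMk (aux _ hy)))))

lemma analyticAt_prelim (p : ℂ²) : AnalyticAt ℂ (fun x : ℂ × ℂ² => prelim x.1 x.2) (0, p) := by
  have hs : AnalyticAt ℂ (fun x : ℂ × ℂ² => x.1) (0, p) := analyticAt_fst
  have hp : AnalyticAt ℂ (fun x : ℂ × ℂ² => x.2) (0, p) := analyticAt_snd
  exact (analyticAt_const.mul (hs.pow 3)).twist ((analyticAt_const.mul hs).shear hp) (by simp)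

/-- The uniform properties of the preliminary form of the Hénon map for small scales `s`. -/
structure PrelimBounds (R A s ε : ℝ) : Prop where
  holo : Holo (fun x : ℂ² × ℂ² => prelimHenon s x.1 x.2) (ball 0 ε ×ˢ ball 0 R)
  jac_eq : ∀ q ∈ 𝔻 ε, ∀ p ∈ 𝔻 R, jac (prelimHenon s q) p = 1
  lip : ∀ q ∈ 𝔻 ε, ∀ p ∈ 𝔻 R,
    ‖prelimHenon s q p - prelimHenon s 0 p‖ ≤ A * ‖q‖
  expansion : ∀ p ∈ 𝔻 R,
    ‖prelimHenon s 0 p - p - (s : ℂ) ^ 4 • quarticField p - (s : ℂ) ^ 5 • cubicField p‖ ≤ A * s ^ 6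
  prelim_holo : Holo (prelim s) (ball 0 R)
  prelim_jac : ∀ p ∈ 𝔻 R, jac (prelim s) p = 1
  prelim_near : ∀ p ∈ 𝔻 R, ‖prelim s p - p‖ ≤ A * s
  prelim_conj : ∀ q, ∀ p ∈ 𝔻 R, diag (lam₁ q) (lam₂ q) (prelimHenon s q (prelim s p)) =
      prelim s (diag (lam₁ q) (lam₂ q) (henonCore (henonCoeff q) s (lam₁ q) (lam₂ q) p))

/-- All bounds come from continuity at `s = 0`, `q = 0` and compactness of the ball in `(z,w)`. -/
theorem exists_prelimBounds (R : ℝ) :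
    ∃ A ε s₀ : ℝ, 1 ≤ A ∧ 0 < ε ∧ 0 < s₀ ∧ ∀ s : ℝ, 0 < s → s < s₀ → PrelimBounds R A s ε := by
  have hK := isCompact_closedBall (0 : ℂ²) R
  obtain ⟨B₁, hB₁⟩ := exists_bound_near hK fun p _ => (analyticAt_prelimHenon p).1.continuousAt
  obtain ⟨B₂, hB₂⟩ := exists_bound_near hK fun p _ => continuousAt_prelimRem p
  obtain ⟨B₃, hB₃⟩ := exists_bound_near hK fun p _ => (analyticAt_prelim p).continuousAt
  have hA₁ : ∀ᶠ x in 𝓝 ((0, 0) : ℂ × ℂ²), ∀ p ∈ closedBall (0 : ℂ²) R,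
      AnalyticAt ℂ (fun x : 𝔼 => prelimHenon x.1.1 x.1.2 x.2) (x, p) :=
    hK.eventually_forall_of_forall_eventually (P := fun x p => AnalyticAt ℂ
      (fun x : 𝔼 => prelimHenon x.1.1 x.1.2 x.2) (x, p))
      fun p _ => (analyticAt_prelimHenon p).1.eventually_analyticAt
  have hA₂ : ∀ᶠ x in 𝓝 (0 : ℂ), ∀ p ∈ closedBall (0 : ℂ²) R,
      AnalyticAt ℂ (fun x : ℂ × ℂ² => prelim x.1 x.2) (x, p) :=
    hK.eventually_forall_of_forall_eventually (P := fun x p => AnalyticAt ℂ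
      (fun x : ℂ × ℂ² => prelim x.1 x.2) (x, p))
      fun p _ => (analyticAt_prelim p).eventually_analyticAt
  have hd₁ : ∀ᶠ s in 𝓝 (0 : ℂ), ∀ p ∈ closedBall (0 : ℂ²) R,
      1 + -(twistCoeff * s ^ 3) * p.2 ≠ 0 :=
    hK.eventually_forall_of_forall_eventually (P := fun s p => 1 + -(twistCoeff * s ^ 3) * p.2 ≠ 0)
      fun p _ => ContinuousAt.eventually_ne
        (g := fun x : ℂ × ℂ² => 1 + -(twistCoeff * x.1 ^ 3) * x.2.2) (by fun_prop) (by simp)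
  have hd₂ : ∀ᶠ s in 𝓝 (0 : ℂ), ∀ p ∈ closedBall (0 : ℂ²) R,
      1 + twistCoeff * s ^ 3 * p.2 ≠ 0 :=
    hK.eventually_forall_of_forall_eventually (P := fun s p => 1 + twistCoeff * s ^ 3 * p.2 ≠ 0)
      fun p _ => ContinuousAt.eventually_ne
        (g := fun x : ℂ × ℂ² => 1 + twistCoeff * x.1 ^ 3 * x.2.2) (by fun_prop) (by simp)
  have hd₃ : ∀ᶠ x in 𝓝 ((0, 0) : ℂ × ℂ²), ∀ p ∈ closedBall (0 : ℂ²) R,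
      1 + twistCoeff * x.1 ^ 3 * lam₂ x.2 * H[x.1, x.2, p].2 ≠ 0 := by
    refine hK.eventually_forall_of_forall_eventually (P := fun (x : ℂ × ℂ²) (p : ℂ²) =>
      1 + twistCoeff * x.1 ^ 3 * lam₂ x.2 * H[x.1, x.2, p].2 ≠ 0)
      fun p _ => ContinuousAt.eventually_ne
        (g := fun z : 𝔼 => 1 + twistCoeff * z.1.1 ^ 3 * lam₂ z.1.2 *
          H[z.1.1, z.1.2, z.2].2) (analyticAt_prelimHenon p).2.continuousAt (by simp)
  obtain ⟨ε, hε, H⟩ := Metric.eventually_nhds_iff.1 (hA₁.and (hd₃.and hB₁))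
  obtain ⟨s₁, hs₁, H'⟩ := Metric.eventually_nhds_iff.1 (hA₂.and (hd₁.and (hd₂.and (hB₂.and hB₃))))
  have hcb : 𝔻 R ⊆ closedBall 0 R := ball_subset_closedBall
  refine ⟨max 1 (max (4 * B₁ / ε) (max B₂ (4 * B₃ / s₁))), ε / 2, min ε (s₁ / 2), le_max_left _ _, half_pos hε,
    lt_min hε (half_pos hs₁), fun s hs hs0 => ?_⟩
  have hsn : ‖(s : ℂ)‖ = s := by rw [Complex.norm_of_nonneg hs.le]
  have hsε : s < ε := hs0.trans_le (min_le_left _ _)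
  have hss : s < s₁ / 2 := hs0.trans_le (min_le_right _ _)
  have HH := fun (q : ℂ²) (hq : q ∈ 𝔻 ε) => H (y := ((s : ℂ), q)) (by
    rw [show ((0, 0) : ℂ × ℂ²) = 0 from rfl, dist_zero_right, Prod.norm_def]
    exact max_lt (by rw [hsn]; exact hsε) (norm_lt hq))
  obtain ⟨H1, H2, H3, H4, H5⟩ := H' (y := (s : ℂ)) (by rw [dist_zero_right, hsn]; linarith)
  have half : 𝔻 (ε / 2) ⊆ ball 0 ε := ball_le
  have hdq : ∀ q ∈ 𝔻 ε, ∀ p ∈ 𝔻 R,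
      HoloAt (fun x : ℂ² × ℂ² => prelimHenon s x.1 x.2) (q, p) := fun q hq p hp =>
    ((HH q hq).1 p (hcb hp)).differentiableAt.comp (q, p)
      (f := fun x : ℂ² × ℂ² => (((s : ℂ), x.1), x.2)) (by fun_prop)
  refine ⟨fun x hx => (hdq x.1 (half hx.1) x.2 hx.2).differentiableWithinAt, fun q hq p hp => ?_,
    fun q hq p hp => ?_, fun p hp => ?_, fun p hp => ?_, fun p hp => ?_, fun p hp => ?_, fun q p hp => ?_⟩
  · exact jac_prelimHenon _ _ (H2 p (hcb hp)) ((HH q (half hq)).2.1 p (hcb hp))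
  · refine (norm_zoom_sub_le (f := fun q => prelimHenon s q p) (fun q hq => ?_) hε
      (fun q hq => (HH q hq).2.2 p (hcb hp)) (norm_lt hq)).trans ?_
    · exact ((hdq q hq p hp).comp q (f := fun q => (q, p)) (by fun_prop)).differentiableWithinAt
    · gcongr
      exact (le_max_left _ _).trans (le_max_right _ _)
  · rw [prelimHenon_expansion (H2 p (hcb hp)) ((HH 0 (mem_ball_self hε)).2.1 p (hcb hp)), norm_smul, norm_pow, hsn,
      mul_comm]
    gcongr
    exact (H4 p (hcb hp)).trans ((le_max_left _ _).trans ((le_max_right _ _).trans (le_max_right _ _)))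
  · exact (jac_prelim _ (H3 p (hcb hp))).1.differentiableWithinAt
  · exact (jac_prelim _ (H3 p (hcb hp))).2
  · have h1 : ∀ x ∈ ball (0 : ℂ) s₁, HoloAt (fun x => prelim x p) x ∧ ‖prelim x p‖ ≤ B₃ := fun x hx => by
      obtain ⟨K1, K2, K3, K4, K5⟩ := H' (y := x) (mem_ball.1 hx)
      exact ⟨(K1 p (hcb hp)).differentiableAt.comp x (f := fun x => (x, p)) (by fun_prop), K5 p (hcb hp)⟩
    have h2 := norm_sub_le_of_bound (f := fun x => prelim x p) (x := (s : ℂ)) (y := 0)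
      (fun x hx => (h1 x hx).1.differentiableWithinAt) (fun x hx => (h1 x hx).2) (half_pos hs₁)
      (by rw [hsn]; linarith) (by simpa using by linarith)
    have h3 : prelim 0 p = p := by simp [prelim, shear, twist]
    rw [h3, sub_zero, hsn] at h2
    refine h2.trans ?_
    gcongr
    rw [show 2 * B₃ / (s₁ / 2) = 4 * B₃ / s₁ by field_simp; ring]
    exact (le_max_right _ _).trans ((le_max_right _ _).trans (le_max_right _ _))
  · exact prelimHenon_prelim _ _ (H3 p (hcb hp))

end Tube

/-! ### Bad monomials and small divisors -/

section Monomials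

/-- The monomials `z^k w^l` of degree between `3` and `3m+1` that must be removed: the nonresonant
ones, `l ≢ 1 mod 3`, and the resonant ones that are divisible by `z w⁴`. -/
def badExp (m : ℕ) : Finset (ℕ × ℕ) :=
  (Finset.range (3 * m + 2) ×ˢ Finset.range (3 * m + 2)).filter fun e =>
    3 ≤ e.1 + e.2 ∧ e.1 + e.2 ≤ 3 * m + 1 ∧ (e.2 % 3 ≠ 1 ∨ (1 ≤ e.1 ∧ 4 ≤ e.2))

/-- The exponents of the generator used to remove the monomial `z^k w^l`: the monomial itself if
it is nonresonant, and otherwise `z^{k+1} w^{l-3}`, whose Poisson bracket with `w⁴` is `z^k w^l`. -/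
def genExp (e : ℕ × ℕ) : ℕ × ℕ := if e.2 % 3 = 1 then (e.1 + 1, e.2 - 3) else e

/-- The size of the generator used to remove the monomial `z^k w^l`. -/
def genScale (s : ℂ) (e : ℕ × ℕ) : ℂ := if e.2 % 3 = 1 then s else s ^ 5

/-- The small divisor attached to the monomial `z^k w^l`. -/
def divisor (e : ℕ × ℕ) : ℂ :=
  if e.2 % 3 = 1 then 4 * quartic * (e.1 + 1) else jRoot ^ e.2 / jRoot - 1

/-- The multiplier of the monomial `z^k w^l` under `diag(λ₁,λ₂)`, which scales area by `λ₁λ₂`. -/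
def multiplier (q : ℂ²) (e : ℕ × ℕ) : ℂ := lam₁ q ^ e.1 * lam₂ q ^ e.2 / (lam₁ q * lam₂ q)

lemma jRoot_pow_eq (l : ℕ) : jRoot ^ l = jRoot ^ (l % 3) := by
  conv_lhs => rw [← Nat.div_add_mod l 3, pow_add, pow_mul, jRoot_pow_three, one_pow, one_mul]

lemma jRoot_pow_div_eq_one_iff (l : ℕ) : jRoot ^ l / jRoot - 1 = 0 ↔ l % 3 = 1 := by
  rw [sub_eq_zero, div_eq_one_iff_eq jRoot_ne_zero, jRoot_pow_eq]
  have h : l % 3 < 3 := Nat.mod_lt _ (by norm_num)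
  interval_cases hl : l % 3
  · simp only [pow_zero, zero_ne_one, iff_false]
    intro h1; exact one_sub_jRoot_ne_zero (by rw [← h1]; ring)
  · simp
  · simp only [OfNat.ofNat_ne_one, iff_false]
    intro h1
    have : jRoot * (1 - jRoot) = 0 := by linear_combination -h1
    rcases mul_eq_zero.1 this with h2 | h2
    · exact jRoot_ne_zero h2
    · exact one_sub_jRoot_ne_zero h2

lemma quartic_ne_zero : quartic ≠ 0 := by
  rw [quartic_eq]
  have : (√3 : ℝ) ≠ 0 := by positivity
  simp

lemma divisor_ne_zero (e : ℕ × ℕ) : divisor e ≠ 0 := by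
  unfold divisor
  split_ifs with h
  · have : ((e.1 : ℂ) + 1) ≠ 0 := by exact_mod_cast Nat.succ_ne_zero e.1
    exact mul_ne_zero (mul_ne_zero (by norm_num) quartic_ne_zero) this
  · exact fun h' => h ((jRoot_pow_div_eq_one_iff _).1 h')

lemma multiplier_zero (e : ℕ × ℕ) : multiplier 0 e = jRoot ^ e.2 / jRoot := by
  simp [multiplier, lam₁_zero, lam₂_zero]

lemma differentiable_multiplier (e : ℕ × ℕ) : Differentiable ℂ (fun q => multiplier q e) := by
  intro q
  obtain ⟨h1, h2⟩ := analyticAt_lam q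
  have h3 : HoloAt (fun q => lam₁ q * lam₂ q) q :=
    h1.differentiableAt.fun_mul h2.differentiableAt
  have h4 : HoloAt (fun q => lam₁ q ^ e.1 * lam₂ q ^ e.2) q :=
    (h1.differentiableAt.fun_pow e.1).fun_mul (h2.differentiableAt.fun_pow e.2)
  unfold multiplier
  simp only [div_eq_mul_inv]
  exact h4.fun_mul (h3.fun_inv (mul_ne_zero (lam₁_ne_zero q) (lam₂_ne_zero q)))

lemma mem_badExp {m : ℕ} {e : ℕ × ℕ} : e ∈ badExp m ↔
    3 ≤ e.1 + e.2 ∧ e.1 + e.2 ≤ 3 * m + 1 ∧ (e.2 % 3 ≠ 1 ∨ (1 ≤ e.1 ∧ 4 ≤ e.2)) := by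
  simp only [badExp, Finset.mem_filter, Finset.mem_product, Finset.mem_range]
  omega

lemma genExp_degree {m : ℕ} {e : ℕ × ℕ} (he : e ∈ badExp m) : 3 ≤ (genExp e).1 + (genExp e).2 := by
  rw [mem_badExp] at he
  unfold genExp
  split_ifs with h
  · simp only; omega
  · exact he.1

/-- The Lie bracket with `X_{b w⁴}` of the field of a resonant generator. -/
lemma bracket_monoField {k l : ℕ} (hl : 4 ≤ l) (p : ℂ²) :
    fderiv ℂ (monoField (k + 1, l - 3)) p (quarticField p)
      - fderiv ℂ quarticField p (monoField (k + 1, l - 3) p)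
      = (4 * quartic * (k + 1)) • monoField (k, l) p := by
  obtain ⟨n, rfl⟩ : ∃ n, l = n + 4 := ⟨l - 4, by omega⟩
  obtain ⟨h1, h2⟩ := hasFDerivAt_coords p
  have hA : HasFDerivAt (monoField (k + 1, n + 4 - 3)) _ p :=
    (((h1.pow (k + 1)).const_mul ((n + 4 - 3 : ℕ) : ℂ)).mul (h2.pow (n + 4 - 3 - 1))).prodMk
      (((h1.pow (k + 1 - 1)).const_mul ((k + 1 : ℕ) : ℂ)).mul (h2.pow (n + 4 - 3))).neg
  have hB : HasFDerivAt quarticField _ p :=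
    ((h2.pow 3).const_mul (4 * quartic)).prodMk (hasFDerivAt_const (0 : ℂ) p)
  rw [hA.fderiv, hB.fderiv]
  have e1 : n + 4 - 3 = n + 1 := by omega
  have e2 : n + 4 - 1 = n + 3 := by omega
  ext
  · simp [monoField, quarticField, e1, e2]
    ring
  · simp [monoField, quarticField, e1, e2]
    ring

end Monomials

/-! ### Canonical maps of polynomials -/

section CanonicalFamily

variable {ι : Type*} [Fintype ι] (e : ι → ℕ × ℕ)

lemma differentiable_monoField_sum : Differentiable ℂ
    (fun x : (ι → ℂ) × ℂ² => ∑ i, x.1 i • monoField (e i) x.2) := by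
  unfold monoField; fun_prop

lemma norm_dz_dw_le_sgrad (H : ℂ² → ℂ) (p : ℂ²) :
    ‖dz H p‖ ≤ ‖sgrad H p‖ ∧ ‖dw H p‖ ≤ ‖sgrad H p‖ :=
  ⟨by simp [sgrad], by simp [sgrad]⟩

/-- The canonical maps of small polynomial observables and their inverses, as holomorphic families
in the coefficients. -/
structure PolyFamily (R r : ℝ) (θ ϑ : (ι → ℂ) × ℂ² → ℂ²) : Prop where
  holo : Holo θ (ball 0 r ×ˢ ball 0 (R - 2))
  pair : ∀ c ∈ ball (0 : ι → ℂ) r, ∀ p ∈ 𝔻 (R - 2),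
    (p.1, (θ (c, p)).2) ∈ 𝔻 (R - 1) ∧ IsCanonicalPair (polyObs e c) p (θ (c, p)) ∧
      ‖θ (c, p) - p‖ ≤ 1 / 4
  unique : ∀ c ∈ ball (0 : ι → ℂ) r, ∀ p ∈ 𝔻 (R - 2), ∀ p',
    (p.1, p'.2) ∈ 𝔻 (R - 1) → IsCanonicalPair (polyObs e c) p p' → p' = θ (c, p)
  inv_holo : Holo ϑ (ball 0 r ×ˢ ball 0 (R - 4))
  inv_mem : ∀ c ∈ ball (0 : ι → ℂ) r, ∀ y ∈ 𝔻 (R - 4), ϑ (c, y) ∈ 𝔻 (R - 3)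
  right_inv : ∀ c ∈ ball (0 : ι → ℂ) r, ∀ y ∈ 𝔻 (R - 4), θ (c, ϑ (c, y)) = y
  left_inv : ∀ c ∈ ball (0 : ι → ℂ) r, ∀ p ∈ 𝔻 (R - 3),
    θ (c, p) ∈ 𝔻 (R - 4) → ϑ (c, θ (c, p)) = p

/-- The canonical maps come from `exists_canonical_family`, and their inverses `ϑ` from
`exists_parametric_inverse`, the coefficients being the parameter. -/
lemma exists_polyFamily (R : ℝ) : ∃ r > 0, ∃ θ ϑ, PolyFamily e R r θ ϑ := by
  obtain ⟨K, hK0, hK⟩ := exists_bound_polyField e R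
  refine ⟨1 / (4 * (K + 1)), by positivity, ?_⟩
  set r := 1 / (4 * (K + 1)) with hr
  have hKr : K * r ≤ 1 / 4 := by
    rw [hr, mul_one_div, div_le_iff₀ (by positivity)]; linarith
  have hd := (differentiable_monoField_sum e).differentiableOn (s := ball (0 : ι → ℂ) r ×ˢ 𝔻 R)
  have hs : ∀ x : (ι → ℂ) × ℂ², sgrad (polyObs e x.1) x.2 = ∑ i, x.1 i • monoField (e i) x.2 :=
    fun x => sgrad_polyObs e x.1 x.2
  have hb : ∀ c ∈ ball (0 : ι → ℂ) r, ∀ p ∈ 𝔻 R, ‖sgrad (polyObs e c) p‖ ≤ 1 / 4 := by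
    intro c hc p hp
    rw [sgrad_polyObs]
    refine (hK c p (ball_subset_closedBall hp)).trans ?_
    have := (norm_lt hc).le
    nlinarith
  have hw : Holo (fun x : (ι → ℂ) × ℂ² => dw (polyObs e x.1) x.2) (ball 0 r ×ˢ ball 0 R) := by
    have := hd.fst
    simp only [← hs] at this
    exact this
  have hz : Holo (fun x : (ι → ℂ) × ℂ² => dz (polyObs e x.1) x.2) (ball 0 r ×ˢ ball 0 R) := by
    have := hd.snd.neg
    simp only [← hs] at this
    refine this.congr fun x hx => ?_
    simp [sgrad]
  obtain ⟨θ, hθ, hθp, hθu⟩ := exists_canonical_family (H := polyObs e) (c := 1 / 4) (d := 1) isOpen_ball hz hw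
    (fun c hc p hp => (norm_dz_dw_le_sgrad _ _).1.trans (hb c hc p hp))
    (fun c hc p hp => (norm_dz_dw_le_sgrad _ _).2.trans (hb c hc p hp)) one_pos (by norm_num)
  rw [mul_one] at hθ hθp hθu
  obtain ⟨ϑ, hϑ, hϑp, hϑu⟩ := exists_parametric_inverse (v := fun x => θ x - x.2) (R := R - 2) (c := 1 / 4) (d := 1)
    isOpen_ball (hθ.sub differentiable_snd.differentiableOn) (fun c hc p hp => (hθp c hc p hp).2.2) one_pos (by norm_num)
  rw [show R - 2 - 2 * 1 = R - 4 by ring, show R - 2 - 1 = R - 3 by ring] at *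
  refine ⟨θ, ϑ, hθ, hθp, hθu, hϑ, fun c hc y hy => (hϑp c hc y hy).1, fun c hc y hy => ?_, fun c hc p hp h => ?_⟩
  · simpa using (hϑp c hc y hy).2
  · have := hϑu c hc p hp (by simpa using h)
    simpa using this

end CanonicalFamily

/-! ### The conjugate family -/

section ConjugateFamily

/-- The coefficients of a polynomial generator whose exponents are indexed by `badExp m`. -/
abbrev Coeffs (m : ℕ) := badExp m → ℂ

/-- A rescaled perturbation of the parameters of the Hénon map, with generator coefficients. -/
abbrev Param (m : ℕ) := ℂ² × Coeffs m

variable {m : ℕ}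

/-- The coefficients of the generator with parameters `t`. -/
def genCoeff (s : ℂ) (t : Coeffs m) (i : badExp m) : ℂ := genScale s i * t i

/-- The coefficients of the generator conjugated by `diag(λ₁,λ₂)`. -/
def genCoeffConj (s : ℂ) (q : ℂ²) (t : Coeffs m) (i : badExp m) : ℂ :=
  genScale s i * multiplier q (genExp i) * t i

/-- The exponents of the generator. -/
def genExps (i : badExp m) : ℕ × ℕ := genExp i

/-- The Hénon map, up to its linear part, after the preliminary change of coordinates and the
canonical map with parameters `x.2`; the eigenvalues are at distance `O(s⁶)` of the resonance. -/
def conjFamily (θ ϑ : Coeffs m × ℂ² → ℂ²) (s : ℂ)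
    (x : Param m × ℂ²) : ℂ² :=
  θ (genCoeffConj s (s ^ 6 • x.1.1) x.1.2, prelimHenon s (s ^ 6 • x.1.1) (ϑ (genCoeff s x.1.2, x.2)))

lemma exists_multiplier_bounds (m : ℕ) : ∃ L ε : ℝ, 0 ≤ L ∧ 0 < ε ∧ ∀ q ∈ 𝔻 ε, ∀ i : badExp m,
    ‖multiplier q (genExp i) - multiplier 0 (genExp i)‖ ≤ L * ‖q‖ ∧ ‖multiplier q (genExp i)‖ ≤ 2 := by
  have hd : Differentiable ℂ (fun q => fun i : badExp m => multiplier q (genExp i)) :=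
    differentiable_pi.2 fun i => differentiable_multiplier _
  obtain ⟨L, hL⟩ := (hd 0).hasFDerivAt.isBigO_sub.bound
  have h2 : ∀ᶠ q in 𝓝 (0 : ℂ²), ∀ i : badExp m, ‖multiplier q (genExp i)‖ < 2 := by
    rw [eventually_all]
    intro i
    have h3 : ‖multiplier 0 (genExp i)‖ < 2 := by
      rw [multiplier_zero, norm_div, norm_pow, norm_jRoot]; norm_num
    exact (differentiable_multiplier (genExp i) 0).continuousAt.norm.eventually (gt_mem_nhds h3)
  obtain ⟨ε, hε, h⟩ := Metric.eventually_nhds_iff.1 (hL.and h2)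
  refine ⟨max L 0, ε, le_max_right _ _, hε, fun q hq i => ?_⟩
  obtain ⟨h4, h5⟩ := h (mem_ball.1 hq)
  refine ⟨?_, (h5 i).le⟩
  have := (norm_le_pi_norm _ i).trans h4
  rw [sub_zero] at this
  exact this.trans (by gcongr; exact le_max_left _ _)

lemma norm_genScale_le {s : ℝ} (hs : 0 < s) (hs1 : s ≤ 1) (e : ℕ × ℕ) : ‖genScale s e‖ ≤ s := by
  unfold genScale
  have h : ‖(s : ℂ)‖ = s := by rw [Complex.norm_of_nonneg hs.le]
  split_ifs
  · exact h.le
  · rw [norm_pow, h]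
    calc _ ≤ s ^ 1 := pow_le_pow_of_le_one hs.le hs1 (by norm_num)
      _ = s := pow_one s

lemma norm_genCoeff_le {s : ℝ} (hs : 0 < s) (hs1 : s ≤ 1) (t : Coeffs m) :
    ‖genCoeff s t‖ ≤ s * ‖t‖ := by
  refine (pi_norm_le_iff_of_nonneg (by positivity)).2 fun i => ?_
  rw [genCoeff, norm_mul]
  exact mul_le_mul (norm_genScale_le hs hs1 _) (norm_le_pi_norm t i) (norm_nonneg _) hs.le

lemma norm_genCoeffConj_le {s : ℝ} (hs : 0 < s) (hs1 : s ≤ 1) {q : ℂ²} (t : Coeffs m)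
    (hq : ∀ i : badExp m, ‖multiplier q (genExp i)‖ ≤ 2) :
    ‖genCoeffConj s q t‖ ≤ 2 * s * ‖t‖ := by
  refine (pi_norm_le_iff_of_nonneg (by positivity)).2 fun i => ?_
  rw [genCoeffConj, norm_mul, norm_mul, mul_comm 2 s]
  exact mul_le_mul (mul_le_mul (norm_genScale_le hs hs1 _) (hq i) (norm_nonneg _) hs.le)
    (norm_le_pi_norm t i) (norm_nonneg _) (by positivity)

/-- The field of the resonant part of the generator. -/
def resField (t : Coeffs m) (p : ℂ²) : ℂ² :=
  ∑ i : badExp m, (if i.1.2 % 3 = 1 then t i else 0) • monoField (genExps i) p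

/-- The effect of conjugating the nonresonant part of the generator by `diag(1,j)`. -/
def nonresField (t : Coeffs m) (p : ℂ²) : ℂ² :=
  ∑ i : badExp m, (if i.1.2 % 3 = 1 then 0 else divisor i * t i) • monoField (genExps i) p

/-- The first-order effect of the generator. -/
def effectField (t : Coeffs m) (p : ℂ²) : ℂ² :=
  ∑ i : badExp m, (divisor i * t i) • monoField i p

lemma differentiable_quarticField : Differentiable ℂ quarticField := by unfold quarticField; fun_prop
lemma differentiable_cubicField : Differentiable ℂ cubicField := by unfold cubicField; fun_prop

lemma differentiable_sum_monoField (c : Coeffs m) (e : badExp m → ℕ × ℕ) :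
    Differentiable ℂ (fun p => ∑ i, c i • monoField (e i) p) :=
  Differentiable.fun_sum fun i _ => (differentiable_monoField _).fun_const_smul _

lemma effectField_eq (t : Coeffs m) (p : ℂ²) :
    nonresField t p + fderiv ℂ (resField t) p (quarticField p) - fderiv ℂ quarticField p (resField t p)
      = effectField t p := by
  have h : HasFDerivAt (resField t) (∑ i : badExp m, (if i.1.2 % 3 = 1 then t i else 0) •
      fderiv ℂ (monoField (genExps i)) p) p :=
    HasFDerivAt.fun_sum fun i _ => ((differentiable_monoField (genExps i)) p).hasFDerivAt.fun_const_smul _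
  rw [h.fderiv, resField, map_sum, sum_apply, nonresField, effectField, add_sub_assoc, ← Finset.sum_sub_distrib,
    ← Finset.sum_add_distrib]
  refine Finset.sum_congr rfl fun i _ => ?_
  rw [smul_apply, map_smul, ← smul_sub]
  by_cases hi : i.1.2 % 3 = 1
  · have hl : 4 ≤ i.1.2 := by
      have := (mem_badExp.1 i.2).2.2
      omega
    rw [if_pos hi, if_pos hi, zero_smul, zero_add, divisor, if_pos hi]
    have e : genExps i = (i.1.1 + 1, i.1.2 - 3) := by rw [genExps, genExp, if_pos hi]
    rw [e, bracket_monoField hl, smul_smul, mul_comm]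
  · rw [if_neg hi, if_neg hi, zero_smul, add_zero]
    have e : genExps i = i.1 := by rw [genExps, genExp, if_neg hi]
    rw [e]

lemma multiplier_zero_genExp (i : badExp m) :
    multiplier 0 (genExp i) = if i.1.2 % 3 = 1 then 1 else divisor i + 1 := by
  rw [multiplier_zero]
  by_cases hi : i.1.2 % 3 = 1
  · have hl : 4 ≤ i.1.2 := by
      have := (mem_badExp.1 i.2).2.2
      omega
    rw [if_pos hi, genExp, if_pos hi]
    have : (i.1.2 - 3) % 3 = 1 := by omega
    have h := (jRoot_pow_div_eq_one_iff _).2 this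
    linear_combination h
  · rw [if_neg hi, genExp, if_neg hi, divisor, if_neg hi]; ring

lemma genCoeff_sub_res (s : ℂ) (t : Coeffs m) (p : ℂ²) :
    sgrad (polyObs genExps (genCoeff s t)) p - s • resField t p =
      ∑ i : badExp m, (if i.1.2 % 3 = 1 then 0 else s ^ 5 * t i) • monoField (genExps i) p := by
  rw [sgrad_polyObs, resField, Finset.smul_sum, ← Finset.sum_sub_distrib]
  refine Finset.sum_congr rfl fun i _ => ?_
  rw [smul_smul, ← sub_smul, genCoeff, genScale]
  congr 1
  split_ifs <;> ring

lemma genCoeffConj_sub (s : ℂ) (q : ℂ²) (t : Coeffs m) (p : ℂ²) :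
    sgrad (polyObs genExps (genCoeffConj s q t)) p - sgrad (polyObs genExps (genCoeff s t)) p
      - s ^ 5 • nonresField t p =
      ∑ i : badExp m, (genScale s i * (multiplier q (genExp i) - multiplier 0 (genExp i)) * t i) •
        monoField (genExps i) p := by
  rw [sgrad_polyObs, sgrad_polyObs, nonresField, Finset.smul_sum, ← Finset.sum_sub_distrib,
    ← Finset.sum_sub_distrib]
  refine Finset.sum_congr rfl fun i _ => ?_
  rw [smul_smul, ← sub_smul, ← sub_smul, genCoeff, genCoeffConj, genScale, multiplier_zero_genExp]
  congr 1
  split_ifs <;> ring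

variable {θ ϑ : Coeffs m × ℂ² → ℂ²} {r : ℝ}

/-- The properties of the conjugate family at scale `s`: it is holomorphic, area preserving, and
has an explicit expansion up to order six. -/
structure FamilyBounds (θ ϑ : Coeffs m × ℂ² → ℂ²) (r A s B : ℝ) : Prop where
  prelim : PrelimBounds 20 A s (2 * s ^ 6)
  coeff_mem : ∀ x ∈ ball (0 : Param m) 2, genCoeff s x.2 ∈ ball (0 : Coeffs m) r ∧
    genCoeffConj s ((s : ℂ) ^ 6 • x.1) x.2 ∈ ball (0 : Coeffs m) r
  maps : ∀ x ∈ ball (0 : Param m) 2, ∀ y ∈ 𝔻 14,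
    ϑ (genCoeff s x.2, y) ∈ 𝔻 15 ∧
      prelimHenon s ((s : ℂ) ^ 6 • x.1) (ϑ (genCoeff s x.2, y)) ∈ 𝔻 16
  holo : Holo (conjFamily θ ϑ s) (ball 0 2 ×ˢ ball 0 14)
  jac_eq : ∀ x ∈ ball (0 : Param m) 2, ∀ y ∈ 𝔻 14,
    jac (fun y => conjFamily θ ϑ s (x, y)) y = 1
  expansion : ∀ x ∈ ball (0 : Param m) 2, ∀ y ∈ 𝔻 14,
    ‖conjFamily θ ϑ s (x, y) - y - (s : ℂ) ^ 4 • quarticField y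
      - (s : ℂ) ^ 5 • (cubicField y + effectField x.2 y)‖ ≤ B * s ^ 6

/-- The expansion is `conjugation_expansion` with `u` the quartic field: the resonant part of the generator
acts through the bracket, the nonresonant part through its variation under `diag(λ₁,λ₂)`. -/
theorem exists_familyBounds (hF : PolyFamily genExps 20 r θ ϑ) (hr : 0 < r) :
    ∃ A B s₀ : ℝ, 0 ≤ B ∧ 0 < s₀ ∧ ∀ s : ℝ, 0 < s → s < s₀ → FamilyBounds θ ϑ r A s B := by
  obtain ⟨A₁, ε₁, s₁, hA₁, hε₁, hs₁, hP⟩ := exists_prelimBounds 20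
  obtain ⟨L, ε₂, hL, hε₂, hχ⟩ := exists_multiplier_bounds m
  obtain ⟨K, hK0, hK⟩ := exists_bound_polyField (genExps (m := m)) 20
  obtain ⟨Bu, hBu⟩ := (isCompact_closedBall (0 : ℂ²) 20).exists_bound_of_continuousOn
    differentiable_quarticField.continuous.continuousOn
  obtain ⟨Bv, hBv⟩ := (isCompact_closedBall (0 : ℂ²) 20).exists_bound_of_continuousOn
    differentiable_cubicField.continuous.continuousOn
  obtain ⟨D, hD0, hD⟩ : ∃ D : ℝ, 0 ≤ D ∧ ∀ i : badExp m, ‖divisor i‖ ≤ D :=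
    ⟨‖fun i : badExp m => divisor i‖, norm_nonneg _, fun i => norm_le_pi_norm (fun i : badExp m => divisor i) i⟩
  have hBu0 : 0 ≤ Bu := (norm_nonneg _).trans (hBu 0 (by simp))
  have hBv0 : 0 ≤ Bv := (norm_nonneg _).trans (hBv 0 (by simp))
  set A := 1 + Bu + Bv + 3 * A₁ + 2 * K + 2 * K * D + 4 * K * L with hA
  have hA1 : 1 ≤ A := by
    have : 0 ≤ A₁ := by linarith
    rw [hA]
    have : 0 ≤ 2 * K * D := by positivity
    have : 0 ≤ 4 * K * L := by positivity
    linarith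
  have p1 : 0 ≤ 2 * K * D := by positivity
  have p2 : 0 ≤ 4 * K * L := by positivity
  refine ⟨A₁, 300 * A ^ 3 + A₁, min (min s₁ (1 / (100 * A))) (min (min ε₁ ε₂ / 2) (r / 4)), by positivity,
    by positivity, fun s hs hs0 => ?_⟩
  have hss₁ : s < s₁ := hs0.trans_le ((min_le_left _ _).trans (min_le_left _ _))
  have hsA : 100 * A * s ≤ 1 := by
    have h1 : s < 1 / (100 * A) := hs0.trans_le ((min_le_left _ _).trans (min_le_right _ _))
    rw [lt_div_iff₀ (by positivity)] at h1
    linarith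
  have hsε : 2 * s < min ε₁ ε₂ := by
    have h1 : s < min ε₁ ε₂ / 2 := hs0.trans_le ((min_le_right _ _).trans (min_le_left _ _))
    linarith
  have hsr : s < r / 4 := hs0.trans_le ((min_le_right _ _).trans (min_le_right _ _))
  have hs1 : s ≤ 1 := by nlinarith
  have hs6 : s ^ 6 ≤ s := by
    calc _ ≤ s ^ 1 := pow_le_pow_of_le_one hs.le hs1 (by norm_num)
      _ = s := pow_one s
  have ns : ‖(s : ℂ)‖ = s := by rw [Complex.norm_of_nonneg hs.le]
  have hq : ∀ x ∈ ball (0 : Param m) 2, ‖(s : ℂ) ^ 6 • x.1‖ < 2 * s ^ 6 := fun x hx => by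
    rw [norm_smul, norm_pow, ns, mul_comm]
    have := (norm_fst_le x).trans_lt (norm_lt hx)
    gcongr
  have ht : ∀ x ∈ ball (0 : Param m) 2, ‖x.2‖ < 2 := fun x hx =>
    (norm_snd_le x).trans_lt (norm_lt hx)
  have hPs := hP s hs hss₁
  have hε6 : 2 * s ^ 6 ≤ min ε₁ ε₂ := by linarith
  have hPs' : PrelimBounds 20 A₁ s (2 * s ^ 6) := by
    have hsub : 𝔻 (2 * s ^ 6) ⊆ ball 0 ε₁ := ball_subset_ball (hε6.trans (min_le_left _ _))
    exact ⟨hPs.holo.mono (prod_mono hsub le_rfl), fun q hq => hPs.jac_eq q (hsub hq), fun q hq => hPs.lip q (hsub hq),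
      hPs.expansion, hPs.prelim_holo, hPs.prelim_jac, hPs.prelim_near, hPs.prelim_conj⟩
  have hqχ : ∀ x ∈ ball (0 : Param m) 2, (s : ℂ) ^ 6 • x.1 ∈ 𝔻 ε₂ := fun x hx =>
    mem_ball₀ ((hq x hx).trans_le (hε6.trans (min_le_right _ _)))
  have hc : ∀ x ∈ ball (0 : Param m) 2, genCoeff s x.2 ∈ ball (0 : Coeffs m) r := fun x hx => by
    rw [mem_ball_zero_iff]
    refine (norm_genCoeff_le hs hs1 x.2).trans_lt ?_
    nlinarith [ht x hx, norm_nonneg x.2]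
  have hc' : ∀ x ∈ ball (0 : Param m) 2,
      genCoeffConj s ((s : ℂ) ^ 6 • x.1) x.2 ∈ ball (0 : Coeffs m) r := fun x hx => by
    rw [mem_ball_zero_iff]
    refine (norm_genCoeffConj_le hs hs1 x.2 fun i => (hχ _ (hqχ x hx) i).2).trans_lt ?_
    nlinarith [ht x hx, norm_nonneg x.2]
  have hκb : ∀ x ∈ ball (0 : Param m) 2, ∀ p ∈ 𝔻 20,
      ‖prelimHenon s ((s : ℂ) ^ 6 • x.1) p - prelimHenon s 0 p‖ ≤ A * s ^ 6 := fun x hx p hp => by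
    refine (hPs'.lip _ (mem_ball₀ (hq x hx)) p hp).trans ?_
    calc _ ≤ A₁ * (2 * s ^ 6) := by gcongr; exact (hq x hx).le
      _ = 2 * A₁ * s ^ 6 := by ring
      _ ≤ A * s ^ 6 := by gcongr; rw [hA]; linarith
  have hκ₀ : ∀ p ∈ 𝔻 20, ‖prelimHenon s 0 p - p - (s : ℂ) ^ 4 • quarticField p‖ ≤ A * s ^ 5 := by
    intro p hp
    have h1 := hPs.expansion p hp
    have h2 : ‖(s : ℂ) ^ 5 • cubicField p‖ ≤ s ^ 5 * Bv := by
      rw [norm_smul, norm_pow, ns]; gcongr; exact hBv p (ball_subset_closedBall hp)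
    have h3 := norm_le_add_sub (prelimHenon s 0 p - p - (s : ℂ) ^ 4 • quarticField p)
      ((s : ℂ) ^ 5 • cubicField p)
    have h4 : s ^ 6 ≤ s ^ 5 := pow_le_pow_of_le_one hs.le hs1 (by norm_num)
    calc _ ≤ s ^ 5 * Bv + A₁ * s ^ 5 := h3.trans (add_le_add h2 (h1.trans (by gcongr)))
      _ = (Bv + A₁) * s ^ 5 := by ring
      _ ≤ A * s ^ 5 := by gcongr; rw [hA]; linarith
  have hθm : ∀ x ∈ ball (0 : Param m) 2, ∀ y ∈ 𝔻 14,
      ϑ (genCoeff s x.2, y) ∈ 𝔻 15 ∧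
      prelimHenon s ((s : ℂ) ^ 6 • x.1) (ϑ (genCoeff s x.2, y)) ∈ 𝔻 16 := by
    intro x hx y hy
    have hy' := norm_lt hy
    have h1 := hF.inv_mem _ (hc x hx) y mem_ball₀
    have h2 := hF.right_inv _ (hc x hx) y mem_ball₀
    have h3 := (hF.pair _ (hc x hx) _ (ball_mono h1)).2.2
    rw [h2, norm_sub_rev] at h3
    have h4 : ‖ϑ (genCoeff s x.2, y)‖ < 15 := by
      linarith [norm_le_add_sub (ϑ (genCoeff s x.2, y)) y]
    have h5 : ϑ (genCoeff s x.2, y) ∈ 𝔻 20 := mem_ball₀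
    refine ⟨mem_ball₀ h4, mem_ball₀ ?_⟩
    have h6 := hκb x hx _ h5
    have h7 := hκ₀ _ h5
    have h8 : ‖(s : ℂ) ^ 4 • quarticField (ϑ (genCoeff s x.2, y))‖ ≤ s ^ 4 * A := by
      rw [norm_smul, norm_pow, ns]
      gcongr
      refine (hBu _ (ball_subset_closedBall h5)).trans ?_
      rw [hA]; linarith
    set P := ϑ (genCoeff s x.2, y)
    have h9 : ∀ n : ℕ, 1 ≤ n → A * s ^ n ≤ 1 / 100 := fun n hn => by
      have : s ^ n ≤ s ^ 1 := pow_le_pow_of_le_one hs.le hs1 hn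
      rw [pow_one] at this
      have h10 : A * s ^ n ≤ A * s := by gcongr
      linarith
    have h10 : prelimHenon s ((s : ℂ) ^ 6 • x.1) P = (prelimHenon s ((s : ℂ) ^ 6 • x.1) P - prelimHenon s 0 P)
      + (prelimHenon s 0 P - P - (s : ℂ) ^ 4 • quarticField P) + (s : ℂ) ^ 4 • quarticField P + P := by abel
    rw [h10]
    have := norm_add_le_of_le (norm_add_le_of_le ((norm_add_le _ _).trans
      (add_le_add h6 h7)) h8) h4.le
    have h11 := h9 6 (by norm_num)
    have h12 := h9 5 (by norm_num)
    have h13 := h9 4 (by norm_num)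
    linarith
  have hdθ : ∀ c ∈ ball (0 : Coeffs m) r, ∀ p ∈ 𝔻 18, HoloAt (fun p => θ (c, p)) p ∧
      jac (fun p => θ (c, p)) p = 1 := by
    intro c hc p hp
    have h0 : Holo (fun p => θ (c, p)) (ball 0 18) := by
      have := hF.holo
      rw [show (20 : ℝ) - 2 = 18 by norm_num] at this
      exact this.comp (f := fun p => (c, p)) (by fun_prop) fun p hp => ⟨hc, hp⟩
    have h1 := h0.at_ball hp
    have hsub : 𝔻 18 = 𝔻 (20 - 2) := by norm_num
    rw [hsub] at hp
    refine ⟨h1, jac_eq_one_of_canonical (U := univ) (differentiable_polyObs genExps c).differentiableOn isOpen_univ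
      h1 (mem_univ _) ?_⟩
    filter_upwards [isOpen_ball.mem_nhds hp] with x hx using (hF.pair c hc x hx).2.1
  refine ⟨hPs', fun x hx => ⟨hc x hx, hc' x hx⟩, hθm, ?_, fun x hx y hy => ?_, fun x hx y hy => ?_⟩
  · -- joint holomorphy
    have d0 : Holo (fun z : Param m × ℂ² => genCoeff (s : ℂ) z.1.2)
        (ball 0 2 ×ˢ ball 0 14) := by
      unfold genCoeff; fun_prop
    have d1 : Holo (fun z : Param m × ℂ² =>
        genCoeffConj (s : ℂ) ((s : ℂ) ^ 6 • z.1.1) z.1.2) (ball 0 2 ×ˢ ball 0 14) := by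
      refine differentiableOn_pi.2 fun i => ?_
      unfold genCoeffConj
      have := (differentiable_multiplier (genExp i)).comp (f := fun z : Param m × ℂ² =>
        (s : ℂ) ^ 6 • z.1.1) (by fun_prop)
      exact ((this.const_mul (genScale s i)).fun_mul (by fun_prop)).differentiableOn
    have d2 : Holo (fun z : Param m × ℂ² => ϑ (genCoeff (s : ℂ) z.1.2, z.2))
        (ball 0 2 ×ˢ ball 0 14) :=
      hF.inv_holo.comp (d0.prodMk differentiable_snd.differentiableOn)
        fun z hz => ⟨hc z.1 hz.1, ball_mono hz.2⟩
    have d3 : Holo (fun z : Param m × ℂ² =>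
        prelimHenon s ((s : ℂ) ^ 6 • z.1.1) (ϑ (genCoeff (s : ℂ) z.1.2, z.2))) (ball 0 2 ×ˢ ball 0 14) :=
      hPs'.holo.comp (f := fun z : Param m × ℂ² =>
        ((s : ℂ) ^ 6 • z.1.1, ϑ (genCoeff (s : ℂ) z.1.2, z.2)))
        ((by fun_prop : Holo (fun z : Param m × ℂ² => (s : ℂ) ^ 6 • z.1.1)
          (ball 0 2 ×ˢ ball 0 14)).prodMk d2)
        fun z hz => ⟨mem_ball₀ (hq z.1 hz.1), ball_mono (hθm z.1 hz.1 z.2 hz.2).1⟩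
    exact hF.holo.comp (d1.prodMk d3) fun z hz => ⟨hc' z.1 hz.1, ball_mono (hθm z.1 hz.1 z.2 hz.2).2⟩
  · -- the Jacobian
    obtain ⟨hm1, hm2⟩ := hθm x hx y hy
    set c := genCoeff (s : ℂ) x.2 with hcd
    have hϑd : HoloAt (fun y => ϑ (c, y)) y := by
      have : Holo (fun y => ϑ (c, y)) (ball 0 (20 - 4)) :=
        hF.inv_holo.comp (f := fun p => (c, p)) (by fun_prop) fun p hp => ⟨hc x hx, hp⟩
      exact this.at_ball (ball_mono hy)
    have h1 := hdθ c (hc x hx) (ϑ (c, y)) (ball_mono hm1)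
    have hϑj : jac (fun y => ϑ (c, y)) y = 1 := by
      have h2 := jac_comp (g := fun p => θ (c, p)) (f := fun y => ϑ (c, y)) h1.1 hϑd
      have h3 : jac (fun y => θ (c, ϑ (c, y))) y = 1 := by
        rw [← jac_id y]
        refine jac_congr ?_
        filter_upwards [isOpen_ball.mem_nhds hy] with z hz
        exact hF.right_inv c (hc x hx) z (ball_mono hz)
      rw [h3, h1.2, one_mul] at h2
      exact h2.symm
    have hqm := mem_ball₀ (hq x hx)
    have hκd : HoloAt (prelimHenon s ((s : ℂ) ^ 6 • x.1)) (ϑ (c, y)) := by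
      have : Holo (prelimHenon s ((s : ℂ) ^ 6 • x.1)) (ball 0 20) :=
        hPs'.holo.comp (f := fun p => ((s : ℂ) ^ 6 • x.1, p)) (by fun_prop) fun p hp => ⟨hqm, hp⟩
      exact this.at_ball (ball_mono hm1)
    obtain ⟨h4, h5⟩ := jac_comp_eq_one (f := fun y => ϑ (c, y)) hκd hϑd
      (hPs'.jac_eq _ hqm _ (ball_mono hm1)) hϑj
    obtain ⟨h6, h7⟩ := hdθ _ (hc' x hx) _ (ball_subset_ball (by norm_num : (16 : ℝ) ≤ 18) hm2)
    exact (jac_comp_eq_one (g := fun p => θ (genCoeffConj s ((s : ℂ) ^ 6 • x.1) x.2, p))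
      (f := fun y => prelimHenon s ((s : ℂ) ^ 6 • x.1) (ϑ (c, y))) h6 h4 h7 h5).2
  · -- the expansion
    obtain ⟨hm1, hm2⟩ := hθm x hx y hy
    set c := genCoeff (s : ℂ) x.2 with hcd
    have hxt := (ht x hx).le
    have hpi : ∀ (f : Coeffs m) (b : ℝ), 0 ≤ b → (∀ i, ‖f i‖ ≤ b) → ‖f‖ ≤ b := fun f b hb h =>
      (pi_norm_le_iff_of_nonneg hb).2 h
    have hti : ∀ i, ‖x.2 i‖ ≤ 2 := fun i => (norm_le_pi_norm x.2 i).trans hxt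
    have hy2 : θ (c, ϑ (c, y)) = y := hF.right_inv c (hc x hx) y (ball_mono hy)
    have hcb : 𝔻 20 ⊆ closedBall 0 20 := ball_subset_closedBall
    have key := conjugation_expansion (R := 20) (s := s) (A := A) (u := quarticField) (κ₀ := prelimHenon s 0)
      (κ := prelimHenon s ((s : ℂ) ^ 6 • x.1)) (Xr := resField x.2) (Xd := nonresField x.2)
      (θ := fun p => θ (c, p)) (θ' := fun p => θ (genCoeffConj s ((s : ℂ) ^ 6 • x.1) x.2, p))
      (H := polyObs genExps c) (H' := polyObs genExps (genCoeffConj s ((s : ℂ) ^ 6 • x.1) x.2))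
      hs hs1 hA1 hsA differentiable_quarticField.differentiableOn
      (fun p hp => (hBu p (hcb hp)).trans (by rw [hA]; linarith))
      (hPs'.holo.comp (f := fun p => ((0 : ℂ²), p)) (by fun_prop)
        fun p hp => ⟨mem_ball_self (by positivity), hp⟩) hκ₀ (hκb x hx)
      (differentiable_sum_monoField _ _).differentiableOn
      (fun p hp => (hK _ p (hcb hp)).trans (by
        have : ‖fun i : badExp m => if i.1.2 % 3 = 1 then x.2 i else 0‖ ≤ 2 := hpi _ _ (by norm_num) fun i => by
          split_ifs
          · exact hti i
          · simp
        rw [hA]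
        nlinarith))
      (differentiable_sum_monoField _ _).differentiableOn
      (fun p hp => (hK _ p (hcb hp)).trans (by
        have : ‖fun i : badExp m => if i.1.2 % 3 = 1 then 0 else divisor i * x.2 i‖ ≤ D * 2 :=
          hpi _ _ (by positivity) fun i => by
            split_ifs
            · rw [norm_zero]; positivity
            · rw [norm_mul]; exact mul_le_mul (hD i) (hti i) (norm_nonneg _) hD0
        rw [hA]
        nlinarith))
      (differentiable_polyObs _ _).differentiableOn (differentiable_polyObs _ _).differentiableOn
      (fun p hp => by
        rw [hcd, genCoeff_sub_res]
        refine (hK _ p (hcb hp)).trans ?_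
        have : ‖fun i : badExp m => if i.1.2 % 3 = 1 then 0 else (s : ℂ) ^ 5 * x.2 i‖ ≤ s ^ 5 * 2 :=
          hpi _ _ (by positivity) fun i => by
            split_ifs
            · rw [norm_zero]; positivity
            · rw [norm_mul, norm_pow, ns]; gcongr; exact hti i
        calc _ ≤ K * (s ^ 5 * 2) := by gcongr
          _ = 2 * K * s ^ 5 := by ring
          _ ≤ A * s ^ 5 := by gcongr; rw [hA]; linarith)
      (fun p hp => by
        rw [hcd, genCoeffConj_sub]
        refine (hK _ p (hcb hp)).trans ?_
        have : ‖fun i : badExp m => genScale (s : ℂ) i * (multiplier ((s : ℂ) ^ 6 • x.1) (genExp i)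
            - multiplier 0 (genExp i)) * x.2 i‖ ≤ 1 * (L * (2 * s ^ 6)) * 2 :=
          hpi _ _ (by positivity) fun i => by
            rw [norm_mul, norm_mul]
            refine mul_le_mul (mul_le_mul ((norm_genScale_le hs hs1 _).trans hs1)
              ((hχ _ (hqχ x hx) i).1.trans ?_) (norm_nonneg _) (by norm_num)) (hti i) (norm_nonneg _) (by positivity)
            gcongr
            exact (hq x hx).le
        calc _ ≤ K * (1 * (L * (2 * s ^ 6)) * 2) := by gcongr
          _ = 4 * K * L * s ^ 6 := by ring
          _ ≤ A * s ^ 6 := by gcongr; rw [hA]; linarith)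
      (hF.holo.comp (f := fun p => (c, p)) (by fun_prop) fun p hp => ⟨hc x hx, hp⟩)
      (fun p hp => ⟨(hF.pair c (hc x hx) p hp).1, (hF.pair c (hc x hx) p hp).2.1⟩)
      (fun p hp => ⟨(hF.pair _ (hc' x hx) p hp).1, (hF.pair _ (hc' x hx) p hp).2.1⟩)
      (p := ϑ (c, y)) (ball_mono hm1)
    rw [hy2, effectField_eq] at key
    have h1 := hPs'.expansion y (ball_mono hy)
    calc _ = ‖(θ (genCoeffConj s ((s : ℂ) ^ 6 • x.1) x.2, prelimHenon s ((s : ℂ) ^ 6 • x.1) (ϑ (c, y)))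
            - prelimHenon s 0 y - (s : ℂ) ^ 5 • effectField x.2 y)
            + (prelimHenon s 0 y - y - (s : ℂ) ^ 4 • quarticField y - (s : ℂ) ^ 5 • cubicField y)‖ := by
          congr 1; rw [conjFamily, smul_add]; abel
      _ ≤ 300 * A ^ 3 * s ^ 6 + A₁ * s ^ 6 := norm_add_le_of_le key h1
      _ = _ := by ring

end ConjugateFamily

/-! ### Families of generators and fixed points -/

section GeneratingFamily

/-- The generating observables of a holomorphic family of area-preserving maps close to the
identity; their Hamiltonian fields depend holomorphically on the parameter. -/
lemma exists_generating_family {Q : Type*} [NormedAddCommGroup Q] [NormedSpace ℂ Q]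
    {U : Set Q} (hU : IsOpen U) {k : Q × ℂ² → ℂ²} {R c d : ℝ}
    (hk : Holo k (U ×ˢ ball 0 R))
    (hb : ∀ q ∈ U, ∀ p ∈ 𝔻 R, ‖k (q, p) - p‖ ≤ c)
    (hj : ∀ q ∈ U, ∀ p ∈ 𝔻 R, jac (fun p => k (q, p)) p = 1)
    (hd : 0 < d) (hcd : 4 * c ≤ d) :
    ∃ F : Q → ℂ² → ℂ, (∀ q ∈ U, Holo (F q) (ball 0 (R - 2 * d)) ∧ F q 0 = 0 ∧
      (∀ p ∈ 𝔻 (R - d), (p.1, (k (q, p)).2) ∈ 𝔻 (R - 2 * d) →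
        IsCanonicalPair (F q) p (k (q, p))) ∧
      ∀ y ∈ 𝔻 (R - 2 * d), ∃ p ∈ 𝔻 (R - d), p.1 = y.1 ∧
        (k (q, p)).2 = y.2 ∧ IsCanonicalPair (F q) p (k (q, p))) ∧
      ∀ y ∈ 𝔻 (R - 2 * d), Holo (fun q => sgrad (F q) y) U := by
  have hex : ∀ q : Q, ∃ F : ℂ² → ℂ, q ∈ U → Holo F (ball 0 (R - 2 * d)) ∧ F 0 = 0 ∧
      (∀ p ∈ 𝔻 (R - d), (p.1, (k (q, p)).2) ∈ 𝔻 (R - 2 * d) →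
        IsCanonicalPair F p (k (q, p))) ∧
      ∀ y ∈ 𝔻 (R - 2 * d), ∃ p ∈ 𝔻 (R - d), p.1 = y.1 ∧
        (k (q, p)).2 = y.2 ∧ IsCanonicalPair F p (k (q, p)) := by
    intro q
    by_cases hq : q ∈ U
    · obtain ⟨F, hF⟩ := exists_generating (f := fun p => k (q, p)) (R := R) (c := c) (d := d)
        (hk.comp (f := fun p => (q, p)) (by fun_prop) fun p hp => ⟨hq, hp⟩) (hb q hq) (hj q hq) hd hcd
      exact ⟨F, fun _ => hF⟩
    · exact ⟨0, fun h => absurd h hq⟩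
  choose F hF using hex
  refine ⟨F, hF, fun y hy => ?_⟩
  obtain ⟨W, hW, hW1, hW2⟩ := exists_partial_inverse hU hk hb hd hcd
  have hWy : Holo (fun q => W (q, y)) U :=
    hW.comp (f := fun q => (q, y)) (by fun_prop) fun q hq => ⟨hq, hy⟩
  have hky : Holo (fun q => k (q, (y.1, W (q, y)))) U :=
    hk.comp (f := fun q => (q, (y.1, W (q, y))))
      (differentiableOn_id.prodMk ((differentiableOn_const y.1).prodMk hWy)) fun q hq =>
        ⟨hq, ball_mono (hW1 q hq y hy).1⟩
  refine (((hky.fst).sub (differentiableOn_const y.1)).prodMk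
    ((differentiableOn_const y.2).sub hWy)).congr fun q hq => ?_
  obtain ⟨p, hp, h1, h2, h3⟩ := (hF q hq).2.2.2 y hy
  have e : (p.1, (k (q, p)).2) = y := Prod.ext h1 h2
  have h4 := hW2 q hq p hp (by rw [e]; exact hy)
  obtain ⟨h5, h6⟩ := h3
  rw [e] at h4 h5 h6
  have e2 : (y.1, W (q, y)) = p := Prod.ext h1.symm h4
  ext
  · simp only [sgrad, Pi.sub_apply]; rw [e2]; linear_combination -h5 - h1
  · simp only [sgrad, Pi.sub_apply]; rw [h4]; linear_combination h6 + h2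

/-- A contraction of a closed ball that depends on a parameter in a Lipschitz way has a fixed
point that depends on the parameter in a Lipschitz way. -/
lemma exists_fixedPoint_family {Q V : Type*} [NormedAddCommGroup Q] [NormedAddCommGroup V] [CompleteSpace V]
    {U : Set Q} {r L : ℝ} (hr : 0 ≤ r) {T : Q → V → V}
    (hm : ∀ q ∈ U, ∀ t ∈ closedBall (0 : V) r, T q t ∈ closedBall (0 : V) r)
    (hc : ∀ q ∈ U, ∀ q' ∈ U, ∀ t ∈ closedBall (0 : V) r, ∀ t' ∈ closedBall (0 : V) r,
      ‖T q t - T q' t'‖ ≤ L * ‖q - q'‖ + 1 / 2 * ‖t - t'‖) :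
    ∃ t : Q → V, (∀ q ∈ U, t q ∈ closedBall (0 : V) r ∧ T q (t q) = t q) ∧
      ∀ q ∈ U, ∀ q' ∈ U, ‖t q - t q'‖ ≤ 2 * L * ‖q - q'‖ := by
  have hex : ∀ q, ∃ t, q ∈ U → t ∈ closedBall (0 : V) r ∧ T q t = t := by
    intro q
    by_cases hq : q ∈ U
    · have hms : MapsTo (T q) (closedBall (0 : V) r) (closedBall (0 : V) r) := hm q hq
      have hcon : ContractingWith (1 / 2) (hms.restrict (T q) _ _) := by
        refine ⟨by norm_num, LipschitzWith.of_dist_le_mul fun t t' => ?_⟩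
        have := hc q hq q hq t t.2 t' t'.2
        rw [sub_self, norm_zero, mul_zero, zero_add] at this
        rw [Subtype.dist_eq, Subtype.dist_eq, dist_eq_norm, dist_eq_norm]
        simpa using this
      obtain ⟨t, ht, hf, -⟩ := hcon.exists_fixedPoint' isClosed_closedBall.isComplete hms
        (mem_closedBall_self hr) (edist_ne_top _ _)
      exact ⟨t, fun _ => ⟨ht, hf⟩⟩
    · exact ⟨0, fun h => absurd h hq⟩
  choose t ht using hex
  refine ⟨t, ht, fun q hq q' hq' => ?_⟩
  have := hc q hq q' hq' _ (ht q hq).1 _ (ht q' hq').1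
  rw [(ht q hq).2, (ht q' hq').2] at this
  linarith

end GeneratingFamily

/-! ### Coefficients of generators -/

section Coefficients

variable {ι : Type*} [Fintype ι] (e : ι → ℕ × ℕ)

lemma coeff₂_polyObs (c : ι → ℂ) (k l : ℕ) :
    coeff₂ k l (polyObs e c) = ∑ i, if e i = (k, l) then c i else 0 := by
  have := coeff₂_sum (k := k) (l := l) Finset.univ (F := fun i p => c i * p.1 ^ (e i).1 * p.2 ^ (e i).2)
    one_pos fun i _ => by fun_prop
  refine Eq.trans this (Finset.sum_congr rfl fun i _ => ?_)
  rw [coeff₂_monomial]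
  congr 1
  rw [Prod.ext_iff]
  exact propext ⟨fun h => ⟨h.1.symm, h.2.symm⟩, fun h => ⟨h.1.symm, h.2.symm⟩⟩

lemma sgrad_sub {F G : ℂ² → ℂ} {y : ℂ²} (hF : HoloAt F y) (hG : HoloAt G y) :
    sgrad (fun p => F p - G p) y = sgrad F y - sgrad G y := by
  have h1 := hF.hasFDerivAt.fun_sub hG.hasFDerivAt
  ext
  · simp [sgrad, dw, h1.fderiv]
  · simp [sgrad, dz, h1.fderiv]; ring

/-- Observables with close Hamiltonian fields have close Taylor coefficients. -/
lemma norm_coeff₂_sub_le {F G : ℂ² → ℂ} {R c : ℝ} (hR : 2 ≤ R)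
    (hF : Holo F (ball 0 R)) (hG : Holo G (ball 0 R)) (hF0 : F 0 = 0) (hG0 : G 0 = 0)
    (h : ∀ y ∈ 𝔻 R, ‖sgrad F y - sgrad G y‖ ≤ c) (k l : ℕ) :
    ‖coeff₂ k l F - coeff₂ k l G‖ ≤ 2 * c * R := by
  have hc : 0 ≤ c := (norm_nonneg _).trans (h 0 (mem_ball_self (by linarith)))
  have hd : ∀ y ∈ 𝔻 R, sgrad (fun p => F p - G p) y = sgrad F y - sgrad G y :=
    fun y hy => sgrad_sub (hF.at_ball hy) (hG.at_ball hy)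
  rw [← coeff₂_sub (by linarith) hF hG]
  refine (norm_coeff₂_le (B := 2 * c * R) (by linarith) (hF.fun_sub hG) fun y hy => ?_).trans ?_
  · have hy' := norm_lt hy
    refine (norm_le_of_sgrad_le (c := c) (hF.fun_sub hG) (by simp [hF0, hG0]) hy fun x hx => ?_).trans ?_
    · have hx' : x ∈ 𝔻 R := mem_ball₀ (hx.trans_lt hy')
      rw [hd x hx']
      exact h x hx'
    · gcongr
  · have h2 : (2 / R) ^ (k + l) ≤ 1 := pow_le_one₀ (by positivity) ((div_le_one (by linarith)).2 hR)
    have h3 : 0 ≤ 2 * c * R := by positivity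
    nlinarith

lemma sgrad_polyObs_sub (c c' : ι → ℂ) (p : ℂ²) :
    sgrad (polyObs e c) p - sgrad (polyObs e c') p = ∑ i, (c i - c' i) • monoField (e i) p := by
  rw [sgrad_polyObs, sgrad_polyObs, ← Finset.sum_sub_distrib]
  exact Finset.sum_congr rfl fun i _ => (sub_smul _ _ _).symm

end Coefficients

/-! ### Removal of the bad monomials -/

section NormalizedFamily

variable {m : ℕ}

/-- The exponents of the leading part of the normalized observable: the bad monomials and the
monomials `w⁴`, `z²w`. -/
def mainExps : badExp m ⊕ Bool → ℕ × ℕ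
  | .inl i => i
  | .inr true => (0, 4)
  | .inr false => (2, 1)

/-- The coefficients of the leading part of the generating observable of the conjugate family. -/
def mainCoeff (s : ℂ) (t : Coeffs m) : badExp m ⊕ Bool → ℂ
  | .inl i => s ^ 5 * (divisor i * t i)
  | .inr true => s ^ 4 * quartic
  | .inr false => s ^ 5 * henonCoeff 0

lemma not_mem_badExp : ((0, 4) : ℕ × ℕ) ∉ badExp m ∧ ((2, 1) : ℕ × ℕ) ∉ badExp m := by
  constructor <;> · rw [mem_badExp]; simp

lemma coeff₂_main_bad (s : ℂ) (t : Coeffs m) (i : badExp m) :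
    coeff₂ i.1.1 i.1.2 (polyObs mainExps (mainCoeff s t)) = s ^ 5 * (divisor i * t i) := by
  have h1 : ((0, 4) : ℕ × ℕ) ≠ i.1 := fun h => not_mem_badExp.1 (h ▸ i.2)
  have h2 : ((2, 1) : ℕ × ℕ) ≠ i.1 := fun h => not_mem_badExp.2 (h ▸ i.2)
  rw [coeff₂_polyObs, Fintype.sum_sum_type, Fintype.sum_bool]
  simp only [mainExps, mainCoeff, Prod.mk.eta, if_neg h1, if_neg h2, add_zero, ← Subtype.ext_iff]
  simp

lemma coeff₂_main_good (s : ℂ) (t : Coeffs m) :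
    coeff₂ 0 4 (polyObs mainExps (mainCoeff s t)) = s ^ 4 * quartic ∧
    coeff₂ 2 1 (polyObs mainExps (mainCoeff s t)) = s ^ 5 * henonCoeff 0 := by
  have h1 : ∀ x : badExp m, x.1 ≠ (0, 4) := fun x h => not_mem_badExp.1 (h ▸ x.2)
  have h2 : ∀ x : badExp m, x.1 ≠ (2, 1) := fun x h => not_mem_badExp.2 (h ▸ x.2)
  constructor
  · rw [coeff₂_polyObs, Fintype.sum_sum_type, Fintype.sum_bool]
    simp [mainExps, mainCoeff, h1]
  · rw [coeff₂_polyObs, Fintype.sum_sum_type, Fintype.sum_bool]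
    simp [mainExps, mainCoeff, h2]

lemma sgrad_main (s : ℂ) (t : Coeffs m) (y : ℂ²) :
    sgrad (polyObs mainExps (mainCoeff s t)) y =
      s ^ 4 • quarticField y + s ^ 5 • (cubicField y + effectField t y) := by
  rw [sgrad_polyObs, Fintype.sum_sum_type, Fintype.sum_bool]
  simp only [mainExps, mainCoeff, effectField, smul_add, Finset.smul_sum, smul_smul]
  have h1 : (s ^ 4 * quartic) • monoField (0, 4) y = s ^ 4 • quarticField y := by
    ext <;> simp [monoField, quarticField]; ring
  have h2 : (s ^ 5 * henonCoeff 0) • monoField (2, 1) y = s ^ 5 • cubicField y := by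
    ext <;> simp [monoField, cubicField] <;> ring
  rw [h1, h2]
  abel

lemma polyObs_zero_of_degree {ι : Type*} [Fintype ι] {e : ι → ℕ × ℕ} (he : ∀ i, 1 ≤ (e i).1 + (e i).2)
    (c : ι → ℂ) : polyObs e c 0 = 0 := by
  refine Finset.sum_eq_zero fun i _ => ?_
  have := he i
  rcases Nat.eq_zero_or_pos (e i).1 with h | h
  · rw [Prod.snd_zero, zero_pow (by omega), mul_zero]
  · rw [Prod.fst_zero, zero_pow (by omega), mul_zero, zero_mul]

lemma mainExps_degree (i : badExp m ⊕ Bool) : 3 ≤ (mainExps i).1 + (mainExps i).2 := by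
  rcases i with i | i | i
  · exact (mem_badExp.1 i.2).1
  · simp [mainExps]
  · simp [mainExps]

variable {θ ϑ : Coeffs m × ℂ² → ℂ²} {r : ℝ}

/-- The observables `F q` generate the normalized maps at scale `s`, with parameters `t q`: their
bad coefficients vanish. The eigenvalues are those at the parameter `s⁶ q`. -/
structure IsNormalizedFamily (θ ϑ : Coeffs m × ℂ² → ℂ²) (s L : ℝ)
    (t : ℂ² → Coeffs m) (F : ℂ² → ℂ² → ℂ) : Prop where
  near : ∀ q ∈ 𝔻 1, ∀ p ∈ 𝔻 14, ‖conjFamily θ ϑ s ((q, t q), p) - p‖ ≤ 1 / 4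
  norm_le : ∀ q ∈ 𝔻 1, ‖t q‖ ≤ 1 / 2
  holo : ∀ q ∈ 𝔻 1, Holo (F q) (ball 0 12)
  map_zero : ∀ q ∈ 𝔻 1, F q 0 = 0
  pair : ∀ q ∈ 𝔻 1, ∀ p ∈ 𝔻 13,
    (p.1, (conjFamily θ ϑ s ((q, t q), p)).2) ∈ 𝔻 12 →
      IsCanonicalPair (F q) p (conjFamily θ ϑ s ((q, t q), p))
  exists_pair : ∀ q ∈ 𝔻 1, ∀ y ∈ 𝔻 12, ∃ p ∈ 𝔻 13, p.1 = y.1 ∧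
    (conjFamily θ ϑ s ((q, t q), p)).2 = y.2 ∧ IsCanonicalPair (F q) p (conjFamily θ ϑ s ((q, t q), p))
  bad : ∀ q ∈ 𝔻 1, ∀ e ∈ badExp m, coeff₂ e.1 e.2 (F q) = 0
  quartic_lip : ∀ q ∈ 𝔻 1, ‖coeff₂ 0 4 (F q) - coeff₂ 0 4 (F 0)‖ ≤ L * ‖q‖
  cubic_lip : ∀ q ∈ 𝔻 1, ‖coeff₂ 2 1 (F q) - coeff₂ 2 1 (F 0)‖ ≤ L * ‖q‖

set_option maxHeartbeats 1000000 in
/-- For a small scale, the coefficients of the generator can be chosen so that the bad coefficients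
vanish. The corrections are of relative size `s⁶ / s⁵`, which makes the fixed-point map a contraction. -/
theorem exists_normalizedFamily {A B s₀ : ℝ} (hB : 0 ≤ B) (hs₀ : 0 < s₀)
    (hF : ∀ s : ℝ, 0 < s → s < s₀ → FamilyBounds θ ϑ r A s B) :
    ∃ s₁ > 0, ∀ s : ℝ, 0 < s → s < s₁ → FamilyBounds θ ϑ r A s B ∧
      ∃ L t F, IsNormalizedFamily (m := m) θ ϑ s L t F := by
  obtain ⟨K₀, hK₀0, hK₀⟩ := exists_bound_polyField (mainExps (m := m)) 14
  obtain ⟨D, hD0, hD, hD'⟩ : ∃ D : ℝ, 0 ≤ D ∧ (∀ i : badExp m, ‖divisor i‖ ≤ D) ∧ ∀ i : badExp m, ‖divisor i‖⁻¹ ≤ D := by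
    refine ⟨max ‖fun i : badExp m => divisor i‖ ‖fun i : badExp m => (divisor i)⁻¹‖,
      le_max_of_le_left (norm_nonneg _), fun i => le_max_of_le_left (norm_le_pi_norm (fun i : badExp m => divisor i) i),
      fun i => le_max_of_le_right ?_⟩
    rw [← norm_inv]
    exact norm_le_pi_norm (fun i : badExp m => (divisor i)⁻¹) i
  set Q := 2 * D + ‖quartic‖ + ‖henonCoeff 0‖ with hQ
  have hQ0 : 0 ≤ Q := by positivity
  set K := K₀ * Q + B with hK
  have hK0 : 0 ≤ K := by positivity
  set B' := B + 2 * K ^ 2 with hB'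
  have hB'0 : 0 ≤ B' := by positivity
  set T₀ := 100 * B' * (D + 1) + 4 * K + 2 with hT₀
  have hT₀0 : 0 < T₀ := by positivity
  refine ⟨min s₀ (1 / T₀), by positivity, fun s hs hs1 => ?_⟩
  have hFs := hF s hs (hs1.trans_le (min_le_left _ _))
  refine ⟨hFs, ?_⟩
  have hsT : T₀ * s ≤ 1 := by
    have h1 : s < 1 / T₀ := hs1.trans_le (min_le_right _ _)
    rw [lt_div_iff₀ hT₀0] at h1
    linarith
  have hp1 : 0 ≤ 100 * B' * (D + 1) * s := by positivity
  have hp2 : 0 ≤ 4 * K * s := by positivity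
  have hsT' : 100 * B' * (D + 1) * s + 4 * K * s + 2 * s ≤ 1 := by rw [hT₀] at hsT; linarith
  have hs2 : s ≤ 1 := by linarith
  have ns : ‖(s : ℂ)‖ = s := by rw [Complex.norm_of_nonneg hs.le]
  have hpow : ∀ a b : ℕ, b ≤ a → s ^ a ≤ s ^ b := fun a b h => pow_le_pow_of_le_one hs.le hs2 h
  -- the family is at distance `O(s⁴)` of the identity
  have hmain : ∀ x ∈ ball (0 : Param m) 2, ∀ y ∈ 𝔻 14,
      ‖sgrad (polyObs mainExps (mainCoeff (s : ℂ) x.2)) y‖ ≤ K₀ * Q * s ^ 4 := by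
    intro x hx y hy
    have ht : ‖x.2‖ ≤ 2 := (norm_snd_le x).trans (norm_lt hx).le
    rw [sgrad_polyObs]
    refine (hK₀ _ y (ball_subset_closedBall hy)).trans ?_
    rw [mul_assoc]
    refine mul_le_mul_of_nonneg_left ((pi_norm_le_iff_of_nonneg (by positivity)).2 fun i => ?_) hK₀0
    have h54 := hpow 5 4 (by norm_num)
    rcases i with i | i | i
    · simp only [mainCoeff, norm_mul, norm_pow, ns]
      calc _ ≤ s ^ 4 * (D * 2) := by
            gcongr
            · exact hD i
            · exact (norm_le_pi_norm x.2 i).trans ht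
        _ ≤ Q * s ^ 4 := by
            rw [mul_comm]; gcongr; rw [hQ]; linarith [norm_nonneg quartic, norm_nonneg (henonCoeff 0)]
    · simp only [mainCoeff, norm_mul, norm_pow, ns]
      calc _ ≤ s ^ 4 * Q := by
            gcongr; rw [hQ]; linarith [norm_nonneg quartic]
        _ = Q * s ^ 4 := mul_comm _ _
    · simp only [mainCoeff, norm_mul, norm_pow, ns]
      calc _ ≤ s ^ 4 * Q := by
            gcongr; rw [hQ]; linarith [norm_nonneg (henonCoeff 0)]
        _ = Q * s ^ 4 := mul_comm _ _
  have hexp : ∀ x ∈ ball (0 : Param m) 2, ∀ y ∈ 𝔻 14,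
      ‖conjFamily θ ϑ s (x, y) - y - sgrad (polyObs mainExps (mainCoeff (s : ℂ) x.2)) y‖ ≤ B * s ^ 6 := by
    intro x hx y hy
    have := hFs.expansion x hx y hy
    rwa [sub_sub, ← sgrad_main] at this
  have hnear : ∀ x ∈ ball (0 : Param m) 2, ∀ y ∈ 𝔻 14,
      ‖conjFamily θ ϑ s (x, y) - y‖ ≤ K * s ^ 4 := by
    intro x hx y hy
    have h1 := norm_le_add_sub (conjFamily θ ϑ s (x, y) - y)
      (sgrad (polyObs mainExps (mainCoeff (s : ℂ) x.2)) y)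
    have h2 : B * s ^ 6 ≤ B * s ^ 4 := mul_le_mul_of_nonneg_left (hpow 6 4 (by norm_num)) hB
    rw [hK]
    linarith [hmain x hx y hy, hexp x hx y hy]
  have hKs : 4 * (K * s ^ 4) ≤ 1 := by
    have : K * s ^ 4 ≤ K * s := mul_le_mul_of_nonneg_left (by simpa using hpow 4 1 (by norm_num)) hK0
    linarith
  obtain ⟨F, hF1, hF2⟩ := exists_generating_family isOpen_ball hFs.holo hnear hFs.jac_eq one_pos hKs
  rw [show (14 : ℝ) - 2 * 1 = 12 by norm_num, show (14 : ℝ) - 1 = 13 by norm_num] at *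
  -- the error field
  set P : Param m → ℂ² → ℂ := fun x => polyObs mainExps (mainCoeff (s : ℂ) x.2) with hP
  have hPd : ∀ x, Differentiable ℂ (P x) := fun x => differentiable_polyObs _ _
  have hP0 : ∀ x, P x 0 = 0 := fun x => polyObs_zero_of_degree (fun i => by linarith [mainExps_degree i]) _
  have herr : ∀ x ∈ ball (0 : Param m) 2, ∀ y ∈ 𝔻 12,
      ‖sgrad (F x) y - sgrad (P x) y‖ ≤ B' * s ^ 6 := by
    intro x hx y hy
    obtain ⟨p, hp, h1, h2, h3⟩ := (hF1 x hx).2.2.2 y hy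
    have h4 := (sgrad_approx (f := fun p => conjFamily θ ϑ s (x, p))
      (hFs.holo.comp (f := fun p => (x, p)) (by fun_prop) fun p hp => ⟨hx, hp⟩) (hnear x hx) one_pos
      (by linarith [norm_lt hy]) (by linarith [norm_lt hp]) h1 h2 h3).2
    have h5 := hexp x hx y (ball_mono hy)
    have e : sgrad (F x) y - sgrad (P x) y = (conjFamily θ ϑ s (x, y) - y - sgrad (P x) y)
      - (conjFamily θ ϑ s (x, y) - y - sgrad (F x) y) := by abel
    rw [e]
    refine (norm_sub_le _ _).trans ((add_le_add h5 h4).trans ?_)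
    have h6 : s ^ 8 ≤ s ^ 6 := hpow 8 6 (by norm_num)
    calc _ = B * s ^ 6 + 2 * K ^ 2 * s ^ 8 := by ring
      _ ≤ B * s ^ 6 + 2 * K ^ 2 * s ^ 6 := by gcongr
      _ = B' * s ^ 6 := by rw [hB']; ring
  have hin : ∀ {x : Param m}, x ∈ ball 0 1 → x ∈ ball (0 : Param m) 2 :=
    fun hx => ball_mono hx
  have hlip : ∀ x ∈ ball (0 : Param m) 1, ∀ x' ∈ ball (0 : Param m) 1,
      ∀ y ∈ 𝔻 12, ‖(sgrad (F x) y - sgrad (P x) y)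
        - (sgrad (F x') y - sgrad (P x') y)‖ ≤ 2 * B' * s ^ 6 * ‖x - x'‖ := by
    intro x hx x' hx' y hy
    have hPx : Differentiable ℂ (fun x => sgrad (P x) y) := by
      have : Differentiable ℂ (fun x : Param m => ∑ i, mainCoeff (s : ℂ) x.2 i • monoField (mainExps i) y) := by
        refine Differentiable.fun_sum fun i _ => Differentiable.smul_const ?_ _
        rcases i with i | i | i <;> simp only [mainCoeff] <;> fun_prop
      simpa only [hP, sgrad_polyObs] using this
    have := norm_sub_le_of_bound (f := fun x => sgrad (F x) y - sgrad (P x) y)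
      ((hF2 y hy).fun_sub hPx.differentiableOn) (fun x hx => herr x hx y hy) one_pos (x := x) (y := x')
      (by linarith [norm_lt hx]) (by linarith [norm_lt hx'])
    refine this.trans_eq (by ring)
  -- the coefficients of the error
  set ε : ℕ → ℕ → Param m → ℂ := fun k l x => coeff₂ k l (F x) - coeff₂ k l (P x) with hε
  have hε1 : ∀ k l, ∀ x ∈ ball (0 : Param m) 1, ‖ε k l x‖ ≤ 24 * B' * s ^ 6 := by
    intro k l x hx
    refine (norm_coeff₂_sub_le (by norm_num) (hF1 x (hin hx)).1 (hPd x).differentiableOn (hF1 x (hin hx)).2.1 (hP0 x)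
      (herr x (hin hx)) k l).trans_eq (by ring)
  have hε2 : ∀ k l, ∀ x ∈ ball (0 : Param m) 1, ∀ x' ∈ ball (0 : Param m) 1,
      ‖ε k l x - ε k l x'‖ ≤ 48 * B' * s ^ 6 * ‖x - x'‖ := by
    intro k l x hx x' hx'
    have d1 := (hF1 x (hin hx)).1
    have d2 := (hF1 x' (hin hx')).1
    rw [hε]
    simp only
    rw [← coeff₂_sub (by norm_num) d1 (hPd x).differentiableOn,
      ← coeff₂_sub (by norm_num) d2 (hPd x').differentiableOn]
    refine (norm_coeff₂_sub_le (c := 2 * B' * s ^ 6 * ‖x - x'‖) (by norm_num) (d1.fun_sub (hPd x).differentiableOn)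
      (d2.fun_sub (hPd x').differentiableOn) (by simp [hP0, (hF1 x (hin hx)).2.1])
      (by simp [hP0, (hF1 x' (hin hx')).2.1]) (fun y hy => ?_) k l).trans_eq (by ring)
    rw [sgrad_sub (d1.at_ball hy) (hPd x y),
      sgrad_sub (d2.at_ball hy) (hPd x' y)]
    exact hlip x hx x' hx' y hy
  -- the bad coefficient `i` is `s⁵ divisor i * t i + O(s⁶)`: solve for `t i`
  have hx1 : ∀ q ∈ 𝔻 1, ∀ t ∈ closedBall (0 : Coeffs m) (1 / 2),
      (q, t) ∈ ball (0 : Param m) 1 := by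
    intro q hq t ht
    rw [mem_ball_zero_iff, Prod.norm_mk, max_lt_iff]
    exact ⟨norm_lt hq, (mem_closedBall_zero_iff.1 ht).trans_lt (by norm_num)⟩
  have hdiv : ∀ i : badExp m, ‖(s : ℂ) ^ 5 * divisor i‖⁻¹ ≤ D / s ^ 5 := by
    intro i
    rw [norm_mul, norm_pow, ns, mul_inv, mul_comm, div_eq_mul_inv]
    gcongr
    exact hD' i
  have hs5 : s ^ 6 * (D / s ^ 5) = D * s := by field_simp
  obtain ⟨t, ht, htL⟩ := exists_fixedPoint_family (U := 𝔻 1) (r := 1 / 2) (L := 1 / 2) (by norm_num)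
    (T := fun q t (i : badExp m) => -(ε i.1.1 i.1.2 (q, t) / ((s : ℂ) ^ 5 * divisor i)))
    (fun q hq t ht => by
      rw [mem_closedBall_zero_iff]
      refine (pi_norm_le_iff_of_nonneg (by norm_num)).2 fun i => ?_
      rw [norm_neg, norm_div, div_eq_mul_inv]
      calc _ ≤ (24 * B' * s ^ 6) * (D / s ^ 5) :=
            mul_le_mul (hε1 _ _ _ (hx1 q hq t ht)) (hdiv i) (by positivity) (by positivity)
        _ = 24 * B' * (D * s) := by rw [mul_assoc (24 * B'), hs5]
        _ ≤ 1 / 2 := by nlinarith [mul_nonneg hB'0 hs.le, mul_nonneg (mul_nonneg hB'0 hD0) hs.le])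
    (fun q hq q' hq' t ht t' ht' => by
      refine (pi_norm_le_iff_of_nonneg (by positivity)).2 fun i => ?_
      rw [Pi.sub_apply, neg_sub_neg, ← sub_div, norm_div, div_eq_mul_inv, norm_sub_rev]
      have h1 : ‖((q, t) : Param m) - (q', t')‖ ≤ ‖q - q'‖ + ‖t - t'‖ := by
        rw [Prod.mk_sub_mk, Prod.norm_mk]
        exact max_le (by linarith [norm_nonneg (t - t')]) (by linarith [norm_nonneg (q - q')])
      calc _ ≤ (48 * B' * s ^ 6 * ‖((q, t) : Param m) - (q', t')‖) * (D / s ^ 5) :=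
            mul_le_mul (hε2 _ _ _ (hx1 q hq t ht) _ (hx1 q' hq' t' ht')) (hdiv i) (by positivity) (by positivity)
        _ = 48 * B' * (s ^ 6 * (D / s ^ 5)) * ‖((q, t) : Param m) - (q', t')‖ := by ring
        _ ≤ 1 / 2 * (‖q - q'‖ + ‖t - t'‖) := by
            rw [hs5]
            refine mul_le_mul ?_ h1 (norm_nonneg _) (by norm_num)
            nlinarith [mul_nonneg hB'0 hs.le, mul_nonneg (mul_nonneg hB'0 hD0) hs.le]
        _ = _ := by ring)
  have hxt : ∀ q ∈ 𝔻 1, (q, t q) ∈ ball (0 : Param m) 1 :=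
    fun q hq => hx1 q hq _ (ht q hq).1
  have h0 : (0 : ℂ²) ∈ 𝔻 1 := mem_ball_self one_pos
  have hgood : ∀ k l, (∀ t t' : Coeffs m, coeff₂ k l (polyObs mainExps (mainCoeff (s : ℂ) t))
      = coeff₂ k l (polyObs mainExps (mainCoeff (s : ℂ) t'))) → ∀ q ∈ 𝔻 1,
      ‖coeff₂ k l (F (q, t q)) - coeff₂ k l (F (0, t 0))‖ ≤ 48 * B' * s ^ 6 * ‖q‖ := by
    intro k l h q hq
    have h1 := hε2 k l _ (hxt q hq) _ (hxt 0 h0)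
    have e : ε k l (q, t q) - ε k l (0, t 0) = coeff₂ k l (F (q, t q)) - coeff₂ k l (F (0, t 0)) := by
      simp only [hε, hP]
      rw [h (t q) (t 0)]; ring
    rw [e] at h1
    refine h1.trans ?_
    gcongr
    have h2 := htL q hq 0 h0
    rw [Prod.mk_sub_mk, Prod.norm_mk]
    rw [sub_zero] at h2 ⊢
    exact max_le le_rfl (by linarith)
  refine ⟨48 * B' * s ^ 6, t, fun q => F (q, t q), ?_⟩
  refine ⟨fun q hq p hp => (hnear _ (hin (hxt q hq)) p hp).trans (by linarith),
    fun q hq => mem_closedBall_zero_iff.1 (ht q hq).1, fun q hq => (hF1 _ (hin (hxt q hq))).1,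
    fun q hq => (hF1 _ (hin (hxt q hq))).2.1, fun q hq => (hF1 _ (hin (hxt q hq))).2.2.1,
    fun q hq => (hF1 _ (hin (hxt q hq))).2.2.2, fun q hq e he => ?_, ?_, ?_⟩
  · have h1 := congrFun (ht q hq).2 ⟨e, he⟩
    simp only [hε, hP] at h1
    have h2 := coeff₂_main_bad (s : ℂ) (t q) ⟨e, he⟩
    simp only at h2
    have hne : (s : ℂ) ^ 5 * divisor e ≠ 0 :=
      mul_ne_zero (pow_ne_zero _ (by exact_mod_cast hs.ne')) (divisor_ne_zero _)
    rw [h2] at h1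
    rw [neg_eq_iff_eq_neg, div_eq_iff hne] at h1
    linear_combination h1
  · exact hgood 0 4 fun t t' => by rw [(coeff₂_main_good _ t).1, (coeff₂_main_good _ t').1]
  · exact hgood 2 1 fun t t' => by rw [(coeff₂_main_good _ t).2, (coeff₂_main_good _ t').2]

end NormalizedFamily

local notation "Δ[" σ "]" => diag ((σ : ℂ) ^ 5) ((σ : ℂ) ^ 3)
local notation "Δ⁻¹[" σ "]" => diag ((σ : ℂ) ^ 5)⁻¹ ((σ : ℂ) ^ 3)⁻¹
local notation "Z[" σ "]" => zoomObs ((σ : ℂ) ^ 5) ((σ : ℂ) ^ 3)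

/-! ### Orders in the dilation parameter -/

section UniformOrder

/-- `f σ p = O(σⁿ)` as `σ → 0⁺`, uniformly for `‖p‖ < r`. -/
def IsUniformO (n : ℕ) (r : ℝ) (f : ℝ → ℂ² → ℂ²) : Prop :=
  ∃ C : ℝ, ∀ᶠ σ : ℝ in 𝓝₊, ∀ p ∈ 𝔻 r, ‖f σ p‖ ≤ C * σ ^ n

variable {n n' : ℕ} {r r' r'' : ℝ} {f g h : ℝ → ℂ² → ℂ²}

lemma eventually_small {ε : ℝ} (hε : 0 < ε) : ∀ᶠ σ : ℝ in 𝓝₊, 0 < σ ∧ σ < ε :=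
  Ioo_mem_nhdsGT hε

lemma IsUniformO.of_norm_le (hg : IsUniformO n r g)
    (h : ∀ᶠ σ : ℝ in 𝓝₊, ∀ p ∈ 𝔻 r', ∃ y ∈ 𝔻 r, ‖f σ p‖ ≤ ‖g σ y‖) : IsUniformO n r' f := by
  obtain ⟨C, hC⟩ := hg
  refine ⟨C, ?_⟩
  filter_upwards [hC, h] with σ h1 h2 p hp
  obtain ⟨y, hy, h3⟩ := h2 p hp
  exact h3.trans (h1 y hy)

lemma IsUniformO.congr (hf : IsUniformO n r f) (hfg : ∀ᶠ σ : ℝ in 𝓝₊, ∀ p ∈ 𝔻 r, g σ p = f σ p) :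
    IsUniformO n r g :=
  hf.of_norm_le (hfg.mono fun _ h p hp => ⟨p, hp, (congrArg norm (h p hp)).le⟩)

lemma IsUniformO.add (hf : IsUniformO n r f) (hg : IsUniformO n r g) : IsUniformO n r (fun σ p => f σ p + g σ p) := by
  obtain ⟨C, hC⟩ := hf
  obtain ⟨C', hC'⟩ := hg
  refine ⟨C + C', ?_⟩
  filter_upwards [hC, hC'] with σ h1 h2 p hp
  rw [add_mul]
  exact norm_add_le_of_le (h1 p hp) (h2 p hp)

lemma IsUniformO.neg (hf : IsUniformO n r f) : IsUniformO n r (fun σ p => -f σ p) := by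
  obtain ⟨C, hC⟩ := hf
  exact ⟨C, by simpa only [norm_neg] using hC⟩

lemma IsUniformO.sub (hf : IsUniformO n r f) (hg : IsUniformO n r g) : IsUniformO n r (fun σ p => f σ p - g σ p) := by
  simpa only [sub_eq_add_neg] using hf.add hg.neg

lemma IsUniformO.mono (hf : IsUniformO n r f) (hn : n' ≤ n) (hr : r' ≤ r) : IsUniformO n' r' f := by
  obtain ⟨C, hC⟩ := hf
  refine ⟨max C 0, ?_⟩
  filter_upwards [hC, eventually_small one_pos] with σ h1 h2 p hp
  refine (h1 p (ball_subset_ball hr hp)).trans ?_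
  have h3 : σ ^ n ≤ σ ^ n' := pow_le_pow_of_le_one h2.1.le h2.2.le hn
  have h4 : 0 ≤ σ ^ n := pow_nonneg h2.1.le n
  exact mul_le_mul (le_max_left _ _) h3 h4 (le_max_right _ _)

/-- The variation of a holomorphic family of order `n` between points at distance `O(σ^n')`. -/
lemma IsUniformO.comp_sub (hf : IsUniformO n r f)
    (hd : ∀ᶠ σ : ℝ in 𝓝₊, Holo (f σ) (ball 0 r))
    (hgh : IsUniformO n' r' (fun σ p => g σ p - h σ p)) (hr : r'' < r)
    (hg : ∀ᶠ σ : ℝ in 𝓝₊, ∀ p ∈ 𝔻 r', g σ p ∈ 𝔻 r'')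
    (hh : ∀ᶠ σ : ℝ in 𝓝₊, ∀ p ∈ 𝔻 r', h σ p ∈ 𝔻 r'') :
    IsUniformO (n + n') r' (fun σ p => f σ (g σ p) - f σ (h σ p)) := by
  obtain ⟨C, hC⟩ := hf
  obtain ⟨C', hC'⟩ := hgh
  refine ⟨2 * max C 0 / (r - r'') * C', ?_⟩
  filter_upwards [hC, hC', hd, hg, hh, eventually_small one_pos] with σ h1 h2 h3 h4 h5 h6 p hp
  have h7 := norm_sub_le_of_bound (c := max C 0 * σ ^ n) h3
    (fun y hy => (h1 y hy).trans (mul_le_mul_of_nonneg_right (le_max_left _ _) (pow_nonneg h6.1.le n)))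
    (sub_pos.2 hr) (x := g σ p) (y := h σ p) (by simpa using h4 p hp) (by simpa using h5 p hp)
  refine h7.trans ?_
  have h8 : 0 ≤ 2 * (max C 0 * σ ^ n) / (r - r'') :=
    div_nonneg (mul_nonneg (by norm_num) (mul_nonneg (le_max_right _ _) (pow_nonneg h6.1.le n))) (sub_pos.2 hr).le
  refine (mul_le_mul_of_nonneg_left (h2 p hp) h8).trans_eq ?_
  rw [pow_add]; ring

lemma IsUniformO.eventually_le (hf : IsUniformO n r f) (hn : 1 ≤ n) {ε : ℝ} (hε : 0 < ε) :
    ∀ᶠ σ : ℝ in 𝓝₊, ∀ p ∈ 𝔻 r, ‖f σ p‖ ≤ ε := by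
  obtain ⟨C, hC⟩ := hf.mono hn le_rfl
  filter_upwards [hC, eventually_small (ε := ε / (|C| + 1)) (by positivity)] with σ h1 h2 p hp
  have h3 := h2.2
  rw [lt_div_iff₀ (by positivity)] at h3
  linarith [h1 p hp, pow_one σ, mul_le_mul_of_nonneg_right (le_abs_self C) (pow_nonneg h2.1.le 1), h2.1]

/-- A family at distance `O(σ)` of the identity maps a ball into any larger one for small `σ`. -/
lemma IsUniformO.eventually_mem (hf : IsUniformO n r (fun σ p => f σ p - p)) (hn : 1 ≤ n) (hr : r' ≤ r) (hr' : r' < r'') :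
    ∀ᶠ σ : ℝ in 𝓝₊, ∀ p ∈ 𝔻 r', f σ p ∈ 𝔻 r'' := by
  filter_upwards [hf.eventually_le hn (sub_pos.2 hr')] with σ h p hp
  exact mem_ball₀ (by linarith [h p (ball_subset_ball hr hp), norm_le_add_sub (f σ p) p, norm_lt hp])

lemma eq_zero_of_pow_le {x : ℂ} {C : ℝ} {k : ℕ} (hk : k < n)
    (h : ∀ᶠ σ : ℝ in 𝓝₊, σ ^ k * ‖x‖ ≤ C * σ ^ n) : x = 0 := by
  have h1 : Tendsto (fun σ : ℝ => C * σ ^ (n - k)) (𝓝[>] 0) (𝓝 0) := by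
    have : Tendsto (fun σ : ℝ => C * σ ^ (n - k)) (𝓝 0) (𝓝 (C * 0 ^ (n - k))) :=
      (continuous_const.mul (continuous_pow _)).tendsto 0
    rw [zero_pow (by omega), mul_zero] at this
    exact this.mono_left nhdsWithin_le_nhds
  have h2 : ‖x‖ ≤ 0 := by
    refine ge_of_tendsto h1 ?_
    filter_upwards [h, eventually_small one_pos] with σ h3 h4
    have h5 : 0 < σ ^ k := pow_pos h4.1 k
    have h6 : σ ^ n = σ ^ (n - k) * σ ^ k := by rw [← pow_add, Nat.sub_add_cancel hk.le]
    rw [h6] at h3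
    exact le_of_mul_le_mul_left (by linarith) h5
  exact norm_le_zero_iff.1 h2

end UniformOrder

/-! ### Conjugation by the weighted dilation -/

section Dilation

/-- The conjugate of a map by the weighted dilation `(σ⁵ z, σ³ w)`. -/
def conjDil (σ : ℝ) (f : ℂ² → ℂ²) (p : ℂ²) : ℂ² := Δ⁻¹[σ] (f (Δ[σ] p))

variable {σ : ℝ} {f : ℂ² → ℂ²} {p : ℂ²}

lemma diag_conjDil (hσ : σ ≠ 0) : Δ[σ] (conjDil σ f p)
    = f (Δ[σ] p) :=
  diag_diag_inv (pow_ne_zero _ (by exact_mod_cast hσ)) (pow_ne_zero _ (by exact_mod_cast hσ)) _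

lemma norm_dilation_le (hσ : 0 < σ) (hσ1 : σ ≤ 1) (p : ℂ²) :
    ‖Δ[σ] p‖ ≤ σ ^ 3 * ‖p‖ := by
  refine (norm_diag_le _ _ p).trans ?_
  gcongr
  rw [norm_pow, norm_pow, Complex.norm_of_nonneg hσ.le]
  exact max_le (pow_le_pow_of_le_one hσ.le hσ1 (by norm_num)) le_rfl

lemma norm_dilation_inv_le (hσ : 0 < σ) (hσ1 : σ ≤ 1) (p : ℂ²) :
    ‖Δ⁻¹[σ] p‖ ≤ (σ ^ 5)⁻¹ * ‖p‖ := by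
  refine (norm_diag_le _ _ p).trans ?_
  gcongr
  rw [norm_inv, norm_inv, norm_pow, norm_pow, Complex.norm_of_nonneg hσ.le]
  refine max_le le_rfl (inv_anti₀ (by positivity) (pow_le_pow_of_le_one hσ.le hσ1 (by norm_num)))

lemma diag_sub (a b : ℂ) (p q : ℂ²) : diag a b (p - q) = diag a b p - diag a b q := by
  ext <;> simp [diag, mul_sub]

lemma norm_conjDil_sub_le (hσ : 0 < σ) (hσ1 : σ ≤ 1)
    (h : ‖f (Δ[σ] p) - Δ[σ] p‖
      ≤ ‖Δ[σ] p‖ ^ 2) : ‖conjDil σ f p - p‖ ≤ ‖p‖ ^ 2 * σ := by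
  have hne : (σ : ℂ) ≠ 0 := by exact_mod_cast hσ.ne'
  have e : conjDil σ f p - p = Δ⁻¹[σ]
      (f (Δ[σ] p) - Δ[σ] p) := by
    rw [diag_sub, diag_inv_diag (pow_ne_zero _ hne) (pow_ne_zero _ hne)]; rfl
  rw [e]
  refine (norm_dilation_inv_le hσ hσ1 _).trans ?_
  calc _ ≤ (σ ^ 5)⁻¹ * (σ ^ 3 * ‖p‖) ^ 2 := by
        gcongr; exact h.trans (pow_le_pow_left₀ (norm_nonneg _) (norm_dilation_le hσ hσ1 p) 2)
    _ = ‖p‖ ^ 2 * σ := by field_simp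

lemma eventually_dilation_mem : ∀ᶠ σ : ℝ in 𝓝₊, 0 < σ ∧ σ ≤ 1 ∧ ∀ p ∈ 𝔻 8,
    Δ[σ] p ∈ 𝔻 1 := by
  filter_upwards [eventually_small (ε := 1 / 8) (by norm_num)] with σ h
  have h1 : σ ≤ 1 := by linarith [h.2]
  refine ⟨h.1, h1, fun p hp => ?_⟩
  rw [mem_ball_zero_iff] at hp ⊢
  have h2 : σ ^ 3 ≤ σ ^ 1 := pow_le_pow_of_le_one h.1.le h1 (by norm_num)
  rw [pow_one] at h2
  have h3 := norm_dilation_le h.1 h1 p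
  have h4 : σ ^ 3 * ‖p‖ ≤ σ * ‖p‖ := mul_le_mul_of_nonneg_right h2 (norm_nonneg _)
  nlinarith [norm_nonneg p, h.2, h.1]

lemma isUniformO_conjDil (h : ∀ P ∈ 𝔻 1, ‖f P - P‖ ≤ ‖P‖ ^ 2) :
    IsUniformO 1 8 (fun σ p => conjDil σ f p - p) := by
  refine ⟨64, ?_⟩
  filter_upwards [eventually_dilation_mem] with σ ⟨h1, h2, h3⟩ p hp
  refine (norm_conjDil_sub_le h1 h2 (h _ (h3 p hp))).trans ?_
  rw [pow_one]
  gcongr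
  have := (norm_lt hp).le
  nlinarith [norm_nonneg p]

lemma eventually_differentiableOn_conjDil (hf : Holo f (ball 0 1)) :
    ∀ᶠ σ : ℝ in 𝓝₊, Holo (conjDil σ f) (ball 0 8) := by
  filter_upwards [eventually_dilation_mem] with σ ⟨h1, h2, h3⟩
  exact (differentiable_diag _ _).comp_differentiableOn (hf.comp (differentiable_diag _ _).differentiableOn h3)

lemma IsCanonicalPair.conjDil {H : ℂ² → ℂ} (hσ : σ ≠ 0)
    (hH : HoloAt H (Δ[σ] (p.1, (conjDil σ f p).2)))
    (h : IsCanonicalPair H (Δ[σ] p) (f (Δ[σ] p))) :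
    IsCanonicalPair (Z[σ] H) p (conjDil σ f p) := by
  have hne : (σ : ℂ) ≠ 0 := by exact_mod_cast hσ
  refine isCanonicalPair_zoomObs (pow_ne_zero _ hne) (pow_ne_zero _ hne) hH ?_
  rwa [diag_conjDil hσ]

lemma shear_diag (a σ : ℂ) (p : ℂ²) :
    shear a (diag (σ ^ 5) (σ ^ 3) p) = diag (σ ^ 5) (σ ^ 3) (shear (a * σ) p) := by
  ext <;> simp only [shear, diag]; ring

lemma twist_diag (γ σ : ℂ) (p : ℂ²) :
    twist γ (diag (σ ^ 5) (σ ^ 3) p) = diag (σ ^ 5) (σ ^ 3) (twist (γ * σ ^ 3) p) := by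
  ext
  · simp only [twist, diag]; ring
  · simp only [twist, diag]; rw [mul_div_assoc, mul_assoc]

lemma henonCore_diag (c s l₁ l₂ σ : ℂ) (p : ℂ²) :
    henonCore c s l₁ l₂ (diag (σ ^ 5) (σ ^ 3) p) = diag (σ ^ 5) (σ ^ 3) (henonCore c (s * σ) l₁ l₂ p) := by
  ext <;> simp only [henonCore, diag] <;> ring

lemma prelimHenon_diag (s σ : ℂ) (q p : ℂ²) :
    prelimHenon s q (diag (σ ^ 5) (σ ^ 3) p) = diag (σ ^ 5) (σ ^ 3) (prelimHenon (s * σ) q p) := by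
  simp only [prelimHenon, twist_diag, shear_diag, henonCore_diag]
  congr 2 <;> ring_nf

lemma conjDil_prelimHenon (hσ : σ ≠ 0) (s : ℝ) (q p : ℂ²) :
    conjDil σ (prelimHenon s q) p = prelimHenon ((s * σ : ℝ) : ℂ) q p := by
  have hne : (σ : ℂ) ≠ 0 := by exact_mod_cast hσ
  rw [conjDil, prelimHenon_diag, diag_inv_diag (pow_ne_zero _ hne) (pow_ne_zero _ hne), Complex.ofReal_mul]

end Dilation

/-! ### Uniqueness of the leading coefficients -/

section Exactness

variable {ι : Type*} [Fintype ι] {e : ι → ℕ × ℕ}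

/-- The coefficients of a polynomial observable after the dilation `(σ⁵ z, σ³ w)`. -/
def dilCoeff (e : ι → ℕ × ℕ) (σ : ℝ) (c : ι → ℂ) (i : ι) : ℂ := c i * (σ : ℂ) ^ (5 * (e i).1 + 3 * (e i).2 - 8)

lemma norm_sgrad_le (H : ℂ² → ℂ) (y : ℂ²) : ‖sgrad H y‖ ≤ ‖fderiv ℂ H y‖ := by
  have h4 : ∀ v : ℂ², ‖v‖ = 1 → ‖fderiv ℂ H y v‖ ≤ ‖fderiv ℂ H y‖ := fun v hv =>
    ((fderiv ℂ H y).le_opNorm v).trans (by rw [hv, mul_one])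
  rw [sgrad, Prod.norm_mk, norm_neg]
  exact max_le (h4 _ (by simp)) (h4 _ (by simp))

lemma zoomObs_polyObs (he : ∀ i, 3 ≤ (e i).1 + (e i).2) {σ : ℝ} (hσ : σ ≠ 0) (c : ι → ℂ) :
    Z[σ] (polyObs e c) = polyObs e (dilCoeff e σ c) := by
  have hne : (σ : ℂ) ≠ 0 := by exact_mod_cast hσ
  funext p
  rw [zoomObs, polyObs, polyObs, Finset.sum_div]
  refine Finset.sum_congr rfl fun i _ => ?_
  obtain ⟨n, hn⟩ : ∃ n, 5 * (e i).1 + 3 * (e i).2 = n + 8 := ⟨5 * (e i).1 + 3 * (e i).2 - 8, by have := he i; omega⟩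
  have h1 : ((σ : ℂ) ^ 5) ^ (e i).1 * ((σ : ℂ) ^ 3) ^ (e i).2 = (σ : ℂ) ^ n * (σ : ℂ) ^ 8 := by
    rw [← pow_mul, ← pow_mul, ← pow_add, ← pow_add, hn]
  rw [dilCoeff, hn, Nat.add_sub_cancel, div_eq_iff (mul_ne_zero (pow_ne_zero _ hne) (pow_ne_zero _ hne))]
  simp only [diag, mul_pow]
  linear_combination c i * p.1 ^ (e i).1 * p.2 ^ (e i).2 * h1

lemma norm_dilCoeff_le {n : ℕ} {σ : ℝ} (hσ : 0 < σ) (hσ1 : σ ≤ 1) {c : ι → ℂ}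
    (h : ∀ i, c i = 0 ∨ n ≤ 5 * (e i).1 + 3 * (e i).2 - 8) : ‖dilCoeff e σ c‖ ≤ ‖c‖ * σ ^ n := by
  refine (pi_norm_le_iff_of_nonneg (by positivity)).2 fun i => ?_
  rcases h i with h | h
  · rw [dilCoeff, h, zero_mul, norm_zero]; positivity
  · rw [dilCoeff, norm_mul, norm_pow, Complex.norm_of_nonneg hσ.le]
    exact mul_le_mul (norm_le_pi_norm c i) (pow_le_pow_of_le_one hσ.le hσ1 h) (by positivity) (norm_nonneg _)

lemma isUniformO_sgrad_polyObs {n : ℕ} {c : ι → ℂ}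
    (h : ∀ i, c i = 0 ∨ n ≤ 5 * (e i).1 + 3 * (e i).2 - 8) :
    IsUniformO n 8 (fun σ p => sgrad (polyObs e (dilCoeff e σ c)) p) := by
  obtain ⟨K, hK0, hK⟩ := exists_bound_polyField e 8
  refine ⟨K * ‖c‖, ?_⟩
  filter_upwards [eventually_small one_pos] with σ hσ p hp
  rw [sgrad_polyObs, mul_assoc]
  exact (hK _ p (ball_subset_closedBall hp)).trans
    (mul_le_mul_of_nonneg_left (norm_dilCoeff_le hσ.1 hσ.2.le h) hK0)

lemma differentiable_sgrad_polyObs (c : ι → ℂ) : Differentiable ℂ (sgrad (polyObs e c)) := by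
  have : sgrad (polyObs e c) = fun p => ∑ i, c i • monoField (e i) p := funext (sgrad_polyObs e c)
  rw [this]
  exact Differentiable.fun_sum fun i _ => (differentiable_monoField _).fun_const_smul _

lemma canonicalPair_sub_eq {H : ℂ² → ℂ} {p q : ℂ²} (h : IsCanonicalPair H p q) :
    q - p = sgrad H (p.1, q.2) := by
  obtain ⟨h1, h2⟩ := h
  ext
  · simp only [Prod.fst_sub, sgrad]; linear_combination h1
  · simp only [Prod.snd_sub, sgrad]; linear_combination -h2

lemma norm_mixed_sub_le (p q : ℂ²) : ‖(p.1, q.2) - p‖ ≤ ‖q - p‖ := by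
  simp only [Prod.norm_def, Prod.fst_sub, Prod.snd_sub, sub_self, norm_zero]
  exact max_le (le_max_of_le_left (norm_nonneg _)) (le_max_right _ _)

lemma eq_of_isUniformO_polyObs {n : ℕ} {c c' : ι → ℂ} (hinj : Function.Injective e) (he : ∀ i, 3 ≤ (e i).1 + (e i).2)
    (h : IsUniformO n 2 (fun σ y => sgrad (polyObs e (dilCoeff e σ c)) y - sgrad (polyObs e (dilCoeff e σ c')) y))
    (i : ι) (hi : 5 * (e i).1 + 3 * (e i).2 - 8 < n) : c i = c' i := by
  obtain ⟨C', hC'⟩ := h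
  rw [← sub_eq_zero]
  refine eq_zero_of_pow_le (C := 4 * C') hi ?_
  filter_upwards [hC', eventually_small one_pos] with σ h1 h2
  have h3 := norm_coeff₂_sub_le le_rfl (differentiable_polyObs e _).differentiableOn
    (differentiable_polyObs e _).differentiableOn (polyObs_zero_of_degree (fun i => by linarith [he i]) _)
    (polyObs_zero_of_degree (fun i => by linarith [he i]) _) h1 (e i).1 (e i).2
  have h4 : ∀ d : ι → ℂ, coeff₂ (e i).1 (e i).2 (polyObs e d) = d i := fun d => by
    rw [coeff₂_polyObs, Finset.sum_eq_single i (fun b _ hb => if_neg fun h => hb (hinj h))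
      (fun h => absurd (Finset.mem_univ i) h)]
    exact if_pos rfl
  rw [h4, h4, dilCoeff, dilCoeff, ← sub_mul, norm_mul, norm_pow, Complex.norm_of_nonneg h2.1.le] at h3
  linarith

/-- The exponents of the leading monomials `w⁴`, `z²w`, `z³w` of a normal form. -/
def leadExp : Fin 3 → ℕ × ℕ := ![(0, 4), (2, 1), (3, 1)]

/-- The Hamiltonian vector field of the dilated observable `a w⁴ + b z²w + c z³w`. -/
def leadField (a b c : ℂ) (σ : ℝ) : ℂ² → ℂ² := sgrad (polyObs leadExp (dilCoeff leadExp σ ![a, b, c]))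

lemma leadField_apply (a b c : ℂ) (σ : ℝ) (p : ℂ²) : leadField a b c σ p = (σ : ℂ) ^ 4 • a • monoField (0, 4) p +
    (σ : ℂ) ^ 5 • b • monoField (2, 1) p + (σ : ℂ) ^ 10 • c • monoField (3, 1) p := by
  rw [leadField, sgrad_polyObs, Fin.sum_univ_three]
  simp only [leadExp, dilCoeff, Matrix.cons_val_zero, Matrix.cons_val_one, Matrix.cons_val]
  norm_num
  module

lemma isUniformO_leadField (a b c : ℂ) : IsUniformO 4 8 (leadField a b c) :=
  isUniformO_sgrad_polyObs fun i => Or.inr (by fin_cases i <;> simp [leadExp])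

/-- The Hamiltonian field of a dilated normal form is given by its leading monomials up to `O(σ⁶)`. -/
lemma isUniformO_sgrad_sub_leadField {a b c : ℂ} {F : ℂ² → ℂ} {C : ℝ} (hF : Holo F (ball 0 1))
    (h : ∀ P ∈ 𝔻 1, ‖F P - polyObs leadExp ![a, b, c] P‖ ≤ C * ‖P‖ ^ 5) :
    (∀ᶠ σ : ℝ in 𝓝₊, Holo (Z[σ] F) (ball 0 8)) ∧ IsUniformO 6 6 (fun σ p => sgrad (Z[σ] F) p - leadField a b c σ p) := by
  have hd : ∀ᶠ σ : ℝ in 𝓝₊, Holo (Z[σ] F) (ball 0 8) := by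
    filter_upwards [eventually_dilation_mem] with σ ⟨h1, h2, h3⟩
    exact (hF.comp (differentiable_diag _ _).differentiableOn h3).mul_const ((σ : ℂ) ^ 5 * (σ : ℂ) ^ 3)⁻¹
  refine ⟨hd, |C| * 8 ^ 5, ?_⟩
  filter_upwards [eventually_dilation_mem, hd] with σ ⟨h1, h2, h3⟩ hd p hp
  have hP := differentiable_polyObs leadExp (dilCoeff leadExp σ ![a, b, c])
  rw [leadField, ← sgrad_sub (hd.at_ball (ball_mono hp)) (hP p)]
  refine (norm_sgrad_le _ p).trans ((norm_fderiv_le_of_bound (c := |C| * 8 ^ 5 * σ ^ 6) (d := 2) (hd.fun_sub hP.differentiableOn)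
    (fun y hy => ?_) (by norm_num) (by linarith [norm_lt hp])).trans_eq (by ring))
  rw [← zoomObs_polyObs (fun i => by fin_cases i <;> simp [leadExp]) h1.ne', zoomObs, zoomObs, ← sub_div, norm_div,
    norm_mul, norm_pow, norm_pow, Complex.norm_of_nonneg h1.le, div_le_iff₀ (by positivity)]
  have h6 : ‖Δ[σ] y‖ ≤ σ ^ 3 * 8 :=
    (norm_dilation_le h1 h2 y).trans (mul_le_mul_of_nonneg_left (norm_lt hy).le (by positivity))
  calc _ ≤ C * ‖Δ[σ] y‖ ^ 5 := h _ (h3 y hy)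
    _ ≤ |C| * (σ ^ 3 * 8) ^ 5 :=
        mul_le_mul (le_abs_self C) (pow_le_pow_left₀ (norm_nonneg _) h6 5) (by positivity) (abs_nonneg _)
    _ = |C| * 8 ^ 5 * σ ^ 14 * σ := by ring
    _ ≤ |C| * 8 ^ 5 * σ ^ 14 * 1 := by gcongr
    _ = _ := by ring

/-- The leading coefficients of a normal form are determined: if `k ∘ θ = θ' ∘ κ`, where `θ`, `θ'`
are the canonical maps of polynomials without low-order common terms, and `k` is the canonical map
of `b₄ w⁴ + b₂ z²w + ⋯`, then `b₄` and `b₂` can be read off the expansion of `κ`. -/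
theorem leading_coefficients_eq {c c' : ι → ℂ} {a₄ a₂ b₄ b₂ b₃ : ℂ} {θ θ' k κ : ℂ² → ℂ²} {F : ℂ² → ℂ} {C : ℝ}
    (hinj : Function.Injective e) (he : ∀ i, 3 ≤ (e i).1 + (e i).2) (he4 : ∀ i, e i ≠ (0, 4))
    (hc0 : ∀ i, c i = 0 → c' i = 0)
    (hlow : ∀ i, e i = (0, 3) ∨ e i = (1, 2) → c i = c' i → c i = 0) (hres : ∀ i, e i = (2, 1) → c i = c' i)
    (hθ : Holo θ (ball 0 1)) (hθ2 : ∀ P ∈ 𝔻 1, ‖θ P - P‖ ≤ ‖P‖ ^ 2)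
    (hθp : ∀ P ∈ 𝔻 1, IsCanonicalPair (polyObs e c) P (θ P))
    (hθ' : Holo θ' (ball 0 1)) (hθ2' : ∀ P ∈ 𝔻 1, ‖θ' P - P‖ ≤ ‖P‖ ^ 2)
    (hθp' : ∀ P ∈ 𝔻 1, IsCanonicalPair (polyObs e c') P (θ' P))
    (hk : Holo k (ball 0 1)) (hk2 : ∀ P ∈ 𝔻 1, ‖k P - P‖ ≤ ‖P‖ ^ 2)
    (hF : Holo F (ball 0 1)) (hkp : ∀ P ∈ 𝔻 1, IsCanonicalPair F P (k P))
    (hF5 : ∀ P ∈ 𝔻 1, ‖F P - polyObs leadExp ![b₄, b₂, b₃] P‖ ≤ C * ‖P‖ ^ 5)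
    (hκ : IsUniformO 6 8 (fun σ p => conjDil σ κ p - p - leadField a₄ a₂ 0 σ p))
    (hconj : ∀ P ∈ 𝔻 1, k (θ P) = θ' (κ P)) : b₄ = a₄ ∧ b₂ = a₂ := by
  have hκ4 : IsUniformO 4 8 (fun σ p => conjDil σ κ p - p) :=
    ((hκ.mono (by norm_num) le_rfl).add (isUniformO_leadField a₄ a₂ 0)).congr (Eventually.of_forall fun σ p _ => by abel)
  have hθ1 := isUniformO_conjDil hθ2
  have hθ1' := isUniformO_conjDil hθ2'
  have hk1 := isUniformO_conjDil hk2
  have dθ := eventually_differentiableOn_conjDil hθ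
  have dθ' := eventually_differentiableOn_conjDil hθ'
  obtain ⟨hXd, hX⟩ := isUniformO_sgrad_sub_leadField hF hF5
  have hX4 : IsUniformO 4 6 (fun σ p => sgrad (Z[σ] F) p) :=
    ((hX.mono (by norm_num) le_rfl).add ((isUniformO_leadField b₄ b₂ b₃).mono le_rfl (by norm_num))).congr
      (Eventually.of_forall fun σ p _ => by abel)
  -- mixed points `(p₁, (f p)₂)`
  have mixed : ∀ {f : ℂ² → ℂ²}, IsUniformO 1 8 (fun σ p => conjDil σ f p - p) →
      ∀ᶠ σ : ℝ in 𝓝₊, ∀ p ∈ 𝔻 4, (p.1, (conjDil σ f p).2) ∈ 𝔻 5 := by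
    intro f hf
    filter_upwards [hf.eventually_mem (r' := 4) (r'' := 5) le_rfl (by norm_num) (by norm_num)] with σ h p hp
    exact mem_ball_prod.2 ⟨by linarith [norm_lt hp, norm_fst_le p], (norm_snd_le _).trans_lt (norm_lt (h p hp))⟩
  have ball_id : ∀ {r r' : ℝ}, r ≤ r' → ∀ᶠ σ : ℝ in 𝓝₊, ∀ p ∈ 𝔻 r, p ∈ 𝔻 r' :=
    fun h => Eventually.of_forall fun σ p hp => ball_subset_ball h hp
  have hkpair : ∀ᶠ σ : ℝ in 𝓝₊, ∀ p ∈ 𝔻 4, conjDil σ k p - p = sgrad (Z[σ] F) (p.1, (conjDil σ k p).2) := by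
    filter_upwards [eventually_dilation_mem, mixed hk1] with σ ⟨h1, h2, h3⟩ h4 p hp
    exact canonicalPair_sub_eq (IsCanonicalPair.conjDil h1.ne' (hF.at_ball (h3 _ (ball_mono (h4 p hp))))
      (hkp _ (h3 p (ball_mono hp))))
  have hk4 : IsUniformO 4 4 (fun σ p => conjDil σ k p - p) := hX4.of_norm_le (by
    filter_upwards [hkpair, mixed hk1] with σ h2 h3 p hp using ⟨_, ball_mono (h3 p hp), (congrArg norm (h2 p hp)).le⟩)
  have hk6 : IsUniformO 6 4 (fun σ p => conjDil σ k p - p - leadField b₄ b₂ b₃ σ p) := by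
    have h1 := hX4.comp_sub (hXd.mono fun σ h => differentiableOn_sgrad
      (h.mono (ball_subset_ball (by norm_num : (6 : ℝ) ≤ 8))) isOpen_ball) (hk4.of_norm_le (r' := 4)
      (Eventually.of_forall fun σ p hp => ⟨p, hp, norm_mixed_sub_le p (conjDil σ k p)⟩))
      (by norm_num : (5 : ℝ) < 6) (mixed hk1) (ball_id (by norm_num))
    refine ((h1.mono (by norm_num : 6 ≤ 4 + 4) le_rfl).add (hX.mono le_rfl (by norm_num : (4 : ℝ) ≤ 6))).congr ?_
    filter_upwards [hkpair] with σ h p hp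
    rw [← h p hp]; abel
  -- the canonical maps `θ` and `θ'`
  have hconjσ : ∀ᶠ σ : ℝ in 𝓝₊, ∀ p ∈ 𝔻 4, conjDil σ k (conjDil σ θ p) = conjDil σ θ' (conjDil σ κ p) := by
    filter_upwards [eventually_dilation_mem] with σ ⟨h1, h2, h3⟩ p hp
    have h4 := hconj _ (h3 p (ball_mono hp))
    rw [conjDil, diag_conjDil h1.ne', h4, ← diag_conjDil (f := κ) h1.ne', ← conjDil]
  have pairσ : ∀ {f : ℂ² → ℂ²} {d : ι → ℂ}, (∀ P ∈ 𝔻 1, IsCanonicalPair (polyObs e d) P (f P)) →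
      ∀ᶠ σ : ℝ in 𝓝₊, ∀ p ∈ 𝔻 4, IsCanonicalPair (polyObs e (dilCoeff e σ d)) p (conjDil σ f p) := by
    intro f d hf
    filter_upwards [eventually_dilation_mem] with σ ⟨h1, h2, h3⟩ p hp
    rw [← zoomObs_polyObs he h1.ne']
    exact IsCanonicalPair.conjDil h1.ne' (differentiable_polyObs _ _ _) (hf _ (h3 p (ball_mono hp)))
  have pθ := pairσ hθp
  have pθ' := pairσ hθp'
  have hdiff : IsUniformO 4 3 (fun σ p => conjDil σ θ p - conjDil σ θ' p) := by
    have h1 : IsUniformO 4 3 (fun σ p => conjDil σ k (conjDil σ θ p) - conjDil σ θ p) := hk4.of_norm_le (by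
      filter_upwards [hθ1.eventually_mem (r' := 3) (r'' := 4) le_rfl (by norm_num) (by norm_num)] with σ h p hp
        using ⟨_, h p hp, le_rfl⟩)
    have h2 := hθ1'.comp_sub (dθ'.mono fun σ h => h.sub differentiableOn_id) (hκ4.mono le_rfl (by norm_num : (3 : ℝ) ≤ 8))
      (by norm_num : (4 : ℝ) < 8) (hκ4.eventually_mem (by norm_num) (by norm_num) (by norm_num)) (ball_id (by norm_num))
    refine ((h2.mono (by norm_num : 4 ≤ 1 + 4) le_rfl).add ((hκ4.mono le_rfl (by norm_num : (3 : ℝ) ≤ 8)).sub h1)).congr ?_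
    filter_upwards [hconjσ] with σ h p hp
    rw [h p (ball_mono hp)]; abel
  have hgrad : IsUniformO 4 2 (fun σ y => sgrad (polyObs e (dilCoeff e σ c)) y - sgrad (polyObs e (dilCoeff e σ c')) y) := by
    have hg := isUniformO_sgrad_polyObs (e := e) (n := 1) (c := c') fun i => Or.inr (by have := he i; omega)
    have h1 := hg.comp_sub (g := fun σ p => (p.1, (conjDil σ θ' p).2)) (h := fun σ p => (p.1, (conjDil σ θ p).2))
      (Eventually.of_forall fun σ => (differentiable_sgrad_polyObs _).differentiableOn) (n' := 4) (r' := 3) (r'' := 5)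
      (hdiff.of_norm_le (Eventually.of_forall fun σ p hp => ⟨p, hp, by
        rw [← norm_neg, Prod.mk_sub_mk, sub_self, Prod.neg_mk, neg_zero, neg_sub, Prod.norm_mk, norm_zero,
          max_eq_right (norm_nonneg _)]
        exact norm_snd_le (conjDil σ θ p - conjDil σ θ' p)⟩)) (by norm_num)
      ((mixed hθ1').mono fun σ h p hp => h p (ball_mono hp)) ((mixed hθ1).mono fun σ h p hp => h p (ball_mono hp))
    refine ((h1.mono (by norm_num : 4 ≤ 1 + 4) le_rfl).add hdiff).of_norm_le ?_
    filter_upwards [hθ1.eventually_le le_rfl (ε := 1 / 8) (by norm_num), dθ, pθ, pθ'] with σ h3 h4 h5 h6 y hy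
    -- every point of the smaller ball is a mixed point of `θ`
    obtain ⟨W, -, hW, -⟩ := exists_partial_inverse (Q := ℂ) (U := univ) isOpen_univ (k := fun x => conjDil σ θ x.2) (R := 3)
      (c := 1 / 8) (d := 1 / 2)
      ((h4.mono ball_le).comp differentiableOn_snd fun x hx => hx.2)
      (fun _ _ p hp => h3 p (ball_mono hp)) (by norm_num) (by norm_num)
    obtain ⟨h9, h10⟩ := hW 0 (mem_univ _) y (by convert hy using 2; norm_num)
    set p : ℂ² := (y.1, W (0, y)) with hp
    have hp4 : p ∈ 𝔻 4 := ball_mono h9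
    have e1 := canonicalPair_sub_eq (h5 p hp4)
    have e2 := canonicalPair_sub_eq (h6 p hp4)
    have e3 : (p.1, (conjDil σ θ p).2) = y := Prod.ext rfl h10
    refine ⟨p, ball_mono h9, (congrArg norm ?_).le⟩
    rw [← e2, e3]
    rw [e3] at e1
    rw [← e1]; abel
  -- the coefficients of weight less than four vanish
  have hlow0 : ∀ i, e i = (0, 3) ∨ e i = (1, 2) → c i = 0 := fun i hi =>
    hlow i hi (eq_of_isUniformO_polyObs hinj he hgrad i (by rcases hi with h | h <;> rw [h] <;> norm_num))
  have hw : ∀ i, e i = (0, 3) ∨ e i = (1, 2) ∨ e i = (2, 1) ∨ 6 ≤ 5 * (e i).1 + 3 * (e i).2 - 8 := fun i => by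
    have h1 := he i
    have h2 := he4 i
    rcases h3 : e i with ⟨k, l⟩
    rw [h3] at h1 h2
    simp only [ne_eq, Prod.mk.injEq] at h2 ⊢
    omega
  have hw5 : ∀ i, c i = 0 ∨ 5 ≤ 5 * (e i).1 + 3 * (e i).2 - 8 := fun i => by
    rcases hw i with h | h | h | h
    · exact Or.inl (hlow0 i (Or.inl h))
    · exact Or.inl (hlow0 i (Or.inr h))
    · right; rw [h]; norm_num
    · right; omega
  have hw5' : ∀ i, c' i = 0 ∨ 5 ≤ 5 * (e i).1 + 3 * (e i).2 - 8 := fun i => (hw5 i).imp_left (hc0 i)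
  have hw6 : ∀ i, c' i - c i = 0 ∨ 6 ≤ 5 * (e i).1 + 3 * (e i).2 - 8 := fun i => by
    rcases hw i with h | h | h | h
    · left; rw [hc0 i (hlow0 i (Or.inl h)), hlow0 i (Or.inl h), sub_zero]
    · left; rw [hc0 i (hlow0 i (Or.inr h)), hlow0 i (Or.inr h), sub_zero]
    · left; rw [hres i h, sub_self]
    · exact Or.inr h
  have hO5 : ∀ {f : ℂ² → ℂ²} {d : ι → ℂ}, (∀ i, d i = 0 ∨ 5 ≤ 5 * (e i).1 + 3 * (e i).2 - 8) →
      IsUniformO 1 8 (fun σ p => conjDil σ f p - p) →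
      (∀ᶠ σ : ℝ in 𝓝₊, ∀ p ∈ 𝔻 4, IsCanonicalPair (polyObs e (dilCoeff e σ d)) p (conjDil σ f p)) →
      IsUniformO 5 4 (fun σ p => conjDil σ f p - p) := fun hd hf hp => (isUniformO_sgrad_polyObs hd).of_norm_le (by
    filter_upwards [hp, mixed hf] with σ h2 h3 p hp
      using ⟨_, ball_mono (h3 p hp), (congrArg norm (canonicalPair_sub_eq (h2 p hp))).le⟩)
  have hdiff6 : IsUniformO 6 4 (fun σ p => conjDil σ θ' p - conjDil σ θ p) := by
    obtain ⟨C₃, h3⟩ := isUniformO_sgrad_polyObs hw6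
    refine ⟨2 * C₃, ?_⟩
    filter_upwards [(isUniformO_sgrad_polyObs hw5).eventually_le (by norm_num) one_pos,
      (isUniformO_sgrad_polyObs hw5').eventually_le (by norm_num) (by norm_num : (0 : ℝ) < 1 / 4), h3, pθ, pθ', mixed hθ1,
      mixed hθ1'] with σ h1 h2 h3 h4 h5 h6 h7 p hp
    have := (canonicalPair_compare (differentiable_polyObs e _).differentiableOn (differentiable_polyObs e _).differentiableOn
      h1 h2 (k := C₃ * σ ^ 6) (fun y hy => by
        refine le_trans (le_of_eq ?_) (h3 y hy)
        rw [sgrad_polyObs_sub, sgrad_polyObs]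
        congr 1
        exact Finset.sum_congr rfl fun i _ => by rw [dilCoeff, dilCoeff, dilCoeff, sub_mul]) one_pos (by norm_num)
      (by linarith [norm_lt hp]) (by linarith [norm_lt (h6 p hp)]) (by linarith [norm_lt (h7 p hp)]) (h4 p hp) (h5 p hp)).1
    linarith
  -- comparison of `k` with `κ`
  have hfinal : IsUniformO 6 2 (fun σ p => leadField b₄ b₂ b₃ σ p - leadField a₄ a₂ 0 σ p) := by
    have h1 := hk1.comp_sub (g := fun σ p => conjDil σ θ p) (h := fun σ p => p)
      ((eventually_differentiableOn_conjDil hk).mono fun σ h => h.sub differentiableOn_id)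
      ((hO5 hw5 hθ1 pθ).mono le_rfl (by norm_num : (2 : ℝ) ≤ 4))
      (by norm_num : (4 : ℝ) < 8) (hθ1.eventually_mem le_rfl (by norm_num) (by norm_num)) (ball_id (by norm_num))
    have h2 := (hO5 hw5' hθ1' pθ').comp_sub (g := fun σ p => conjDil σ κ p) (h := fun σ p => p)
      (dθ'.mono fun σ h => (h.sub differentiableOn_id).mono ball_le)
      (hκ4.mono le_rfl (by norm_num : (2 : ℝ) ≤ 8))
      (by norm_num : (3 : ℝ) < 4) (hκ4.eventually_mem (by norm_num) (by norm_num) (by norm_num)) (ball_id (by norm_num))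
    have h3 := ((h2.mono (by norm_num : 6 ≤ 5 + 4) le_rfl).sub (h1.mono (by norm_num : 6 ≤ 1 + 5) le_rfl)).add
      (hdiff6.mono le_rfl (by norm_num : (2 : ℝ) ≤ 4))
    refine ((h3.sub (hk6.mono le_rfl (by norm_num))).add (hκ.mono le_rfl (by norm_num))).congr ?_
    filter_upwards [hconjσ] with σ h p hp
    rw [h p (ball_mono hp)]; abel
  have hlead := eq_of_isUniformO_polyObs (e := leadExp) (by decide) (by decide) hfinal
  exact ⟨hlead 0 (by decide), hlead 1 (by decide)⟩

end Exactness

/-! ### Tangency to the identity of polynomial canonical maps -/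

section TangentFamilies

lemma norm_monoField_le (e : ℕ × ℕ) (p : ℂ²) :
    ‖monoField e p‖ ≤ (e.1 + e.2) * ‖p‖ ^ (e.1 + e.2 - 1) := by
  have h1 := norm_fst_le p
  have h2 := norm_snd_le p
  have key : ∀ k l : ℕ, ‖p.1‖ ^ k * ‖p.2‖ ^ l ≤ ‖p‖ ^ (k + l) := fun k l => by
    rw [pow_add]; gcongr
  rw [monoField, Prod.norm_mk, norm_neg]
  refine max_le ?_ ?_
  · rcases Nat.eq_zero_or_pos e.2 with h | h
    · rw [h]; simp; positivity
    · rw [norm_mul, norm_mul, norm_pow, norm_pow, Complex.norm_natCast, mul_assoc, Nat.add_sub_assoc h]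
      refine mul_le_mul ?_ (key _ _) (by positivity) (by positivity)
      linarith [(Nat.cast_nonneg e.1 : (0 : ℝ) ≤ e.1)]
  · rcases Nat.eq_zero_or_pos e.1 with h | h
    · rw [h]; simp; positivity
    · rw [norm_mul, norm_mul, norm_pow, norm_pow, Complex.norm_natCast, mul_assoc,
        show e.1 + e.2 - 1 = e.1 - 1 + e.2 by omega]
      refine mul_le_mul ?_ (key _ _) (by positivity) (by positivity)
      linarith [(Nat.cast_nonneg e.2 : (0 : ℝ) ≤ e.2)]

variable {ι : Type*} [Fintype ι] {e : ι → ℕ × ℕ}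

lemma exists_sgrad_polyObs_sq (he : ∀ i, 3 ≤ (e i).1 + (e i).2) (c : ι → ℂ) :
    ∃ K, 0 ≤ K ∧ ∀ y : ℂ², ‖y‖ ≤ 1 → ‖sgrad (polyObs e c) y‖ ≤ K * ‖y‖ ^ 2 := by
  refine ⟨∑ i, ‖c i‖ * ((e i).1 + (e i).2), Finset.sum_nonneg fun i _ => by positivity, fun y hy => ?_⟩
  rw [sgrad_polyObs, Finset.sum_mul]
  refine (norm_sum_le _ _).trans (Finset.sum_le_sum fun i _ => ?_)
  rw [norm_smul, mul_assoc]
  refine mul_le_mul_of_nonneg_left ((norm_monoField_le _ _).trans ?_) (norm_nonneg _)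
  refine mul_le_mul_of_nonneg_left (pow_le_pow_of_le_one (norm_nonneg _) hy ?_) (by positivity)
  have := he i; omega

/-- The canonical map of an observable of order three is tangent to the identity. -/
lemma isTangentId_of_pair {H : ℂ² → ℂ} {f : ℂ² → ℂ²} {K : ℝ} (hK : 0 ≤ K) (hf : HoloAt f 0)
    (hf0 : f 0 = 0) (hp : ∀ᶠ p in 𝓝 0, IsCanonicalPair H p (f p))
    (hH : ∀ y : ℂ², ‖y‖ ≤ 1 → ‖sgrad H y‖ ≤ K * ‖y‖ ^ 2) : IsTangentId f := by
  refine ⟨hf0, ?_⟩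
  obtain ⟨c, hc⟩ := hf.hasFDerivAt.isBigO_sub.bound
  have hmix : Tendsto (fun p : ℂ² => (p.1, (f p).2)) (𝓝 0) (𝓝 0) := by
    have : ContinuousAt (fun p : ℂ² => (p.1, (f p).2)) 0 := continuousAt_fst.prodMk hf.continuousAt.snd
    have e : ((0 : ℂ²).1, (f 0).2) = (0 : ℂ²) := by rw [hf0]
    rwa [ContinuousAt, e] at this
  have h1 : ∀ᶠ p in 𝓝 (0 : ℂ²), ‖(p.1, (f p).2)‖ < 1 := by
    simpa using hmix.norm.eventually (gt_mem_nhds (by simp : ‖(0 : ℂ²)‖ < 1))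
  rw [hasFDerivAt_iff_isLittleO_nhds_zero]
  have h2 : (fun h => f (0 + h) - f 0 - ContinuousLinearMap.id ℂ ℂ² h) =O[𝓝 0] fun h => ‖h‖ ^ 2 := by
    refine Asymptotics.IsBigO.of_bound (K * (1 + |c|) ^ 2) ?_
    filter_upwards [hp, h1, hc] with p h3 h4 h5
    rw [zero_add, hf0, sub_zero, ContinuousLinearMap.coe_id', id, canonicalPair_sub_eq h3]
    refine (hH _ h4.le).trans ?_
    rw [norm_pow, norm_norm, mul_assoc, ← mul_pow]
    gcongr
    rw [hf0, sub_zero, sub_zero] at h5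
    have h6 : ‖f p‖ ≤ |c| * ‖p‖ := h5.trans (mul_le_mul_of_nonneg_right (le_abs_self c) (norm_nonneg _))
    have h7 : 0 ≤ |c| * ‖p‖ := by positivity
    rw [Prod.norm_mk]
    exact max_le (by linarith [norm_fst_le p]) (by linarith [norm_snd_le (f p), norm_nonneg p])
  exact h2.trans_isLittleO (by simpa using Asymptotics.isLittleO_norm_pow_id (E' := ℂ²) one_lt_two)

variable {R r : ℝ} {θ ϑ : (ι → ℂ) × ℂ² → ℂ²}

lemma PolyFamily.isTangentId (h : PolyFamily e R r θ ϑ) (hR : 4 < R) (he : ∀ i, 3 ≤ (e i).1 + (e i).2) {c : ι → ℂ}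
    (hc : c ∈ ball (0 : ι → ℂ) r) : IsTangentId (fun p => θ (c, p)) ∧ IsTangentId (fun p => ϑ (c, p)) := by
  obtain ⟨K, hK0, hK⟩ := exists_sgrad_polyObs_sq he c
  have h0 : ∀ {x : ℝ}, 0 < x → (0 : ℂ²) ∈ 𝔻 x := fun h => mem_ball_self h
  have hθ0 : θ (c, 0) = 0 := by
    refine (h.unique c hc 0 (h0 (by linarith)) 0 (h0 (by linarith)) ?_).symm
    have h1 : sgrad (polyObs e c) (0, 0) = 0 := by
      have := hK 0 (by simp)
      rw [norm_zero, zero_pow two_ne_zero, mul_zero] at this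
      exact norm_le_zero_iff.1 this
    rw [sgrad, Prod.mk_eq_zero, neg_eq_zero] at h1
    refine ⟨?_, ?_⟩
    · simp [h1.1]
    · simp [h1.2]
  have hd : HoloAt (fun p => θ (c, p)) 0 := by
    have : Holo (fun p => θ (c, p)) (ball 0 (R - 2)) :=
      h.holo.comp (f := fun p => (c, p)) (by fun_prop) fun p hp => ⟨hc, hp⟩
    exact this.at_ball (h0 (by linarith))
  have ht : IsTangentId (fun p => θ (c, p)) := isTangentId_of_pair hK0 hd hθ0
    (by filter_upwards [isOpen_ball.mem_nhds (h0 (by linarith : 0 < R - 2))] with p hp using (h.pair c hc p hp).2.1) hK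
  refine ⟨ht, ?_⟩
  have hϑ0 : ϑ (c, 0) = 0 := by
    have := h.left_inv c hc 0 (h0 (by linarith)) (by rw [hθ0]; exact h0 (by linarith))
    rwa [hθ0] at this
  have hd' : HoloAt (fun p => ϑ (c, p)) 0 := by
    have : Holo (fun p => ϑ (c, p)) (ball 0 (R - 4)) :=
      h.inv_holo.comp (f := fun p => (c, p)) (by fun_prop) fun p hp => ⟨hc, hp⟩
    exact this.at_ball (h0 (by linarith))
  refine ⟨hϑ0, ?_⟩
  have h1 : HasFDerivAt (fun p => θ (c, p)) (ContinuousLinearMap.id ℂ ℂ²) (ϑ (c, 0)) := by rw [hϑ0]; exact ht.2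
  have h2 := h1.comp (0 : ℂ²) hd'.hasFDerivAt
  rw [ContinuousLinearMap.id_comp] at h2
  have h3 : HasFDerivAt (fun p : ℂ² => p) (fderiv ℂ (fun p => ϑ (c, p)) 0) 0 :=
    h2.congr_of_eventuallyEq (by
      filter_upwards [isOpen_ball.mem_nhds (h0 (by linarith : 0 < R - 4))] with p hp using (h.right_inv c hc p hp).symm)
  have h4 := h3.unique (hasFDerivAt_id (0 : ℂ²))
  rw [← h4]
  exact hd'.hasFDerivAt

lemma coeff₂_eq_zero_of_cube {F : ℂ² → ℂ} {R A : ℝ} (hR : 0 < R) (hF : Holo F (ball 0 R))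
    (h : ∀ y ∈ 𝔻 R, ‖F y‖ ≤ A * ‖y‖ ^ 3) {k l : ℕ} (hkl : k + l < 3) : coeff₂ k l F = 0 := by
  refine eq_zero_of_pow_le (n := 3) (k := k + l) (C := |A| * 2 ^ (k + l)) hkl ?_
  filter_upwards [eventually_small hR] with σ hσ
  have h1 := norm_coeff₂_le (k := k) (l := l) (B := |A| * σ ^ 3) hσ.1 (hF.mono (ball_subset_ball hσ.2.le)) fun y hy => by
    refine (h y (ball_subset_ball hσ.2.le hy)).trans ?_
    exact mul_le_mul (le_abs_self A) (pow_le_pow_left₀ (norm_nonneg _) (norm_lt hy).le 3) (by positivity)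
      (abs_nonneg _)
  have h2 : 0 < σ ^ (k + l) := pow_pos hσ.1 _
  rw [div_pow, mul_div_assoc', le_div_iff₀ h2] at h1
  linarith

end TangentFamilies

/-! ### Normal forms and their Taylor expansion -/

section NormalForm

variable {m : ℕ}

lemma sum_eq_normalForm (hm : 1 ≤ m) {f : ℕ → ℕ → ℂ} (hlow : ∀ k l, k + l < 3 → f k l = 0)
    (hbad : ∀ e ∈ badExp m, f e.1 e.2 = 0) :
    ∑ k ∈ Finset.range (3 * m + 2), ∑ l ∈ Finset.range (3 * m + 2 - k), f k l =
      f 2 1 + f 0 4 + ∑ k ∈ Finset.Icc 3 (3 * m), f k 1 + ∑ n ∈ Finset.Icc 2 m, f 0 (3 * n + 1) := by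
  set N := 3 * m + 2 with hN
  have hz : ∀ k l, k + l < N → l ≠ 1 → (k ≠ 0 ∨ l % 3 ≠ 1) → f k l = 0 := by
    intro k l h1 h2 h3
    by_cases h4 : k + l < 3
    · exact hlow k l h4
    · refine hbad (k, l) (mem_badExp.2 ⟨by simp only; omega, by simp only; omega, ?_⟩)
      simp only; omega
  have h1 : ∀ k ∈ Finset.range (3 * m + 1), ∑ l ∈ Finset.range (N - (k + 1)), f (k + 1) l = if k = 3 * m then 0 else f (k + 1) 1 := by
    intro k hk
    rw [Finset.mem_range] at hk
    split_ifs with h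
    · exact Finset.sum_eq_zero fun l hl => by
        rw [Finset.mem_range] at hl
        exact hz _ _ (by omega) (by omega) (Or.inl (by omega))
    · exact Finset.sum_eq_single 1 (fun l hl hl1 => hz _ _ (by rw [Finset.mem_range] at hl; omega) hl1 (Or.inl (by omega)))
        fun h' => absurd (Finset.mem_range.2 (by omega)) h'
  have h0 : ∑ l ∈ Finset.range N, f 0 l = ∑ n ∈ Finset.Icc 1 m, f 0 (3 * n + 1) := by
    have h2 : ∑ n ∈ Finset.Icc 1 m, f 0 (3 * n + 1) = ∑ l ∈ (Finset.Icc 1 m).image (fun n => 3 * n + 1), f 0 l := by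
      rw [Finset.sum_image]
      intro a _ b _ hab
      simp only at hab; omega
    rw [h2]
    symm
    refine Finset.sum_subset (fun l hl => ?_) fun l hl hl' => ?_
    · obtain ⟨n, hn, rfl⟩ := Finset.mem_image.1 hl
      rw [Finset.mem_Icc] at hn
      exact Finset.mem_range.2 (by omega)
    · rw [Finset.mem_range] at hl
      by_cases h3 : l = 1
      · rw [h3]; exact hlow 0 1 (by norm_num)
      · refine hz 0 l (by omega) h3 (Or.inr fun h4 => hl' ?_)
        exact Finset.mem_image.2 ⟨l / 3, Finset.mem_Icc.2 ⟨by omega, by omega⟩, by omega⟩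
  rw [hN, Finset.sum_range_succ', ← hN, Nat.sub_zero, h0, Finset.sum_congr rfl h1, Finset.sum_range_succ, if_pos rfl, add_zero]
  have h2 : ∑ k ∈ Finset.range (3 * m), (if k = 3 * m then 0 else f (k + 1) 1) = ∑ k ∈ Finset.Icc 1 (3 * m), f k 1 := by
    rw [Finset.range_eq_Ico, Finset.sum_congr rfl fun k hk => if_neg (by rw [Finset.mem_Ico] at hk; omega),
      Finset.sum_Ico_add' (fun k => f k 1) 0 (3 * m) 1]
    rfl
  have h3 : ∑ k ∈ Finset.Icc 1 (3 * m), f k 1 = f 2 1 + ∑ k ∈ Finset.Icc 3 (3 * m), f k 1 := by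
    rw [← Finset.add_sum_Ioc_eq_sum_Icc (by omega), ← Finset.Icc_add_one_left_eq_Ioc,
      ← Finset.add_sum_Ioc_eq_sum_Icc (by omega), ← Finset.Icc_add_one_left_eq_Ioc, hlow 1 1 (by norm_num), zero_add]
    rfl
  have h4 : ∑ n ∈ Finset.Icc 1 m, f 0 (3 * n + 1) = f 0 4 + ∑ n ∈ Finset.Icc 2 m, f 0 (3 * n + 1) := by
    rw [← Finset.add_sum_Ioc_eq_sum_Icc hm, ← Finset.Icc_add_one_left_eq_Ioc]
    rfl
  rw [h2, h3, h4]
  ring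

/-- The terms of the normal form. -/
def normalTerms (m : ℕ) (b₂₁ b₀₄ : ℂ) (b c : ℕ → ℂ) (p : ℂ²) : ℂ :=
  b₂₁ * p.1 ^ 2 * p.2 + b₀₄ * p.2 ^ 4 + ∑ k ∈ Finset.Icc 3 (3 * m), b k * p.1 ^ k * p.2
    + ∑ n ∈ Finset.Icc 2 m, c n * p.2 ^ (3 * n + 1)

/-- The observable `F` is in resonant normal form on the ball of radius `r`, with constants `C`, `η`. -/
def HasNormalForm (m : ℕ) (C η r : ℝ) (F : ℂ² → ℂ) : Prop :=
  ∃ (b₂₁ b₀₄ : ℂ) (b c : ℕ → ℂ),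
    ‖b₂₁ - I * (1 / √3 : ℝ)‖ ≤ C * η ∧
    ‖b₀₄ - I * (-(2 / 3) * (1 / √3) : ℝ) / 4‖ ≤ C * η ∧
    (∀ k ∈ Finset.Icc 3 (3 * m), ‖b k‖ ≤ C) ∧
    (∀ n ∈ Finset.Icc 2 m, ‖c n‖ ≤ C) ∧
    ∀ p ∈ 𝔻 r, ‖F p - normalTerms m b₂₁ b₀₄ b c p‖ ≤ C * ‖p‖ ^ (3 * m + 2)

lemma norm_sub_normalTerms_le (hm : 1 ≤ m) {F : ℂ² → ℂ} {R B : ℝ} (hF : Holo F (ball 0 R))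
    (hb : ∀ p ∈ 𝔻 R, ‖F p‖ ≤ B) (hlow : ∀ k l, k + l < 3 → coeff₂ k l F = 0)
    (hbad : ∀ e ∈ badExp m, coeff₂ e.1 e.2 F = 0) {p : ℂ²} (hp : p ∈ 𝔻 R) :
    ‖F p - normalTerms m (coeff₂ 2 1 F) (coeff₂ 0 4 F) (fun k => coeff₂ k 1 F)
      (fun n => coeff₂ 0 (3 * n + 1) F) p‖ ≤ B * (2 ^ (3 * m + 2) * ((3 * m + 2 : ℕ) + 1)) * (‖p‖ / R) ^ (3 * m + 2) := by
  have h := norm_sub_taylor₂_le (3 * m + 2) hF hb hp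
  rw [sum_eq_normalForm hm (f := fun k l => coeff₂ k l F * p.1 ^ k * p.2 ^ l)
    (fun k l hkl => by rw [hlow k l hkl]; ring) (fun e he => by rw [hbad e he]; ring)] at h
  simpa only [normalTerms, pow_one, pow_zero, mul_one] using h

end NormalForm

/-! ### Leading coefficients at the exact resonance -/

section ExactResonance

variable {m : ℕ} {θ ϑ : Coeffs m × ℂ² → ℂ²} {r A B s L : ℝ}
  {t : ℂ² → Coeffs m} {F : ℂ² → ℂ² → ℂ}

lemma genExp_injective : Function.Injective (genExps (m := m)) := by
  intro i i' h
  have h1 := (mem_badExp.1 i.2).2.2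
  have h2 := (mem_badExp.1 i'.2).2.2
  simp only [genExps, genExp] at h
  refine Subtype.ext (Prod.ext ?_ ?_) <;> split_ifs at h <;> simp only [Prod.ext_iff] at h <;> omega

lemma genExps_degree (i : badExp m) : 3 ≤ (genExps i).1 + (genExps i).2 := genExp_degree i.2

lemma genExps_ne (i : badExp m) : genExps i ≠ (0, 4) := by
  have h1 := (mem_badExp.1 i.2).2.2
  intro h
  simp only [genExps, genExp] at h
  split_ifs at h <;> simp only [Prod.ext_iff] at h <;> omega

lemma genCoeffConj_eq (s : ℂ) (q : ℂ²) (t : Coeffs m) (i : badExp m) :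
    genCoeffConj s q t i = multiplier q (genExps i) * genCoeff s t i := by
  rw [genCoeffConj, genCoeff, genExps]; ring

lemma IsNormalizedFamily.mem_ball (hN : IsNormalizedFamily θ ϑ s L t F) {q : ℂ²} (hq : q ∈ 𝔻 1) :
    (q, t q) ∈ ball (0 : Param m) 2 := by
  rw [mem_ball_zero_iff, Prod.norm_mk, max_lt_iff]
  exact ⟨(norm_lt hq).trans (by norm_num), (hN.norm_le q hq).trans_lt (by norm_num)⟩

lemma isTangentId_conjFamily (hP : PolyFamily genExps 20 r θ ϑ) (hFB : FamilyBounds θ ϑ r A s B)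
    {x : Param m} (hx : x ∈ ball (0 : Param m) 2) :
    IsTangentId (fun p => conjFamily θ ϑ s (x, p)) := by
  obtain ⟨h1, h2⟩ := hFB.coeff_mem x hx
  have h3 := (hP.isTangentId (by norm_num) genExps_degree h2).1
  have h4 := (hP.isTangentId (by norm_num) genExps_degree h1).2
  have h5 := isTangentId_prelimHenon s ((s : ℂ) ^ 6 • x.1)
  exact h3.comp (h5.comp h4)

lemma IsNormalizedFamily.quadratic (hP : PolyFamily genExps 20 r θ ϑ) (hFB : FamilyBounds θ ϑ r A s B)
    (hN : IsNormalizedFamily θ ϑ s L t F) {q : ℂ²} (hq : q ∈ 𝔻 1) :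
    Holo (fun p => conjFamily θ ϑ s ((q, t q), p)) (ball 0 14) ∧
    (∀ p ∈ 𝔻 14, ‖conjFamily θ ϑ s ((q, t q), p) - p‖ ≤ 1 / 196 * ‖p‖ ^ 2) ∧
    ∀ y ∈ 𝔻 12, ‖F q y‖ ≤ ‖y‖ ^ 3 := by
  have hx := hN.mem_ball hq
  have hd : Holo (fun p => conjFamily θ ϑ s ((q, t q), p)) (ball 0 14) :=
    hFB.holo.comp (f := fun p => ((q, t q), p)) (by fun_prop) fun p hp => ⟨hx, hp⟩
  obtain ⟨h0, h1⟩ := isTangentId_conjFamily hP hFB hx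
  have h2 : ∀ p ∈ 𝔻 14, ‖conjFamily θ ϑ s ((q, t q), p) - p‖ ≤ 1 / 196 * ‖p‖ ^ 2 := fun p hp =>
    (norm_sub_self_le_sq hd (hN.near q hq) h0 h1 (norm_lt hp)).trans_eq (by ring)
  refine ⟨hd, h2, fun y hy => ?_⟩
  have h3 := (generating_norm_le_cube (A := 1 / 196) (r := 13) (by norm_num) (hN.holo q hq) (hN.map_zero q hq)
    (fun p hp => h2 p (ball_mono hp)) (by norm_num) (hN.exists_pair q hq) hy).2
  have : 0 ≤ ‖y‖ ^ 3 := by positivity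
  linarith

lemma IsNormalizedFamily.low (hP : PolyFamily genExps 20 r θ ϑ) (hFB : FamilyBounds θ ϑ r A s B)
    (hN : IsNormalizedFamily θ ϑ s L t F) {q : ℂ²} (hq : q ∈ 𝔻 1) {k l : ℕ} (hkl : k + l < 3) :
    coeff₂ k l (F q) = 0 :=
  coeff₂_eq_zero_of_cube (A := 1) (by norm_num) (hN.holo q hq)
    (fun y hy => by rw [one_mul]; exact (hN.quadratic hP hFB hq).2.2 y hy) hkl

lemma IsNormalizedFamily.norm_obs_le (hP : PolyFamily genExps 20 r θ ϑ) (hFB : FamilyBounds θ ϑ r A s B)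
    (hN : IsNormalizedFamily θ ϑ s L t F) {q : ℂ²} (hq : q ∈ 𝔻 1) :
    ∀ y ∈ 𝔻 12, ‖F q y‖ ≤ 12 ^ 3 := fun y hy =>
  ((hN.quadratic hP hFB hq).2.2 y hy).trans (pow_le_pow_left₀ (norm_nonneg _) (norm_lt hy).le 3)

lemma quarticField_eq (y : ℂ²) : quarticField y = quartic • monoField (0, 4) y := by
  ext <;> simp [monoField, quarticField]; ring

lemma cubicField_eq (y : ℂ²) : cubicField y = henonCoeff 0 • monoField (2, 1) y := by
  ext <;> simp [monoField, cubicField]; ring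

/-- At the exact resonance the two leading coefficients of the normal form are exact. -/
lemma IsNormalizedFamily.exact (hm : 1 ≤ m) (hP : PolyFamily genExps 20 r θ ϑ) (hs : 0 < s)
    (hFB : ∀ s', 0 < s' → s' ≤ s → FamilyBounds θ ϑ r A s' B) (hN : IsNormalizedFamily θ ϑ s L t F) :
    coeff₂ 0 4 (F 0) = (s : ℂ) ^ 4 * quartic ∧ coeff₂ 2 1 (F 0) = (s : ℂ) ^ 5 * henonCoeff 0 := by
  have hq : (0 : ℂ²) ∈ 𝔻 1 := mem_ball_self one_pos
  have hFs := hFB s hs le_rfl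
  have hx := hN.mem_ball hq
  obtain ⟨hc, hc'⟩ := hFs.coeff_mem _ hx
  simp only [smul_zero] at hc hc'
  obtain ⟨hkd, hk2, hF3⟩ := hN.quadratic hP hFs hq
  have hθd : ∀ c ∈ ball (0 : Coeffs m) r, Holo (fun p => θ (c, p)) (ball 0 18) := fun c hc => by
    have := hP.holo
    rw [show (20 : ℝ) - 2 = 18 by norm_num] at this
    exact this.comp (f := fun p => (c, p)) (by fun_prop) fun p hp => ⟨hc, hp⟩
  have hin : ∀ {P : ℂ²} {R : ℝ}, 1 ≤ R → P ∈ 𝔻 1 → P ∈ 𝔻 R :=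
    fun h hP => ball_subset_ball h hP
  have hθ2 : ∀ c ∈ ball (0 : Coeffs m) r, ∀ P ∈ 𝔻 1, ‖θ (c, P) - P‖ ≤ ‖P‖ ^ 2 := fun c hc P hP1 => by
    obtain ⟨h0, h1⟩ := (hP.isTangentId (by norm_num) genExps_degree hc).1
    have := norm_sub_self_le_sq (hθd c hc) (fun p hp => (hP.pair c hc p (by convert hp using 2; norm_num)).2.2) h0 h1
      (norm_lt (hin (by norm_num : (1 : ℝ) ≤ 18) hP1))
    refine this.trans ?_
    have h2 : 0 ≤ ‖P‖ ^ 2 := by positivity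
    rw [div_pow]; linarith
  have hθp : ∀ c ∈ ball (0 : Coeffs m) r, ∀ P ∈ 𝔻 1, IsCanonicalPair (polyObs genExps c) P (θ (c, P)) :=
    fun c hc P hP1 => (hP.pair c hc P (hin (by norm_num) hP1)).2.1
  have hmul : ∀ i : badExp m, genCoeffConj s 0 (t 0) i = jRoot ^ (genExps i).2 / jRoot * genCoeff s (t 0) i := fun i => by
    rw [genCoeffConj_eq, multiplier_zero]
  refine leading_coefficients_eq (e := genExps (m := m)) (c := genCoeff s (t 0)) (c' := genCoeffConj s 0 (t 0))
    (θ := fun p => θ (genCoeff s (t 0), p)) (θ' := fun p => θ (genCoeffConj s 0 (t 0), p))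
    (k := fun p => conjFamily θ ϑ s ((0, t 0), p)) (κ := prelimHenon s 0) (F := F 0) (b₃ := coeff₂ 3 1 (F 0))
    genExp_injective genExps_degree genExps_ne (fun i hi => by rw [hmul, hi, mul_zero]) (fun i hi h => ?_) (fun i hi => ?_)
    ((hθd _ hc).mono ball_le) (hθ2 _ hc) (hθp _ hc)
    ((hθd _ hc').mono ball_le) (hθ2 _ hc') (hθp _ hc')
    (hkd.mono ball_le) (fun P hP1 => ?_) ((hN.holo 0 hq).mono ball_le)
    (fun P hP1 => ?_) (C := 12 ^ 3 * (2 ^ 5 * ((5 : ℕ) + 1))) (fun P hP1 => ?_) ?_ (fun P hP1 => ?_)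
  · rw [hmul] at h
    have h1 : jRoot ^ (genExps i).2 / jRoot - 1 ≠ 0 := fun h2 => by
      have := (jRoot_pow_div_eq_one_iff _).1 h2
      rcases hi with hi | hi <;> rw [hi] at this <;> norm_num at this
    have h3 : (jRoot ^ (genExps i).2 / jRoot - 1) * genCoeff s (t 0) i = 0 := by linear_combination -h
    exact (mul_eq_zero.1 h3).resolve_left h1
  · rw [hmul, hi, pow_one, div_self jRoot_ne_zero, one_mul]
  · refine (hk2 P (hin (by norm_num) hP1)).trans ?_
    have : 0 ≤ ‖P‖ ^ 2 := by positivity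
    linarith
  · have h1 := hN.near 0 hq P (hin (by norm_num) hP1)
    have hP2 := norm_lt hP1
    refine hN.pair 0 hq P (hin (by norm_num) hP1) (mem_ball_prod.2 ⟨?_, ?_⟩)
    · linarith [norm_fst_le P]
    · have := norm_snd_le (conjFamily θ ϑ s ((0, t 0), P))
      have h2 := norm_le_add_sub (conjFamily θ ϑ s ((0, t 0), P)) P
      linarith
  · have h1 := norm_sub_normalTerms_le (m := 1) le_rfl (hN.holo 0 hq) (hN.norm_obs_le hP hFs hq)
      (fun k l hkl => hN.low hP hFs hq hkl)
      (fun e he => hN.bad 0 hq e (by rw [mem_badExp] at he ⊢; omega)) (hin (by norm_num : (1 : ℝ) ≤ 12) hP1)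
    simp only [normalTerms, mul_one, Finset.Icc_self, Finset.sum_singleton] at h1
    rw [Finset.Icc_eq_empty (by norm_num), Finset.sum_empty, add_zero] at h1
    have e : polyObs leadExp ![coeff₂ 0 4 (F 0), coeff₂ 2 1 (F 0), coeff₂ 3 1 (F 0)] P
      = coeff₂ 2 1 (F 0) * P.1 ^ 2 * P.2 + coeff₂ 0 4 (F 0) * P.2 ^ 4 + coeff₂ 3 1 (F 0) * P.1 ^ 3 * P.2 := by
      simp [polyObs, Fin.sum_univ_three, leadExp]; ring
    rw [e]
    refine h1.trans (mul_le_mul_of_nonneg_left (pow_le_pow_left₀ (by positivity) ?_ 5) (by positivity))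
    have := norm_nonneg P
    linarith
  · refine ⟨A * s ^ 6, ?_⟩
    filter_upwards [eventually_small one_pos] with σ hσ p hp
    have h1 := (hFB (s * σ) (mul_pos hs hσ.1) (by nlinarith [hσ.2])).prelim.expansion p (ball_mono hp)
    rw [quarticField_eq, cubicField_eq] at h1
    rw [conjDil_prelimHenon hσ.1.ne', leadField_apply]
    refine le_trans (le_of_eq ?_) (h1.trans_eq (by ring))
    congr 1
    push_cast
    module
  · have h1 := hP.left_inv _ hc P (hin (by norm_num) hP1) (by
      have h2 := hθ2 _ hc P hP1
      have h3 := norm_lt hP1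
      have h4 := norm_le_add_sub (θ (genCoeff s (t 0), P)) P
      rw [mem_ball_zero_iff]
      nlinarith [norm_nonneg P])
    simp only [conjFamily, smul_zero, h1]

end ExactResonance

/-! ### The normalizing germ -/

section Germ

variable {m : ℕ}

/-- `Φ` conjugates the germ at the origin of the Hénon map to its resonant normal form, with
quantitative bounds on the ball of radius `r`. -/
structure IsGerm (m : ℕ) (r C : ℝ) (q : ℂ²) (Φ : ℂ² → ℂ²) (F : ℂ² → ℂ) : Prop where
  holo : Holo Φ (ball 0 r)
  jac_eq : ∀ p ∈ 𝔻 r, jac Φ p = 1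
  quad : ∀ p ∈ 𝔻 r, ‖Φ p - p‖ ≤ C * ‖p‖ ^ 2
  obs_holo : Holo F (ball 0 r)
  pair : ∀ p ∈ 𝔻 r, henonMod (1 / 6 + q.1) (1 / 3 + q.2) p ∈ 𝔻 r →
    IsCanonicalPair F (Φ p) (diag (lam₁ q)⁻¹ (lam₂ q)⁻¹ (Φ (henonMod (1 / 6 + q.1) (1 / 3 + q.2) p)))
  normal : HasNormalForm m C ‖q‖ r F

lemma jac_conj_diag {f : ℂ² → ℂ²} {a b : ℂ} (ha : a ≠ 0) (hb : b ≠ 0) {p : ℂ²}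
    (hf : HoloAt f (diag a b p)) (hj : jac f (diag a b p) = 1) :
    jac (fun p => diag a⁻¹ b⁻¹ (f (diag a b p))) p = 1 := by
  have hd := (differentiable_diag a b).differentiableAt (x := p)
  rw [jac_comp (g := diag a⁻¹ b⁻¹) (f := fun p => f (diag a b p)) (differentiable_diag _ _ _) (hf.comp p hd),
    jac_comp hf hd, jac_diag, jac_diag, hj]
  field_simp

/-- The normalizing germ, uniformly in the parameters: the normalized family at a fixed scale `s`, undilated.
The eigenvalue parameter `q` corresponds to the point `s⁻⁶ q` of the family. -/
theorem exists_germ (hm : 1 ≤ m) : ∃ r C ε : ℝ, 0 < r ∧ 0 ≤ C ∧ 0 < ε ∧ ∀ q ∈ 𝔻 ε,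
    ∃ Φ F, IsGerm m r C q Φ F := by
  obtain ⟨r, hr, θ, ϑ, hP⟩ := exists_polyFamily (genExps (m := m)) 20
  obtain ⟨A, B, s₀, hB, hs₀, hFB₀⟩ := exists_familyBounds hP hr
  obtain ⟨s₁, hs₁, hN₁⟩ := exists_normalizedFamily hB hs₀ hFB₀
  have hlam : ∀ᶠ q in 𝓝 (0 : ℂ²), ‖lam₁ q‖ < 11 / 10 ∧ ‖lam₂ q‖ < 11 / 10 := by
    obtain ⟨h1, h2⟩ := analyticAt_lam 0
    exact (h1.continuousAt.norm.eventually (gt_mem_nhds (by simp only [lam₁_zero]; norm_num))).and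
      (h2.continuousAt.norm.eventually (gt_mem_nhds (by simp only [lam₂_zero, norm_jRoot]; norm_num)))
  obtain ⟨ε, hε, hlam⟩ := Metric.eventually_nhds_iff.1 hlam
  -- one fixed scale; `hFB` keeps all smaller ones, for the exactness of the leading coefficients
  set s := min (min (s₁ / 2) (1 / 2)) (1 / (4 * (|A| + 1))) with hs_def
  have hs : 0 < s := by positivity
  have hss₁ : s < s₁ := (min_le_left _ _).trans_lt ((min_le_left _ _).trans_lt (by linarith))
  have hs2 : s ≤ 1 / 2 := (min_le_left _ _).trans (min_le_right _ _)
  have hs1 : s ≤ 1 := hs2.trans (by norm_num)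
  have hAs : A * s ≤ 1 / 4 := by
    have h1 : s ≤ 1 / (4 * (|A| + 1)) := min_le_right _ _
    rw [le_div_iff₀ (by positivity)] at h1
    nlinarith [le_abs_self A]
  have hFB : ∀ s', 0 < s' → s' ≤ s → FamilyBounds θ ϑ r A s' B := fun s' h h' => (hN₁ s' h (h'.trans_lt hss₁)).1
  have hFs := hFB s hs le_rfl
  obtain ⟨-, L, t, F, hN⟩ := hN₁ s hs hss₁
  clear_value s
  obtain ⟨hex4, hex2⟩ := hN.exact hm hP hs hFB
  have hsC : (s : ℂ) ≠ 0 := by exact_mod_cast hs.ne'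
  have ns : ‖(s : ℂ)‖ = s := by rw [Complex.norm_of_nonneg hs.le]
  have h5 : (s : ℂ) ^ 5 ≠ 0 := pow_ne_zero _ hsC
  have h3 : (s : ℂ) ^ 3 ≠ 0 := pow_ne_zero _ hsC
  set N := 3 * m + 2 with hN_def
  set B₁ : ℝ := 12 ^ 3 * (2 ^ N * ((N : ℕ) + 1)) with hB₁
  set C := (s ^ 10)⁻¹ + |L| * (s ^ 11)⁻¹ + 12 ^ 3 * ((s ^ (15 * m + 3))⁻¹ + (s ^ (9 * m + 3))⁻¹) + B₁ * (s ^ (5 * N))⁻¹ with hC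
  have hB₁0 : 0 ≤ B₁ := by positivity
  refine ⟨s ^ 5, C, min ε (s ^ 6), by positivity, by positivity, by positivity, fun q hq => ?_⟩
  have hqε : ‖q‖ < ε := (norm_lt hq).trans_le (min_le_left _ _)
  obtain ⟨hl1, hl2⟩ := hlam (by simpa using hqε : dist q 0 < ε)
  set q' : ℂ² := ((s : ℂ) ^ 6)⁻¹ • q with hq'
  have hqq' : (s : ℂ) ^ 6 • q' = q := by rw [hq', smul_inv_smul₀ (pow_ne_zero _ hsC)]
  have nq' : ‖q'‖ = (s ^ 6)⁻¹ * ‖q‖ := by rw [hq', norm_smul, norm_inv, norm_pow, ns]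
  have hq1 : q' ∈ 𝔻 1 := by
    rw [mem_ball_zero_iff, nq', inv_mul_lt_iff₀ (by positivity), mul_one]
    exact (norm_lt hq).trans_le (min_le_right _ _)
  have hx := hN.mem_ball hq1
  obtain ⟨hc, hc'⟩ := hFs.coeff_mem _ hx
  simp only [hqq'] at hc hc'
  set c := genCoeff (s : ℂ) (t q') with hc_def
  set c' := genCoeffConj (s : ℂ) q (t q') with hc'_def
  obtain ⟨hkd, hk2, hF3⟩ := hN.quadratic hP hFs hq1
  have hθd : Holo (fun p => θ (c, p)) (ball 0 18) := by
    have := hP.holo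
    rw [show (20 : ℝ) - 2 = 18 by norm_num] at this
    exact this.comp (f := fun p => (c, p)) (by fun_prop) fun p hp => ⟨hc, hp⟩
  -- the change of coordinates in the zoomed coordinates
  set Ψ : ℂ² → ℂ² := fun p => θ (c, prelim s p) with hΨ
  have hpre : ∀ p ∈ 𝔻 1, prelim s p ∈ 𝔻 2 := fun p hp => by
    have h1 := hFs.prelim.prelim_near p (ball_mono hp)
    have h2 := norm_le_add_sub (prelim s p) p
    rw [mem_ball_zero_iff] at hp ⊢
    linarith
  have hθnear : ∀ p ∈ 𝔻 18, ‖θ (c, p) - p‖ ≤ 1 / 4 := fun p hp =>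
    (hP.pair c hc p (by convert hp using 2; norm_num)).2.2
  have hpd : Holo (prelim s) (ball 0 1) := hFs.prelim.prelim_holo.mono ball_le
  have hΨd : Holo Ψ (ball 0 1) :=
    hθd.comp hpd fun p hp => ball_mono (hpre p hp)
  have hΨj : ∀ p ∈ 𝔻 1, jac Ψ p = 1 := fun p hp => by
    have h1 := hpre p hp
    have h2 : prelim s p ∈ 𝔻 18 := ball_mono h1
    have h4 := hθd.at_ball h2
    refine (jac_comp_eq_one (g := fun p => θ (c, p)) h4 (hpd.at_ball hp) ?_
      (hFs.prelim.prelim_jac p (ball_mono hp))).2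
    refine jac_eq_one_of_canonical (U := univ) (differentiable_polyObs genExps c).differentiableOn isOpen_univ h4 (mem_univ _) ?_
    filter_upwards [isOpen_ball.mem_nhds h2] with x hx using (hP.pair c hc x (by convert hx using 2; norm_num)).2.1
  have hΨt : IsTangentId Ψ := (hP.isTangentId (by norm_num) genExps_degree hc).1.comp (isTangentId_prelim s)
  have hΨn : ∀ p ∈ 𝔻 1, ‖Ψ p - p‖ ≤ 1 / 2 := fun p hp => by
    have h1 := hFs.prelim.prelim_near p (ball_mono hp)
    have h2 := hθnear _ (ball_mono (hpre p hp))
    have e : Ψ p - p = (θ (c, prelim s p) - prelim s p) + (prelim s p - p) := by simp only [hΨ]; abel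
    rw [e]
    exact (norm_add_le _ _).trans (by linarith)
  -- the conjugacy in the zoomed coordinates
  have hin : ∀ p ∈ 𝔻 (s ^ 5), Δ⁻¹[s] p ∈ 𝔻 1 := fun p hp => by
    rw [mem_ball_zero_iff] at hp ⊢
    refine (norm_dilation_inv_le hs hs1 p).trans_lt ?_
    rwa [inv_mul_lt_iff₀ (by positivity), mul_one]
  set Φ : ℂ² → ℂ² := fun p => diag (((s : ℂ) ^ 5)⁻¹)⁻¹ (((s : ℂ) ^ 3)⁻¹)⁻¹ (Ψ (Δ⁻¹[s] p)) with hΦ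
  have hh : ∀ p, Δ⁻¹[s] (henonMod (1 / 6 + q.1) (1 / 3 + q.2) p) =
      diag (lam₁ q) (lam₂ q) (henonCore (henonCoeff q) s (lam₁ q) (lam₂ q) (Δ⁻¹[s] p)) := by
    intro p
    have := henonMod_zoom s q (Δ⁻¹[s] p)
    rw [diag_diag_inv h5 h3] at this
    rw [this, diag_inv_diag h5 h3]
  have hD : ∀ P ∈ 𝔻 16, diag (lam₁ q) (lam₂ q) (θ (c', P)) = θ (c, diag (lam₁ q) (lam₂ q) P) := by
    intro P hP16
    have hmax : max ‖lam₁ q‖ ‖lam₂ q‖ ≤ 11 / 10 := max_le hl1.le hl2.le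
    have hsc : ∀ v : ℂ², ‖diag (lam₁ q) (lam₂ q) v‖ ≤ 11 / 10 * ‖v‖ := fun v =>
      (norm_diag_le _ _ v).trans (mul_le_mul_of_nonneg_right hmax (norm_nonneg _))
    have hP' := norm_lt hP16
    obtain ⟨h6, h7, h8⟩ := hP.pair c' hc' P (ball_mono hP16)
    have h9 := norm_le_add_sub (θ (c', P)) P
    refine hP.unique c hc _ (mem_ball₀ (by linarith [hsc P])) _ (mem_ball_prod.2 ⟨?_, ?_⟩) ?_
    · linarith [norm_fst_le (diag (lam₁ q) (lam₂ q) P), hsc P]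
    · linarith [norm_snd_le (diag (lam₁ q) (lam₂ q) (θ (c', P))), hsc (θ (c', P))]
    · have e : polyObs genExps c = zoomObs (lam₁ q)⁻¹ (lam₂ q)⁻¹ (polyObs genExps c') := by
        funext p
        have := lam₁_ne_zero q
        have := lam₂_ne_zero q
        rw [zoomObs, polyObs, polyObs, Finset.sum_div]
        refine Finset.sum_congr rfl fun i _ => ?_
        rw [hc'_def, genCoeffConj_eq, multiplier]
        simp only [diag, mul_pow, inv_pow]
        rw [hc_def]
        field_simp
      rw [e]
      refine isCanonicalPair_zoomObs (inv_ne_zero (lam₁_ne_zero q)) (inv_ne_zero (lam₂_ne_zero q))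
        (differentiable_polyObs _ _ _) ?_
      rwa [diag_inv_diag (lam₁_ne_zero q) (lam₂_ne_zero q), diag_inv_diag (lam₁_ne_zero q) (lam₂_ne_zero q)]
  have hconj : ∀ p ∈ 𝔻 1, Ψ (diag (lam₁ q) (lam₂ q) (henonCore (henonCoeff q) s (lam₁ q) (lam₂ q) p)) =
      diag (lam₁ q) (lam₂ q) (conjFamily θ ϑ s ((q', t q'), Ψ p)) := by
    intro p hp
    have h1 := hpre p hp
    have h2 := norm_lt h1
    have h4 := hθnear _ (ball_mono h1)
    have h6 := norm_le_add_sub (θ (c, prelim s p)) (prelim s p)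
    have h7 : ϑ (c, θ (c, prelim s p)) = prelim s p := hP.left_inv c hc _ (ball_mono h1)
      mem_ball₀
    have h8 := (hFs.maps _ hx (θ (c, prelim s p)) mem_ball₀).2
    simp only [hqq', ← hc_def, h7] at h8
    simp only [hΨ, conjFamily, hqq', ← hc_def, ← hc'_def, h7]
    rw [hD _ h8, hFs.prelim.prelim_conj q p (ball_mono hp)]
  refine ⟨Φ, zoomObs ((s : ℂ) ^ 5)⁻¹ ((s : ℂ) ^ 3)⁻¹ (F q'), ?_, ?_, ?_, ?_, ?_, ?_⟩
  · exact (differentiable_diag _ _).comp_differentiableOn (hΨd.comp (differentiable_diag _ _).differentiableOn hin)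
  · intro p hp
    exact jac_conj_diag (inv_ne_zero h5) (inv_ne_zero h3) (hΨd.at_ball (hin p hp))
      (hΨj _ (hin p hp))
  · intro p hp
    have h1 := norm_sub_self_le_sq hΨd hΨn hΨt.1 hΨt.2 (norm_lt (hin p hp))
    have e : Φ p - p = Δ[s] (Ψ (Δ⁻¹[s] p)
        - Δ⁻¹[s] p) := by
      rw [diag_sub, diag_diag_inv h5 h3]; simp only [hΦ, inv_inv]
    rw [e]
    have h2 := norm_dilation_inv_le hs hs1 p
    have h4 : s ^ 3 ≤ 1 / 2 := (pow_le_of_le_one hs.le hs1 three_ne_zero).trans hs2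
    calc _ ≤ s ^ 3 * (4 * (1 / 2) * ((s ^ 5)⁻¹ * ‖p‖ / 1) ^ 2) := by
          refine (norm_dilation_le hs hs1 _).trans (mul_le_mul_of_nonneg_left (h1.trans ?_) (by positivity))
          gcongr
      _ = (s ^ 3 * 2) * ((s ^ 10)⁻¹ * ‖p‖ ^ 2) := by rw [div_one, mul_pow, inv_pow, ← pow_mul]; ring
      _ ≤ 1 * ((s ^ 10)⁻¹ * ‖p‖ ^ 2) := by gcongr; linarith
      _ ≤ C * ‖p‖ ^ 2 := by
          rw [one_mul]; gcongr; rw [hC]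
          have : 0 ≤ |L| * (s ^ 11)⁻¹ + 12 ^ 3 * ((s ^ (15 * m + 3))⁻¹ + (s ^ (9 * m + 3))⁻¹) + B₁ * (s ^ (5 * N))⁻¹ := by
            positivity
          linarith
  · exact ((hN.holo q' hq1).comp (differentiable_diag _ _).differentiableOn
      fun p hp => ball_mono (hin p hp)).mul_const (((s : ℂ) ^ 5)⁻¹ * ((s : ℂ) ^ 3)⁻¹)⁻¹
  · intro p hp hhp
    set P := Ψ (Δ⁻¹[s] p) with hPdef
    have hp1 := hin p hp
    have hP2 : ‖P‖ < 2 := by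
      have := norm_le_add_sub P (Δ⁻¹[s] p)
      linarith [hΨn _ hp1, norm_lt hp1]
    have hkP := hN.near q' hq1 P mem_ball₀
    have hkP2 := norm_le_add_sub (conjFamily θ ϑ s ((q', t q'), P)) P
    have hmem : (P.1, (conjFamily θ ϑ s ((q', t q'), P)).2) ∈ 𝔻 12 :=
      mem_ball_prod.2 ⟨by linarith [norm_fst_le P], by linarith [norm_snd_le (conjFamily θ ϑ s ((q', t q'), P))]⟩
    have hpair := hN.pair q' hq1 P mem_ball₀ hmem
    have e1 : Δ⁻¹[s] (Φ p) = P := by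
      simp only [hΦ]; exact diag_diag_inv (inv_ne_zero h5) (inv_ne_zero h3) _
    have e2 : Δ⁻¹[s] (diag (lam₁ q)⁻¹ (lam₂ q)⁻¹ (Φ (henonMod (1 / 6 + q.1) (1 / 3 + q.2) p)))
        = conjFamily θ ϑ s ((q', t q'), P) := by
      simp only [hΦ]
      rw [hh, hconj _ hp1, diag_diag, diag_diag, diag_diag]
      have := lam₁_ne_zero q
      have := lam₂_ne_zero q
      have i1 : ((s : ℂ) ^ 5)⁻¹ * (lam₁ q)⁻¹ * (((s : ℂ) ^ 5)⁻¹)⁻¹ * lam₁ q = 1 := by field_simp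
      have i2 : ((s : ℂ) ^ 3)⁻¹ * (lam₂ q)⁻¹ * (((s : ℂ) ^ 3)⁻¹)⁻¹ * lam₂ q = 1 := by field_simp
      rw [i1, i2, diag_one_one]
    refine isCanonicalPair_zoomObs (inv_ne_zero h5) (inv_ne_zero h3) ?_ (by rw [e1, e2]; exact hpair)
    refine (hN.holo q' hq1).differentiableAt (isOpen_ball.mem_nhds ?_)
    have e3 : ∀ u v : ℂ², Δ⁻¹[s] (u.1, v.2) =
        ((Δ⁻¹[s] u).1, (Δ⁻¹[s] v).2) := fun u v => rfl
    rw [e3, e1, e2]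
    exact hmem
  · have hco : ∀ k l, ‖coeff₂ k l (F q')‖ ≤ 12 ^ 3 := fun k l =>
      (norm_coeff₂_le (by norm_num) (hN.holo q' hq1) (hN.norm_obs_le hP hFs hq1)).trans
        (mul_le_of_le_one_right (by norm_num) (pow_le_one₀ (by norm_num) (by norm_num)))
    have p1 : 0 ≤ (s ^ 10)⁻¹ := by positivity
    have p2 : 0 ≤ |L| * (s ^ 11)⁻¹ := by positivity
    have p3 : 0 ≤ 12 ^ 3 * ((s ^ (15 * m + 3))⁻¹ + (s ^ (9 * m + 3))⁻¹) := by positivity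
    have p4 : 0 ≤ B₁ * (s ^ (5 * N))⁻¹ := by positivity
    have s8 : s ^ 8 ≤ 1 := pow_le_one₀ hs.le hs1
    have hlead : ∀ (k : ℕ) (x y : ℂ), k ≤ 5 → ‖x - y‖ ≤ L * ‖q'‖ → ‖((s : ℂ) ^ k)⁻¹ * x - ((s : ℂ) ^ k)⁻¹ * y‖ ≤ C * ‖q‖ := by
      intro k x y hk h
      rw [← mul_sub, norm_mul, norm_inv, norm_pow, ns]
      have h1 : (s ^ k)⁻¹ ≤ (s ^ 5)⁻¹ := inv_anti₀ (by positivity) (pow_le_pow_of_le_one hs.le hs1 hk)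
      calc _ ≤ (s ^ 5)⁻¹ * (|L| * ‖q'‖) := by
            gcongr
            exact h.trans (mul_le_mul_of_nonneg_right (le_abs_self L) (norm_nonneg _))
        _ = |L| * (s ^ 11)⁻¹ * ‖q‖ := by rw [nq']; field_simp
        _ ≤ C * ‖q‖ := by gcongr; rw [hC]; linarith
    refine ⟨((s : ℂ) ^ 5)⁻¹ * coeff₂ 2 1 (F q'), ((s : ℂ) ^ 4)⁻¹ * coeff₂ 0 4 (F q'),
      fun k => (s : ℂ) ^ 8 * (((s : ℂ) ^ 5)⁻¹ ^ k * ((s : ℂ) ^ 3)⁻¹) * coeff₂ k 1 (F q'),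
      fun n => (s : ℂ) ^ 8 * ((s : ℂ) ^ 3)⁻¹ ^ (3 * n + 1) * coeff₂ 0 (3 * n + 1) (F q'), ?_, ?_, ?_, ?_, ?_⟩
    · have := hlead 5 _ _ le_rfl (hN.cubic_lip q' hq1)
      rw [hex2, inv_mul_cancel_left₀ h5, henonCoeff_zero] at this
      exact this
    · have := hlead 4 _ _ (by norm_num) (hN.quartic_lip q' hq1)
      rw [hex4, inv_mul_cancel_left₀ (pow_ne_zero _ hsC), quartic_eq] at this
      exact this
    · intro k hk
      rw [Finset.mem_Icc] at hk
      rw [norm_mul, norm_mul, norm_mul, norm_pow, norm_pow, norm_inv, norm_inv, norm_pow, norm_pow, ns, ← inv_pow, ← inv_pow,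
        ← pow_mul, ← pow_add]
      have h1 : s⁻¹ ^ (5 * k + 3) ≤ s⁻¹ ^ (15 * m + 3) := pow_le_pow_right₀ ((one_le_inv₀ hs).2 hs1) (by omega)
      have h2 : 0 ≤ (s ^ (9 * m + 3))⁻¹ := by positivity
      calc _ ≤ 1 * s⁻¹ ^ (15 * m + 3) * 12 ^ 3 := by gcongr; exact hco k 1
        _ ≤ C := by rw [hC, inv_pow]; linarith
    · intro n hn
      rw [Finset.mem_Icc] at hn
      rw [norm_mul, norm_mul, norm_pow, norm_pow, norm_inv, norm_pow, ns, ← inv_pow, ← pow_mul]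
      have h1 : s⁻¹ ^ (3 * (3 * n + 1)) ≤ s⁻¹ ^ (9 * m + 3) := pow_le_pow_right₀ ((one_le_inv₀ hs).2 hs1) (by omega)
      have h2 : 0 ≤ (s ^ (15 * m + 3))⁻¹ := by positivity
      calc _ ≤ 1 * s⁻¹ ^ (9 * m + 3) * 12 ^ 3 := by gcongr; exact hco 0 _
        _ ≤ C := by rw [hC, inv_pow]; linarith
    · intro p hp
      have h1 := norm_sub_normalTerms_le hm (hN.holo q' hq1) (hN.norm_obs_le hP hFs hq1)
        (fun k l hkl => hN.low hP hFs hq1 hkl) (hN.bad q' hq1) (ball_subset_ball (by norm_num : (1 : ℝ) ≤ 12) (hin p hp))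
      set x := Δ⁻¹[s] p with hxdef
      have e : zoomObs ((s : ℂ) ^ 5)⁻¹ ((s : ℂ) ^ 3)⁻¹ (F q') p - normalTerms m (((s : ℂ) ^ 5)⁻¹ * coeff₂ 2 1 (F q'))
          (((s : ℂ) ^ 4)⁻¹ * coeff₂ 0 4 (F q'))
          (fun k => (s : ℂ) ^ 8 * (((s : ℂ) ^ 5)⁻¹ ^ k * ((s : ℂ) ^ 3)⁻¹) * coeff₂ k 1 (F q'))
          (fun n => (s : ℂ) ^ 8 * ((s : ℂ) ^ 3)⁻¹ ^ (3 * n + 1) * coeff₂ 0 (3 * n + 1) (F q')) p =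
          (s : ℂ) ^ 8 * (F q' x - normalTerms m (coeff₂ 2 1 (F q')) (coeff₂ 0 4 (F q'))
            (fun k => coeff₂ k 1 (F q')) (fun n => coeff₂ 0 (3 * n + 1) (F q')) x) := by
        have e1 : zoomObs ((s : ℂ) ^ 5)⁻¹ ((s : ℂ) ^ 3)⁻¹ (F q') p = (s : ℂ) ^ 8 * F q' x := by
          rw [zoomObs, ← hxdef]; field_simp
        have x1 : x.1 = ((s : ℂ) ^ 5)⁻¹ * p.1 := rfl
        have x2 : x.2 = ((s : ℂ) ^ 3)⁻¹ * p.2 := rfl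
        rw [e1, mul_sub]
        congr 1
        simp only [normalTerms, mul_add, Finset.mul_sum, x1, x2]
        congr 1
        · congr 1
          · congr 1
            · field_simp
            · field_simp
          · refine Finset.sum_congr rfl fun k _ => ?_
            rw [mul_pow]; ring
        · refine Finset.sum_congr rfl fun n _ => ?_
          rw [mul_pow]; ring
      rw [e, norm_mul, norm_pow, ns]
      have h2 : ‖x‖ / 12 ≤ (s ^ 5)⁻¹ * ‖p‖ := by
        have := norm_dilation_inv_le hs hs1 p
        rw [← hxdef] at this
        linarith [norm_nonneg x]
      calc _ ≤ 1 * (B₁ * ((s ^ 5)⁻¹ * ‖p‖) ^ N) := by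
            refine mul_le_mul s8 (h1.trans ?_) (norm_nonneg _) zero_le_one
            gcongr
        _ = B₁ * (s ^ (5 * N))⁻¹ * ‖p‖ ^ N := by rw [mul_pow, inv_pow, ← pow_mul]; ring
        _ ≤ C * ‖p‖ ^ N := by gcongr; rw [hC]; linarith

end Germ

/-! ### Polynomial generators -/

section Truncation

lemma eventually_mul_le (a : ℝ) {b : ℝ} (hb : 0 < b) : ∀ᶠ x : ℝ in 𝓝[>] (0 : ℝ), a * x ≤ b := by
  have h : Tendsto (fun x : ℝ => a * x) (𝓝 0) (𝓝 (a * 0)) := (continuous_const_mul a).tendsto 0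
  rw [mul_zero] at h
  exact ((h.mono_left nhdsWithin_le_nhds).eventually (gt_mem_nhds hb)).mono fun x hx => le_of_lt hx

/-- Cauchy's estimate for the symplectic gradient of an observable vanishing to order `k + 1`. -/
lemma norm_sgrad_le_pow {H : ℂ² → ℂ} {R A : ℝ} {k : ℕ} (hH : Holo H (ball 0 R))
    (hb : ∀ y ∈ 𝔻 R, ‖H y‖ ≤ A * ‖y‖ ^ (k + 1)) (hA : 0 ≤ A) {y : ℂ²} (hy : ‖y‖ < R / 2) :
    ‖sgrad H y‖ ≤ A * 2 ^ (k + 2) * ‖y‖ ^ k := by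
  have h1 : ∀ᶠ t in 𝓝[>] ‖y‖, ‖sgrad H y‖ ≤ A * 2 ^ (k + 2) * t ^ k := by
    filter_upwards [Ioo_mem_nhdsGT hy] with t ht
    have ht0 : 0 < t := (norm_nonneg y).trans_lt ht.1
    have h2 : ‖fderiv ℂ H y‖ ≤ 2 * (A * (2 * t) ^ (k + 1)) / t :=
      norm_fderiv_le_of_bound (R := 2 * t) (hH.mono (ball_subset_ball (by linarith [ht.2])))
        (fun x hx => (hb x (ball_subset_ball (by linarith [ht.2]) hx)).trans (by
          gcongr; exact (norm_lt hx).le)) ht0 (by linarith [ht.1])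
    have h3 : 2 * (A * (2 * t) ^ (k + 1)) / t = A * 2 ^ (k + 2) * t ^ k := by
      field_simp; ring
    rw [h3] at h2
    exact (norm_sgrad_le H y).trans h2
  have h2 : Tendsto (fun t : ℝ => A * 2 ^ (k + 2) * t ^ k) (𝓝[>] ‖y‖) (𝓝 (A * 2 ^ (k + 2) * ‖y‖ ^ k)) :=
    ((continuous_const.mul (continuous_pow k)).tendsto _).mono_left nhdsWithin_le_nhds
  exact ge_of_tendsto h2 h1

lemma exists_canonicalMap {H : ℂ² → ℂ} {R c d : ℝ} (hH : Holo H (ball 0 R))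
    (hb : ∀ p ∈ 𝔻 R, ‖sgrad H p‖ ≤ c) (hd : 0 < d) (hcd : 4 * c ≤ d) :
    ∃ θ : ℂ² → ℂ², Holo θ (ball 0 (R - 2 * d)) ∧
      (∀ p ∈ 𝔻 (R - 2 * d), (p.1, (θ p).2) ∈ 𝔻 (R - d) ∧
        IsCanonicalPair H p (θ p) ∧ ‖θ p - p‖ ≤ c) ∧
      ∀ p ∈ 𝔻 (R - 2 * d), ∀ p', (p.1, p'.2) ∈ 𝔻 (R - d) →
        IsCanonicalPair H p p' → p' = θ p := by
  have hs : ∀ p, sgrad H p = (dw H p, -dz H p) := fun p => rfl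
  obtain ⟨θ, h1, h2, h3⟩ := exists_canonical_family (Q := ℂ) (U := univ) (H := fun _ => H) isOpen_univ
    ((hH.fderiv_apply_const isOpen_ball (1, 0)).comp (f := Prod.snd) (by fun_prop) fun _ h => h.2)
    ((hH.fderiv_apply_const isOpen_ball (0, 1)).comp (f := Prod.snd) (by fun_prop) fun _ h => h.2)
    (fun _ _ p hp => le_trans (by rw [hs, Prod.norm_mk, norm_neg]; exact le_max_right _ _) (hb p hp))
    (fun _ _ p hp => le_trans (by rw [hs, Prod.norm_mk, norm_neg]; exact le_max_left _ _) (hb p hp)) hd hcd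
  exact ⟨fun p => θ (0, p), h1.comp (f := fun p => ((0 : ℂ), p)) (by fun_prop) fun p hp => ⟨mem_univ _, hp⟩,
    h2 0 (mem_univ _), h3 0 (mem_univ _)⟩

lemma IsCanonicalPair.quadratic {H : ℂ² → ℂ} {p q : ℂ²} {K : ℝ} (h : IsCanonicalPair H p q) (hK : 0 ≤ K)
    (hy : ‖sgrad H (p.1, q.2)‖ ≤ K * ‖(p.1, q.2)‖ ^ 2) (hs : K * ‖(p.1, q.2)‖ ≤ 1 / 2) :
    ‖(p.1, q.2)‖ ≤ 2 * ‖p‖ ∧ ‖q - p‖ ≤ 4 * K * ‖p‖ ^ 2 := by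
  rw [← canonicalPair_sub_eq h] at hy
  have h1 := norm_mixed_sub_le p q
  have h2 := norm_le_add_sub (p.1, q.2) p
  have h3 : ‖(p.1, q.2)‖ ≤ 2 * ‖p‖ := by nlinarith [norm_nonneg (p.1, q.2)]
  refine ⟨h3, hy.trans ?_⟩
  calc _ ≤ K * (2 * ‖p‖) ^ 2 := by gcongr
    _ = _ := by ring

/-- A symplectic map tangent to the identity agrees to any given order with the canonical map of a
polynomial, which is an entire observable. -/
lemma exists_polynomial_approximation {r C : ℝ} (hr : 0 < r) (hC : 0 ≤ C) (n : ℕ) :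
    ∃ r' K : ℝ, 0 < r' ∧ 0 ≤ K ∧ ∀ Φ : ℂ² → ℂ², Holo Φ (ball 0 r) →
      (∀ p ∈ 𝔻 r, jac Φ p = 1) → (∀ p ∈ 𝔻 r, ‖Φ p - p‖ ≤ C * ‖p‖ ^ 2) →
      ∃ (G : ℂ² → ℂ) (Φ' : ℂ² → ℂ²), Differentiable ℂ G ∧ Holo Φ' (ball 0 r') ∧
        ∀ p ∈ 𝔻 r', IsCanonicalPair G p (Φ' p) ∧ ‖Φ' p - p‖ ≤ K * ‖p‖ ^ 2 ∧
          ‖Φ' p - Φ p‖ ≤ K * ‖p‖ ^ (n + 2) := by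
  obtain ⟨r₁, hr₁r, hr₁C, hr₁1, hr₁⟩ : ∃ r₁ : ℝ, 1 * r₁ ≤ r ∧ 16 * C * r₁ ≤ 1 ∧ 1 * r₁ ≤ 1 ∧ 0 < r₁ :=
    ((eventually_mul_le _ hr).and ((eventually_mul_le _ one_pos).and ((eventually_mul_le _ one_pos).and
      self_mem_nhdsWithin))).exists
  set N := n + 3 with hN
  set K₂ := 8 * C * (2 ^ N * (N + 1)) * (2 / r₁) ^ N with hK₂
  set K₁ := (8 * C + K₂) * 2 ^ 4 with hK₁
  set K₃ := K₂ * 2 ^ (n + 4) with hK₃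
  have hK₂0 : 0 ≤ K₂ := by positivity
  have hK₁0 : 0 ≤ K₁ := by positivity
  have hK₃0 : 0 ≤ K₃ := by positivity
  obtain ⟨r₃, hr₃r, hr₃K, hr₃⟩ : ∃ r₃ : ℝ, 4 * r₃ ≤ r₁ ∧ 64 * K₁ * r₃ ≤ 1 ∧ 0 < r₃ :=
    ((eventually_mul_le _ hr₁).and ((eventually_mul_le _ one_pos).and self_mem_nhdsWithin)).exists
  have hK4 : 0 ≤ 2 * (K₃ * 8 ^ (n + 2)) := by positivity
  refine ⟨r₃ / 32, 4 * K₁ + 2 * (K₃ * 8 ^ (n + 2)), by positivity, by positivity, fun Φ hΦ hj hq => ?_⟩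
  have hs1 : 𝔻 r₁ ⊆ ball 0 r := ball_le
  obtain ⟨G₀, hG₀, hG₀0, hpair, hex⟩ := exists_generating (c := C * r₁ ^ 2) (d := r₁ / 4) (hΦ.mono hs1)
    (fun p hp => (hq p (hs1 hp)).trans (by gcongr; exact (norm_lt hp).le)) (fun p hp => hj p (hs1 hp))
    (by positivity) (by nlinarith)
  have hcube := fun y hy => generating_norm_le_cube (A := C) (y := y) hC hG₀ hG₀0
    (fun p hp => hq p (ball_subset_ball (by linarith : r₁ - r₁ / 4 ≤ r) hp)) (by nlinarith) hex hy
  rw [show r₁ - 2 * (r₁ / 4) = r₁ / 2 by ring] at *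
  set G : ℂ² → ℂ := fun p => ∑ k ∈ Finset.range N, ∑ l ∈ Finset.range (N - k),
      coeff₂ k l G₀ * p.1 ^ k * p.2 ^ l with hG
  have hGd : Differentiable ℂ G := by
    refine Differentiable.fun_sum fun k _ => Differentiable.fun_sum fun l _ => ?_
    fun_prop
  have hd1 : ∀ y ∈ 𝔻 (r₁ / 2), ‖G₀ y - G y‖ ≤ K₂ * ‖y‖ ^ N := fun y hy => by
    have := norm_sub_taylor₂_le (B := 8 * C) N hG₀ (fun y hy => ((hcube y hy).2).trans
      (mul_le_of_le_one_right (by positivity) (pow_le_one₀ (norm_nonneg _) (by linarith [norm_lt hy])))) hy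
    refine this.trans_eq ?_
    rw [hK₂, mul_assoc (8 * C * (2 ^ N * ((N : ℝ) + 1))), ← mul_pow]
    congr 2
    field_simp
  have hG3 : ∀ y ∈ 𝔻 (r₁ / 2), ‖G y‖ ≤ (8 * C + K₂) * ‖y‖ ^ (2 + 1) := fun y hy => by
    have h1 : ‖y‖ ^ N ≤ ‖y‖ ^ 3 :=
      pow_le_pow_of_le_one (norm_nonneg _) (by linarith [norm_lt hy]) (by omega)
    have h2 := norm_le_norm_add_norm_sub (G₀ y) (G y)
    have h3 := mul_le_mul_of_nonneg_left h1 hK₂0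
    have h4 := (hcube y hy).2
    have h5 := hd1 y hy
    rw [add_mul]
    exact h2.trans (add_le_add h4 (h5.trans h3))
  have hsG : ∀ y : ℂ², ‖y‖ < r₁ / 4 → ‖sgrad G y‖ ≤ K₁ * ‖y‖ ^ 2 := fun y hy =>
    norm_sgrad_le_pow hGd.differentiableOn hG3 (by positivity) (by linarith)
  have hsd : ∀ y : ℂ², ‖y‖ < r₁ / 4 → ‖sgrad G y - sgrad G₀ y‖ ≤ K₃ * ‖y‖ ^ (n + 2) := fun y hy => by
    rw [← sgrad_sub (hGd y) (hG₀.at_ball mem_ball₀)]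
    exact norm_sgrad_le_pow (hGd.differentiableOn.fun_sub hG₀)
      (fun y hy => by rw [norm_sub_rev]; exact hd1 y hy) (by positivity) (by linarith)
  have hsb : ∀ y : ℂ², ‖y‖ < r₃ → ‖sgrad G y‖ ≤ K₁ * r₃ ^ 2 := fun y hy =>
    (hsG y (by linarith)).trans (by gcongr)
  obtain ⟨θ, hθ, hθp, -⟩ := exists_canonicalMap (c := K₁ * r₃ ^ 2) (d := r₃ / 4) (R := r₃) hGd.differentiableOn
    (fun y hy => hsb y (norm_lt hy)) (by positivity) (by nlinarith)
  refine ⟨G, θ, hGd, hθ.mono ball_le, fun p hp => ?_⟩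
  rw [mem_ball_zero_iff] at hp
  obtain ⟨hm, hc, -⟩ := hθp p mem_ball₀
  rw [mem_ball_zero_iff] at hm
  obtain ⟨hm2, hq2⟩ := hc.quadratic hK₁0 (hsG _ (by linarith)) (by nlinarith)
  have hp0 := norm_nonneg p
  refine ⟨hc, hq2.trans (by gcongr; linarith), ?_⟩
  have hΦp := hq p mem_ball₀
  rcases hp0.eq_or_lt with h0 | h0
  · rw [← h0] at hΦp hq2 ⊢
    simp only [ne_eq, OfNat.ofNat_ne_zero, not_false_eq_true, zero_pow, mul_zero, norm_le_zero_iff, sub_eq_zero,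
      Nat.add_eq_zero_iff, and_false] at hΦp hq2 ⊢
    rw [hΦp, hq2]
  have hΦp' : ‖Φ p - p‖ ≤ ‖p‖ := hΦp.trans (by nlinarith)
  have hmΦ : ‖(p.1, (Φ p).2)‖ ≤ 2 * ‖p‖ := by
    linarith [norm_mixed_sub_le p (Φ p), norm_le_add_sub (p.1, (Φ p).2) p]
  have key := (canonicalPair_compare (H := G₀) (H' := G) (R := 8 * ‖p‖) (c := 4 * C * (8 * ‖p‖) ^ 2)
    (c' := K₁ * (8 * ‖p‖) ^ 2) (k := K₃ * (8 * ‖p‖) ^ (n + 2)) (d := 4 * ‖p‖)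
    (hG₀.mono ball_le) hGd.differentiableOn
    (fun y hy => by
      rw [mem_ball_zero_iff] at hy
      exact (hcube y mem_ball₀).1.trans (by gcongr))
    (fun y hy => by
      rw [mem_ball_zero_iff] at hy
      exact (hsG y (by linarith)).trans (by gcongr))
    (fun y hy => by
      rw [mem_ball_zero_iff] at hy
      exact (hsd y (by linarith)).trans (by gcongr))
    (by positivity) (by nlinarith) (by linarith) (by linarith) (by linarith)
    (hpair p mem_ball₀ mem_ball₀) hc).1
  refine key.trans ?_
  rw [mul_pow, add_mul]
  have : 0 ≤ 4 * K₁ * ‖p‖ ^ (n + 2) := by positivity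
  linarith

/-- Bounds on the Hénon map near the origin, uniform in the parameters. -/
lemma exists_henonMod_bounds : ∃ K ε : ℝ, 0 ≤ K ∧ 0 < ε ∧ ∀ q ∈ 𝔻 ε,
    ‖lam₁ q‖ ≤ 11 / 10 ∧ ‖lam₂ q‖ ≤ 11 / 10 ∧ ‖(lam₁ q)⁻¹‖ ≤ 11 / 10 ∧ ‖(lam₂ q)⁻¹‖ ≤ 11 / 10 ∧
    ∀ p, HoloAt (henonMod (1 / 6 + q.1) (1 / 3 + q.2)) p ∧
      jac (henonMod (1 / 6 + q.1) (1 / 3 + q.2)) p = lam₁ q * lam₂ q ∧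
      ‖henonMod (1 / 6 + q.1) (1 / 3 + q.2) p - diag (lam₁ q) (lam₂ q) p‖ ≤ K * ‖p‖ ^ 2 := by
  obtain ⟨h1, h2⟩ := analyticAt_lam 0
  have n1 : ‖lam₁ 0‖ = 1 := by rw [lam₁_zero, norm_one]
  have n2 : ‖lam₂ 0‖ = 1 := by rw [lam₂_zero, norm_jRoot]
  have h3 := analyticAt_henonCoeff_zero.continuousAt.norm.eventually (gt_mem_nhds (lt_add_one _))
  have h4 := h1.continuousAt.norm.eventually (gt_mem_nhds (by simp only [n1]; norm_num : _ < (11 / 10 : ℝ)))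
  have h5 := h2.continuousAt.norm.eventually (gt_mem_nhds (by simp only [n2]; norm_num : _ < (11 / 10 : ℝ)))
  have h6 := h1.continuousAt.norm.eventually (lt_mem_nhds (by simp only [n1]; norm_num : (10 / 11 : ℝ) < _))
  have h7 := h2.continuousAt.norm.eventually (lt_mem_nhds (by simp only [n2]; norm_num : (10 / 11 : ℝ) < _))
  obtain ⟨ε, hε, h⟩ := Metric.eventually_nhds_iff.1 ((((h3.and h4).and h5).and h6).and h7)
  refine ⟨(‖henonCoeff 0‖ + 1) * 9, ε, by positivity, hε, fun q hq => ?_⟩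
  obtain ⟨⟨⟨⟨h3, h4⟩, h5⟩, h6⟩, h7⟩ := h (mem_ball.1 hq)
  have hz : henonMod (1 / 6 + q.1) (1 / 3 + q.2) =
      fun p => diag (lam₁ q) (lam₂ q) (henonCore (henonCoeff q) 1 (lam₁ q) (lam₂ q) p) := by
    funext p
    have := henonMod_zoom 1 q p
    simpa only [one_pow, diag_one_one] using this
  have hi : ∀ {x : ℂ}, 10 / 11 < ‖x‖ → ‖x⁻¹‖ ≤ 11 / 10 := fun {x} hx => by
    rw [norm_inv, inv_le_comm₀ (by linarith) (by norm_num)]; norm_num; linarith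
  refine ⟨h4.le, h5.le, hi h6, hi h7, fun p => ?_⟩
  obtain ⟨L, hL, -⟩ := henonCore_deriv (c := henonCoeff q) (s := 1) (lam₁_ne_zero q) (lam₂_ne_zero q) p
  have hd := (differentiable_diag (lam₁ q) (lam₂ q)) (henonCore (henonCoeff q) 1 (lam₁ q) (lam₂ q) p)
  refine ⟨?_, ?_, ?_⟩
  · rw [hz]; exact hd.comp p hL.differentiableAt
  · rw [hz, jac_comp hd hL.differentiableAt, jac_diag, jac_henonCore (lam₁_ne_zero q) (lam₂_ne_zero q), mul_one]
  · have e : henonMod (1 / 6 + q.1) (1 / 3 + q.2) p - diag (lam₁ q) (lam₂ q) p =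
        (henonCoeff q * (lam₁ q * p.1 + lam₂ q * p.2) ^ 2) • ((1, -1) : ℂ²) := by
      rw [henonMod, henonCoeff, lam₁, lam₂, add_sub_cancel_left]; congr 1; ring
    have h8 : ‖lam₁ q * p.1 + lam₂ q * p.2‖ ≤ 3 * ‖p‖ := by
      refine (norm_add_le _ _).trans ?_
      rw [norm_mul, norm_mul]
      have := mul_le_mul h4.le (norm_fst_le p) (norm_nonneg _) (by norm_num)
      have := mul_le_mul h5.le (norm_snd_le p) (norm_nonneg _) (by norm_num)
      linarith [norm_nonneg p]
    rw [e, norm_smul, norm_mul, norm_pow]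
    have h9 : ‖((1, -1) : ℂ²)‖ = 1 := by simp
    rw [h9, mul_one]
    calc _ ≤ (‖henonCoeff 0‖ + 1) * (3 * ‖p‖) ^ 2 := by
          refine mul_le_mul h3.le ?_ (by positivity) (by positivity)
          gcongr
      _ = _ := by ring

lemma HasNormalForm.mono {m : ℕ} {C C' η η' r r' : ℝ} {F : ℂ² → ℂ} (h : HasNormalForm m C η r F)
    (hC : C ≤ C') (hη : C * η ≤ C' * η') (hr : r' ≤ r) : HasNormalForm m C' η' r' F := by
  obtain ⟨b₂₁, b₀₄, b, c, h1, h2, h3, h4, h5⟩ := h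
  exact ⟨b₂₁, b₀₄, b, c, h1.trans hη, h2.trans hη, fun k hk => (h3 k hk).trans hC, fun n hn => (h4 n hn).trans hC,
    fun p hp => (h5 p (ball_subset_ball hr hp)).trans (by gcongr)⟩

lemma norm_normalTerms_le {m : ℕ} (hm : 1 ≤ m) {b₂₁ b₀₄ : ℂ} {b c : ℕ → ℂ} {A X : ℝ} {p : ℂ²}
    (hX : ∀ i, 3 ≤ i → i ≤ 3 * m + 1 → ‖p‖ ^ i ≤ X) (h1 : ‖b₂₁‖ ≤ A) (h2 : ‖b₀₄‖ ≤ A)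
    (h3 : ∀ k ∈ Finset.Icc 3 (3 * m), ‖b k‖ ≤ A) (h4 : ∀ n ∈ Finset.Icc 2 m, ‖c n‖ ≤ A) :
    ‖normalTerms m b₂₁ b₀₄ b c p‖ ≤ A * (4 * m + 2) * X := by
  have hA : 0 ≤ A := (norm_nonneg _).trans h1
  have hX0 : 0 ≤ X := le_trans (by positivity) (hX 3 le_rfl (by omega))
  have key : ∀ (a : ℂ) (k l : ℕ), ‖a‖ ≤ A → 3 ≤ k + l → k + l ≤ 3 * m + 1 → ‖a * p.1 ^ k * p.2 ^ l‖ ≤ A * X := by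
    intro a k l ha h h'
    rw [norm_mul, norm_mul, norm_pow, norm_pow, mul_assoc]
    refine mul_le_mul ha (le_trans ?_ (hX (k + l) h h')) (by positivity) hA
    rw [pow_add]
    gcongr
    exacts [norm_fst_le p, norm_snd_le p]
  have k1 := key b₂₁ 2 1 h1 le_rfl (by omega)
  have k2 := key b₀₄ 0 4 h2 (by norm_num) (by omega)
  have hs : ∀ (s : Finset ℕ) (N : ℕ) (f : ℕ → ℂ), s.card ≤ N → (∀ i ∈ s, ‖f i‖ ≤ A * X) → ‖∑ i ∈ s, f i‖ ≤ N * (A * X) := by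
    intro s N f hN hf
    refine (norm_sum_le_of_le _ hf).trans ?_
    rw [Finset.sum_const, nsmul_eq_mul]
    gcongr
  have k3 := hs (Finset.Icc 3 (3 * m)) (3 * m) (fun k => b k * p.1 ^ k * p.2) (by rw [Nat.card_Icc]; omega) fun k hk => by
    have hk' := Finset.mem_Icc.1 hk
    simpa using key (b k) k 1 (h3 k hk) (by omega) (by omega)
  have k4 := hs (Finset.Icc 2 m) m (fun n => c n * p.2 ^ (3 * n + 1)) (by rw [Nat.card_Icc]; omega) fun k hk => by
    have hk' := Finset.mem_Icc.1 hk
    simpa using key (c k) 0 (3 * k + 1) (h4 k hk) (by omega) (by omega)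
  simp only [pow_zero, pow_one, mul_one] at k1 k2
  push_cast at k3
  rw [normalTerms]
  refine (norm_add₄_le).trans ?_
  linarith

lemma HasNormalForm.norm_le {m : ℕ} {C η r : ℝ} {F : ℂ² → ℂ} (h : HasNormalForm m C η r F) (hm : 1 ≤ m)
    (hC : 0 ≤ C) (hη : η ≤ 1) {p : ℂ²} (hp : p ∈ 𝔻 r) (hp1 : ‖p‖ ≤ 1) :
    ‖F p‖ ≤ ((C + 1) * (4 * m + 2) + C) * ‖p‖ ^ 3 := by
  obtain ⟨b₂₁, b₀₄, b, c, h1, h2, h3, h4, h5⟩ := h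
  have hC1 : C * η ≤ C := mul_le_of_le_one_right hC hη
  have s3 : 1 ≤ √3 := Real.one_le_sqrt.2 (by norm_num)
  have s4 : 1 / √3 ≤ 1 := by rw [div_le_one (by positivity)]; exact s3
  have n1 : ‖I * ((1 / √3 : ℝ) : ℂ)‖ ≤ 1 := by
    rw [norm_mul, Complex.norm_I, Complex.norm_of_nonneg (by positivity), one_mul]; exact s4
  have n2 : ‖I * ((-(2 / 3) * (1 / √3) : ℝ) : ℂ) / 4‖ ≤ 1 := by
    rw [norm_div, norm_mul, Complex.norm_I, Complex.norm_real, norm_mul, Real.norm_of_nonneg (by positivity : 0 ≤ 1 / √3)]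
    norm_num
    have : 0 ≤ (√3)⁻¹ := by positivity
    rw [one_div] at s4
    linarith
  have k1 := norm_normalTerms_le hm (b₂₁ := b₂₁) (b₀₄ := b₀₄) (b := b) (c := c) (A := C + 1)
    (fun i hi _ => pow_le_pow_of_le_one (norm_nonneg p) hp1 hi)
    (by linarith [norm_le_add_sub b₂₁ (I * ((1 / √3 : ℝ) : ℂ))])
    (by linarith [norm_le_add_sub b₀₄ (I * ((-(2 / 3) * (1 / √3) : ℝ) : ℂ) / 4)])
    (fun k hk => (h3 k hk).trans (by linarith)) (fun k hk => (h4 k hk).trans (by linarith))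
  have k2 : C * ‖p‖ ^ (3 * m + 2) ≤ C * ‖p‖ ^ 3 :=
    mul_le_mul_of_nonneg_left (pow_le_pow_of_le_one (norm_nonneg _) hp1 (by omega)) hC
  have k3 := norm_le_add_sub (F p) (normalTerms m b₂₁ b₀₄ b c p)
  have k4 := h5 p hp
  rw [add_mul]
  exact k3.trans (add_le_add k1 (k4.trans k2))

end Truncation

/-! ### The resonant Birkhoff normal form -/

section Birkhoff

/-- A symplectic map tangent to the identity is, near the origin, a canonical diffeomorphism. -/
lemma exists_isCanonicalDiffeo {f : ℂ² → ℂ²} {ρ K : ℝ} (hρ : 0 < ρ) (hK : 0 ≤ K) (hKρ : 64 * K * ρ ≤ 1)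
    (hf : Holo f (ball 0 (4 * ρ))) (hj : ∀ p ∈ 𝔻 (4 * ρ), jac f p = 1)
    (hq : ∀ p ∈ 𝔻 (4 * ρ), ‖f p - p‖ ≤ K * ‖p‖ ^ 2) :
    ∃ (F : ℂ² → ℂ) (ψ : OpenPartialHomeomorph ℂ² ℂ²), IsCanonicalDiffeo F (polydisk (2 * ρ)) ψ ∧
      ψ.source = ball 0 (3 / 2 * ρ) ∧ (ψ : ℂ² → ℂ²) = f ∧ F 0 = 0 ∧
      (∀ y ∈ 𝔻 (2 * ρ), ‖F y‖ ≤ 8 * K * ‖y‖ ^ 3) ∧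
      ∀ y ∈ 𝔻 (2 * ρ), ∃ p ∈ 𝔻 (3 * ρ), p.1 = y.1 ∧ (f p).2 = y.2 ∧
        IsCanonicalPair F p (f p) := by
  have hb : ∀ p ∈ 𝔻 (4 * ρ), ‖f p - p‖ ≤ K * (4 * ρ) ^ 2 := fun p hp =>
    (hq p hp).trans (by gcongr; exact (norm_lt hp).le)
  have hc : 4 * (K * (4 * ρ) ^ 2) ≤ ρ := by nlinarith
  obtain ⟨F, hF, hF0, hpair, hex⟩ := exists_generating hf hb hj hρ hc
  obtain ⟨e, he, hes, -, hei⟩ := exists_openPartialHomeomorph_near_id hf hb hρ hc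
  rw [show 4 * ρ - 2 * ρ = 2 * ρ by ring] at *
  rw [show 4 * ρ - ρ = 3 * ρ by ring] at *
  have hsrc : (e.restrOpen (ball 0 (3 / 2 * ρ)) isOpen_ball).source = ball 0 (3 / 2 * ρ) := by
    rw [e.restrOpen_source, hes]
    exact inter_eq_right.2 ball_le
  have hmem : ∀ p ∈ 𝔻 (3 / 2 * ρ), (p.1, (f p).2) ∈ 𝔻 (2 * ρ) := fun p hp => by
    have h1 := norm_mixed_sub_le p (f p)
    have h2 := norm_le_add_sub (p.1, (f p).2) p
    have h3 := hb p (ball_mono hp)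
    rw [mem_ball_zero_iff] at hp ⊢
    linarith
  have hP : ∀ p ∈ 𝔻 (3 / 2 * ρ), IsCanonicalPair F p (f p) := fun p hp =>
    hpair p (ball_mono hp) (hmem p hp)
  refine ⟨F, e.restrOpen (ball 0 (3 / 2 * ρ)) isOpen_ball, ⟨?_, ?_, ?_, ⟨?_, ?_, ?_, ?_, ?_⟩, ?_⟩, hsrc, he, hF0,
    fun y hy => ?_, hex⟩
  · rw [hsrc]
    exact ⟨⟨0, mem_ball_self (by positivity)⟩, (convex_ball 0 _).isPreconnected⟩
  · rw [hsrc]; exact mem_ball_self (by positivity)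
  · have := hq 0 (mem_ball_self (by positivity))
    rw [norm_zero, zero_pow two_ne_zero, mul_zero, norm_le_zero_iff, sub_zero] at this
    rw [← he] at this
    exact this
  · rw [polydisk_eq_ball]; exact hF
  · rw [hsrc]; exact (he ▸ hf).mono ball_le
  · intro p hp
    rw [hsrc] at hp
    rw [polydisk_eq_ball]
    have := hmem p hp
    rw [← he] at this
    exact this
  · intro p hp
    rw [hsrc] at hp
    have := (hP p hp).1
    rw [← he] at this
    exact this
  · intro p hp
    rw [hsrc] at hp
    have := (hP p hp).2
    rw [← he] at this
    exact this
  · exact hei.mono fun y hy => by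
      rw [e.restrOpen_toPartialEquiv] at hy
      exact hy.1
  · exact (generating_norm_le_cube hK hF hF0 (fun p hp => hq p (ball_subset_ball (by linarith : 3 * ρ ≤ 4 * ρ) hp))
      (by linarith) hex hy).2

lemma HasNormalForm.perturb {m : ℕ} {C K η r r' : ℝ} {F F' : ℂ² → ℂ} (h : HasNormalForm m C η r F) (hK : 0 ≤ K)
    (hη : 0 ≤ η) (hr : r' ≤ r) (hF : ∀ p ∈ 𝔻 r', ‖F' p - F p‖ ≤ K * ‖p‖ ^ (3 * m + 2)) :
    HasNormalForm m (C + K) η r' F' := by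
  obtain ⟨b₂₁, b₀₄, b, c, h1, h2, h3, h4, h5⟩ := h
  have hC : C ≤ C + K := by linarith
  have hCη : C * η ≤ (C + K) * η := by gcongr
  refine ⟨b₂₁, b₀₄, b, c, h1.trans hCη, h2.trans hCη, fun k hk => (h3 k hk).trans hC, fun n hn => (h4 n hn).trans hC,
    fun p hp => ?_⟩
  have e : F' p - normalTerms m b₂₁ b₀₄ b c p = (F p - normalTerms m b₂₁ b₀₄ b c p) + (F' p - F p) := by ring
  rw [e, add_mul]
  exact norm_add_le_of_le (h5 p (ball_subset_ball hr hp)) (hF p hp)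

lemma IsResonantBNF.mono {m : ℕ} {ρ C C' η η' : ℝ} {α β : ℂ} {Y F : ℂ² → ℂ}
    {φ : OpenPartialHomeomorph ℂ² ℂ²} (h : IsResonantBNF m ρ C η α β Y F φ) (hC : C ≤ C')
    (hη : C * η ≤ C' * η') : IsResonantBNF m ρ C' η' α β Y F φ := by
  refine ⟨h.change, h.change_dom, fun p hp => (h.change_order p hp).trans (by gcongr), h.conj, ?_⟩
  obtain ⟨b₂₁, b₀₄, b, c, h1, h2, h3, h4, h5⟩ := h.normal_form
  exact ⟨b₂₁, b₀₄, b, c, h1.trans hη, h2.trans hη, fun k hk => (h3 k hk).trans hC, fun n hn => (h4 n hn).trans hC,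
    fun p hp => (h5 p hp).trans (by gcongr)⟩

lemma pow_two_norm_le {K R : ℝ} {p : ℂ²} (hK : 0 ≤ K) (hp : ‖p‖ ≤ R) (h : 16 * K * R ≤ 1) :
    16 * (K * ‖p‖ ^ 2) ≤ ‖p‖ := by
  have h1 := mul_le_mul_of_nonneg_left (mul_le_mul_of_nonneg_right hp (norm_nonneg p)) hK
  have h2 := mul_le_mul_of_nonneg_right h (norm_nonneg p)
  linarith

variable {m : ℕ}

set_option maxHeartbeats 1000000 in
/-- The resonant Birkhoff normal form, with a normalizing map whose inverse is generated by an entire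
observable. -/
theorem exists_resonantBNF (hm : 1 ≤ m) {M : ℝ} (hM : 0 < M) : ∃ ρ ε C : ℝ, 0 < ρ ∧ 0 < ε ∧ 0 ≤ C ∧
    ∀ q ∈ 𝔻 ε, ∃ (Y F G : ℂ² → ℂ) (φ : OpenPartialHomeomorph ℂ² ℂ²),
      IsCanonicalDiffeo G (polydisk M) φ.symm ∧
      IsResonantBNF m ρ C ‖q‖ (1 / 6 + q.1) (1 / 3 + q.2) Y F φ ∧
      ∀ p ∈ 𝔻 ρ, ‖φ.symm (henonMod (1 / 6 + q.1) (1 / 3 + q.2) (φ p))‖ ≤ 4 * ‖p‖ := by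
  obtain ⟨r, C, ε, hr, hC, hε, hgerm⟩ := exists_germ hm
  obtain ⟨r', K, hr', hK, happ⟩ := exists_polynomial_approximation hr hC (3 * m)
  obtain ⟨K₀, ε₀, hK₀, hε₀, hhen⟩ := exists_henonMod_bounds
  set K' := 2 * (2 + K₀) with hK'
  set K₃ := 2 * (K * K' ^ 2 + 4 * K₀ + 8 * K) with hK₃
  set A := (C + 1) * (4 * m + 2) + C with hA
  set N := 3 * m + 2 with hN
  obtain ⟨r₅, hr₅r, hr₅1, hr₅⟩ : ∃ r₅ : ℝ, 1 * r₅ ≤ r ∧ 1 * r₅ ≤ 1 ∧ 0 < r₅ :=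
    ((eventually_mul_le _ hr).and ((eventually_mul_le _ one_pos).and self_mem_nhdsWithin)).exists
  set Λ := 2 * (A * 2 ^ 4) / (r₅ / 4) with hΛ
  set T := 4 + 2 * K' with hT
  set K₅ := (4 * K + 2 * K * Λ) * T ^ N with hK₅
  have hK'0 : 0 ≤ K' := by positivity
  have hK₃0 : 0 ≤ K₃ := by positivity
  have hA0 : 0 ≤ A := by positivity
  have hΛ0 : 0 ≤ Λ := by positivity
  have hT0 : 0 ≤ T := by positivity
  have hK₅0 : 0 ≤ K₅ := by positivity
  -- `R` and `ρ` depend on `m` and `M` only, not on `q`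
  obtain ⟨R, hRr, hRK, hR⟩ : ∃ R : ℝ, 1 * R ≤ r' ∧ 16 * K * R ≤ 1 ∧ 0 < R :=
    ((eventually_mul_le _ hr').and ((eventually_mul_le _ one_pos).and self_mem_nhdsWithin)).exists
  obtain ⟨ρ, ⟨⟨⟨⟨⟨⟨⟨⟨a1, a2⟩, a3⟩, a4⟩, a5⟩, a6⟩, a7⟩, a8⟩, a9⟩, hρ⟩ : ∃ ρ : ℝ, ((((((((8 * ρ ≤ R ∧ 256 * K * ρ ≤ 1) ∧ 8 * ρ ≤ 1) ∧
      K' * ρ * 4 ≤ R / 2) ∧ K' * ρ * 4 ≤ r / 2) ∧ 64 * K₃ * ρ ≤ 1) ∧ (2 + 4 * K * T) * ρ ≤ r₅ / 8) ∧ T * 2 * ρ ≤ 1) ∧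
      8 * ρ ≤ min M (r / 2)) ∧ 0 < ρ := by
    refine (Filter.Eventually.and (Filter.Eventually.and (Filter.Eventually.and (Filter.Eventually.and (Filter.Eventually.and
      (Filter.Eventually.and (Filter.Eventually.and (Filter.Eventually.and (Filter.Eventually.and (eventually_mul_le _ hR)
      (eventually_mul_le _ one_pos)) (eventually_mul_le _ one_pos)) ?_) ?_) (eventually_mul_le _ one_pos))
      (eventually_mul_le _ (by positivity))) (eventually_mul_le _ one_pos)) (eventually_mul_le _ (by positivity)))
      (self_mem_nhdsWithin : Ioi (0 : ℝ) ∈ 𝓝[>] 0)).exists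
    · filter_upwards [eventually_mul_le (K' * 4) (by positivity : 0 < R / 2)] with x hx using by linarith
    · filter_upwards [eventually_mul_le (K' * 4) (by positivity : 0 < r / 2)] with x hx using by linarith
  have a10 := a9.trans (min_le_left _ _)
  have a11 := a9.trans (min_le_right _ _)
  refine ⟨ρ, min (min ε ε₀) 1, C + 2 * K₅ + 8 * (4 * K), hρ, by positivity, by positivity, fun q hq => ?_⟩
  rw [mem_ball_zero_iff, lt_min_iff, lt_min_iff] at hq
  obtain ⟨⟨hq1, hq2⟩, hq3⟩ := hq
  obtain ⟨Φ, F₀, hg⟩ := hgerm q (mem_ball₀ hq1)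
  obtain ⟨hl1, hl2, hi1, hi2, hh⟩ := hhen q (mem_ball₀ hq2)
  obtain ⟨G, Φ', hGd, hΦ'd, hΦ'⟩ := happ Φ hg.holo hg.jac_eq hg.quad
  set l₁ := lam₁ q with hl₁
  set l₂ := lam₂ q with hl₂
  have hl₁0 : l₁ ≠ 0 := lam₁_ne_zero q
  have hl₂0 : l₂ ≠ 0 := lam₂_ne_zero q
  set h := henonMod (1 / 6 + q.1) (1 / 3 + q.2) with hh_def
  have hD : ∀ v, ‖diag l₁ l₂ v‖ ≤ 11 / 10 * ‖v‖ := fun v =>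
    (norm_diag_le _ _ v).trans (mul_le_mul_of_nonneg_right (max_le hl1 hl2) (norm_nonneg _))
  have hDi : ∀ v, ‖diag l₁⁻¹ l₂⁻¹ v‖ ≤ 11 / 10 * ‖v‖ := fun v =>
    (norm_diag_le _ _ v).trans (mul_le_mul_of_nonneg_right (max_le hi1 hi2) (norm_nonneg _))
  have hin : ∀ {x : ℂ²}, ‖x‖ < R → x ∈ 𝔻 r' := fun hx => mem_ball₀
  have hΦ'at : ∀ {x : ℂ²}, ‖x‖ < R → HoloAt Φ' x := fun hx =>
    hΦ'd.at_ball (hin hx)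
  have hΦ'j : ∀ {x : ℂ²}, ‖x‖ < R → jac Φ' x = 1 := fun hx =>
    jac_eq_one_of_canonical (U := univ) hGd.differentiableOn isOpen_univ (hΦ'at hx) (mem_univ _)
      (by filter_upwards [isOpen_ball.mem_nhds (hin hx)] with y hy using (hΦ' y hy).1)
  -- the inverse of the normalizing germ
  obtain ⟨e, he, hes, het, hei⟩ := exists_openPartialHomeomorph_near_id (f := Φ') (R := R) (c := K * R ^ 2) (d := R / 4)
    (hΦ'd.mono ball_le)
    (fun p hp => (hΦ' p (hin (norm_lt hp))).2.1.trans (by gcongr; exact (norm_lt hp).le))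
    (by positivity) (by linarith [mul_le_mul_of_nonneg_right hRK hR.le])
  set g : ℂ² → ℂ² := ⇑e.symm with hg_def
  have htar : 𝔻 (4 * ρ) ⊆ e.target := (ball_le (by linarith)).trans het
  have hgx : ∀ p ∈ 𝔻 (4 * ρ), ‖g p‖ < R ∧ Φ' (g p) = p ∧ ‖g p‖ ≤ 2 * ‖p‖ ∧ ‖g p - p‖ ≤ 4 * K * ‖p‖ ^ 2 := by
    intro p hp
    have h1 : g p ∈ 𝔻 (R - R / 4) := by rw [← hes]; exact e.map_target (htar hp)
    have h2 : Φ' (g p) = p := by rw [← he]; exact e.right_inv (htar hp)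
    rw [mem_ball_zero_iff] at h1 hp
    have h3 := (hΦ' (g p) (hin (by linarith))).2.1
    rw [h2, norm_sub_rev] at h3
    have h4 := norm_le_add_sub (g p) p
    have h6 := pow_two_norm_le hK (by linarith : ‖g p‖ ≤ R) hRK
    have h5 : ‖g p‖ ≤ 2 * ‖p‖ := by linarith [norm_nonneg (g p)]
    refine ⟨by linarith, h2, h5, h3.trans ?_⟩
    calc _ ≤ K * (2 * ‖p‖) ^ 2 := by gcongr
      _ = _ := by ring
  have hgd : Holo g (ball 0 (4 * ρ)) := hei.mono htar
  have hgj : ∀ p ∈ 𝔻 (4 * ρ), jac g p = 1 := fun p hp => by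
    obtain ⟨h1, -⟩ := hgx p hp
    have h2 := jac_comp (hΦ'at h1) (hgd.at_ball hp)
    rw [hΦ'j h1, one_mul] at h2
    rw [← h2, ← jac_id p]
    exact jac_congr (by filter_upwards [isOpen_ball.mem_nhds hp] with y hy using (hgx y hy).2.1)
  obtain ⟨Y, φ, hφ, hφs, hφf, -, hY, -⟩ := exists_isCanonicalDiffeo hρ (by positivity : 0 ≤ 4 * K) (by linarith) hgd hgj
    (fun p hp => (hgx p hp).2.2.2)
  -- the conjugated map
  have hhx : ∀ p ∈ 𝔻 (4 * ρ), ‖h (g p) - diag l₁ l₂ (g p)‖ ≤ 4 * K₀ * ‖p‖ ^ 2 ∧ ‖h (g p)‖ ≤ K' * ‖p‖ ∧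
      ‖h (g p)‖ < R / 2 + R / 8 ∧ ‖h (g p)‖ < r := by
    intro p hp
    obtain ⟨h1, -, h3, -⟩ := hgx p hp
    have h4 := (hh (g p)).2.2
    have h5 := norm_le_add_sub (h (g p)) (diag l₁ l₂ (g p))
    have h6 := hD (g p)
    rw [mem_ball_zero_iff] at hp
    have h9 : K₀ * ‖g p‖ ^ 2 ≤ K₀ * (2 * ‖p‖) :=
      mul_le_mul_of_nonneg_left ((pow_le_of_le_one (norm_nonneg _) (by linarith) two_ne_zero).trans h3) hK₀
    have h7 : ‖h (g p)‖ ≤ K' * ‖p‖ := by rw [hK']; linarith [norm_nonneg p]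
    have h8 : K' * ‖p‖ ≤ K' * (4 * ρ) := by gcongr
    refine ⟨h4.trans ?_, h7, by linarith, by linarith⟩
    calc _ ≤ K₀ * (2 * ‖p‖) ^ 2 := by gcongr
      _ = _ := by ring
  set k : ℂ² → ℂ² := fun p => diag l₁⁻¹ l₂⁻¹ (Φ' (h (g p))) with hk
  have hkd : ∀ p ∈ 𝔻 (4 * ρ), HoloAt k p ∧ jac k p = 1 := by
    intro p hp
    have d1 := hgd.at_ball hp
    obtain ⟨d2, j2, -⟩ := hh (g p)
    have d3 : HoloAt Φ' (h (g p)) := hΦ'at (by linarith [(hhx p hp).2.2.1])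
    have d4 := (differentiable_diag l₁⁻¹ l₂⁻¹) (Φ' (h (g p)))
    have d5 : HoloAt (fun p => h (g p)) p := DifferentiableAt.comp (g := h) (f := g) p d2 d1
    have d6 : HoloAt (fun p => Φ' (h (g p))) p := DifferentiableAt.comp (g := Φ') p d3 d5
    refine ⟨DifferentiableAt.comp (g := diag l₁⁻¹ l₂⁻¹) p d4 d6, ?_⟩
    rw [hk, jac_comp (g := diag l₁⁻¹ l₂⁻¹) (f := fun p => Φ' (h (g p))) d4 d6,
      jac_comp (g := Φ') (f := fun p => h (g p)) d3 d5, jac_comp d2 d1, jac_diag,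
      hΦ'j (by linarith [(hhx p hp).2.2.1]), j2, hgj p hp]
    field_simp
  have hkq : ∀ p ∈ 𝔻 (4 * ρ), ‖k p - p‖ ≤ K₃ * ‖p‖ ^ 2 := by
    intro p hp
    obtain ⟨h1, h2, h3, h4⟩ := hgx p hp
    obtain ⟨h5, h6, h7, -⟩ := hhx p hp
    have h8 := (hΦ' (h (g p)) (hin (by linarith))).2.1
    have e1 : k p - p = diag l₁⁻¹ l₂⁻¹ ((Φ' (h (g p)) - h (g p)) + (h (g p) - diag l₁ l₂ (g p)) + diag l₁ l₂ (g p - p)) := by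
      rw [diag_sub, show ∀ a b c d : ℂ², (a - b) + (b - c) + (c - d) = a - d by intros; abel, diag_sub,
        diag_inv_diag hl₁0 hl₂0]
    rw [e1]
    have h9 := norm_add₃_le (a := Φ' (h (g p)) - h (g p)) (b := h (g p) - diag l₁ l₂ (g p)) (c := diag l₁ l₂ (g p - p))
    have h10 := hD (g p - p)
    have h11 : K * ‖h (g p)‖ ^ 2 ≤ K * (K' * ‖p‖) ^ 2 := by gcongr
    have h12 := hDi ((Φ' (h (g p)) - h (g p)) + (h (g p) - diag l₁ l₂ (g p)) + diag l₁ l₂ (g p - p))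
    have h13 : 0 ≤ K * K' ^ 2 * ‖p‖ ^ 2 := by positivity
    have h14 : 0 ≤ K₀ * ‖p‖ ^ 2 := by positivity
    have h15 : 0 ≤ K * ‖p‖ ^ 2 := by positivity
    rw [hK₃]
    linarith
  obtain ⟨F, ψ, hψ, hψs, hψf, hF0, -, hex⟩ := exists_isCanonicalDiffeo hρ hK₃0 a6
    (fun p hp => (hkd p hp).1.differentiableWithinAt) (fun p hp => (hkd p hp).2) hkq
  have hconj : ∀ p, Φ' (h (g p)) = diag l₁ l₂ (k p) := fun p => (diag_diag_inv hl₁0 hl₂0 _).symm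
  have hφt : ∀ x ∈ φ.target, φ.symm x ∈ 𝔻 (3 / 2 * ρ) ∧ g (φ.symm x) = x := fun x hx => by
    refine ⟨by rw [← hφs]; exact φ.map_target hx, ?_⟩
    rw [← hφf]; exact φ.right_inv hx
  have hφsymm : ∀ x ∈ φ.target, φ.symm x = Φ' x := fun x hx => by
    obtain ⟨h1, h2⟩ := hφt x hx
    have := (hgx (φ.symm x) (ball_mono h1)).2.1
    rw [h2] at this
    exact this.symm
  have hk2 : ∀ p ∈ 𝔻 ρ, ‖k p‖ ≤ 5 / 4 * ‖p‖ := fun p hp => by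
    have h1 := hkq p (ball_mono hp)
    have h2 := norm_le_add_sub (k p) p
    have h3 := pow_two_norm_le (mul_nonneg hK₃0 (by norm_num : (0 : ℝ) ≤ 4)) (norm_lt hp).le (by linarith)
    linarith [norm_nonneg p]
  have hfix : ∀ p ∈ 𝔻 ρ, h (g p) ∈ φ.target ∧ φ.symm (h (g p)) = diag l₁ l₂ (k p) := by
    intro p hp
    have h1 := hk2 p hp
    have h2 := hD (k p)
    have h3 := (hhx p (ball_mono hp)).2.2.1
    have h4 : h (g p) ∈ e.source := by rw [hes, mem_ball_zero_iff]; linarith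
    have h5 : g (Φ' (h (g p))) = h (g p) := by rw [hg_def, ← he]; exact e.left_inv h4
    have h6 : diag l₁ l₂ (k p) ∈ φ.source := by
      rw [hφs, mem_ball_zero_iff]
      rw [mem_ball_zero_iff] at hp
      linarith [norm_nonneg p]
    replace h5 : φ (diag l₁ l₂ (k p)) = h (g p) := by rw [hφf, ← hconj]; exact h5
    rw [← h5]
    exact ⟨φ.map_source h6, φ.left_inv h6⟩
  refine ⟨Y, F, G, φ, ⟨?_, ?_, ?_, ⟨?_, ?_, ?_, ?_, ?_⟩, ?_⟩, ⟨hφ, ?_, ?_, ⟨ψ, hψ, ?_, ?_⟩, ?_⟩, ?_⟩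
  · rw [φ.symm_source, ← φ.image_source_eq_target]
    exact hφ.connected.image _ φ.continuousOn
  · have := φ.map_source hφ.zero_mem
    rwa [hφ.map_zero] at this
  · have := φ.left_inv hφ.zero_mem
    rwa [hφ.map_zero] at this
  · exact hGd.differentiableOn
  · exact hφ.holo_symm
  · intro x hx
    obtain ⟨h1, h2⟩ := hφt x hx
    have h3 := (hgx _ (ball_mono h1)).2.2.1
    rw [h2] at h3
    rw [mem_ball_zero_iff] at h1
    rw [polydisk_eq_ball, mem_ball_prod]
    exact ⟨by linarith [norm_fst_le x], by linarith [norm_snd_le (φ.symm x)]⟩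
  · intro x hx
    obtain ⟨h1, h2⟩ := hφt x hx
    have h3 := (hgx _ (ball_mono h1)).1
    rw [h2] at h3
    rw [hφsymm x hx]
    exact (hΦ' x (hin h3)).1.1
  · intro x hx
    obtain ⟨h1, h2⟩ := hφt x hx
    have h3 := (hgx _ (ball_mono h1)).1
    rw [h2] at h3
    rw [hφsymm x hx]
    exact (hΦ' x (hin h3)).1.2
  · rw [φ.symm_symm, φ.symm_target]; exact hφ.canonical.holo
  · rw [hφs, polydisk_eq_ball]; exact ball_le
  · intro p hp
    rw [polydisk_eq_ball] at hp
    exact (hY p hp).trans (by gcongr; linarith)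
  · rw [hψs, polydisk_eq_ball]; exact ball_le
  · intro p hp
    rw [polydisk_eq_ball] at hp
    rw [hφf, hψf]
    exact hfix p hp
  · -- the two observables differ by terms of high order
    have hF₀3 : ∀ y ∈ 𝔻 r₅, ‖F₀ y‖ ≤ A * ‖y‖ ^ (2 + 1) := fun y hy => by
      have hy' := norm_lt hy
      exact hg.normal.norm_le hm hC hq3.le (ball_mono hy) (by linarith)
    have hF₀d : Holo F₀ (ball 0 r₅) := hg.obs_holo.mono ball_le
    have hF₀0 : F₀ 0 = 0 := by simpa using hF₀3 0 (mem_ball_self hr₅)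
    have hlip : ∀ u v : ℂ², ‖u‖ < r₅ / 4 → ‖v‖ < r₅ / 4 → ‖sgrad F₀ u - sgrad F₀ v‖ ≤ Λ * ‖u - v‖ :=
      fun u v hu hv => norm_sub_le_of_bound (R := r₅ / 2) (d := r₅ / 4)
        ((differentiableOn_sgrad hF₀d isOpen_ball).mono ball_le)
        (fun y hy => by
          rw [mem_ball_zero_iff] at hy
          exact (norm_sgrad_le_pow hF₀d hF₀3 hA0 hy).trans
            (mul_le_of_le_one_right (by positivity) (pow_le_one₀ (norm_nonneg _) (by linarith))))
        (by positivity) (by linarith) (by linarith)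
    have hgrad : ∀ y ∈ 𝔻 (2 * ρ), ‖sgrad F y - sgrad F₀ y‖ ≤ K₅ * ‖y‖ ^ N := by
      intro y hy
      obtain ⟨p, hp, hp1, hp2, hpair⟩ := hex y hy
      have hp4 : p ∈ 𝔻 (4 * ρ) := ball_mono hp
      obtain ⟨g1, g2, g3, -⟩ := hgx p hp4
      obtain ⟨-, x2, x3, x4⟩ := hhx p hp4
      rw [mem_ball_zero_iff] at hp hp4 hy
      have hpy : ‖p‖ ≤ 2 * ‖y‖ := norm_le_two_mul_of_quadratic (hkq p (mem_ball₀ hp4)) hp.le (by linarith) hK₃0 hp1 hp2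
      have hpair₀ := hg.pair (g p) mem_ball₀ (mem_ball₀ x4)
      have hy0 := norm_nonneg y
      have n1 : ‖Φ (g p) - p‖ ≤ K * (T * ‖y‖) ^ N := by
        have h1 := (hΦ' (g p) (hin g1)).2.2
        rw [g2, norm_sub_rev] at h1
        refine h1.trans ?_
        gcongr
        rw [hT]; linarith [mul_nonneg hK'0 hy0]
      have n2 : ‖diag l₁⁻¹ l₂⁻¹ (Φ (h (g p))) - k p‖ ≤ 2 * K * (T * ‖y‖) ^ N := by
        have h1 := (hΦ' (h (g p)) (hin (by linarith))).2.2
        have h2 := hDi (Φ (h (g p)) - Φ' (h (g p)))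
        rw [diag_sub] at h2
        rw [norm_sub_rev] at h1
        have h3 : K * ‖h (g p)‖ ^ N ≤ K * (T * ‖y‖) ^ N := by
          gcongr
          refine x2.trans ((mul_le_mul_of_nonneg_left hpy hK'0).trans ?_)
          rw [hT]; linarith
        have h4 : 0 ≤ K * (T * ‖y‖) ^ N := by positivity
        linarith
      set P := Φ (g p) with hP
      set Q := diag l₁⁻¹ l₂⁻¹ (Φ (h (g p))) with hQ
      have hK0 : 0 ≤ K * (T * ‖y‖) ^ N := by positivity
      have hmix : ‖(P.1, Q.2) - y‖ ≤ 2 * K * (T * ‖y‖) ^ N := by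
        have e1 : (P.1, Q.2) - y = ((P - p).1, (Q - k p).2) := by
          ext
          · simp [hp1]
          · simp [hp2]
        rw [e1, Prod.norm_mk]
        exact max_le ((norm_fst_le _).trans (n1.trans (by linarith))) ((norm_snd_le _).trans n2)
      have hTy : (T * ‖y‖) ^ N ≤ T * (2 * ρ) := by
        have h1 : T * ‖y‖ ≤ T * (2 * ρ) := by gcongr
        exact (pow_le_of_le_one (by positivity) (by linarith) (by omega)).trans h1
      have hTK := mul_le_mul_of_nonneg_left hTy hK
      have e1 : sgrad F y = k p - p := by rw [canonicalPair_sub_eq hpair, hp1, hp2]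
      have e2 : sgrad F₀ (P.1, Q.2) = Q - P := (canonicalPair_sub_eq hpair₀).symm
      have e3 : sgrad F y - sgrad F₀ y = (P - p) - (Q - k p) + (sgrad F₀ (P.1, Q.2) - sgrad F₀ y) := by
        rw [e1, e2]; abel
      have h1 := hlip (P.1, Q.2) y (by linarith [norm_le_add_sub (P.1, Q.2) y]) (by
        have : 0 ≤ K * T * ρ := by positivity
        linarith)
      have h2 := mul_le_mul_of_nonneg_left hmix hΛ0
      rw [e3]
      refine (norm_add_le _ _).trans ((add_le_add_left (norm_sub_le _ _) _).trans ?_)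
      rw [hK₅, mul_assoc, ← mul_pow]
      linarith
    have hclose : ∀ y ∈ 𝔻 (2 * ρ), ‖F y - F₀ y‖ ≤ 2 * K₅ * ‖y‖ ^ N := by
      intro y hy
      have hFd : Holo F (ball 0 (2 * ρ)) := by
        have := hψ.canonical.holo_obs
        rwa [polydisk_eq_ball] at this
      have hF₀d' : Holo F₀ (ball 0 (2 * ρ)) := hg.obs_holo.mono ball_le
      have h1 := norm_le_of_sgrad_le (c := K₅ * ‖y‖ ^ N) (hFd.fun_sub hF₀d') (by rw [hF0, hF₀0, sub_zero]) hy
        fun x hx => by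
          have hx' : x ∈ 𝔻 (2 * ρ) := mem_ball₀ (hx.trans_lt (norm_lt hy))
          rw [sgrad_sub (hFd.at_ball hx') (hF₀d'.at_ball hx')]
          exact (hgrad x hx').trans (by gcongr)
      refine h1.trans ?_
      rw [← mul_assoc]
      exact mul_le_of_le_one_right (by positivity) (by linarith [norm_lt hy])
    have h1 := (hg.normal.perturb (K := 2 * K₅) (by positivity) (norm_nonneg q) (by linarith : 2 * ρ ≤ r) hclose).mono
      (C' := C + 2 * K₅ + 8 * (4 * K)) (η' := ‖q‖) (by linarith) (mul_le_mul_of_nonneg_right (by linarith) (norm_nonneg q)) le_rfl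
    rw [polydisk_eq_ball]
    exact h1
  · intro p hp
    rw [hφf, (hfix p hp).2]
    linarith [hD (k p), hk2 p hp, norm_nonneg p]

end Birkhoff

/-! ### The zoomed normal form -/

section Zoomed

/-- The factor `κ/(β̊δ)`. -/
def zoomFactor : ℝ := 2 * π * (√3 / 2)

lemma one_le_zoomFactor : 1 ≤ zoomFactor := by
  have h1 : 1 ≤ √3 := Real.one_le_sqrt.2 (by norm_num)
  rw [zoomFactor]
  nlinarith [Real.pi_gt_three]

/-- The Hamiltonian of the nonlinear part of the model vector field. -/
def modelObs (ε : ℂ) (p : ℂ²) : ℂ :=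
  zoomFactor * ε * (I * (1 / √3 : ℝ)) * p.1 ^ 2 * p.2 +
    zoomFactor * ε * (I * (-(2 / 3) * (1 / √3) : ℝ) / 4) * p.2 ^ 4

lemma sgrad_modelObs (τ ε : ℂ) (p : ℂ²) : sgrad (modelObs ε) p =
    ε • modelField τ p - diag (2 * π * I * ((1 - τ) * ε)) (2 * π * I * (τ * ε)) p := by
  have h3 : (√3 : ℂ) ≠ 0 := by exact_mod_cast (by positivity : √3 ≠ 0)
  have h1 : modelObs ε = polyObs (ι := Fin 2) ![(2, 1), (0, 4)] ![π * ε * I, -(π * ε * I / 6)] := by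
    funext p
    simp only [modelObs, polyObs, Fin.sum_univ_two, zoomFactor]
    push_cast
    simp
    field_simp
    ring
  rw [h1, sgrad_polyObs]
  simp only [Fin.sum_univ_two, monoField, modelField, diag]
  ext
  · simp; ring
  · simp; ring

lemma exp_sub_one_sub_le {x : ℂ} {r : ℝ} (hx : ‖x‖ ≤ r) (hr : r ≤ 1) :
    ‖exp x - 1‖ ≤ 2 * r ∧ ‖exp x - 1 - x‖ ≤ r ^ 2 :=
  ⟨(Complex.norm_exp_sub_one_le (hx.trans hr)).trans (by gcongr),
    (Complex.norm_exp_sub_one_sub_id_le (hx.trans hr)).trans (by gcongr)⟩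

lemma zoomObs_normalTerms_jRoot (m : ℕ) (b₂₁ b₀₄ : ℂ) (b c : ℕ → ℂ) :
    zoomObs 1 jRoot⁻¹ (normalTerms m b₂₁ b₀₄ b c) = normalTerms m b₂₁ b₀₄ b c := by
  funext p
  have h0 := jRoot_ne_zero
  have h1 : ∀ n : ℕ, jRoot⁻¹ ^ (3 * n + 1) = jRoot⁻¹ := fun n => by
    rw [pow_succ, pow_mul, inv_pow, jRoot_pow_three, inv_one, one_pow, one_mul]
  have h2 : jRoot⁻¹ ^ 4 = jRoot⁻¹ := h1 1
  simp only [zoomObs, normalTerms, diag, one_mul, mul_pow, h1]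
  rw [h2, div_eq_iff (inv_ne_zero h0), add_mul, add_mul, add_mul, Finset.sum_mul, Finset.sum_mul]
  congr 1
  · congr 1
    · ring
    · exact Finset.sum_congr rfl fun k _ => by ring
  · exact Finset.sum_congr rfl fun k _ => by ring

lemma differentiable_normalTerms (m : ℕ) (b₂₁ b₀₄ : ℂ) (b c : ℕ → ℂ) : Differentiable ℂ (normalTerms m b₂₁ b₀₄ b c) := by
  unfold normalTerms
  fun_prop

lemma zoomObs_normalTerms (m : ℕ) {κ ω : ℂ} (hκ : κ ≠ 0) (hω : ω ^ 3 = κ ^ 2) (b₂₁ b₀₄ : ℂ) (b c : ℕ → ℂ) (p : ℂ²) :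
    zoomObs κ ω (normalTerms m b₂₁ b₀₄ b c) p =
      normalTerms m (κ * b₂₁) (κ * b₀₄) (fun k => κ ^ (k - 1) * b k) (fun n => κ ^ (2 * n - 1) * c n) p := by
  have hω0 : ω ≠ 0 := by
    rintro rfl
    exact hκ (by simpa using hω.symm)
  have h1 : ∀ n : ℕ, ω ^ (3 * n + 1) = κ ^ (2 * n) * ω := fun n => by rw [pow_succ, pow_mul, hω, ← pow_mul]
  have h4 : ω ^ 4 = κ ^ 2 * ω := h1 1
  simp only [zoomObs, normalTerms, diag, mul_pow, h1, h4]
  rw [div_eq_iff (mul_ne_zero hκ hω0), add_mul, add_mul, add_mul, Finset.sum_mul, Finset.sum_mul]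
  congr 1
  · congr 1
    · ring
    · refine Finset.sum_congr rfl fun k hk => ?_
      obtain ⟨i, rfl⟩ := Nat.exists_eq_add_of_le (Finset.mem_Icc.1 hk).1
      rw [show 3 + i - 1 = 2 + i by omega]
      ring
  · refine Finset.sum_congr rfl fun n hn => ?_
    obtain ⟨i, rfl⟩ := Nat.exists_eq_add_of_le (Finset.mem_Icc.1 hn).1
    rw [show 2 * (2 + i) - 1 = 3 + 2 * i by omega]
    ring

/-- The canonical map of the zoomed normal form, followed by the linear part, is the flow of the
model vector field up to a quadratic error. -/
lemma exists_zoomed_model {m : ℕ} (hm : 1 ≤ m) (τ : ℂ) {A R : ℝ} (hA : 0 ≤ A) (hR : 0 ≤ R) :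
    ∃ K ε₀ : ℝ, 0 ≤ K ∧ 0 < ε₀ ∧ ∀ ε κ : ℂ, ‖ε‖ < ε₀ → κ = zoomFactor * ε → ∀ (b₂₁ b₀₄ : ℂ) (b c : ℕ → ℂ),
      ‖b₂₁ - I * (1 / √3 : ℝ)‖ ≤ A * ‖ε‖ →
      ‖b₀₄ - I * (-(2 / 3) * (1 / √3) : ℝ) / 4‖ ≤ A * ‖ε‖ →
      (∀ k ∈ Finset.Icc 3 (3 * m), ‖b k‖ ≤ A) → (∀ n ∈ Finset.Icc 2 m, ‖c n‖ ≤ A) →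
      ∀ H, H = normalTerms m (κ * b₂₁) (κ * b₀₄) (fun k => κ ^ (k - 1) * b k) (fun n => κ ^ (2 * n - 1) * c n) →
      (∀ p ∈ 𝔻 (R + 2), ‖sgrad H p‖ ≤ K * ‖ε‖) ∧
      (∀ v, ‖diag (exp (2 * π * I * ((1 - τ) * ε))) (exp (2 * π * I * (τ * ε))) v‖ ≤ 3 * ‖v‖) ∧
      ∃ θ f : ℂ² → ℂ², (∀ p, f p = diag (exp (2 * π * I * ((1 - τ) * ε)))
          (exp (2 * π * I * (τ * ε))) (θ p)) ∧
        (∀ p ∈ 𝔻 R, IsCanonicalPair H p (θ p) ∧ ‖θ p - p‖ ≤ K * ‖ε‖) ∧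
        Holo f (ball 0 R) ∧
        (∀ p ∈ 𝔻 R, f (diag 1 jRoot p) = diag 1 jRoot (f p)) ∧
        (∀ p ∈ 𝔻 R, jac f p = exp (2 * π * I * ε)) ∧
        ∀ p ∈ 𝔻 R, ‖f p - (p + ε • modelField τ p)‖ ≤ K * ‖ε‖ ^ 2 := by
  obtain ⟨L, hL0, hL⟩ := exists_bound_modelField τ (R + 2)
  set T := 2 * π * (1 + ‖τ‖) with hT
  have hT0 : 0 ≤ T := by positivity
  have hz := one_le_zoomFactor
  set B := A * zoomFactor ^ 2 * (4 * m + 2) * (R + 3) ^ (3 * m + 1) with hB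
  have hB0 : 0 ≤ B := by positivity
  set K₁ := L + T * (R + 2) + 2 * B with hK₁
  have hK₁0 : 0 ≤ K₁ := by positivity
  set K₂ := 2 * B + 4 * K₁ ^ 2 + T ^ 2 * R + 2 * T * K₁ with hK₂
  have hK₂0 : 0 ≤ K₂ := by positivity
  obtain ⟨ε₀, ⟨⟨h1, h2⟩, h3⟩, hε₀⟩ : ∃ x : ℝ, ((zoomFactor * x ≤ 1 ∧ T * x ≤ 1) ∧ 4 * K₁ * x ≤ 1) ∧ 0 < x :=
    ((((eventually_mul_le _ one_pos).and (eventually_mul_le _ one_pos)).and (eventually_mul_le _ one_pos)).and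
      self_mem_nhdsWithin).exists
  refine ⟨K₁ + K₂, ε₀, by positivity, hε₀, fun ε κ hε hκ b₂₁ b₀₄ b c hb₂₁ hb₀₄ hb hc H hH => ?_⟩
  have hε0 := norm_nonneg ε
  have hε1 : ‖ε‖ ≤ 1 := by nlinarith
  have hTε : T * ‖ε‖ ≤ 1 := le_trans (by gcongr) h2
  have hKε : 4 * (K₁ * ‖ε‖) ≤ 1 := by
    have : K₁ * ‖ε‖ ≤ K₁ * ε₀ := by gcongr
    linarith
  have nκ : ‖κ‖ = zoomFactor * ‖ε‖ := by rw [hκ, norm_mul, Complex.norm_of_nonneg (by linarith)]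
  have hκ1 : ‖κ‖ ≤ 1 := by rw [nκ]; exact le_trans (by gcongr) h1
  have hHd : Differentiable ℂ H := hH ▸ differentiable_normalTerms _ _ _ _ _
  have hMd : Differentiable ℂ (modelObs ε) := by unfold modelObs; fun_prop
  -- the difference with the model
  have hdiff : ∀ p ∈ 𝔻 (R + 3), ‖H p - modelObs ε p‖ ≤ B * ‖ε‖ ^ 2 := by
    intro p hp
    have e : H p - modelObs ε p = normalTerms m (κ * (b₂₁ - I * (1 / √3 : ℝ)))
        (κ * (b₀₄ - I * (-(2 / 3) * (1 / √3) : ℝ) / 4)) (fun k => κ ^ (k - 1) * b k) (fun n => κ ^ (2 * n - 1) * c n) p := by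
      rw [hH, modelObs, normalTerms, normalTerms, hκ]; ring
    have hpow : ∀ (i : ℕ) (x : ℂ), 2 ≤ i → ‖x‖ ≤ A → ‖κ ^ i * x‖ ≤ A * zoomFactor ^ 2 * ‖ε‖ ^ 2 := fun i x hi hx => by
      rw [norm_mul, norm_pow]
      calc _ ≤ ‖κ‖ ^ 2 * A := mul_le_mul (pow_le_pow_of_le_one (norm_nonneg _) hκ1 hi) hx (norm_nonneg _) (by positivity)
        _ = _ := by rw [nκ]; ring
    have hlin : ∀ x : ℂ, ‖x‖ ≤ A * ‖ε‖ → ‖κ * x‖ ≤ A * zoomFactor ^ 2 * ‖ε‖ ^ 2 := fun x hx => by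
      rw [norm_mul, nκ]
      calc _ ≤ zoomFactor * ‖ε‖ * (A * ‖ε‖) := by gcongr
        _ = zoomFactor * (A * ‖ε‖ ^ 2) := by ring
        _ ≤ zoomFactor ^ 2 * (A * ‖ε‖ ^ 2) := by gcongr; exact le_self_pow₀ hz two_ne_zero
        _ = _ := by ring
    rw [e]
    refine (norm_normalTerms_le hm (X := (R + 3) ^ (3 * m + 1)) (fun i _ hi => ?_) (hlin _ hb₂₁) (hlin _ hb₀₄)
      (fun k hk => hpow _ _ (by have := Finset.mem_Icc.1 hk; omega) (hb k hk))
      (fun n hn => hpow _ _ (by have := Finset.mem_Icc.1 hn; omega) (hc n hn))).trans_eq (by rw [hB]; ring)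
    calc _ ≤ (R + 3) ^ i := by gcongr; exact (norm_lt hp).le
      _ ≤ _ := pow_le_pow_right₀ (by linarith) hi
  have hsg : ∀ p ∈ 𝔻 (R + 2), ‖sgrad H p - sgrad (modelObs ε) p‖ ≤ 2 * B * ‖ε‖ ^ 2 := fun p hp => by
    rw [← sgrad_sub (hHd p) (hMd p)]
    refine (norm_sgrad_le _ _).trans ((norm_fderiv_le_of_bound (hHd.sub hMd).differentiableOn hdiff one_pos ?_).trans_eq ?_)
    · linarith [norm_lt hp]
    · ring
  set D : ℂ² → ℂ² := diag (2 * π * I * ((1 - τ) * ε)) (2 * π * I * (τ * ε)) with hD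
  have n2 : ‖(2 * π * I : ℂ)‖ = 2 * π := by simp [Real.pi_nonneg]
  have hx1 : ‖2 * π * I * ((1 - τ) * ε)‖ ≤ T * ‖ε‖ := by
    rw [norm_mul, n2, norm_mul, hT, mul_assoc (2 * π)]
    have : ‖1 - τ‖ ≤ 1 + ‖τ‖ := (norm_sub_le _ _).trans_eq (by rw [norm_one])
    gcongr
  have hx2 : ‖2 * π * I * (τ * ε)‖ ≤ T * ‖ε‖ := by
    rw [norm_mul, n2, norm_mul, hT, mul_assoc (2 * π)]
    have : ‖τ‖ ≤ 1 + ‖τ‖ := by linarith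
    gcongr
  have hDn : ∀ p, ‖D p‖ ≤ T * ‖ε‖ * ‖p‖ := fun p =>
    (norm_diag_le _ _ p).trans (mul_le_mul_of_nonneg_right (max_le hx1 hx2) (norm_nonneg _))
  have hgrad : ∀ p ∈ 𝔻 (R + 2), ‖sgrad H p‖ ≤ K₁ * ‖ε‖ := fun p hp => by
    have h4 := norm_le_add_sub (sgrad H p) (sgrad (modelObs ε) p)
    have h5 := hsg p hp
    rw [sgrad_modelObs τ] at h4 h5
    have h6 := norm_sub_le (ε • modelField τ p) (D p)
    rw [norm_smul] at h6
    have h7 : ‖ε‖ * ‖modelField τ p‖ ≤ ‖ε‖ * L := mul_le_mul_of_nonneg_left (hL p hp) hε0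
    have h8 : T * ‖ε‖ * ‖p‖ ≤ T * ‖ε‖ * (R + 2) := mul_le_mul_of_nonneg_left (norm_lt hp).le (by positivity)
    have h9 : 2 * B * ‖ε‖ ^ 2 ≤ 2 * B * ‖ε‖ := by gcongr; exact pow_le_of_le_one hε0 hε1 two_ne_zero
    have h10 := hDn p
    rw [hK₁]
    linarith
  obtain ⟨e1, e1'⟩ := exp_sub_one_sub_le hx1 hTε
  obtain ⟨e2, e2'⟩ := exp_sub_one_sub_le hx2 hTε
  have hexp : ∀ {x : ℂ}, ‖exp x - 1‖ ≤ 2 * (T * ‖ε‖) → ‖exp x‖ ≤ 3 := fun {x} hx => by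
    have := norm_le_add_sub (exp x) 1
    rw [norm_one] at this
    linarith
  refine ⟨fun p hp => (hgrad p hp).trans (by gcongr; linarith), fun v => (norm_diag_le _ _ v).trans
    (mul_le_mul_of_nonneg_right (max_le (hexp e1) (hexp e2)) (norm_nonneg _)), ?_⟩
  obtain ⟨θ, hθ, hθp, huniq⟩ := exists_canonicalMap (R := R + 2) (d := 1) hHd.differentiableOn hgrad one_pos hKε
  rw [show R + 2 - 2 * 1 = R by ring, show R + 2 - 1 = R + 1 by ring] at *
  refine ⟨θ, _, fun p => rfl, fun p hp => ⟨(hθp p hp).2.1, (hθp p hp).2.2.trans (by gcongr; linarith)⟩,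
    (differentiable_diag _ _).comp_differentiableOn hθ, fun p hp => ?_, fun p hp => ?_, fun p hp => ?_⟩
  · obtain ⟨h4, h5, -⟩ := hθp p hp
    have h6 : diag 1 jRoot (θ p) = θ (diag 1 jRoot p) := by
      refine huniq _ (by rw [mem_ball_zero_iff, norm_diag_one_jRoot]; exact norm_lt hp) _ ?_ ?_
      · have : ((diag 1 jRoot p).1, (diag 1 jRoot (θ p)).2) = diag 1 jRoot (p.1, (θ p).2) := rfl
        rw [this, mem_ball_zero_iff, norm_diag_one_jRoot]
        exact norm_lt h4
      · rw [hH, ← zoomObs_normalTerms_jRoot, ← hH]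
        have e : ∀ v, diag 1 jRoot⁻¹ (diag 1 jRoot v) = v := fun v => by
          rw [diag_diag, inv_mul_cancel₀ jRoot_ne_zero, one_mul, diag_one_one]
        exact isCanonicalPair_zoomObs one_ne_zero (inv_ne_zero jRoot_ne_zero) (hHd _) (by rw [e, e]; exact h5)
    simp only [← h6, diag_diag, mul_comm]
  · have h4 := hθ.at_ball hp
    rw [jac_comp (g := diag _ _) ((differentiable_diag _ _) _) h4, jac_diag, ← Complex.exp_add,
      jac_eq_one_of_canonical (U := univ) hHd.differentiableOn isOpen_univ h4 (mem_univ _)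
        (by filter_upwards [isOpen_ball.mem_nhds hp] with x hx using (hθp x hx).2.1), mul_one]
    congr 1
    ring
  · obtain ⟨h4, h5, h6⟩ := hθp p hp
    rw [mem_ball_zero_iff] at hp h4
    have hs0 : ∀ y, sgrad (fun _ : ℂ² => (0 : ℂ)) y = 0 := fun y => by simp [sgrad, dw, dz]
    have h7 := (canonicalPair_compare (H := fun _ => 0) (H' := H) (R := R + 2) (c := 0) (c' := K₁ * ‖ε‖) (k := K₁ * ‖ε‖) (d := 1)
      (p := p) (q := p) (q' := θ p) (differentiable_const _).differentiableOn hHd.differentiableOn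
      (fun y _ => by rw [hs0, norm_zero]) hgrad (fun y hy => by rw [hs0, sub_zero]; exact hgrad y hy) one_pos hKε
      (by linarith) (by simp only [Prod.mk.eta]; linarith) (by linarith) (by simp [IsCanonicalPair, dw, dz]) h5).2
    rw [hs0, sub_zero] at h7
    have h8 := hsg p mem_ball₀
    rw [sgrad_modelObs τ] at h8
    set x₁ := 2 * π * I * ((1 - τ) * ε)
    set x₂ := 2 * π * I * (τ * ε)
    have e : diag (exp x₁) (exp x₂) (θ p) - (p + ε • modelField τ p) =
        diag (exp x₁ - 1) (exp x₂ - 1) (θ p - p) + diag (exp x₁ - 1 - x₁) (exp x₂ - 1 - x₂) p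
        + (θ p - p - sgrad H p) + (sgrad H p - (ε • modelField τ p - D p)) := by
      ext
      · simp [diag, hD]; ring
      · simp [diag, hD]; ring
    have n3 := (norm_diag_le (exp x₁ - 1) (exp x₂ - 1) (θ p - p)).trans
      (mul_le_mul (max_le e1 e2) h6 (norm_nonneg _) (by positivity))
    have n4 := (norm_diag_le (exp x₁ - 1 - x₁) (exp x₂ - 1 - x₂) p).trans
      (mul_le_mul (max_le e1' e2') hp.le (norm_nonneg _) (by positivity))
    rw [e]
    refine norm_add₄_le.trans ?_
    have h9 : 0 ≤ K₁ * ‖ε‖ ^ 2 := by positivity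
    rw [hK₂]
    linarith

end Zoomed

/-! ### Interpolation of the zoomed map -/

section Interpolation

lemma norm_omega_pow {κ ω : ℂ} (h : ω ^ 3 = κ ^ 2) (hκ : κ ≠ 0) (m : ℕ) :
    ‖ω‖ ^ (3 * m + 1) / ‖κ‖ = ‖κ‖ ^ (2 * (m : ℝ) - 1 / 3) := by
  have h0 : 0 < ‖κ‖ := norm_pos_iff.2 hκ
  have h1 : ‖ω‖ ^ 3 = ‖κ‖ ^ 2 := by rw [← norm_pow, h, norm_pow]
  have h2 : ‖ω‖ = ‖κ‖ ^ (2 / 3 : ℝ) := by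
    rw [← Real.pow_rpow_inv_natCast (norm_nonneg ω) three_ne_zero, h1, ← Real.rpow_natCast, ← Real.rpow_mul h0.le]
    norm_num
  rw [h2, ← Real.rpow_natCast, ← Real.rpow_mul h0.le, ← Real.rpow_sub_one h0.ne']
  congr 1
  push_cast
  ring

lemma norm_sub_le_two_mul {φ : ℂ² → ℂ²} {R c d : ℝ} {x y : ℂ²} (hφ : Holo φ (ball 0 R))
    (hb : ∀ p ∈ 𝔻 R, ‖φ p - p‖ ≤ c) (hd : 0 < d) (hcd : 4 * c ≤ d) (hx : ‖x‖ < R - d) (hy : ‖y‖ < R - d) :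
    ‖x - y‖ ≤ 2 * ‖φ x - φ y‖ := by
  have h1 := norm_sub_le_of_bound (f := fun p => φ p - p) (hφ.sub differentiableOn_id) hb hd hx hy
  have h2 : 2 * c / d * ‖x - y‖ ≤ 1 / 2 * ‖x - y‖ := by
    refine mul_le_mul_of_nonneg_right ?_ (norm_nonneg _)
    rw [div_le_iff₀ hd]; linarith
  have h3 := norm_sub_le (φ x - φ y) (φ x - x - (φ y - y))
  rw [show φ x - φ y - (φ x - x - (φ y - y)) = x - y by abel] at h3
  linarith

set_option maxHeartbeats 1000000 in
/-- In the zoomed coordinates the normal form is interpolated by the flow of a vector field close to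
the model, up to a canonical map close to the identity. -/
theorem exists_interpolation {m : ℕ} (hm : 1 ≤ m) (τ : ℂ) {M A ρ : ℝ} (hM : 0 < M) (hA : 0 ≤ A) (hρ : 0 < ρ) :
    ∃ C ε₀ : ℝ, 0 ≤ C ∧ 0 < ε₀ ∧ ∀ ε κ ω : ℂ, ε ≠ 0 → ‖ε‖ < ε₀ → κ = zoomFactor * ε → ω ^ 3 = κ ^ 2 →
      ∀ (F : ℂ² → ℂ) (ψ : ℂ² → ℂ²), HasNormalForm m A ‖ε‖ (2 * ρ) F → Holo F (ball 0 (2 * ρ)) →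
      Holo ψ (ball 0 ρ) → (∀ p ∈ 𝔻 ρ, (p.1, (ψ p).2) ∈ 𝔻 (2 * ρ) ∧
        IsCanonicalPair F p (ψ p) ∧ ‖ψ p‖ ≤ 5 * ‖p‖) →
      ∃ (R : ℂ² → ℂ) (X r : ℂ² → ℂ²), Holo X (ball 0 (2 * M)) ∧
        (∀ p ∈ 𝔻 (2 * M), divergence X p = 2 * π * I ∧ X (diag 1 jRoot p) = diag 1 jRoot (X p) ∧
          ‖X p - modelField τ p‖ ≤ C * ‖ε‖ ∧ ‖R p‖ ≤ C * ‖ε‖ ^ (2 * (m : ℝ) - 1 / 3)) ∧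
        IsCanonicalOn R (ball 0 (2 * M)) (ball 0 M) r ∧
        ∀ p ∈ 𝔻 M, diag κ ω p ∈ 𝔻 ρ ∧ TimeOneMap (fun x => ε • X x) (ball 0 (2 * M)) (r p)
          (diag (exp (2 * π * I * ((1 - τ) * ε))) (exp (2 * π * I * (τ * ε)))
            (diag κ⁻¹ ω⁻¹ (ψ (diag κ ω p)))) := by
  -- mixed points satisfy `‖(p₁, (ψ p)₂)‖ ≤ 5‖p‖`, and each of the `2m` interpolation steps loses one
  -- unit of radius
  set R' : ℝ := 5 * (2 * M + 2) + 2 * m with hR'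
  have hR'0 : 0 < R' := by positivity
  have hm0 : (0 : ℝ) ≤ m := by positivity
  obtain ⟨K, ε₁, hK, hε₁, hmod⟩ := exists_zoomed_model hm τ hA hR'0.le
  obtain ⟨C₁, ε₂, hC₁, hε₂, hint⟩ := exists_isInterpolating τ K hK (2 * m) (2 * M + 1)
  obtain ⟨L, hL, hLb⟩ := exists_bound_modelField τ (2 * M + 1)
  have hz := one_le_zoomFactor
  set s : ℝ := 2 * (m : ℝ) - 1 / 3 with hs
  have hs1 : 1 ≤ s := by
    have : (1 : ℝ) ≤ m := by exact_mod_cast hm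
    linarith
  set C₂ := 2 * (A * (R' + 2) ^ (3 * m + 2) * zoomFactor ^ s) with hC₂
  have hC₂0 : 0 ≤ C₂ := by positivity
  set C₃ := 6 * C₂ + C₁ with hC₃
  set c := L + C₁ with hc
  obtain ⟨ε₀, ⟨⟨⟨⟨⟨b1, b2⟩, b3⟩, b4⟩, b5⟩, b6⟩, hε₀⟩ : ∃ x : ℝ, (((((1 * x ≤ min ε₁ ε₂ ∧ zoomFactor * x ≤ 1) ∧
      zoomFactor ^ 2 * x ≤ (ρ / (R' + 2)) ^ 3) ∧ (K + C₂) * x ≤ 1 / 4) ∧ (C₃ + c) * x ≤ 1 / 128) ∧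
      (C₃ + c) * x ≤ M / 8) ∧ 0 < x :=
    ((((((eventually_mul_le _ (by positivity)).and (eventually_mul_le _ one_pos)).and (eventually_mul_le _ (by positivity))).and
      (eventually_mul_le _ (by positivity))).and (eventually_mul_le _ (by positivity))).and
      (eventually_mul_le _ (by positivity))|>.and self_mem_nhdsWithin).exists
  refine ⟨C₁ + 8 * M * C₃, ε₀, by positivity, hε₀, fun ε κ ω hε hεε₀ hκ hω F ψ hF hFd hψd hψ => ?_⟩
  have b7 := b1.trans (min_le_left _ _)
  have b8 := b1.trans (min_le_right _ _)
  have hε0 : 0 < ‖ε‖ := norm_pos_iff.2 hε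
  have hmono : ∀ {a : ℝ}, 0 ≤ a → a * ‖ε‖ ≤ a * ε₀ := fun ha => mul_le_mul_of_nonneg_left hεε₀.le ha
  have nκ : ‖κ‖ = zoomFactor * ‖ε‖ := by rw [hκ, norm_mul, Complex.norm_of_nonneg (by linarith)]
  have hκ1 : ‖κ‖ ≤ 1 := by rw [nκ]; exact (hmono (by linarith)).trans b2
  have hε1 : ‖ε‖ ≤ 1 := by nlinarith
  have hκ0 : κ ≠ 0 := norm_pos_iff.1 (by rw [nκ]; positivity)
  have hω0 : ω ≠ 0 := by
    rintro rfl
    exact hκ0 (by simpa using hω.symm)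
  have nω : ‖ω‖ ^ 3 = ‖κ‖ ^ 2 := by rw [← norm_pow, hω, norm_pow]
  have hκω : ‖κ‖ ≤ ‖ω‖ := by
    refine le_of_pow_le_pow_left₀ three_ne_zero (norm_nonneg _) ?_
    rw [nω]
    exact pow_le_pow_of_le_one (norm_nonneg _) hκ1 (by norm_num)
  have hωρ : ‖ω‖ * (R' + 2) ≤ ρ := by
    rw [← le_div_iff₀ (by positivity)]
    refine le_of_pow_le_pow_left₀ three_ne_zero (by positivity) ?_
    rw [nω, nκ, mul_pow]
    refine le_trans ?_ ((hmono (by positivity)).trans b3)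
    gcongr
    exact pow_le_of_le_one hε0.le hε1 two_ne_zero
  set S := ‖ε‖ ^ s with hS
  have hS0 : 0 ≤ S := by positivity
  have hSε : S ≤ ‖ε‖ := by
    have := Real.rpow_le_rpow_of_exponent_ge hε0 hε1 hs1
    rwa [Real.rpow_one] at this
  have hS2 : ‖ε‖ ^ (2 * m + 2) ≤ S := by
    rw [← Real.rpow_natCast]
    refine Real.rpow_le_rpow_of_exponent_ge hε0 hε1 ?_
    push_cast; linarith
  have hσ : ‖ω‖ ^ (3 * m + 1) / ‖κ‖ = zoomFactor ^ s * S := by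
    rw [norm_omega_pow hω hκ0, nκ, Real.mul_rpow (by linarith) hε0.le]
  have hdil : ∀ p, ‖diag κ ω p‖ ≤ ‖ω‖ * ‖p‖ := fun p =>
    (norm_diag_le _ _ p).trans (mul_le_mul_of_nonneg_right (max_le hκω le_rfl) (norm_nonneg _))
  have hdilρ : ∀ p ∈ 𝔻 (R' + 2), diag κ ω p ∈ 𝔻 ρ := fun p hp => by
    rw [mem_ball_zero_iff] at hp ⊢
    refine (hdil p).trans_lt (lt_of_lt_of_le ?_ hωρ)
    exact mul_lt_mul_of_pos_left hp (norm_pos_iff.2 hω0)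
  -- the truncated normal form
  obtain ⟨b₂₁, b₀₄, b, d, h1, h2, h3, h4, h5⟩ := hF
  set H := normalTerms m (κ * b₂₁) (κ * b₀₄) (fun k => κ ^ (k - 1) * b k) (fun n => κ ^ (2 * n - 1) * d n) with hH
  obtain ⟨hHg, hD3, θ, f, hf, hθ, hfd, hfe, hfj, hfm⟩ := hmod ε κ (by linarith) hκ b₂₁ b₀₄ b d h1 h2 h3 h4 H rfl
  set D := diag (exp (2 * π * I * ((1 - τ) * ε))) (exp (2 * π * I * (τ * ε))) with hD
  have hHd : Differentiable ℂ H := differentiable_normalTerms _ _ _ _ _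
  have hFz : Holo (zoomObs κ ω F) (ball 0 (R' + 2)) :=
    (hFd.comp (differentiable_diag κ ω).differentiableOn fun p hp =>
      ball_mono (hdilρ p hp)).mul_const (κ * ω)⁻¹
  have hE : ∀ p ∈ 𝔻 (R' + 2), ‖zoomObs κ ω F p - H p‖ ≤ A * (R' + 2) ^ (3 * m + 2) * (zoomFactor ^ s * S) := by
    intro p hp
    have e : zoomObs κ ω F p - H p = (F (diag κ ω p) - normalTerms m b₂₁ b₀₄ b d (diag κ ω p)) / (κ * ω) := by
      rw [hH, ← zoomObs_normalTerms m hκ0 hω, zoomObs, zoomObs, sub_div]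
    have h6 := h5 (diag κ ω p) (ball_mono (hdilρ p hp))
    have hωp := norm_pos_iff.2 hω0
    have hκp := norm_pos_iff.2 hκ0
    rw [e, norm_div, norm_mul, div_le_iff₀ (by positivity), ← hσ]
    refine h6.trans ?_
    calc _ ≤ A * (‖ω‖ * (R' + 2)) ^ (3 * m + 2) := by
          gcongr
          exact (hdil p).trans (by gcongr; exact (norm_lt hp).le)
      _ = _ := by rw [mul_pow, pow_succ ‖ω‖]; field_simp
  have hEg : ∀ p ∈ 𝔻 (R' + 1), ‖sgrad (zoomObs κ ω F) p - sgrad H p‖ ≤ C₂ * S := fun p hp => by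
    have hp' : p ∈ 𝔻 (R' + 2) := ball_mono hp
    rw [← sgrad_sub (hFz.at_ball hp') (hHd p)]
    refine (norm_sgrad_le _ _).trans ((norm_fderiv_le_of_bound (hFz.fun_sub hHd.differentiableOn) hE one_pos ?_).trans_eq ?_)
    · linarith [norm_lt hp]
    · rw [hC₂]; ring
  -- the zoomed normal form
  set k : ℂ² → ℂ² := fun p => diag κ⁻¹ ω⁻¹ (ψ (diag κ ω p)) with hk
  have hkpair : ∀ p ∈ 𝔻 (R' + 2), IsCanonicalPair (zoomObs κ ω F) p (k p) ∧ ‖(k p).2‖ ≤ 5 * ‖p‖ ∧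
      HoloAt k p := by
    intro p hp
    obtain ⟨k1, k2, k3⟩ := hψ _ (hdilρ p hp)
    have e1 : diag κ ω (k p) = ψ (diag κ ω p) := diag_diag_inv hκ0 hω0 _
    refine ⟨isCanonicalPair_zoomObs hκ0 hω0 (hFd.differentiableAt (isOpen_ball.mem_nhds ?_)) (by rwa [e1]), ?_, ?_⟩
    · have e2 : diag κ ω (p.1, (k p).2) = ((diag κ ω p).1, (diag κ ω (k p)).2) := rfl
      rwa [e2, e1]
    · have e3 : (k p).2 = ω⁻¹ * (ψ (diag κ ω p)).2 := rfl
      rw [e3, norm_mul, norm_inv, inv_mul_le_iff₀ (norm_pos_iff.2 hω0)]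
      linarith [norm_snd_le (ψ (diag κ ω p)), hdil p]
    · have d1 := (differentiable_diag κ ω) p
      have d2 := hψd.at_ball (hdilρ p hp)
      exact DifferentiableAt.comp (g := diag κ⁻¹ ω⁻¹) p ((differentiable_diag _ _) _) (DifferentiableAt.comp (g := ψ) p d2 d1)
  have hKC : 4 * (K * ‖ε‖ + C₂ * S) ≤ 1 := by
    have := hmono (by positivity : 0 ≤ K + C₂)
    have := mul_le_mul_of_nonneg_left hSε hC₂0
    linarith
  have hC₂S : 0 ≤ C₂ * S := by positivity
  have hkθ : ∀ p ∈ 𝔻 (2 * M + 1), ‖k p - θ p‖ ≤ 2 * (C₂ * S) := by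
    intro p hp
    rw [mem_ball_zero_iff] at hp
    obtain ⟨k1, k2, -⟩ := hkpair p mem_ball₀
    obtain ⟨k3, k4⟩ := hθ p mem_ball₀
    have hmix : ‖(p.1, (k p).2)‖ < R' := by
      rw [Prod.norm_mk]
      exact max_lt (by linarith [norm_fst_le p]) (by linarith)
    have hmix' := norm_le_add_sub (p.1, (θ p).2) p
    have hmix'' := norm_mixed_sub_le p (θ p)
    refine (canonicalPair_compare (H := H) (H' := zoomObs κ ω F) (R := R' + 1) (c := K * ‖ε‖) (c' := K * ‖ε‖ + C₂ * S)
      (k := C₂ * S) (d := 1) hHd.differentiableOn (hFz.mono ball_le)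
      (fun y hy => hHg y (ball_mono hy)) (fun y hy => ?_) hEg one_pos hKC (by linarith) (by linarith)
      (by linarith) k3 k1).1
    have := norm_le_add_sub (sgrad (zoomObs κ ω F) y) (sgrad H y)
    linarith [hEg y hy, hHg y (ball_mono hy)]
  -- the interpolating vector field
  have hsub : 𝔻 (2 * M + 1 + (2 * m : ℕ)) ⊆ ball 0 R' := ball_subset_ball (by push_cast; linarith)
  obtain ⟨X, hX⟩ := hint ε f hε (by linarith) (hfd.mono hsub) (fun p hp => hfe p (hsub hp)) (fun p hp => hfj p (hsub hp))
    (fun p hp => hfm p (hsub hp))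
  have hcε : c * ‖ε‖ ≤ 1 / 128 ∧ c * ‖ε‖ ≤ M / 8 ∧ C₃ * S ≤ 1 / 128 ∧ C₃ * S ≤ M / 8 ∧ C₃ * S + c * ‖ε‖ ≤ 1 / 128 := by
    have h6 := hmono (by positivity : 0 ≤ C₃ + c)
    have h7 : 0 ≤ c * ‖ε‖ := by positivity
    have h8 : C₃ * S ≤ C₃ * ‖ε‖ := by gcongr
    have h9 : 0 ≤ C₃ * S := by positivity
    refine ⟨?_, ?_, ?_, ?_, ?_⟩ <;> linarith
  obtain ⟨c1, c2, c3, c4, c5⟩ := hcε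
  have hXb : ∀ p ∈ 𝔻 (2 * M + 1), ‖ε • X p‖ ≤ c * ‖ε‖ := fun p hp => by
    rw [norm_smul, mul_comm]
    gcongr
    have h6 := norm_le_add_sub (X p) (modelField τ p)
    have h7 : C₁ * ‖ε‖ ≤ C₁ := mul_le_of_le_one_right hC₁ hε1
    linarith [hX.near p hp, hLb p hp]
  obtain ⟨φ, hφd, hφ⟩ := exists_timeOneMap (Ξ := fun p => ε • X p) (κ := ε * (2 * π * I)) (d := 1 / 4)
    (hX.holo.const_smul ε) hXb (by norm_num) (by linarith) fun p hp => by
      rw [divergence_const_smul ε (hX.holo.at_ball hp), hX.div p hp]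
  rw [show 2 * M + 1 - 2 * (1 / 4) = 2 * M + 1 / 2 by ring] at *
  have hφf : ∀ p ∈ 𝔻 (2 * M + 1 / 2), ‖φ p - f p‖ ≤ C₁ * S := fun p hp => by
    obtain ⟨-, -, γ, g1, g2, g3, g4⟩ := hφ p hp
    have := hX.flow γ g3 fun t ht => by
      have := norm_le_add_sub (γ t) p
      linarith [g4 t ht, norm_lt hp]
    rw [g1, g2] at this
    exact this.trans (by gcongr)
  have hDk : ∀ p ∈ 𝔻 (2 * M + 1 / 2), ‖D (k p) - φ p‖ ≤ C₃ * S := fun p hp => by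
    have h6 := hD3 (k p - θ p)
    have h7 := hkθ p (ball_mono hp)
    have h8 := norm_sub_le_norm_sub_add_norm_sub (D (k p)) (f p) (φ p)
    have h9 : D (k p - θ p) = D (k p) - f p := by rw [hf, hD, diag_sub]
    rw [h9] at h6
    rw [norm_sub_rev (f p)] at h8
    rw [hC₃]
    linarith [hφf p hp]
  obtain ⟨e, he, hes, het, hei⟩ := exists_openPartialHomeomorph_near_id (f := φ) (c := c * ‖ε‖) (d := 1 / 8) hφd
    (fun p hp => (hφ p hp).2.1) (by norm_num) (by linarith)
  rw [show 2 * M + 1 / 2 - 2 * (1 / 8) = 2 * M + 1 / 4 by ring, show 2 * M + 1 / 2 - 1 / 8 = 2 * M + 3 / 8 by ring] at *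
  have hDt : ∀ p ∈ 𝔻 (2 * M + 1 / 8), D (k p) ∈ e.target := fun p hp => by
    refine het (mem_ball₀ ?_)
    have hp' : p ∈ 𝔻 (2 * M + 1 / 2) := ball_mono hp
    have h6 := norm_sub_le_norm_sub_add_norm_sub (D (k p)) (φ p) p
    have h7 := norm_le_add_sub (D (k p)) p
    linarith [hDk p hp', (hφ p hp').2.1, norm_lt hp]
  set r : ℂ² → ℂ² := fun p => e.symm (D (k p)) with hr
  have hrs : ∀ p ∈ 𝔻 (2 * M + 1 / 8), r p ∈ 𝔻 (2 * M + 3 / 8) ∧ φ (r p) = D (k p) := fun p hp => by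
    refine ⟨by rw [← hes]; exact e.map_target (hDt p hp), ?_⟩
    rw [← he]; exact e.right_inv (hDt p hp)
  have hkd : ∀ p ∈ 𝔻 (2 * M + 1 / 8), HoloAt k p ∧ jac k p = 1 := fun p hp => by
    have hp' := norm_lt hp
    have hp2 : p ∈ 𝔻 (R' + 2) := mem_ball₀
    obtain ⟨k1, k2, k3⟩ := hkpair p hp2
    refine ⟨k3, jac_eq_one_of_canonical hFz isOpen_ball k3 (mem_ball_prod.2 ⟨?_, ?_⟩) ?_⟩
    · linarith [norm_fst_le p]
    · linarith
    · filter_upwards [isOpen_ball.mem_nhds hp2] with x hx using (hkpair x hx).1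
  have hDd : Differentiable ℂ D := differentiable_diag _ _
  have hrd : ∀ p ∈ 𝔻 (2 * M + 1 / 8), HoloAt r p := fun p hp =>
    DifferentiableAt.comp (g := e.symm) (f := fun p => D (k p)) p (hei.differentiableAt (e.open_target.mem_nhds (hDt p hp)))
      (DifferentiableAt.comp (g := D) p (hDd _) (hkd p hp).1)
  have hrj : ∀ p ∈ 𝔻 (2 * M + 1 / 8), jac r p = 1 := fun p hp => by
    obtain ⟨r1, r2⟩ := hrs p hp
    have r3 : r p ∈ 𝔻 (2 * M + 1 / 2) := ball_mono r1
    have h6 := jac_comp (hφd.at_ball r3) (hrd p hp)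
    have h7 : jac (fun x => φ (r x)) p = jac (fun x => D (k x)) p :=
      jac_congr (by filter_upwards [isOpen_ball.mem_nhds hp] with x hx using (hrs x hx).2)
    rw [h7, jac_comp (hDd _) (hkd p hp).1, (hkd p hp).2, mul_one, hD, jac_diag, ← Complex.exp_add, (hφ _ r3).1] at h6
    have h8 : 2 * π * I * ((1 - τ) * ε) + 2 * π * I * (τ * ε) = ε * (2 * π * I) := by ring
    rw [h8] at h6
    exact (mul_eq_left₀ (Complex.exp_ne_zero _)).1 h6.symm
  have hrn : ∀ p ∈ 𝔻 (2 * M + 1 / 8), ‖r p - p‖ ≤ 2 * (C₃ * S) := fun p hp => by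
    obtain ⟨r1, r2⟩ := hrs p hp
    have h6 := norm_sub_le_two_mul (d := 1 / 8) hφd (fun p hp => (hφ p hp).2.1) (by norm_num) (by linarith)
      (by linarith [norm_lt r1] : ‖r p‖ < _) (by linarith [norm_lt hp] : ‖p‖ < _)
    rw [r2] at h6
    linarith [hDk p (ball_mono hp)]
  obtain ⟨Q, hQd, hQ0, hQp, hQe⟩ := exists_generating (d := 1 / 16) (fun p hp => (hrd p hp).differentiableWithinAt) hrn hrj
    (by norm_num) (by linarith)
  rw [show 2 * M + 1 / 8 - 2 * (1 / 16) = 2 * M by ring] at *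
  have hmix : ∀ p ∈ 𝔻 M, p ∈ 𝔻 (2 * M + 1 / 8 - 1 / 16) ∧ ‖r p - p‖ ≤ M / 4 ∧
      (p.1, (r p).2) ∈ 𝔻 (2 * M) := fun p hp => by
    rw [mem_ball_zero_iff] at hp
    have h6 := hrn p mem_ball₀
    refine ⟨mem_ball₀, by linarith, mem_ball₀ ?_⟩
    linarith [norm_le_add_sub (p.1, (r p).2) p, norm_mixed_sub_le p (r p)]
  refine ⟨Q, X, r, hX.holo.mono ball_le, fun p hp => ?_, ⟨hQd, fun p hp => ?_, fun p hp => (hmix p hp).2.2,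
    fun p hp => (hQp p (hmix p hp).1 (hmix p hp).2.2).1, fun p hp => (hQp p (hmix p hp).1 (hmix p hp).2.2).2⟩,
    fun p hp => ⟨?_, ?_⟩⟩
  · have hp' : p ∈ 𝔻 (2 * M + 1) := ball_mono hp
    have hMC : 0 ≤ 8 * M * C₃ := by positivity
    refine ⟨hX.div p hp', hX.equivariant p hp', (hX.near p hp').trans (by gcongr; linarith), ?_⟩
    have h6 := norm_le_of_sgrad_le (c := 2 * (C₃ * S)) hQd hQ0 hp fun x hx => by
      obtain ⟨u, hu, u1, u2, u3⟩ := hQe x (mem_ball₀ (hx.trans_lt (norm_lt hp)))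
      rw [sgrad_norm_le_of_pair u3 u1 u2]
      exact hrn u (ball_mono hu)
    calc _ ≤ 2 * (2 * (C₃ * S)) * (2 * M) := h6.trans (by gcongr; exact (norm_lt hp).le)
      _ = 8 * M * C₃ * S := by ring
      _ ≤ _ := by gcongr; linarith
  · exact (hrd p (ball_mono hp)).differentiableWithinAt
  · exact hdilρ p (ball_mono hp)
  · obtain ⟨m1, m2, -⟩ := hmix p hp
    obtain ⟨r1, r2⟩ := hrs p (ball_mono m1)
    obtain ⟨-, -, γ, g1, g2, g3, g4⟩ := hφ (r p) (ball_mono r1)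
    refine ⟨γ, g1, g2.trans r2, g3, fun t ht => mem_ball₀ ?_⟩
    linarith [norm_le_add_sub (γ t) (r p), norm_le_add_sub (r p) p, g4 t ht, norm_lt hp]

end Interpolation

/-! ### Change of coordinates and symmetry -/

section Assembly

/-- The dilation `diag(a,b)` as a homeomorphism of `ℂ²`. -/
def diagHomeomorph {a b : ℂ} (ha : a ≠ 0) (hb : b ≠ 0) : ℂ² ≃ₜ ℂ² where
  toFun := diag a b
  invFun := diag a⁻¹ b⁻¹
  left_inv := diag_inv_diag ha hb
  right_inv := diag_diag_inv ha hb
  continuous_toFun := (differentiable_diag a b).continuous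
  continuous_invFun := (differentiable_diag _ _).continuous

lemma diagPush_eq {X : ℂ² → ℂ²} {R : ℝ} (h : ∀ p ∈ 𝔻 R, X (diag 1 jRoot p) = diag 1 jRoot (X p))
    {p : ℂ²} (hp : p ∈ 𝔻 R) : diagPush 1 jRoot X p = X p := by
  have h1 := diag_diag_inv one_ne_zero jRoot_ne_zero p
  rw [diagPush, ← h _ ?_, h1]
  rw [mem_ball_zero_iff, ← norm_diag_one_jRoot, h1]
  exact norm_lt hp

lemma IsResonantBNF.hasNormalForm {m : ℕ} {ρ C η : ℝ} {α β : ℂ} {Y F : ℂ² → ℂ}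
    {φ : OpenPartialHomeomorph ℂ² ℂ²} (h : IsResonantBNF m ρ C η α β Y F φ) : HasNormalForm m C η (2 * ρ) F := by
  have := h.normal_form
  rwa [polydisk_eq_ball] at this

end Assembly

end

theorem theorem5p1 (m : ℕ) (hm : 1 ≤ m) :
    -- the resonant Birkhoff normal form
    (∃ ρ > (0 : ℝ), ∃ ε > (0 : ℝ), ∃ C : ℝ, ∀ (ao bo : ℂ) (δ : ℝ),
      |δ| * (‖ao‖ + ‖bo‖) < ε →
      ∃ (Y F : ℂ × ℂ → ℂ) (φ : OpenPartialHomeomorph (ℂ × ℂ) (ℂ × ℂ)),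
        IsResonantBNF m ρ C (|δ| * (‖ao‖ + ‖bo‖)) (1 / 6 + δ * ao) (1 / 3 + δ * bo) Y F φ) ∧
    -- the approximation by a vector field
    (∀ (M : ℝ) (_ : 0 < M) (bo τ : ℂ) (_ : bo ≠ 0),
      ∃ δ₀ > (0 : ℝ), ∃ ρ > (0 : ℝ), ∃ C : ℝ, ∀ δ : ℝ, δ ≠ 0 → |δ| < δ₀ →
      ∀ α β : ℂ, α = 1 / 6 + δ * ((τ - 1 / 2) * bo) → β = 1 / 3 + δ * bo →
      ∀ ω : ℂ, ω ^ 3 = zoom bo δ ^ 2 →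
      ∃ (Y F G R : ℂ × ℂ → ℂ) (X r : ℂ × ℂ → ℂ × ℂ)
        (ιG Z : OpenPartialHomeomorph (ℂ × ℂ) (ℂ × ℂ)),
        -- `Z` is the dilation composed with `ι_G`, the inverse of a normalizing map `ι_Y`
        IsCanonicalDiffeo G (polydisk M) ιG ∧
        IsResonantBNF m ρ C |δ| α β Y F ιG.symm ∧
        Z.source = ιG.source ∧
        (∀ x ∈ Z.source, Z x = diag (zoom bo δ)⁻¹ ω⁻¹ (ιG x)) ∧
        DifferentiableOn ℂ Z Z.source ∧ DifferentiableOn ℂ Z.symm Z.target ∧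
        polydisk M ⊆ Z.target ∧
        -- the vector field
        DifferentiableOn ℂ X (polydisk (2 * M)) ∧
        (∀ p ∈ polydisk (2 * M), divergence X p = 2 * π * Complex.I) ∧
        (∀ p ∈ polydisk (2 * M), diagPush 1 jRoot X p = X p) ∧
        (∀ p ∈ polydisk (2 * M), ‖X p - modelField τ p‖ ≤ C * |δ|) ∧
        -- the remainder
        IsCanonicalOn R (polydisk (2 * M)) (polydisk M) r ∧
        (∀ p ∈ polydisk (2 * M), ‖R p‖ ≤ C * |δ| ^ (2 * (m : ℝ) - 1 / 3)) ∧
        -- the conjugation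
        ∀ p ∈ polydisk M, henonMod α β (Z.symm p) ∈ Z.source ∧
          ∃ q, TimeOneMap (fun x => ((δ : ℂ) * bo) • X x) (polydisk (2 * M)) (r p) q ∧
            Z (henonMod α β (Z.symm p)) = diag 1 jRoot q) := by
  constructor
  · obtain ⟨ρ, ε, C, hρ, hε, hC, h⟩ := exists_resonantBNF hm one_pos
    refine ⟨ρ, hρ, ε, hε, C, fun ao bo δ hδ => ?_⟩
    have hq : ‖((δ * ao, δ * bo) : ℂ × ℂ)‖ ≤ |δ| * (‖ao‖ + ‖bo‖) := by
      refine norm_prod_le_iff.2 ⟨?_, ?_⟩ <;>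
      · simp only [norm_mul, Complex.norm_real, Real.norm_eq_abs]
        refine mul_le_mul_of_nonneg_left ?_ (abs_nonneg δ)
        linarith [norm_nonneg ao, norm_nonneg bo]
    obtain ⟨Y, F, -, φ, -, hN, -⟩ := h _ (mem_ball_zero_iff.2 (hq.trans_lt hδ))
    exact ⟨Y, F, φ, hN.mono le_rfl (mul_le_mul_of_nonneg_left hq hC)⟩
  intro M hM bo τ hbo
  obtain ⟨ρ, ε₁, C₁, hρ, hε₁, hC₁, hbnf⟩ := exists_resonantBNF hm hM
  obtain ⟨K, ε₂, -, hε₂, hhen⟩ := exists_henonMod_bounds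
  obtain ⟨C₂, ε₃, hC₂, hε₃, hint⟩ := exists_interpolation hm τ hM (A := C₁ * (‖τ‖ + 1)) (by positivity) hρ
  have hb : 0 < ‖bo‖ := norm_pos_iff.2 hbo
  have hD : 0 < (‖τ‖ + 1) * ‖bo‖ := by positivity
  set D := (‖τ‖ + 1) * ‖bo‖ with hDd
  refine ⟨min (min (ε₁ / D) (ε₂ / D)) (ε₃ / ‖bo‖), by positivity, ρ, hρ,
    C₁ * (D + 1) + C₂ * ‖bo‖ + C₂ * ‖bo‖ ^ (2 * (m : ℝ) - 1 / 3), ?_⟩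
  rintro δ hδ0 hδ _ _ rfl rfl ω hω
  simp only [lt_min_iff, lt_div_iff₀ hD, lt_div_iff₀ hb] at hδ
  -- the small parameter of the interpolation is `ε = δ β̊`
  have hz : zoom bo δ = zoomFactor * (δ * bo) := by simp only [zoom, zoomFactor]; ring
  have hε0 : (δ : ℂ) * bo ≠ 0 := mul_ne_zero (by exact_mod_cast hδ0) hbo
  have hεn : ‖(δ : ℂ) * bo‖ = |δ| * ‖bo‖ := by rw [norm_mul, Complex.norm_real, Real.norm_eq_abs]
  have hκ0 : zoom bo δ ≠ 0 := by
    rw [hz]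
    exact mul_ne_zero (by exact_mod_cast (one_pos.trans_le one_le_zoomFactor).ne') hε0
  have hω0 : ω ≠ 0 := by rintro rfl; exact hκ0 (by simpa using hω.symm)
  set κ := zoom bo δ
  set q : ℂ × ℂ := (δ * ((τ - 1 / 2) * bo), δ * bo) with hq
  have hqn : ‖q‖ ≤ |δ| * D := by
    have h1 : ‖τ - 1 / 2‖ ≤ ‖τ‖ + 1 := (norm_sub_le _ _).trans (by norm_num)
    refine norm_prod_le_iff.2 ⟨?_, ?_⟩
    · simp only [hq, hDd, norm_mul, Complex.norm_real, Real.norm_eq_abs]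
      gcongr
    · simp only [hq, hDd, hεn]
      refine mul_le_mul_of_nonneg_left (le_mul_of_one_le_left hb.le ?_) (abs_nonneg _)
      linarith [norm_nonneg τ]
  obtain ⟨Y, F, G, φ, hG, hN, h4⟩ := hbnf q (mem_ball_zero_iff.2 (hqn.trans_lt hδ.1.1))
  obtain ⟨k1, k2, k3, k4, -⟩ := hhen q (mem_ball_zero_iff.2 (hqn.trans_lt hδ.1.2))
  -- `diag(λ₁,λ₂)` is `diag(1,j)` times a factor close to the identity, which enters the flow
  have hl₁ : lam₁ q = Complex.exp (2 * π * Complex.I * ((1 - τ) * (δ * bo))) := by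
    rw [lam₁_eq]; congr 2; simp only [hq]; ring
  have hl₂ : lam₂ q = jRoot * Complex.exp (2 * π * Complex.I * (τ * (δ * bo))) := by
    rw [lam₂_eq]; congr 3; simp only [hq]; ring
  obtain ⟨ψ, hψ, hψs, hconj⟩ := hN.conj
  have hψc := hψ.canonical
  simp only [polydisk_eq_ball] at hψc hψs hconj
  have hsub := hN.change_dom
  rw [polydisk_eq_ball] at hsub
  have hnf : HasNormalForm m (C₁ * (‖τ‖ + 1)) ‖(δ : ℂ) * bo‖ (2 * ρ) F := by
    refine hN.hasNormalForm.mono (le_mul_of_one_le_right hC₁ (by linarith [norm_nonneg τ])) ?_ le_rfl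
    rw [hεn, mul_assoc]
    refine mul_le_mul_of_nonneg_left (hqn.trans_eq ?_) hC₁
    rw [hDd]; ring
  obtain ⟨R, X, r, hX, hXp, hr, hT⟩ := hint (δ * bo) κ ω hε0 (hεn ▸ hδ.2) hz hω F ψ hnf hψc.holo_obs (hψc.holo.mono hψs)
    fun p hp => by
      refine ⟨hψc.mem p (hψs hp), ⟨hψc.eq_fst p (hψs hp), hψc.eq_snd p (hψs hp)⟩, ?_⟩
      have h5 := h4 p hp
      rw [(hconj p hp).2] at h5
      have h6 : ‖ψ p‖ ≤ 11 / 10 * ‖diag (lam₁ q) (lam₂ q) (ψ p)‖ := by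
        conv_lhs => rw [← diag_inv_diag (lam₁_ne_zero q) (lam₂_ne_zero q) (ψ p)]
        exact (norm_diag_le _ _ _).trans (mul_le_mul_of_nonneg_right (max_le k3 k4) (norm_nonneg _))
      have h7 : ‖diag (lam₁ q) (lam₂ q) (ψ p)‖ ≤ 4 * ‖p‖ := h5
      linarith [norm_nonneg p]
  set e := diagHomeomorph (inv_ne_zero hκ0) (inv_ne_zero hω0)
  have hZs : ∀ p, (φ.symm.transHomeomorph e).symm p = φ (diag κ ω p) := fun p => by
    change φ (diag κ⁻¹⁻¹ ω⁻¹⁻¹ p) = _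
    rw [inv_inv, inv_inv]
  have hZt : ∀ p, p ∈ (φ.symm.transHomeomorph e).target ↔ diag κ ω p ∈ φ.source := fun p => by
    change diag κ⁻¹⁻¹ ω⁻¹⁻¹ p ∈ φ.source ↔ _
    rw [inv_inv, inv_inv]
  have hd := abs_nonneg δ
  have hd' : 0 ≤ |δ| ^ (2 * (m : ℝ) - 1 / 3) := by positivity
  have hb' : 0 ≤ ‖bo‖ ^ (2 * (m : ℝ) - 1 / 3) := by positivity
  simp only [polydisk_eq_ball (2 * M)]
  refine ⟨Y, F, G, R, X, r, φ.symm, φ.symm.transHomeomorph e, hG, ?_, rfl, fun _ _ => rfl,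
    ((differentiable_diag _ _).comp_differentiableOn hG.canonical.holo), ?_, ?_, hX, fun p hp => (hXp p hp).1,
    fun p => diagPush_eq fun p hp => (hXp p hp).2.1, fun p hp => ?_, ?_, fun p hp => ?_, fun p hp => ?_⟩
  · rw [OpenPartialHomeomorph.symm_symm]
    refine hN.mono ?_ ?_
    · nlinarith [mul_nonneg hC₁ hD.le, mul_nonneg hC₂ hb.le, mul_nonneg hC₂ hb']
    · have h5 := mul_le_mul_of_nonneg_left hqn hC₁
      nlinarith [mul_nonneg hC₁ hd, mul_nonneg (mul_nonneg hC₂ hb.le) hd, mul_nonneg (mul_nonneg hC₂ hb') hd]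
  · refine DifferentiableOn.congr ?_ fun p _ => hZs p
    exact hN.change.canonical.holo.comp (differentiable_diag κ ω).differentiableOn fun p hp => (hZt p).1 hp
  · rw [polydisk_eq_ball]
    exact fun p hp => (hZt p).2 (hsub (hT p hp).1)
  · refine (hXp p hp).2.2.1.trans ?_
    rw [hεn]
    nlinarith [mul_nonneg (mul_nonneg hC₁ (add_nonneg hD.le zero_le_one)) hd, mul_nonneg (mul_nonneg hC₂ hb') hd]
  · rw [polydisk_eq_ball]; exact hr
  · refine (hXp p hp).2.2.2.trans ?_
    rw [hεn, Real.mul_rpow hd hb.le]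
    nlinarith [mul_nonneg (mul_nonneg hC₁ (add_nonneg hD.le zero_le_one)) hd', mul_nonneg (mul_nonneg hC₂ hb.le) hd']
  · rw [polydisk_eq_ball] at hp
    obtain ⟨h5, h6⟩ := hT p hp
    obtain ⟨h7, h8⟩ := hconj _ h5
    rw [hZs]
    refine ⟨h7, _, h6, ?_⟩
    change diag κ⁻¹ ω⁻¹ (φ.symm _) = _
    rw [h8, diag_diag, diag_diag, diag_diag]
    change diag (κ⁻¹ * lam₁ q) (ω⁻¹ * lam₂ q) _ = _
    rw [hl₁, hl₂]
    congr 1 <;> ring
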